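/- Let $V$ be one of the following spaces of trace zero endomorphisms, on which a complex Lie algebra $\mathfrak k$ acts by commutators: $V^{I}=\mathfrak{sl}_n$, with $\mathfrak k=\mathfrak{sl}_n$; $V^{II}=\mathfrak{sl}_n/\mathfrak{so}_n$, the trace zero endomorphisms of $\mathbb C^n$ that are self-adjoint for the standard non-degenerate quadratic form, with $\mathfrak k=\mathfrak{so}_n$; $V^{III}=\mathfrak{sl}_{2n}/\mathfrak{sp}_{2n}$, the trace zero endomorphisms of $\mathbb C^{2n}$ that are self-adjoint for the standard symplectic form, with $\mathfrak k=\mathfrak{sp}_{2n}$. Let $K$ be the connected group with Lie algebra $\mathfrak k$, let $\mathcal N\subset V$ be the cone of nilpotent elements, and let $\Lambda\subset V\times V\cong T^*V$ (identified through the form $\operatorname{tr}(CB)$) be the union of the conormal bundles to the $K$-orbits in $\mathcal N$. For $A\in\mathcal N$, let $\Lambda_A=\{B\in V : (A,B)\in\Lambda\}$, and let $\Lambda_A^0$, the set of generic conormals at $A$, be the set of those $B$ for which $(A,B)$ is a smooth point of $\Lambda$. Let $\bar n: n=n_1+\dots+n_k$ be a partition of $n$ into positive parts, and let $A\in\mathcal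 N$ have Jordan blocks of sizes $n_1,\dots,n_k$ (in the cases $V^{I}$ and $V^{II}$), respectively $n_1,n_1,n_2,n_2,\dots,n_k,n_k$ (in the case $V^{III}$). Let $\Pi_{\bar n}$ be the space of unordered $k$-tuples of distinct points of $\mathbb C$, colored by the distinct values among the $n_i$, with as many points of the color $s$ as there are indices $i$ with $n_i=s$. The colored braid group is $B_{\bar n}=\pi_1(\Pi_{\bar n})$. Lemma 1.1. Let $\tilde\Lambda_A$ be the set of all $B\in\Lambda_A$ that have exactly $k$ distinct eigenvalues. Then $\tilde\Lambda_A$ is a non-empty, path-connected Zariski open subset of $\Lambda^0_A$. There is a unique map $r:\tilde\Lambda_A\to\Pi_{\bar n}$ that sends $B$ to its spectrum, each eigenvalue being colored by its algebraic multiplicity (by half of this multiplicity in the case $V^{III}$), and $r$ is continuous. For every base point, the induced homomorphism $\rho=r_*:\pi_1(\tilde\Lambda_A)\to B_{\bar n}$ is an isomorphism when $V=V^{I}$ or $V=V^{III}$, and a surjection when $V=V^{II}$. -/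

import Mathlib

open Topology

noncomputable section

namespace NilconeSymmetric

/-! ### Colored configurations and the colored braid group -/

/-- Ordered `k`-tuples of pairwise distinct points of `ℂ`. -/
abbrev OrderedConfig (k : ℕ) : Type := {u : Fin k → ℂ // Function.Injective u}

/-- Two ordered `k`-tuples define the same colored configuration (the `i`-th point having color
`c i`) when they differ by a permutation of the indices that preserves the colors. -/
def coloredSetoid {k : ℕ} (c : Fin k → ℕ) : Setoid (OrderedConfig k) where
  r u v := ∃ σ : Equiv.Perm (Fin k), (∀ i, c (σ i) = c i) ∧ ∀ i, v.1 i = u.1 (σ i)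
  iseqv :=
    { refl := fun _ => ⟨1, fun _ => rfl, fun _ => rfl⟩
      symm := by
        rintro u v ⟨σ, hc, h⟩
        refine ⟨σ⁻¹, fun i => ?_, fun i => ?_⟩
        · simpa using (hc (σ⁻¹ i)).symm
        · simp [h]
      trans := by
        rintro u v w ⟨σ, hc, h⟩ ⟨τ, hc', h'⟩
        refine ⟨σ * τ, fun i => ?_, fun i => ?_⟩
        · simp [hc, hc']
        · simp [h, h'] }

/-- The space of unordered `k`-tuples of distinct points of `ℂ`, colored so that there are as many
points of a given color as there are indices `i` with that color `c i`. It carries the quotient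
topology. -/
abbrev ColoredConfig {k : ℕ} (c : Fin k → ℕ) : Type := Quotient (coloredSetoid c)

/-- The colored configuration underlying an ordered tuple. -/
abbrev ColoredConfig.mk {k : ℕ} (c : Fin k → ℕ) (u : OrderedConfig k) : ColoredConfig c :=
  Quotient.mk (coloredSetoid c) u

/-- The colored braid group: the fundamental group of the colored configuration space. -/
abbrev ColoredBraidGroup {k : ℕ} (c : Fin k → ℕ) (b : ColoredConfig c) : Type :=
  FundamentalGroup (ColoredConfig c) b

/-! ### The three symmetric spaces

Each symmetric space is the complement `V` of a Lie subalgebra `𝔨`, realized as a space of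
matrices on which `𝔨` acts by commutators. -/

section Trace

variable (ι : Type*) [Fintype ι]

/-- The space of trace zero matrices. -/
def traceZero : Submodule ℂ (Matrix ι ι ℂ) := LinearMap.ker (Matrix.traceLinearMap ι ℂ ℂ)

end Trace

/-- `𝔰𝔩ₙ`: trace zero endomorphisms of `ℂⁿ`. -/
def spaceI (n : ℕ) : Submodule ℂ (Matrix (Fin n) (Fin n) ℂ) := traceZero (Fin n)

/-- The Lie algebra `𝔨 = 𝔰𝔩ₙ` acting on `spaceI n`. -/
def lieI (n : ℕ) : Submodule ℂ (Matrix (Fin n) (Fin n) ℂ) := traceZero (Fin n)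

/-- `𝔰𝔩ₙ / 𝔰𝔬ₙ`: trace zero endomorphisms of `ℂⁿ` that are self-adjoint for the standard
non-degenerate quadratic form. -/
def spaceII (n : ℕ) : Submodule ℂ (Matrix (Fin n) (Fin n) ℂ) :=
  traceZero (Fin n) ⊓ selfAdjointMatricesSubmodule (1 : Matrix (Fin n) (Fin n) ℂ)

/-- The Lie algebra `𝔨 = 𝔰𝔬ₙ` acting on `spaceII n`. -/
def lieII (n : ℕ) : Submodule ℂ (Matrix (Fin n) (Fin n) ℂ) :=
  skewAdjointMatricesSubmodule (1 : Matrix (Fin n) (Fin n) ℂ)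

/-- `𝔰𝔩₂ₙ / 𝔰𝔭₂ₙ`: trace zero endomorphisms of `ℂ²ⁿ` that are self-adjoint for the standard
symplectic form. -/
def spaceIII (n : ℕ) : Submodule ℂ (Matrix (Fin n ⊕ Fin n) (Fin n ⊕ Fin n) ℂ) :=
  traceZero (Fin n ⊕ Fin n) ⊓ selfAdjointMatricesSubmodule (Matrix.J (Fin n) ℂ)

/-- The Lie algebra `𝔨 = 𝔰𝔭₂ₙ` acting on `spaceIII n`. -/
def lieIII (n : ℕ) : Submodule ℂ (Matrix (Fin n ⊕ Fin n) (Fin n ⊕ Fin n) ℂ) :=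
  skewAdjointMatricesSubmodule (Matrix.J (Fin n) ℂ)

/-! ### Smooth points and Zariski open subsets -/

/-- `p` is a smooth point of the subset `Z` of a complex vector space: near `p`, the set `Z` is a
complex submanifold, i.e. it is cut out by holomorphic functions with linearly independent
differentials at `p`. -/
def IsSmoothPoint {E : Type*} [NormedAddCommGroup E] [NormedSpace ℂ E] (Z : Set E) (p : E) :
    Prop :=
  p ∈ Z ∧ ∃ (c : ℕ) (F : E → (Fin c → ℂ)), AnalyticAt ℂ F p ∧
    Function.Surjective (fderiv ℂ F p) ∧ ∀ᶠ q in 𝓝 p, q ∈ Z ↔ F q = 0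

section Matrices

variable {ι : Type*} [Fintype ι] [DecidableEq ι]

/-- `S` is a Zariski open subset of `T`: it is contained in `T`, and it consists of the points
of `T` at which some member of a set of polynomials in the matrix entries does not vanish. -/
def IsZariskiOpenIn (S T : Set (Matrix ι ι ℂ)) : Prop :=
  S ⊆ T ∧ ∃ P : Set (MvPolynomial (ι × ι) ℂ), ∀ B ∈ T,
    (B ∈ S ↔ ∃ p ∈ P, MvPolynomial.eval (fun e : ι × ι => B e.1 e.2) p ≠ 0)

/-! ### Jordan type, conormals, colored spectrum -/

/-- `A` is nilpotent and the blocks of its Jordan normal form have the sizes `s a`: in a suitable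
basis, `A` sends each vector of a block to the preceding one and kills the first one. -/
def HasJordanType {α : Type*} (A : Matrix ι ι ℂ) (s : α → ℕ) : Prop :=
  ∃ b : Module.Basis (Σ a : α, Fin (s a)) ℂ (ι → ℂ),
    (∀ (a : α) (h : 0 < s a), A.mulVec (b ⟨a, ⟨0, h⟩⟩) = 0) ∧
    ∀ (a : α) (j : ℕ) (h : j + 1 < s a),
      A.mulVec (b ⟨a, ⟨j + 1, h⟩⟩) = b ⟨a, ⟨j, Nat.lt_of_succ_lt h⟩⟩

/-- The conormal space at `A` to the orbit of `A` under the connected group `K` with Lie algebra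
`𝔨`, as a subset of `V`. The tangent space to the orbit is `{X A - A X | X ∈ 𝔨}`, and `V` is
identified with its dual by the form `tr (C * B)`. -/
def conormalSpace (V 𝔨 : Submodule ℂ (Matrix ι ι ℂ))
    (A : Matrix ι ι ℂ) : Set (Matrix ι ι ℂ) :=
  {B | B ∈ V ∧ ∀ X ∈ 𝔨, ((X * A - A * X) * B).trace = 0}

/-- The conormal variety `Λ ⊆ V × V` of the stratification of the nilcone of `V` by `K`-orbits:
the union of the conormal bundles to all the orbits. -/
def conormalVariety (V 𝔨 : Submodule ℂ (Matrix ι ι ℂ)) :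
    Set (Matrix ι ι ℂ × Matrix ι ι ℂ) :=
  {q | q.1 ∈ V ∧ IsNilpotent q.1 ∧ q.2 ∈ conormalSpace V 𝔨 q.1}

section

attribute [local instance] Matrix.normedAddCommGroup Matrix.normedSpace

/-- The set `Λ⁰_A` of generic conormals at `A`: those `B` for which `(A, B)` lies in the smooth
part of the conormal variety. -/
def genericConormals (V 𝔨 : Submodule ℂ (Matrix ι ι ℂ))
    (A : Matrix ι ι ℂ) : Set (Matrix ι ι ℂ) :=
  {B | IsSmoothPoint (conormalVariety V 𝔨) (A, B)}

end

/-- The set of all conormals `B` at `A` that have exactly `k` distinct eigenvalues. -/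
def distinctConormals (V 𝔨 : Submodule ℂ (Matrix ι ι ℂ))
    (A : Matrix ι ι ℂ) (k : ℕ) : Set (Matrix ι ι ℂ) :=
  {B | B ∈ conormalSpace V 𝔨 A ∧ (spectrum ℂ B).ncard = k}

/-- `u` lists the spectrum of `B`, colored by multiplicity: the `u i` are the eigenvalues of `B`,
and `u i`, of color `c i`, has algebraic multiplicity `d * c i`. -/
def IsColoredSpectrum {k : ℕ} (d : ℕ) (c : Fin k → ℕ) (B : Matrix ι ι ℂ) (u : OrderedConfig k) :
    Prop :=
  Set.range u.1 = spectrum ℂ B ∧ ∀ i, B.charpoly.rootMultiplicity (u.1 i) = d * c i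

end Matrices

end NilconeSymmetric

end

/-!
All three cases are instances of a `SymmetricPair`: a space `S` of self-adjoint matrices for an
anti-involution (all matrices in the case `𝔰𝔩ₙ`), with its skew-adjoint matrices and its
isometries. The theorem holds at every nilpotent `A ∈ S` with a suitable normal form,
`AdaptedData`.

*The conormals with `k` eigenvalues.* The conormals at `A` are the `B ∈ S` of trace zero that
commute with `A` (`conormalSpace_eq`). The spectral idempotents of `B` are polynomials in `B`.
They split the Jordan blocks of `A` into nonempty groups, so `B` has at most `k` eigenvalues
(`SymmetricPair.ncard_spectrum_le`), and it has exactly `k` if and only if the Hankel determinant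
of the traces of its powers does not vanish (`hankel_ne_zero_iff`). So these `B` form the
complement of a hypersurface in a linear space, which is Zariski open and path connected. The
multiplicities are locally constant, hence they are those of a diagonal example
(`AdaptedData.exists_hasRoots`). This gives the map `AdaptedData.spectrumMap` to the colored
configurations.

*Smoothness.* Let `B` have `k` eigenvalues. For a pair `(A', B')` of the conormal variety near
`(A, B)`, the spectral idempotents of `B'` transport a Jordan basis of `A` to one of `A'`, so the
two are conjugate by a matrix near `1`. By a polar decomposition the matrix can be taken to be an
isometry (`AdaptedData.exists_tendsto_conj`). Hence Cayley transforms in a slice transversal to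
the centralizer of `A`, together with the conormal space at `A`, parametrize the conormal variety
near `(A, B)` (`AdaptedData.isSmoothPoint_conormalPairs`).

*Fundamental groups.* The eigenvalues of `B` can be moved freely while its generalized eigenspaces
and its nilpotent part are kept (`moveRoots`). So over the ordered configurations, which cover the
colored ones, the spectrum map becomes a product with a fibre. Loops of configurations lift to
paths of conormals, and these can be closed up since the fibres are path connected
(`AdaptedData.joinedIn_fibre_diag`): rotations interchange blocks of equal size. This proves
surjectivity. The kernel comes from the fundamental group of a fibre. A fibre retracts to its
semisimple elements, which are locally the image of the centralizer `H` of `A` in the group of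
isometries (`AdaptedData.exists_local_section`). If every block admits an infinitesimal isometry
with the square `-1`, which happens for `𝔰𝔩ₙ` and in the symplectic case, then the stabilizers in
`H` are connected (`AdaptedData.joinedIn_stabilizer`) and the orbit map kills the loops of `H`
(`AdaptedData.pathClass_orbitMap_eq_refl`). Indeed, by general position such a loop can be moved
into the image of the Cayley transform, the fundamental group of whose domain is generated by
loops in complex lines of the Lie algebra. A generic line is spanned by an `X` such that `X²` has
`k` eigenvalues. Then `X` commutes with a point of the fibre, and the loop fixes that point.

*Normal form.* A form for which `A` is self-adjoint differs from the standard one on a Jordan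
basis by a matrix that commutes with `A`. A square root of it, polynomial in this matrix, maps the
Jordan basis to one on which the form is standard (`CyclicBasis.exists_gram_eq`).
-/

open unitInterval

namespace NilconeSymmetric

/-! ### Homotopy classes of paths -/

section Paths

variable {X Z : Type*} [TopologicalSpace X] [TopologicalSpace Z]

/-- The homotopy class, relative to the endpoints, of a path. -/
abbrev pathClass {x y : Z} (p : Path x y) : Path.Homotopic.Quotient x y :=
  Path.Homotopic.Quotient.mk p

theorem pathClass_trans {x y z : Z} (p : Path x y) (q : Path y z) :
    pathClass (p.trans q) = (pathClass p).trans (pathClass q) := rfl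

theorem pathClass_subpath_trans {x y : Z} (γ : Path x y) (r s t : I) :
    (pathClass (γ.subpath r s)).trans (pathClass (γ.subpath s t)) = pathClass (γ.subpath r t) :=
  Path.Homotopic.Quotient.eq.2 ⟨Path.Homotopy.subpathTransSubpath γ r s t⟩

theorem pathClass_trans_cancel_right {x y z : Z} {α β : Path.Homotopic.Quotient x y}
    (γ : Path.Homotopic.Quotient y z) (h : α.trans γ = β.trans γ) : α = β := by
  have := congrArg (fun δ => δ.trans γ.symm) h
  simpa [Path.Homotopic.Quotient.trans_assoc] using this

/-- The boundary of a square: the two ways around it are homotopic. -/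
theorem pathClass_square {a b c d : Z} (p : Path a b) (q : Path b d) (p' : Path a c)
    (q' : Path c d) (Q : C(I × I, Z)) (hp : ∀ s, Q (s, 0) = p s) (hq : ∀ t, Q (1, t) = q t)
    (hp' : ∀ t, Q (0, t) = p' t) (hq' : ∀ s, Q (s, 1) = q' s) :
    (pathClass p).trans (pathClass q) = (pathClass p').trans (pathClass q') := by
  have h0 : a = Q (0, 0) := by rw [hp, p.source]
  have h1 : b = Q (1, 0) := by rw [hp, p.target]
  have h2 : c = Q (0, 1) := by rw [hp', p'.target]
  have h3 : d = Q (1, 1) := by rw [hq, q.target]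
  subst h0 h1 h2 h3
  let P : Path ((0, 0) : I × I) (1, 0) := ⟨⟨fun s => (s, 0), by fun_prop⟩, rfl, rfl⟩
  let R : Path ((1, 0) : I × I) (1, 1) := ⟨⟨fun t => (1, t), by fun_prop⟩, rfl, rfl⟩
  let P' : Path ((0, 0) : I × I) (0, 1) := ⟨⟨fun t => (0, t), by fun_prop⟩, rfl, rfl⟩
  let R' : Path ((0, 1) : I × I) (1, 1) := ⟨⟨fun s => (s, 1), by fun_prop⟩, rfl, rfl⟩
  have hP : P.map Q.continuous = p := by ext s; exact hp s
  have hR : R.map Q.continuous = q := by ext s; exact hq s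
  have hP' : P'.map Q.continuous = p' := by ext s; exact hp' s
  have hR' : R'.map Q.continuous = q' := by ext s; exact hq' s
  have : ContractibleSpace I := (convex_Icc (0 : ℝ) 1).contractibleSpace ⟨0, by simp⟩
  have key : (P.trans R).Homotopic (P'.trans R') := SimplyConnectedSpace.paths_homotopic _ _
  have := key.map Q
  rw [Path.map_trans, Path.map_trans] at this
  rw [← hP, ← hR, ← hP', ← hR']
  exact Path.Homotopic.Quotient.eq.2 this

/-- A homotopy of paths whose starting points do not move. -/
theorem pathClass_square_left {a b d : Z} (p : Path a b) (q : Path b d) (q' : Path a d)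
    (Q : C(I × I, Z)) (hp : ∀ s, Q (s, 0) = p s) (hq : ∀ t, Q (1, t) = q t)
    (hp' : ∀ t, Q (0, t) = a) (hq' : ∀ s, Q (s, 1) = q' s) :
    (pathClass p).trans (pathClass q) = pathClass q' := by
  rw [pathClass_square p q (Path.refl a) q' Q hp hq hp' hq']
  exact Path.Homotopic.Quotient.refl_trans _

/-- A homotopy of paths whose endpoints do not move. -/
theorem pathClass_eq_of_square {a b : Z} (p q : Path a b) (Q : C(I × I, Z))
    (hp : ∀ s, Q (s, 0) = p s) (hq : ∀ t, Q (1, t) = b) (hp' : ∀ t, Q (0, t) = a)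
    (hq' : ∀ s, Q (s, 1) = q s) : pathClass p = pathClass q := by
  rw [← pathClass_square_left p (Path.refl b) q Q hp hq hp' hq']
  exact (Path.Homotopic.Quotient.trans_refl _).symm

/-- A property that holds near `t₀` holds on the whole segment from `t₀` to any nearby point, hence
along short subpaths. -/
theorem eventually_forall_convexComb {t₀ : I} {P : I → Prop} (h : ∀ᶠ t in 𝓝 t₀, P t) :
    ∀ᶠ t in 𝓝 t₀, ∀ s : I, P (Set.Icc.convexComb t₀ t s) := by
  have := isCompact_univ.eventually_forall_of_forall_eventually (x₀ := t₀)
    (K := (Set.univ : Set I)) (P := fun t s => P (Set.Icc.convexComb t₀ t s)) (by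
      intro s _
      have hc : Continuous fun z : I × I => Set.Icc.convexComb t₀ z.1 z.2 :=
        Set.Icc.continuous_convexComb_prod.comp (by fun_prop : Continuous fun z : I × I =>
          (t₀, z.1, z.2))
      have := hc.tendsto (t₀, s)
      rw [Set.Icc.convexComb_eq] at this
      exact this.eventually h)
  filter_upwards [this] with t ht s using ht s trivial

/-- A clopen argument on the unit interval: a property that holds at `0` and that is, near every
point, either true everywhere or false everywhere, holds at `1`. -/
theorem unitInterval_induction {P : I → Prop} (h0 : P 0)
    (hstep : ∀ t₀, ∀ᶠ t in 𝓝 t₀, (P t ↔ P t₀)) (t : I) : P t := by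
  have hcl : IsClopen {t | P t} := by
    refine ⟨⟨isOpen_iff_mem_nhds.2 fun t₀ ht₀ => ?_⟩, isOpen_iff_mem_nhds.2 fun t₀ ht₀ => ?_⟩
    · filter_upwards [hstep t₀] with t ht h using ht₀ (ht.1 h)
    · filter_upwards [hstep t₀] with t ht using ht.2 ht₀
  have := hcl.eq_univ ⟨0, h0⟩
  exact (Set.eq_univ_iff_forall.1 this) t

/-- Suppose that to every point of a path `γ` there is attached a class of paths from `z₀` to it
("admissible" spoke), uniquely, and that short subpaths of `γ` carry admissible spokes to
admissible spokes. Then so does `γ`. -/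
theorem admissible_subpath {z₀ a b : Z} (γ : Path a b)
    (Adm : ∀ t : I, Path.Homotopic.Quotient z₀ (γ t) → Prop)
    (hex : ∀ t, ∃ α, Adm t α) (huniq : ∀ t α β, Adm t α → Adm t β → α = β)
    (hloc : ∀ t₀ α, Adm t₀ α →
      ∀ᶠ t in 𝓝 t₀, Adm t (α.trans (pathClass (γ.subpath t₀ t))))
    (α : Path.Homotopic.Quotient z₀ (γ 0)) (hα : Adm 0 α) :
    Adm 1 (α.trans (pathClass (γ.subpath 0 1))) := by
  refine unitInterval_induction (P := fun t => Adm t (α.trans (pathClass (γ.subpath 0 t)))) ?_ ?_ 1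
  · rw [Path.subpath_self]
    have : pathClass (Path.refl (γ 0)) = Path.Homotopic.Quotient.refl _ := rfl
    rw [this, Path.Homotopic.Quotient.trans_refl]
    exact hα
  · intro t₀
    obtain ⟨β, hβ⟩ := hex t₀
    filter_upwards [hloc t₀ β hβ] with t ht
    constructor
    · intro h
      have h1 := huniq t _ _ h ht
      rw [← pathClass_subpath_trans γ 0 t₀ t, ← Path.Homotopic.Quotient.trans_assoc] at h1
      rw [pathClass_trans_cancel_right _ h1]
      exact hβ
    · intro h
      have h1 := huniq t₀ _ _ h hβ
      rw [← pathClass_subpath_trans γ 0 t₀ t, ← Path.Homotopic.Quotient.trans_assoc, h1]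
      exact ht

theorem pathClass_subpath_zero_one {a b : Z} (γ : Path a b) :
    pathClass (γ.subpath 0 1) = (pathClass γ).cast γ.source γ.target := by
  rw [Path.subpath_zero_one]; rfl

end Paths

/-! ### Paths in the complement of a hypersurface -/

section Arcs

/-- The parabolic arc from `0` to `1` in the complex plane, of height proportional to `ε`. -/
noncomputable def arc (ε : ℝ) : Path (0 : ℂ) 1 where
  toFun (t : I) := (t : ℝ) + Complex.I * ((ε * (t * (1 - t)) : ℝ) : ℂ)
  continuous_toFun := by fun_prop
  source' := by simp
  target' := by simp

theorem arc_apply (ε : ℝ) (t : I) :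
    arc ε t = ((t : ℝ) : ℂ) + Complex.I * ((ε * (t * (1 - t)) : ℝ) : ℂ) := rfl

/-- Arbitrarily flat arcs from `0` to `1` avoid the roots of a polynomial that does not vanish at
the endpoints: a given root lies on at most one of the arcs. -/
theorem exists_arc_eval_ne_zero (p : Polynomial ℂ) (h0 : p.eval 0 ≠ 0) (h1 : p.eval 1 ≠ 0)
    {δ : ℝ} (hδ : 0 < δ) : ∃ ε ∈ Set.Ioo 0 δ, ∀ t : I, p.eval (arc ε t) ≠ 0 := by
  have hp : p ≠ 0 := by rintro rfl; simp at h0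
  let g : ℂ → ℝ := fun z => z.im / (z.re * (1 - z.re))
  have hfin : (g '' {z | p.IsRoot z}).Finite := (p.finite_setOfPred_isRoot hp).image g
  obtain ⟨ε, hε, hne⟩ := ((Set.Ioo_infinite hδ).sdiff hfin).nonempty
  refine ⟨ε, hε, fun t ht => hne ⟨arc ε t, ht, ?_⟩⟩
  have hre : (arc ε t).re = t := by simp [arc_apply]
  have him : (arc ε t).im = ε * (t * (1 - t)) := by simp [arc_apply]
  have ht0 : (t : ℝ) ≠ 0 := by
    intro h
    apply h0
    rwa [show t = 0 from Subtype.ext h, Path.source] at ht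
  have ht1 : (1 - t : ℝ) ≠ 0 := by
    intro h
    apply h1
    rwa [show t = 1 from Subtype.ext (by simpa using (sub_eq_zero.1 h).symm), Path.target] at ht
  simp only [g, hre, him]
  field_simp

end Arcs

/-! ### Loops in complex lines, and general position -/

/-- The class of a path, recovered from its parametrization `γ 0 ⟶ γ 1` by adjusting the
endpoints, which are only propositionally equal to those of `γ`. -/
theorem refl_trans_cast {Z : Type*} [TopologicalSpace Z] {a b : Z} (γ : Path a b) :
    ((pathClass ((Path.refl a).cast rfl γ.source : Path a (γ 0))).trans
      ((pathClass γ).cast γ.source γ.target)).cast rfl γ.target.symm = pathClass γ := by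
  obtain ⟨⟨f, hf⟩, h0, h1⟩ := γ
  simp only at h0 h1
  subst h0 h1
  exact Path.Homotopic.Quotient.refl_trans (pathClass (⟨⟨f, hf⟩, rfl, rfl⟩ : Path (f 0) (f 1)))

section Rays

variable {W Z : Type*} [TopologicalSpace Z] [TopologicalSpace W] [AddCommGroup W] [Module ℂ W]
  [ContinuousSMul ℂ W] {D : Set W}

/-- The path from `0` to `x` in the complex line through `x` that is traced by `ζ`. -/
noncomputable def rayPath (hD : (0 : W) ∈ D) (x : D) (ζ : Path (0 : ℂ) 1) (h : ∀ s, ζ s • x.1 ∈ D) :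
    Path (⟨0, hD⟩ : D) x where
  toFun s := ⟨ζ s • x.1, h s⟩
  continuous_toFun := by fun_prop
  source' := by ext; simp
  target' := by ext; simp

theorem rayPath_apply (hD : (0 : W) ∈ D) (x : D) (ζ : Path (0 : ℂ) 1) (h : ∀ s, ζ s • x.1 ∈ D)
    (s : I) : rayPath hD x ζ h s = ⟨ζ s • x.1, h s⟩ := rfl

/-- The loop at `0` in the complex line through `x` that is traced by the loop `ζ`. -/
noncomputable def rayLoop (hD : (0 : W) ∈ D) (x : D) (ζ : Path (0 : ℂ) 0) (h : ∀ s, ζ s • x.1 ∈ D) :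
    Path (⟨0, hD⟩ : D) ⟨0, hD⟩ where
  toFun s := ⟨ζ s • x.1, h s⟩
  continuous_toFun := by fun_prop
  source' := by ext; simp
  target' := by ext; simp

/-- The fundamental groupoid of an open subset `D` of a complex vector space in which every point
is joined to `0` within its complex line is generated by the loops in the complex lines:
if a map out of `D` kills these loops, then it identifies any two paths from `0` to the same
point. -/
theorem pathClass_map_eq_of_rayLoop (hDo : IsOpen D) (hD : (0 : W) ∈ D) (F : C(D, Z))
    (harc : ∀ x : D, ∃ ζ : Path (0 : ℂ) 1, ∀ s, ζ s • x.1 ∈ D)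
    (hloop : ∀ (x : D) (ζ : Path (0 : ℂ) 0) (h : ∀ s, ζ s • x.1 ∈ D),
      pathClass ((rayLoop hD x ζ h).map F.continuous) = Path.Homotopic.Quotient.refl _)
    {x : D} (p q : Path (⟨0, hD⟩ : D) x) :
    pathClass (p.map F.continuous) = pathClass (q.map F.continuous) := by
  have huniq : ∀ (y : D) (ζ ζ' : Path (0 : ℂ) 1) (h : ∀ s, ζ s • y.1 ∈ D)
      (h' : ∀ s, ζ' s • y.1 ∈ D), pathClass ((rayPath hD y ζ h).map F.continuous) =
        pathClass ((rayPath hD y ζ' h').map F.continuous) := by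
    intro y ζ ζ' h h'
    have hh : ∀ s, (ζ.trans ζ'.symm) s • y.1 ∈ D := by
      intro s
      rw [Path.trans_apply]
      split_ifs
      · exact h _
      · exact h' _
    have h1 := hloop y _ hh
    have h2 : rayLoop hD y _ hh = (rayPath hD y ζ h).trans (rayPath hD y ζ' h').symm := by
      ext s
      simp only [rayLoop, rayPath, Path.trans_apply, Path.coe_mk', ContinuousMap.coe_mk]
      split_ifs <;> rfl
    rw [h2, Path.map_trans, pathClass_trans] at h1
    apply pathClass_trans_cancel_right (pathClass ((rayPath hD y ζ' h').map F.continuous).symm)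
    rw [show (pathClass ((rayPath hD y ζ' h').map F.continuous).symm) =
      pathClass ((rayPath hD y ζ' h').symm.map F.continuous) from rfl, h1]
    exact (Path.Homotopic.Quotient.trans_symm _).symm
  -- It suffices to compare an arbitrary path with a ray.
  suffices H : ∀ p : Path (⟨0, hD⟩ : D) x, ∃ (ζ : Path (0 : ℂ) 1) (h : ∀ s, ζ s • x.1 ∈ D),
      pathClass (p.map F.continuous) = pathClass ((rayPath hD x ζ h).map F.continuous) by
    obtain ⟨ζ, h, hp⟩ := H p
    obtain ⟨ζ', h', hq⟩ := H q
    rw [hp, hq, huniq x ζ ζ' h h']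
  intro p
  let γ := p.map F.continuous
  let Adm : ∀ t : I, Path.Homotopic.Quotient (F ⟨0, hD⟩) (γ t) → Prop := fun t α =>
    ∃ (ζ : Path (0 : ℂ) 1) (h : ∀ s, ζ s • (p t).1 ∈ D),
      α = pathClass ((rayPath hD (p t) ζ h).map F.continuous)
  have key := admissible_subpath γ Adm ?_ ?_ ?_
    (pathClass ((Path.refl (F ⟨0, hD⟩)).cast rfl γ.source)) ?_
  · obtain ⟨ζ, h, hα⟩ := key
    have h1 : p 1 = x := p.target
    refine ⟨ζ, fun s => h1 ▸ h s, ?_⟩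
    rw [pathClass_subpath_zero_one] at hα
    have h2 := congrArg (fun δ => δ.cast rfl γ.target.symm) hα
    have h3 : Path.Homotopic.Quotient.cast (pathClass ((rayPath hD (p 1) ζ h).map F.continuous))
        rfl (congrArg F h1.symm) =
        pathClass ((rayPath hD x ζ (fun s => h1 ▸ h s)).map F.continuous) := by
      rw [← Path.Homotopic.Quotient.mk_cast]
      congr 1
      ext s
      simp only [Path.cast_coe, Path.map_coe, Function.comp_apply]
      congr 1
      ext
      simp [rayPath_apply]
    exact (refl_trans_cast γ).symm.trans (h2.trans h3)
  · intro t
    obtain ⟨ζ, h⟩ := harc (p t)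
    exact ⟨_, ζ, h, rfl⟩
  · rintro t α β ⟨ζ, h, rfl⟩ ⟨ζ', h', rfl⟩
    exact huniq _ _ _ _ _
  · rintro t₀ α ⟨ζ, h, rfl⟩
    have hev : ∀ᶠ t in 𝓝 t₀, ∀ s ∈ (Set.univ : Set I), ζ s • (p t).1 ∈ D := by
      refine isCompact_univ.eventually_forall_of_forall_eventually fun s _ => ?_
      have hc : Continuous fun z : I × I => ζ z.2 • (p z.1).1 := by fun_prop
      exact (hDo.preimage hc).mem_nhds (h s)
    filter_upwards [eventually_forall_convexComb hev] with t ht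
    have h' : ∀ s, ζ s • (p t).1 ∈ D := fun s => by
      simpa using ht 1 s trivial
    refine ⟨ζ, h', ?_⟩
    let Q : C(I × I, D) := ⟨fun z => ⟨ζ z.1 • (p (Set.Icc.convexComb t₀ t z.2)).1,
      ht z.2 z.1 trivial⟩, by
        have := Set.Icc.continuous_convexComb t₀ t
        fun_prop⟩
    refine pathClass_square_left _ _ _ (F.comp Q) ?_ ?_ ?_ ?_
    · intro s; exact congrArg F (Subtype.ext (by simp [Q, rayPath_apply]))
    · intro s; simp [Q, γ, Path.subpath]
    · intro s; simp [Q]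
    · intro s; exact congrArg F (Subtype.ext (by simp [Q, rayPath_apply]))
  · obtain ⟨ζ, h⟩ := harc ⟨0, hD⟩
    have h1 : p 0 = ⟨0, hD⟩ := p.source
    refine ⟨ζ, fun s => by rw [h1]; exact h s, ?_⟩
    congr 1
    ext s
    exact congrArg F (Subtype.ext (by simp [rayPath_apply, h1]))

end Rays

section GeneralPosition

variable {X Z : Type*} [TopologicalSpace X] [TopologicalSpace Z]

/-- General position: suppose that a path `γ` runs in a space in which `U` is dense and does not
disconnect small neighborhoods. If a map `F` identifies all pairs of paths in `U` with the same
endpoints, then it identifies `γ` with any path in `U` that has the same endpoints. -/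
theorem pathClass_map_eq_of_generalPosition (F : C(X, Z)) (U : Set X) {x₀ x₁ : X}
    (γ : Path x₀ x₁) (hx₀ : x₀ ∈ U) (hx₁ : x₁ ∈ U)
    (basis : ∀ t, ∀ O : Set X, IsOpen O → γ t ∈ O → ∃ N ⊆ O, N ∈ 𝓝 (γ t) ∧
      (∀ x ∈ N, ∀ y ∈ N, JoinedIn N x y) ∧
      (∀ (x y : X) (p q : Path x y), (∀ t, p t ∈ N) → (∀ t, q t ∈ N) →
        pathClass (p.map F.continuous) = pathClass (q.map F.continuous)) ∧
      (N ∩ U).Nonempty ∧ ∀ x ∈ N ∩ U, ∀ y ∈ N ∩ U, JoinedIn (N ∩ U) x y)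
    (hU : ∀ (y : X) (p q : Path x₀ y), (∀ t, p t ∈ U) → (∀ t, q t ∈ U) →
        pathClass (p.map F.continuous) = pathClass (q.map F.continuous))
    (hconn : ∀ y ∈ U, JoinedIn U x₀ y) (q : Path x₀ x₁) (hq : ∀ t, q t ∈ U) :
    pathClass (γ.map F.continuous) = pathClass (q.map F.continuous) := by
  let Adm : ∀ t : I, Path.Homotopic.Quotient (F x₀) (γ.map F.continuous t) → Prop := fun t α =>
    ∃ N ∈ 𝓝 (γ t),
      (∀ (x y : X) (p q : Path x y), (∀ t, p t ∈ N) → (∀ t, q t ∈ N) →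
        pathClass (p.map F.continuous) = pathClass (q.map F.continuous)) ∧
      (∀ x ∈ N ∩ U, ∀ y ∈ N ∩ U, JoinedIn (N ∩ U) x y) ∧
      ∃ g ∈ N ∩ U, ∃ (ζ : Path x₀ g) (δ : Path g (γ t)), (∀ s, ζ s ∈ U) ∧ (∀ s, δ s ∈ N) ∧
        α = pathClass ((ζ.trans δ).map F.continuous)
  have huniq : ∀ t α β, Adm t α → Adm t β → α = β := by
    rintro t α β ⟨N, hN, hN1, hN2, g, hg, ζ, δ, hζ, hδ, rfl⟩
      ⟨N', hN', hN1', hN2', g', hg', ζ', δ', hζ', hδ', rfl⟩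
    obtain ⟨N₂, hN₂, hmem, hj, -, ⟨g₂, hg₂⟩, -⟩ := basis t (interior (N ∩ N')) isOpen_interior
      (mem_interior_iff_mem_nhds.2 (Filter.inter_mem hN hN'))
    replace hN₂ := hN₂.trans interior_subset
    obtain ⟨δ₂, hδ₂⟩ := hj g₂ hg₂.1 (γ t) (mem_of_mem_nhds hmem)
    obtain ⟨η, hη⟩ := hN2 g hg g₂ ⟨(hN₂ hg₂.1).1, hg₂.2⟩
    obtain ⟨η', hη'⟩ := hN2' g' hg' g₂ ⟨(hN₂ hg₂.1).2, hg₂.2⟩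
    have mem_trans : ∀ {S : Set X} {a b c : X} (p : Path a b) (q : Path b c), (∀ t, p t ∈ S) →
        (∀ t, q t ∈ S) → ∀ t, (p.trans q) t ∈ S := by
      intro S a b c p q hp hq t
      rw [Path.trans_apply]
      split_ifs
      · exact hp _
      · exact hq _
    have e1 : pathClass (δ.map F.continuous) = pathClass ((η.trans δ₂).map F.continuous) :=
      hN1 _ _ _ _ hδ (mem_trans _ _ (fun t => (hη t).1) fun t => (hN₂ (hδ₂ t)).1)
    have e2 : pathClass (δ'.map F.continuous) = pathClass ((η'.trans δ₂).map F.continuous) :=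
      hN1' _ _ _ _ hδ' (mem_trans _ _ (fun t => (hη' t).1) fun t => (hN₂ (hδ₂ t)).2)
    have e3 := hU g₂ (ζ.trans η) (ζ'.trans η') (mem_trans _ _ hζ fun t => (hη t).2)
      (mem_trans _ _ hζ' fun t => (hη' t).2)
    simp only [Path.map_trans, pathClass_trans] at e1 e2 e3 ⊢
    rw [e1, e2, ← Path.Homotopic.Quotient.trans_assoc, ← Path.Homotopic.Quotient.trans_assoc, e3]
  have key := admissible_subpath (γ.map F.continuous) Adm ?_ huniq ?_
    (pathClass ((Path.refl _).cast rfl (γ.map F.continuous).source)) ?_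
  · have h2 := huniq 1 _ (pathClass ((q.cast rfl γ.target).map F.continuous)) key ?_
    · have h3 := congrArg (fun δ => δ.cast rfl (γ.map F.continuous).target.symm) h2
      rw [pathClass_subpath_zero_one] at h3
      rw [refl_trans_cast] at h3
      rw [h3]
      rfl
    · obtain ⟨N, -, hmem, -, hN1, -, hN2⟩ := basis 1 Set.univ isOpen_univ trivial
      refine ⟨N, hmem, hN1, hN2, γ 1, ⟨mem_of_mem_nhds hmem, by simpa using hx₁⟩,
        q.cast rfl γ.target, Path.refl _, hq, fun _ => mem_of_mem_nhds hmem, ?_⟩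
      rw [Path.map_trans, pathClass_trans]
      exact (Path.Homotopic.Quotient.trans_refl _).symm
  · intro t
    obtain ⟨N, -, hmem, hj, hN1, ⟨g, hg⟩, hN2⟩ := basis t Set.univ isOpen_univ trivial
    obtain ⟨ζ, hζ⟩ := hconn g hg.2
    obtain ⟨δ, hδ⟩ := hj g hg.1 (γ t) (mem_of_mem_nhds hmem)
    exact ⟨_, N, hmem, hN1, hN2, g, hg, ζ, δ, hζ, hδ, rfl⟩
  · rintro t₀ α ⟨N, hN, hN1, hN2, g, hg, ζ, δ, hζ, hδ, rfl⟩
    have hev : ∀ᶠ t in 𝓝 t₀, γ t ∈ interior N :=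
      (γ.continuous.tendsto t₀).eventually (isOpen_interior.mem_nhds
        (mem_interior_iff_mem_nhds.2 hN))
    filter_upwards [eventually_forall_convexComb hev] with t ht
    refine ⟨N, mem_interior_iff_mem_nhds.1 (by simpa using ht 1), hN1, hN2, g, hg, ζ,
      δ.trans (γ.subpath t₀ t), hζ, ?_, ?_⟩
    · intro s
      rw [Path.trans_apply]
      split_ifs
      · exact hδ _
      · exact interior_subset (ht _)
    · simp only [Path.map_trans, pathClass_trans]
      exact Path.Homotopic.Quotient.trans_assoc _ _ _
  · obtain ⟨N, -, hmem, -, hN1, -, hN2⟩ := basis 0 Set.univ isOpen_univ trivial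
    refine ⟨N, hmem, hN1, hN2, γ 0, ⟨mem_of_mem_nhds hmem, by simpa using hx₀⟩,
      (Path.refl x₀).cast rfl γ.source, Path.refl _, fun s => hx₀,
      fun _ => mem_of_mem_nhds hmem, ?_⟩
    rw [Path.map_trans, pathClass_trans]
    exact (Path.Homotopic.Quotient.trans_refl _).symm

end GeneralPosition

/-! ### Spectral idempotents -/

section Spectral

open Polynomial

variable {ι : Type*} [Fintype ι] [DecidableEq ι] {k : ℕ}

/-- A polynomial `L` with `L (u i) = 1` and `L (u j) = 0` for `j ≠ i`. -/
noncomputable def lagrangePoly (u : Fin k → ℂ) (i : Fin k) : ℂ[X] :=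
  ∏ j, if j = i then 1 else C (u i - u j)⁻¹ * (X - C (u j))

/-- A polynomial that is congruent to `1` modulo `(X - u i) ^ N` and to `0` modulo
`(X - u j) ^ N` for `j ≠ i`. -/
noncomputable def specPoly (N : ℕ) (u : Fin k → ℂ) (i : Fin k) : ℂ[X] :=
  1 - (1 - lagrangePoly u i ^ N) ^ N

theorem lagrangePoly_eval_self {u : Fin k → ℂ} (hu : Function.Injective u) (i : Fin k) :
    (lagrangePoly u i).eval (u i) = 1 := by
  rw [lagrangePoly, eval_prod]
  refine Finset.prod_eq_one fun j _ => ?_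
  split_ifs with h
  · simp
  · have : u i - u j ≠ 0 := sub_ne_zero.2 fun h' => h (hu h').symm
    simp [this]

theorem dvd_lagrangePoly (u : Fin k → ℂ) {i j : Fin k} (hij : j ≠ i) :
    X - C (u j) ∣ lagrangePoly u i := by
  refine Dvd.dvd.trans ?_ (Finset.dvd_prod_of_mem _ (Finset.mem_univ j))
  rw [if_neg hij]
  exact Dvd.intro_left _ rfl

/-- The congruences that characterize `specPoly`. They make `specIdem` an idempotent, for `N` at
least the size of the matrix. -/
theorem dvd_specPoly_sub (N : ℕ) {u : Fin k → ℂ} (hu : Function.Injective u) (i j : Fin k) :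
    (X - C (u j)) ^ N ∣ specPoly N u i - C (if i = j then 1 else 0) := by
  unfold specPoly
  split_ifs with h
  · subst h
    have h1 : X - C (u i) ∣ 1 - lagrangePoly u i ^ N := by
      rw [dvd_iff_isRoot]
      simp [lagrangePoly_eval_self hu]
    have h2 := pow_dvd_pow_of_dvd h1 N
    rw [← dvd_neg] at h2
    simpa using h2
  · have h1 := pow_dvd_pow_of_dvd (dvd_lagrangePoly u (Ne.symm h)) N
    refine h1.trans ?_
    have := one_sub_dvd_one_sub_pow (1 - lagrangePoly u i ^ N) N
    simpa using this

/-- The `i`-th spectral idempotent of a matrix `B` whose eigenvalues are among the `u j`: the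
projection to the generalized eigenspace of `u i`. It is a polynomial in `B`, with coefficients
depending continuously on `u`. -/
noncomputable def specIdem (u : Fin k → ℂ) (B : Matrix ι ι ℂ) (i : Fin k) : Matrix ι ι ℂ :=
  aeval B (specPoly (Fintype.card ι) u i)

/-- The `e i` are the projections of a decomposition into `B`-stable subspaces, the `i`-th of
which has the only eigenvalue `u i`. Some of the `e i` may vanish. -/
structure IsSpecDecomp (B : Matrix ι ι ℂ) (u : Fin k → ℂ) (e : Fin k → Matrix ι ι ℂ) :
    Prop where
  mul_eq : ∀ i j, e i * e j = if i = j then e i else 0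
  sum_eq : ∑ i, e i = 1
  comm : ∀ i, Commute (e i) B
  nil : ∀ i, (B - u i • 1) ^ Fintype.card ι * e i = 0

namespace IsSpecDecomp

variable {B : Matrix ι ι ℂ} {u : Fin k → ℂ} {e : Fin k → Matrix ι ι ℂ}

theorem idem (h : IsSpecDecomp B u e) (i : Fin k) : e i * e i = e i := by
  simpa using h.mul_eq i i

theorem aeval_mul_of_dvd (h : IsSpecDecomp B u e) (i : Fin k) {p : ℂ[X]}
    (hp : (X - C (u i)) ^ Fintype.card ι ∣ p) : aeval B p * e i = 0 := by
  obtain ⟨q, rfl⟩ := hp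
  rw [mul_comm, map_mul, mul_assoc]
  have : aeval B ((X - C (u i)) ^ Fintype.card ι) * e i = 0 := by
    rw [← h.nil i]
    simp [Algebra.algebraMap_eq_smul_one]
  rw [this, mul_zero]

theorem specIdem_eq (h : IsSpecDecomp B u e) (hu : Function.Injective u) (i : Fin k) :
    specIdem u B i = e i := by
  have h1 : ∀ j, specIdem u B i * e j = if i = j then e i else 0 := by
    intro j
    have := h.aeval_mul_of_dvd j (dvd_specPoly_sub (Fintype.card ι) hu i j)
    rw [map_sub, sub_mul, sub_eq_zero] at this
    rw [specIdem, this]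
    split_ifs with hij
    · simp [hij]
    · simp
  calc specIdem u B i = specIdem u B i * ∑ j, e j := by rw [h.sum_eq, mul_one]
    _ = e i := by rw [Finset.mul_sum]; simp [h1]

/-- Moving the eigenvalues. -/
theorem shift (h : IsSpecDecomp B u e) (v : Fin k → ℂ) :
    IsSpecDecomp (B + ∑ i, (v i - u i) • e i) v e := by
  have hcomm : ∀ i, Commute (e i) (∑ j, (v j - u j) • e j) := fun i =>
    Commute.sum_right _ _ _ fun j _ => by
      refine Commute.smul_right ?_ _
      show e i * e j = e j * e i
      rw [h.mul_eq, h.mul_eq]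
      by_cases hij : i = j
      · simp [hij]
      · simp [hij, Ne.symm hij]
  refine ⟨h.mul_eq, h.sum_eq, fun i => (h.comm i).add_right (hcomm i), fun i => ?_⟩
  have key : (B + ∑ j, (v j - u j) • e j - v i • 1) * e i = (B - u i • 1) * e i := by
    have : (∑ j, (v j - u j) • e j) * e i = (v i - u i) • e i := by
      rw [Finset.sum_mul]
      simp [h.mul_eq]
    rw [sub_mul, add_mul, this, sub_mul]
    simp only [smul_mul_assoc, one_mul, sub_smul]
    abel
  have c1 : Commute (B + ∑ j, (v j - u j) • e j - v i • 1) (e i) :=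
    ((h.comm i).symm.add_left (hcomm i).symm).sub_left ((Commute.one_left _).smul_left _)
  have c2 : Commute (B - u i • 1) (e i) :=
    (h.comm i).symm.sub_left ((Commute.one_left _).smul_left _)
  rcases Nat.eq_zero_or_pos (Fintype.card ι) with h0 | h0
  · have := h.nil i
    rw [h0] at this ⊢
    simpa using this
  · have e1 : ∀ X : Matrix ι ι ℂ, Commute X (e i) →
        X ^ Fintype.card ι * e i = (X * e i) ^ Fintype.card ι := by
      intro X hX
      rw [hX.mul_pow, (show IsIdempotentElem (e i) from h.idem i).pow_eq h0.ne']
    rw [e1 _ c1, key, ← e1 _ c2, h.nil i]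

theorem commute_of_commute (h : IsSpecDecomp B u e) (hu : Function.Injective u)
    {A : Matrix ι ι ℂ} (hA : Commute A B) (i : Fin k) : Commute A (e i) := by
  rw [← h.specIdem_eq hu i, specIdem]
  exact Algebra.commute_of_mem_adjoin_singleton_of_commute
    (Polynomial.aeval_mem_adjoin_singleton _ _) hA

theorem mulVec_eq_self_iff (h : IsSpecDecomp B u e) (hu : Function.Injective u) (i : Fin k)
    (x : ι → ℂ) : (e i).mulVec x = x ↔
      x ∈ Module.End.maxGenEigenspace (Matrix.toLin' B) (u i) := by
  have hpow : ∀ n, ((Matrix.toLin' B - u i • (1 : Module.End ℂ (ι → ℂ))) ^ n) x =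
      ((B - u i • 1) ^ n).mulVec x := by
    intro n
    rw [← Matrix.toLin'_apply, Matrix.toLin'_pow]
    simp [Matrix.toLin'_one, Module.End.one_eq_id]
  rw [Module.End.mem_maxGenEigenspace]
  constructor
  · intro hx
    refine ⟨Fintype.card ι, ?_⟩
    rw [hpow]
    conv_lhs => rw [← hx]
    rw [Matrix.mulVec_mulVec, h.nil, Matrix.zero_mulVec]
  · rintro ⟨n, hn⟩
    rw [hpow] at hn
    -- `specPoly` may be taken with any exponent that is large enough
    have h1 : ∀ j, j ≠ i → (e j).mulVec x = 0 := by
      intro j hj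
      obtain ⟨a, b, hab⟩ := ((Polynomial.pairwise_coprime_X_sub_C hu hj).pow
        (m := Fintype.card ι) (n := n) : IsCoprime ((X - C (u j)) ^ Fintype.card ι)
          ((X - C (u i)) ^ n))
      have h2 := congrArg (fun p => (aeval B p * e j).mulVec x) hab
      simp only [map_one, one_mul, map_add, add_mul] at h2
      rw [h.aeval_mul_of_dvd j (Dvd.intro_left _ rfl), zero_add] at h2
      rw [← h2]
      have c : Commute (aeval B (b * (X - C (u i)) ^ n)) (e j) :=
        (Algebra.commute_of_mem_adjoin_singleton_of_commute
          (Polynomial.aeval_mem_adjoin_singleton _ _) (h.comm j)).symm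
      rw [c.eq, map_mul, ← Matrix.mulVec_mulVec, ← Matrix.mulVec_mulVec]
      have : aeval B ((X - C (u i)) ^ n) = (B - u i • 1) ^ n := by
        simp [Algebra.algebraMap_eq_smul_one]
      rw [this, hn]
      simp
    have h3 : (∑ j, e j).mulVec x = x := by rw [h.sum_eq, Matrix.one_mulVec]
    rw [Matrix.sum_mulVec, Finset.sum_eq_single i (fun j _ hj => h1 j hj) (by simp)] at h3
    exact h3

theorem rootMultiplicity_eq (h : IsSpecDecomp B u e) (hu : Function.Injective u) (i : Fin k) :
    B.charpoly.rootMultiplicity (u i) = (e i).rank := by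
  have : Module.End.maxGenEigenspace (Matrix.toLin' B) (u i) = LinearMap.range (e i).mulVecLin := by
    ext x
    rw [← h.mulVec_eq_self_iff hu i, LinearMap.mem_range]
    constructor
    · exact fun hx => ⟨x, hx⟩
    · rintro ⟨y, rfl⟩
      simp [Matrix.mulVec_mulVec, h.idem i]
  rw [← Matrix.charpoly_toLin', ← LinearMap.finrank_maxGenEigenspace_eq, Matrix.rank, this]

end IsSpecDecomp

/-- The eigenvalues of `B` are among the `u i`. -/
theorem isSpecDecomp_specIdem {B : Matrix ι ι ℂ} {u : Fin k → ℂ} (hu : Function.Injective u)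
    (hB : spectrum ℂ B ⊆ Set.range u) : IsSpecDecomp B u (specIdem u B) := by
  have hdvd : B.charpoly ∣ (∏ j, (X - C (u j)) ^ Fintype.card ι) := by
    have hs := (IsAlgClosed.splits B.charpoly).eq_prod_roots
    rw [B.charpoly_monic.leadingCoeff, C_1, one_mul] at hs
    rw [hs]
    refine (Multiset.prod_dvd_prod_of_dvd (S := B.charpoly.roots) _
      (fun _ => ∏ j, (X - C (u j))) ?_).trans ?_
    · intro a ha
      obtain ⟨j, rfl⟩ := hB (Matrix.mem_spectrum_iff_isRoot_charpoly.2 (isRoot_of_mem_roots ha))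
      exact Finset.dvd_prod_of_mem (fun j => X - C (u j)) (Finset.mem_univ j)
    · rw [Multiset.map_const', Multiset.prod_replicate, Finset.prod_pow,
        splits_iff_card_roots.1 (IsAlgClosed.splits B.charpoly), Matrix.charpoly_natDegree_eq_dim]
  have hz : ∀ p : ℂ[X], (∀ j, (X - C (u j)) ^ Fintype.card ι ∣ p) → aeval B p = 0 := by
    intro p hp
    have h1 : (∏ j, (X - C (u j)) ^ Fintype.card ι) ∣ p :=
      Finset.prod_dvd_of_coprime (fun a _ b _ hab =>
        (Polynomial.pairwise_coprime_X_sub_C hu hab).pow) fun j _ => hp j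
    obtain ⟨q, rfl⟩ := hdvd.trans h1
    rw [map_mul, Matrix.aeval_self_charpoly, zero_mul]
  have hmod : ∀ i j, ∃ q, specPoly (Fintype.card ι) u i =
      (X - C (u j)) ^ Fintype.card ι * q + C (if i = j then 1 else 0) := by
    intro i j
    obtain ⟨q, hq⟩ := dvd_specPoly_sub (Fintype.card ι) hu i j
    exact ⟨q, by rw [← hq]; ring⟩
  refine ⟨fun i j => ?_, ?_, fun i => ?_, fun i => ?_⟩
  · simp only [specIdem]
    rw [← map_mul, ← sub_eq_zero]
    have : (if i = j then aeval B (specPoly (Fintype.card ι) u i) else 0) =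
        aeval B (if i = j then specPoly (Fintype.card ι) u i else 0) := by
      split_ifs <;> simp
    rw [this, ← map_sub]
    refine hz _ fun l => ?_
    obtain ⟨q, hq⟩ := hmod i l
    obtain ⟨q', hq'⟩ := hmod j l
    by_cases hij : i = j
    · subst hij
      rw [if_pos rfl]
      by_cases hl : i = l
      · rw [hq, if_pos hl, C_1]
        exact ⟨q * ((X - C (u l)) ^ Fintype.card ι * q) + q, by ring⟩
      · rw [hq, if_neg hl, C_0]
        exact ⟨q * ((X - C (u l)) ^ Fintype.card ι * q) - q, by ring⟩
    · rw [if_neg hij, sub_zero]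
      by_cases hl : i = l
      · rw [hq', if_neg (fun h => hij (hl.trans h.symm)), C_0, add_zero]
        exact Dvd.dvd.mul_left (Dvd.intro _ rfl) _
      · rw [hq, if_neg hl, C_0, add_zero]
        exact Dvd.dvd.mul_right (Dvd.intro _ rfl) _
  · simp only [specIdem]
    rw [← map_sum, ← sub_eq_zero, ← map_one (aeval (R := ℂ) B), ← map_sub]
    refine hz _ fun l => ?_
    have : (∑ i, specPoly (Fintype.card ι) u i) - 1 =
        ∑ i, (specPoly (Fintype.card ι) u i - C (if i = l then 1 else 0)) := by
      rw [Finset.sum_sub_distrib]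
      congr 1
      rw [Finset.sum_eq_single l] <;> simp +contextual
    rw [this]
    exact Finset.dvd_sum fun i _ => dvd_specPoly_sub _ hu i l
  · exact (Algebra.commute_of_mem_adjoin_singleton_of_commute
      (Polynomial.aeval_mem_adjoin_singleton _ _) (Commute.refl B)).symm
  · have : (B - u i • 1) ^ Fintype.card ι = aeval B ((X - C (u i)) ^ Fintype.card ι) := by
      simp [Algebra.algebraMap_eq_smul_one]
    rw [this, specIdem, ← map_mul]
    refine hz _ fun l => ?_
    by_cases hl : i = l
    · exact hl ▸ Dvd.intro _ rfl
    · obtain ⟨q, hq⟩ := hmod i l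
      rw [hq, if_neg hl, C_0, add_zero]
      exact Dvd.dvd.mul_left (Dvd.intro _ rfl) _

/-- The explicit product shows that `specIdem` depends continuously on the eigenvalues and on the
matrix jointly. -/
theorem aeval_lagrangePoly (u : Fin k → ℂ) (B : Matrix ι ι ℂ) (i : Fin k) :
    aeval B (lagrangePoly u i) =
      ((List.finRange k).map fun j => if j = i then 1 else (u i - u j)⁻¹ • (B - u j • 1)).prod := by
  rw [lagrangePoly, Fin.prod_univ_def, map_list_prod, List.map_map]
  congr 1
  refine List.map_congr_left fun j _ => ?_
  simp only [Function.comp_apply]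
  split_ifs
  · simp
  · simp [Algebra.algebraMap_eq_smul_one, smul_sub]

theorem continuousOn_specIdem (i : Fin k) :
    ContinuousOn (fun z : (Fin k → ℂ) × Matrix ι ι ℂ => specIdem z.1 z.2 i)
      {z | Function.Injective z.1} := by
  simp only [specIdem, specPoly, map_sub, map_one, map_pow, aeval_lagrangePoly]
  refine continuousOn_const.sub ((continuousOn_const.sub (ContinuousOn.pow ?_ _)).pow _)
  refine continuousOn_list_prod _ fun j _ => ?_
  split_ifs with h
  · exact continuousOn_const
  · have h1 : Continuous fun z : (Fin k → ℂ) × Matrix ι ι ℂ => z.1 i - z.1 j := by fun_prop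
    have h2 : Continuous fun z : (Fin k → ℂ) × Matrix ι ι ℂ =>
        z.2 - z.1 j • (1 : Matrix ι ι ℂ) := by fun_prop
    refine (h1.continuousOn.inv₀ ?_).smul h2.continuousOn
    intro z hz
    exact sub_ne_zero.2 fun h' => h (hz h').symm

theorem continuous_specIdem {T : Type*} [TopologicalSpace T] {u : T → Fin k → ℂ}
    {B : T → Matrix ι ι ℂ} (hu : Continuous u) (hB : Continuous B)
    (hinj : ∀ t, Function.Injective (u t)) (i : Fin k) :
    Continuous fun t => specIdem (u t) (B t) i :=
  (continuousOn_specIdem i).comp_continuous (hu.prodMk hB) hinj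

theorem tendsto_specIdem {T : Type*} {l : Filter T} {u : T → Fin k → ℂ}
    {B : T → Matrix ι ι ℂ} {u₀ : Fin k → ℂ} {B₀ : Matrix ι ι ℂ}
    (hu : Filter.Tendsto u l (𝓝 u₀)) (hB : Filter.Tendsto B l (𝓝 B₀))
    (hinj : ∀ᶠ t in l, Function.Injective (u t)) (hinj₀ : Function.Injective u₀) (i : Fin k) :
    Filter.Tendsto (fun t => specIdem (u t) (B t) i) l
      (𝓝 (specIdem u₀ B₀ i)) :=
  ((continuousOn_specIdem i) (u₀, B₀) hinj₀).tendsto.comp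
    (tendsto_nhdsWithin_iff.2 ⟨hu.prodMk_nhds hB, hinj⟩)

end Spectral

/-! ### Eigenvalues and their multiplicities -/

section Roots

open Polynomial

variable {ι : Type*} [Fintype ι] [DecidableEq ι] {k : ℕ}

/-- The eigenvalues of `B` are the `u i`, with multiplicities `m i` (if the `u i` are distinct). -/
def HasRoots (B : Matrix ι ι ℂ) (u : Fin k → ℂ) (m : Fin k → ℕ) : Prop :=
  B.charpoly = ∏ i, (X - C (u i)) ^ m i

theorem hasRoots_rootMultiplicity {B : Matrix ι ι ℂ} {u : Fin k → ℂ} (hu : Function.Injective u)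
    (hB : spectrum ℂ B ⊆ Set.range u) :
    HasRoots B u fun i => B.charpoly.rootMultiplicity (u i) := by
  have hs := (IsAlgClosed.splits B.charpoly).eq_prod_roots
  rw [B.charpoly_monic.leadingCoeff, C_1, one_mul, prod_multiset_root_eq_finset_root] at hs
  rw [HasRoots, ← Finset.prod_image (s := Finset.univ) (g := u)
    (f := fun a => (X - C a) ^ B.charpoly.rootMultiplicity a) (fun _ _ _ _ h => hu h)]
  refine hs.trans (Finset.prod_subset ?_ ?_)
  · intro a ha
    obtain ⟨j, rfl⟩ := hB (Matrix.mem_spectrum_iff_isRoot_charpoly.2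
      (isRoot_of_mem_roots (Multiset.mem_toFinset.1 ha)))
    exact Finset.mem_image_of_mem _ (Finset.mem_univ j)
  · intro a _ ha
    rw [Multiset.mem_toFinset, mem_roots B.charpoly_monic.ne_zero] at ha
    rw [rootMultiplicity_eq_zero ha, pow_zero]

namespace HasRoots

variable {B : Matrix ι ι ℂ} {u : Fin k → ℂ} {m : Fin k → ℕ}

theorem spectrum_subset (h : HasRoots B u m) : spectrum ℂ B ⊆ Set.range u := by
  intro a ha
  rw [Matrix.mem_spectrum_iff_isRoot_charpoly, h, IsRoot.def, eval_prod,
    Finset.prod_eq_zero_iff] at ha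
  obtain ⟨i, -, hi⟩ := ha
  rw [eval_pow] at hi
  have := eq_zero_of_pow_eq_zero hi
  exact ⟨i, by simpa [sub_eq_zero, eq_comm] using this⟩

theorem spectrum_eq (h : HasRoots B u m) (hm : ∀ i, 0 < m i) : spectrum ℂ B = Set.range u := by
  refine h.spectrum_subset.antisymm ?_
  rintro _ ⟨i, rfl⟩
  rw [Matrix.mem_spectrum_iff_isRoot_charpoly, h, IsRoot.def, eval_prod]
  refine Finset.prod_eq_zero (Finset.mem_univ i) ?_
  simp [(hm i).ne']

theorem rootMultiplicity_eq (h : HasRoots B u m) (hu : Function.Injective u) (i : Fin k) :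
    B.charpoly.rootMultiplicity (u i) = m i := by
  have hne : ∀ i, (X - C (u i)) ^ m i ≠ 0 := fun i => pow_ne_zero _ (X_sub_C_ne_zero _)
  rw [← count_roots, h, roots_prod _ _ (Finset.prod_ne_zero_iff.2 fun i _ => hne i),
    Multiset.count_bind]
  simp only [roots_pow, roots_X_sub_C, Multiset.count_nsmul, Multiset.count_singleton]
  show ∑ j, _ = _
  rw [Finset.sum_eq_single i]
  · simp
  · intro j _ hj
    rw [if_neg fun h => hj (hu h.symm), mul_zero]
  · simp

theorem sum_eq (h : HasRoots B u m) : ∑ i, m i = Fintype.card ι := by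
  rw [← B.charpoly_natDegree_eq_dim, h, natDegree_prod _ _ fun i _ =>
    pow_ne_zero _ (X_sub_C_ne_zero _)]
  simp

theorem isSpecDecomp (h : HasRoots B u m) (hu : Function.Injective u) :
    IsSpecDecomp B u (specIdem u B) := isSpecDecomp_specIdem hu h.spectrum_subset

theorem injective_of_ncard (h : HasRoots B u m) (hm : ∀ i, 0 < m i)
    (hk : (spectrum ℂ B).ncard = k) : Function.Injective u := by
  rw [h.spectrum_eq hm, ← Set.image_univ] at hk
  have := Set.injOn_of_ncard_image_eq (s := Set.univ) (f := u) (by rw [hk]; simp)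
  exact Set.injOn_univ.1 this

theorem ncard_spectrum (h : HasRoots B u m) (hm : ∀ i, 0 < m i) (hu : Function.Injective u) :
    (spectrum ℂ B).ncard = k := by
  rw [h.spectrum_eq hm, Set.ncard_range_of_injective hu]
  simp

end HasRoots

theorem IsSpecDecomp.hasRoots {B : Matrix ι ι ℂ} {u : Fin k → ℂ} {e : Fin k → Matrix ι ι ℂ}
    (h : IsSpecDecomp B u e) (hu : Function.Injective u) : HasRoots B u fun i => (e i).rank := by
  have hsub : spectrum ℂ B ⊆ Set.range u := by
    intro a ha
    by_contra hne
    rw [← Matrix.spectrum_toLin', ← Module.End.hasEigenvalue_iff_mem_spectrum] at ha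
    obtain ⟨x, hx⟩ := ha.exists_hasEigenvector
    have hBx : B.mulVec x = a • x := by simpa using hx.apply_eq_smul
    have hpow : ∀ (i : Fin k) (n : ℕ), ((B - u i • 1) ^ n).mulVec x = (a - u i) ^ n • x := by
      intro i n
      induction n with
      | zero => simp
      | succ n ih =>
        rw [pow_succ, ← Matrix.mulVec_mulVec, Matrix.sub_mulVec, hBx, Matrix.smul_mulVec,
          Matrix.one_mulVec, ← sub_smul, Matrix.mulVec_smul, ih, smul_smul, pow_succ, mul_comm]
    apply hx.2
    have h1 : ∀ i, (e i).mulVec x = 0 := by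
      intro i
      have c : Commute (e i) ((B - u i • 1) ^ Fintype.card ι) :=
        ((h.comm i).sub_right ((Commute.one_right _).smul_right _)).pow_right _
      have h2 := congrArg (fun Y => Matrix.mulVec Y x) (c.eq.trans (h.nil i))
      simp only [← Matrix.mulVec_mulVec, hpow, Matrix.mulVec_smul, Matrix.zero_mulVec] at h2
      exact (smul_eq_zero.1 h2).resolve_left
        (pow_ne_zero _ (sub_ne_zero.2 fun h => hne ⟨i, h.symm⟩))
    rw [← Matrix.one_mulVec x, ← h.sum_eq, Matrix.sum_mulVec]
    exact Finset.sum_eq_zero fun i _ => h1 i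
  have := hasRoots_rootMultiplicity hu hsub
  simpa only [h.rootMultiplicity_eq hu] using this

theorem exists_hasRoots_of_ncard {B : Matrix ι ι ℂ} (hk : (spectrum ℂ B).ncard = k) :
    ∃ (u : Fin k → ℂ) (m : Fin k → ℕ), Function.Injective u ∧ (∀ i, 0 < m i) ∧
      HasRoots B u m := by
  have hf := Matrix.finite_spectrum B
  rw [Set.ncard_eq_toFinset_card _ hf] at hk
  let f := Finset.equivFinOfCardEq hk
  have hu : Function.Injective fun i => (f.symm i).1 :=
    Subtype.val_injective.comp f.symm.injective
  refine ⟨fun i => (f.symm i).1, _, hu, ?_, hasRoots_rootMultiplicity hu ?_⟩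
  · intro i
    have := (f.symm i).2
    rw [Set.Finite.mem_toFinset, Matrix.mem_spectrum_iff_isRoot_charpoly] at this
    exact (rootMultiplicity_pos B.charpoly_monic.ne_zero).2 this
  · intro a ha
    exact ⟨f ⟨a, hf.mem_toFinset.2 ha⟩, by simp⟩

/-- The colored spectrum in terms of the characteristic polynomial. -/
theorem isColoredSpectrum_iff {d : ℕ} {c : Fin k → ℕ} (hd : 0 < d) (hc : ∀ i, 0 < c i)
    {B : Matrix ι ι ℂ} {u : OrderedConfig k} :
    IsColoredSpectrum d c B u ↔ HasRoots B u.1 fun i => d * c i := by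
  constructor
  · rintro ⟨h1, h2⟩
    have := hasRoots_rootMultiplicity u.2 h1.ge
    simpa only [h2] using this
  · intro h
    exact ⟨(h.spectrum_eq fun i => Nat.mul_pos hd (hc i)).symm, h.rootMultiplicity_eq u.2⟩

/-- The colored spectrum is unique up to a permutation that preserves the colors. -/
theorem HasRoots.exists_perm {B : Matrix ι ι ℂ} {u v : Fin k → ℂ} {m m' : Fin k → ℕ}
    (h : HasRoots B u m) (h' : HasRoots B v m') (hu : Function.Injective u)
    (hv : Function.Injective v) (hm : ∀ i, 0 < m i) (hm' : ∀ i, 0 < m' i) :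
    ∃ w : Equiv.Perm (Fin k), (∀ i, m (w i) = m' i) ∧ ∀ i, v i = u (w i) := by
  have hr : Set.range v = Set.range u := by rw [← h.spectrum_eq hm, h'.spectrum_eq hm']
  have hex : ∀ i, ∃ j, u j = v i := fun i => hr.le ⟨i, rfl⟩
  choose s hs using hex
  have hinj : Function.Injective s := fun i j hij => hv (by rw [← hs, ← hs, hij])
  refine ⟨Equiv.ofBijective s (Finite.injective_iff_bijective.1 hinj), fun i => ?_,
    fun i => (hs i).symm⟩
  rw [← h.rootMultiplicity_eq hu, ← h'.rootMultiplicity_eq hv, Equiv.ofBijective_apply, hs]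

/-- A bound on the eigenvalues that is continuous in `B`, by Gershgorin circles. -/
theorem norm_le_of_mem_spectrum {B : Matrix ι ι ℂ} {a : ℂ} (ha : a ∈ spectrum ℂ B) :
    ‖a‖ ≤ ∑ i, ∑ j, ‖B i j‖ := by
  rw [← Matrix.spectrum_toLin', ← Module.End.hasEigenvalue_iff_mem_spectrum] at ha
  obtain ⟨i, hi⟩ := eigenvalue_mem_ball ha
  rw [mem_closedBall_iff_norm] at hi
  calc ‖a‖ = ‖B i i + (a - B i i)‖ := by rw [add_sub_cancel]
    _ ≤ ‖B i i‖ + ∑ j ∈ Finset.univ.erase i, ‖B i j‖ := (norm_add_le _ _).trans (by gcongr)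
    _ = ∑ j, ‖B i j‖ := Finset.add_sum_erase _ (fun j => ‖B i j‖) (Finset.mem_univ i)
    _ ≤ _ := Finset.single_le_sum (f := fun i => ∑ j, ‖B i j‖)
        (fun _ _ => Finset.sum_nonneg fun _ _ => norm_nonneg _) (Finset.mem_univ i)

/-- Continuity of roots: along an ultrafilter, the eigenvalues of a convergent family of matrices
converge to the eigenvalues of the limit. -/
theorem exists_tendsto_roots {T : Type*} (l : Ultrafilter T) {B : T → Matrix ι ι ℂ}
    {B₀ : Matrix ι ι ℂ} (hB : Filter.Tendsto B l (𝓝 B₀)) {u : T → Fin k → ℂ} {m : Fin k → ℕ}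
    (hm : ∀ i, 0 < m i) (h : ∀ᶠ t in l, HasRoots (B t) (u t) m) :
    ∃ v, Filter.Tendsto u l (𝓝 v) ∧ HasRoots B₀ v m := by
  have hev : ∀ᶠ t in l, ∀ i, ‖u t i‖ ≤ ∑ i, ∑ j, ‖B₀ i j‖ + 1 := by
    have hc : Continuous fun B : Matrix ι ι ℂ => ∑ i, ∑ j, ‖B i j‖ := by
      refine continuous_finsetSum _ fun i _ => continuous_finsetSum _ fun j _ => ?_
      exact (continuous_id.matrix_elem i j).norm
    have := ((hc.tendsto B₀).comp hB).eventually (eventually_le_nhds (lt_add_one _))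
    filter_upwards [this, h] with t ht ht' i
    refine (norm_le_of_mem_spectrum ?_).trans ht
    rw [ht'.spectrum_eq hm]
    exact ⟨i, rfl⟩
  have hK : IsCompact (Set.univ.pi fun _ : Fin k =>
      Metric.closedBall (0 : ℂ) (∑ i, ∑ j, ‖B₀ i j‖ + 1)) :=
    isCompact_univ_pi fun _ => isCompact_closedBall _ _
  obtain ⟨v, -, hv⟩ := hK.ultrafilter_le_nhds (l.map u) (by
    rw [Filter.le_principal_iff, Ultrafilter.mem_coe, Ultrafilter.mem_map]
    show _ ∈ (l : Filter T)
    filter_upwards [hev] with t ht i _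
    simpa using ht i)
  refine ⟨v, hv, Polynomial.funext fun z => ?_⟩
  have h1 : Filter.Tendsto (fun t => (B t).charpoly.eval z) l (𝓝 (B₀.charpoly.eval z)) := by
    simp only [Matrix.eval_charpoly]
    have hc : Continuous fun B : Matrix ι ι ℂ => (Matrix.scalar ι z - B).det := by fun_prop
    exact (hc.tendsto B₀).comp hB
  have h2 : Filter.Tendsto (fun t => (∏ i, (X - C (u t i)) ^ m i).eval z) l
      (𝓝 ((∏ i, (X - C (v i)) ^ m i).eval z)) := by
    simp only [eval_prod, eval_pow, eval_sub, eval_X, eval_C]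
    have hc : Continuous fun u : Fin k → ℂ => ∏ i, (z - u i) ^ m i := by fun_prop
    exact (hc.tendsto v).comp hv
  refine tendsto_nhds_unique h1 (h2.congr' ?_)
  filter_upwards [h] with t ht
  rw [ht]

end Roots

/-! ### The locus of matrices with many eigenvalues -/

section Hankel

open Polynomial

variable {ι : Type*} [Fintype ι] [DecidableEq ι]

/-- The Hankel determinant of the traces of powers of `B`. It detects whether `B` has at least
`k` distinct eigenvalues. -/
noncomputable def hankel (k : ℕ) (B : Matrix ι ι ℂ) : ℂ :=
  (Matrix.of fun a b : Fin k => (B ^ (a + b : ℕ)).trace).det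

/-- On each generalized eigenspace, `B ^ n` is `u i ^ n` up to a nilpotent matrix. -/
theorem trace_pow_mul_of_isSpecDecomp {m : ℕ} {B : Matrix ι ι ℂ} {u : Fin m → ℂ}
    {e : Fin m → Matrix ι ι ℂ} (h : IsSpecDecomp B u e) (n : ℕ) :
    (B ^ n).trace = ∑ i, u i ^ n * (e i).trace := by
  have h1 : ∀ i, (B ^ n * e i).trace = u i ^ n * (e i).trace := by
    intro i
    have c : Commute (B ^ n - u i ^ n • 1) (e i) :=
      ((h.comm i).symm.pow_left n).sub_left ((Commute.one_left _).smul_left _)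
    obtain ⟨q, hq⟩ := sub_dvd_pow_sub_pow X (C (u i)) n
    have hnil : IsNilpotent ((B ^ n - u i ^ n • 1) * e i) := by
      refine ⟨Fintype.card ι + 1, ?_⟩
      rw [c.mul_pow, (show IsIdempotentElem (e i) from h.idem i).pow_succ_eq]
      have : B ^ n - u i ^ n • 1 = aeval B (X ^ n - C (u i) ^ n) := by
        simp [Algebra.algebraMap_eq_smul_one, _root_.smul_pow]
      rw [this, ← map_pow]
      refine h.aeval_mul_of_dvd i ?_
      rw [hq, mul_pow, pow_succ, mul_assoc]
      exact Dvd.intro _ rfl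
    have h2 := (Matrix.isNilpotent_trace_of_isNilpotent hnil).eq_zero
    rw [sub_mul, Matrix.trace_sub, sub_eq_zero] at h2
    simpa using h2
  rw [← mul_one (B ^ n), ← h.sum_eq, Finset.mul_sum, Matrix.trace_sum]
  exact Finset.sum_congr rfl fun i _ => h1 i

theorem trace_ne_zero_of_idem {e : Matrix ι ι ℂ} (he : e * e = e) (h0 : e ≠ 0) :
    e.trace ≠ 0 := by
  intro h
  apply h0
  have h1 : IsIdempotentElem (Matrix.toLin' e) := by
    show Matrix.toLin' e * Matrix.toLin' e = _
    rw [Module.End.mul_eq_comp, ← Matrix.toLin'_mul, he]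
  have h2 := (LinearMap.IsIdempotentElem.trace_eq_zero_iff h1).1
    (by rw [Matrix.trace_toLin'_eq, h])
  simpa using h2

/-- The Hankel matrix factors as `Vᵀ * D * V`, with the Vandermonde matrix `V` of the distinct
eigenvalues and the diagonal matrix `D` of their multiplicities. So its rank is at most the number
of eigenvalues, and it is invertible if there are exactly `k` of them. -/
theorem hankel_ne_zero_iff {k : ℕ} {B : Matrix ι ι ℂ} (hB : (spectrum ℂ B).ncard ≤ k) :
    hankel k B ≠ 0 ↔ (spectrum ℂ B).ncard = k := by
  obtain ⟨u, m, hu, hm, h⟩ := exists_hasRoots_of_ncard (B := B) rfl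
  have hd := h.isSpecDecomp hu
  have hH : (Matrix.of fun a b : Fin k => (B ^ (a + b : ℕ)).trace) =
      (Matrix.of fun (i : Fin (spectrum ℂ B).ncard) (a : Fin k) => u i ^ (a : ℕ)).transpose *
        (Matrix.diagonal (fun i => (specIdem u B i).trace) *
          Matrix.of fun (i : Fin (spectrum ℂ B).ncard) (a : Fin k) => u i ^ (a : ℕ)) := by
    ext a b
    rw [Matrix.of_apply, trace_pow_mul_of_isSpecDecomp hd, Matrix.mul_apply]
    refine Finset.sum_congr rfl fun i _ => ?_
    rw [Matrix.diagonal_mul]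
    simp only [Matrix.transpose_apply, Matrix.of_apply]
    ring
  constructor
  · intro hne
    refine hB.antisymm ?_
    have h1 : (Matrix.of fun a b : Fin k => (B ^ (a + b : ℕ)).trace).rank = k := by
      rw [Matrix.rank_of_isUnit _ ((Matrix.isUnit_iff_isUnit_det _).2 (isUnit_iff_ne_zero.2 hne)),
        Fintype.card_fin]
    rw [hH] at h1
    exact h1.symm.le.trans ((Matrix.rank_mul_le_left _ _).trans
      ((Matrix.rank_le_card_width _).trans_eq (Fintype.card_fin _)))
  · intro hk
    have hgen : ∀ (n : ℕ) (u : Fin n → ℂ) (w : Fin n → ℂ), n = k → Function.Injective u →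
        (∀ i, w i ≠ 0) →
        ((Matrix.of fun (i : Fin n) (a : Fin k) => u i ^ (a : ℕ)).transpose *
        (Matrix.diagonal w *
          Matrix.of fun (i : Fin n) (a : Fin k) => u i ^ (a : ℕ))).det ≠ 0 := by
      rintro n u w rfl hu hw
      have hv : (Matrix.of fun (i : Fin n) (a : Fin n) => u i ^ (a : ℕ)) =
        Matrix.vandermonde u := rfl
      rw [hv, Matrix.det_mul, Matrix.det_mul, Matrix.det_transpose, Matrix.det_diagonal]
      have := Matrix.det_vandermonde_ne_zero_iff.2 hu
      exact mul_ne_zero this (mul_ne_zero (Finset.prod_ne_zero_iff.2 fun i _ => hw i) this)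
    rw [hankel, hH]
    refine hgen _ u _ hk hu fun i => trace_ne_zero_of_idem (hd.idem i) ?_
    intro h0
    have := hd.rootMultiplicity_eq hu i
    rw [h0, Matrix.rank_zero, h.rootMultiplicity_eq hu] at this
    exact (hm i).ne' this

/-- The function on matrices defined by a polynomial in the matrix entries. -/
noncomputable abbrev evalEntries (p : MvPolynomial (ι × ι) ℂ) (B : Matrix ι ι ℂ) : ℂ :=
  MvPolynomial.eval (fun e : ι × ι => B e.1 e.2) p

/-- The Hankel determinant is a polynomial in the matrix entries. -/
theorem exists_evalEntries_eq_hankel (k : ℕ) :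
    ∃ p : MvPolynomial (ι × ι) ℂ, ∀ B : Matrix ι ι ℂ, evalEntries p B = hankel k B := by
  let G : Matrix ι ι (MvPolynomial (ι × ι) ℂ) := Matrix.of fun i j => MvPolynomial.X (i, j)
  refine ⟨(Matrix.of fun a b : Fin k => (G ^ (a + b : ℕ)).trace).det, fun B => ?_⟩
  have hG : (MvPolynomial.eval (fun e : ι × ι => B e.1 e.2)).mapMatrix G = B := by
    ext i j
    simp [G]
  rw [evalEntries, RingHom.map_det, hankel]
  congr 1
  ext a b
  rw [RingHom.mapMatrix_apply, Matrix.map_apply, Matrix.of_apply, Matrix.of_apply,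
    AddMonoidHom.map_trace]
  have h2 : (G ^ (a + b : ℕ)).map (MvPolynomial.eval fun e : ι × ι => B e.1 e.2) =
      B ^ (a + b : ℕ) := by
    rw [← RingHom.mapMatrix_apply, map_pow, hG]
  rw [← h2]

omit [Fintype ι] [DecidableEq ι] in
/-- The restriction of a polynomial function to an affine line is a polynomial in one variable. -/
theorem exists_evalEntries_line (p : MvPolynomial (ι × ι) ℂ) (x y : Matrix ι ι ℂ) :
    ∃ q : ℂ[X], ∀ z, q.eval z = evalEntries p (x + z • y) := by
  refine ⟨MvPolynomial.eval₂ C (fun e => C (x e.1 e.2) + X * C (y e.1 e.2)) p, fun z => ?_⟩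
  have := MvPolynomial.hom_eval₂ p C (Polynomial.evalRingHom z)
    (fun e : ι × ι => C (x e.1 e.2) + X * C (y e.1 e.2))
  rw [Polynomial.coe_evalRingHom] at this
  rw [this, evalEntries, MvPolynomial.eval, MvPolynomial.coe_eval₂Hom]
  congr 1
  · ext w
    simp
  · ext e
    simp only [eval_add, eval_C, eval_mul, eval_X, Matrix.add_apply,
      Matrix.smul_apply, smul_eq_mul]

omit [Fintype ι] [DecidableEq ι] in
/-- The complement of a hypersurface in a complex vector space is path connected. -/
theorem joinedIn_evalEntries_ne_zero (V : Submodule ℂ (Matrix ι ι ℂ))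
    (p : MvPolynomial (ι × ι) ℂ) {x y : Matrix ι ι ℂ} (hx : x ∈ V) (hy : y ∈ V)
    (hpx : evalEntries p x ≠ 0) (hpy : evalEntries p y ≠ 0) :
    JoinedIn {B | B ∈ V ∧ evalEntries p B ≠ 0} x y := by
  obtain ⟨q, hq⟩ := exists_evalEntries_line p x (y - x)
  obtain ⟨ε, -, hε⟩ := exists_arc_eval_ne_zero q (by simpa [hq] using hpx)
    (by simpa [hq] using hpy) one_pos
  refine ⟨⟨⟨fun t => x + arc ε t • (y - x), by fun_prop⟩, by simp, by simp⟩, fun t => ?_⟩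
  refine ⟨V.add_mem hx (V.smul_mem _ (V.sub_mem hy hx)), ?_⟩
  have := hε t
  rwa [hq] at this

end Hankel

/-! ### The covering by ordered configurations -/

section Covering

variable {k : ℕ}

/-- The permutations of the indices that preserve the colors. -/
def colorPerm (c : Fin k → ℕ) : Subgroup (Equiv.Perm (Fin k)) where
  carrier := {w | ∀ i, c (w i) = c i}
  mul_mem' {v w} hv hw i := by simp [hv (w i), hw i]
  one_mem' _ := rfl
  inv_mem' {w} hw i := by simpa using (hw (w⁻¹ i)).symm

instance (c : Fin k → ℕ) : MulAction (colorPerm c) (OrderedConfig k) where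
  smul w u := ⟨fun i => u.1 (w.1⁻¹ i), u.2.comp (w.1⁻¹).injective⟩
  one_smul _ := rfl
  mul_smul _ _ _ := by ext; simp [HSMul.hSMul]

theorem colorPerm_smul_apply {c : Fin k → ℕ} (w : colorPerm c) (u : OrderedConfig k) (i : Fin k) :
    (w • u).1 i = u.1 (w.1⁻¹ i) := rfl

/-- The ordered configurations cover the colored ones, as the quotient by a finite group that acts
freely. -/
theorem isCoveringMap_coloredConfigMk (c : Fin k → ℕ) : IsCoveringMap (ColoredConfig.mk c) := by
  suffices h : IsQuotientCoveringMap (ColoredConfig.mk c) (colorPerm c) from h.isCoveringMap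
  refine ⟨isQuotientMap_quotient_mk', ⟨fun w => ?_⟩, fun {u v} => ?_, fun u => ?_⟩
  · refine Continuous.subtype_mk (continuous_pi fun i => ?_) _
    exact (continuous_apply (w.1⁻¹ i)).comp continuous_subtype_val
  · rw [Quotient.eq]
    constructor
    · rintro ⟨w, hw, h⟩
      refine ⟨⟨w, hw⟩, Subtype.ext (funext fun i => ?_)⟩
      simp [colorPerm_smul_apply, h]
    · rintro ⟨w, rfl⟩
      exact ⟨w.1, w.2, fun i => by simp [colorPerm_smul_apply]⟩
  · -- each point of a tuple in `U` is closest to the corresponding point of `u`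
    refine ⟨{v | ∀ i j, i ≠ j → ‖v.1 i - u.1 i‖ < ‖v.1 i - u.1 j‖}, ?_, ?_⟩
    · simp only [Set.ofPred_forall]
      refine (Filter.iInter_mem.2 fun i => Filter.iInter_mem.2 fun j =>
        Filter.iInter_mem.2 fun hij => ?_)
      refine (isOpen_lt ?_ ?_).mem_nhds ?_
      · exact (((continuous_apply i).comp continuous_subtype_val).sub continuous_const).norm
      · exact (((continuous_apply i).comp continuous_subtype_val).sub continuous_const).norm
      · simpa [sub_eq_zero] using fun h => hij (u.2 h)
    · rintro w ⟨_, ⟨v, hv, rfl⟩, hv'⟩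
      ext1
      rw [← inv_inj]
      ext1 i
      by_contra hne
      have h1 := hv (w.1⁻¹ i) i hne
      have h2 := hv' i (w.1⁻¹ i) (Ne.symm hne)
      rw [colorPerm_smul_apply] at h2
      exact lt_asymm h1 h2

/-- A path of colored configurations lifts to a path of ordered configurations. -/
theorem exists_orderedConfig_lift {c : Fin k → ℕ} (γ : C(I, ColoredConfig c)) (u : OrderedConfig k)
    (hu : γ 0 = ColoredConfig.mk c u) :
    ∃ v : C(I, OrderedConfig k), (∀ t, ColoredConfig.mk c (v t) = γ t) ∧ v 0 = u := by
  obtain ⟨v, hv, h0⟩ := (isCoveringMap_coloredConfigMk c).exists_path_lifts γ u hu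
  exact ⟨v, fun t => congrFun hv t, h0⟩

end Covering

/-! ### The Cayley transform -/

section Cayley

variable {ι : Type*} [Fintype ι] [DecidableEq ι]

/-- The matrices whose Cayley transform is defined and invertible. -/
def cayleyDomain (ι : Type*) [Fintype ι] [DecidableEq ι] : Set (Matrix ι ι ℂ) :=
  {X | (1 + X).det ≠ 0 ∧ (1 - X).det ≠ 0}

theorem zero_mem_cayleyDomain : (0 : Matrix ι ι ℂ) ∈ cayleyDomain ι := by
  simp [cayleyDomain]

theorem neg_mem_cayleyDomain {X : Matrix ι ι ℂ} (hX : X ∈ cayleyDomain ι) :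
    -X ∈ cayleyDomain ι := by
  simpa [cayleyDomain, sub_eq_add_neg, and_comm] using hX

theorem isOpen_cayleyDomain : IsOpen (cayleyDomain ι) := by
  have h1 : Continuous fun X : Matrix ι ι ℂ => (1 + X).det := by fun_prop
  have h2 : Continuous fun X : Matrix ι ι ℂ => (1 - X).det := by fun_prop
  exact (isOpen_ne_fun h1 continuous_const).inter (isOpen_ne_fun h2 continuous_const)

open Classical in
/-- The Cayley transform `(1 + X)⁻¹ (1 - X)`. Outside of `cayleyDomain` it has the value `1`. -/
noncomputable def cayley (X : Matrix ι ι ℂ) : (Matrix ι ι ℂ)ˣ :=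
  if h : X ∈ cayleyDomain ι then
    { val := (1 + X)⁻¹ * (1 - X)
      inv := (1 - X)⁻¹ * (1 + X)
      val_inv := by
        rw [mul_assoc, Matrix.mul_nonsing_inv_cancel_left _ _ (isUnit_iff_ne_zero.2 h.2),
          Matrix.nonsing_inv_mul _ (isUnit_iff_ne_zero.2 h.1)]
      inv_val := by
        rw [mul_assoc, Matrix.mul_nonsing_inv_cancel_left _ _ (isUnit_iff_ne_zero.2 h.1),
          Matrix.nonsing_inv_mul _ (isUnit_iff_ne_zero.2 h.2)] }
  else 1

theorem cayley_val {X : Matrix ι ι ℂ} (hX : X ∈ cayleyDomain ι) :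
    (cayley X).val = (1 + X)⁻¹ * (1 - X) := by
  rw [cayley, dif_pos hX]

theorem cayley_inv_val {X : Matrix ι ι ℂ} (hX : X ∈ cayleyDomain ι) :
    (cayley X)⁻¹.val = (1 - X)⁻¹ * (1 + X) := by
  rw [cayley, dif_pos hX]
  rfl

theorem one_add_mul_cayley {X : Matrix ι ι ℂ} (hX : X ∈ cayleyDomain ι) :
    (1 + X) * (cayley X).val = 1 - X := by
  rw [cayley_val hX, Matrix.mul_nonsing_inv_cancel_left _ _ (isUnit_iff_ne_zero.2 hX.1)]

theorem eq_cayley {X : Matrix ι ι ℂ} (hX : X ∈ cayleyDomain ι) {g : (Matrix ι ι ℂ)ˣ}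
    (h : (1 + X) * g.val = 1 - X) : g = cayley X := by
  ext1
  rw [cayley_val hX, ← h, Matrix.nonsing_inv_mul_cancel_left _ _ (isUnit_iff_ne_zero.2 hX.1)]

theorem cayley_inv {X : Matrix ι ι ℂ} (hX : X ∈ cayleyDomain ι) :
    (cayley X)⁻¹ = cayley (-X) := by
  refine eq_cayley (neg_mem_cayleyDomain hX) ?_
  rw [cayley_inv_val hX, ← sub_eq_add_neg,
    Matrix.mul_nonsing_inv_cancel_left _ _ (isUnit_iff_ne_zero.2 hX.2), sub_neg_eq_add]

@[simp] theorem cayley_zero : cayley (0 : Matrix ι ι ℂ) = 1 :=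
  (eq_cayley zero_mem_cayleyDomain (by simp)).symm

theorem commute_matrix_inv {A X : Matrix ι ι ℂ} (h : Commute A X) : Commute A X⁻¹ := by
  by_cases hX : IsUnit X.det
  · exact Commute.units_inv_right (u := Matrix.nonsingInvUnit X hX) h
  · rw [Matrix.nonsing_inv_apply_not_isUnit X hX]
    exact Commute.zero_right _

theorem commute_cayley {A X : Matrix ι ι ℂ} (h : Commute A X) :
    Commute A (cayley X).val := by
  by_cases hX : X ∈ cayleyDomain ι
  · rw [cayley_val hX]
    exact (commute_matrix_inv ((Commute.one_right _).add_right h)).mul_right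
      ((Commute.one_right _).sub_right h)
  · rw [cayley, dif_neg hX]
    exact Commute.one_right _

theorem cayley_mul_one_add {X : Matrix ι ι ℂ} (hX : X ∈ cayleyDomain ι) :
    (cayley X).val * (1 + X) = 1 - X := by
  rw [← one_add_mul_cayley hX]
  exact (commute_cayley ((Commute.one_left _).add_left (Commute.refl X))).symm

theorem continuousOn_matrix_inv :
    ContinuousOn (fun X : Matrix ι ι ℂ => X⁻¹) {X | X.det ≠ 0} := by
  simp only [Matrix.inv_def, Ring.inverse_eq_inv']
  have h : Continuous fun X : Matrix ι ι ℂ => X.det := by fun_prop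
  have h' : Continuous fun X : Matrix ι ι ℂ => X.adjugate := by fun_prop
  exact (h.continuousOn.inv₀ fun _ hX => hX).smul h'.continuousOn

theorem continuousOn_cayley :
    ContinuousOn (cayley : Matrix ι ι ℂ → (Matrix ι ι ℂ)ˣ) (cayleyDomain ι) := by
  rw [continuousOn_iff_continuous_domRestrict, Units.continuous_iff]
  have h1 : Continuous fun X : cayleyDomain ι => (1 + X.1)⁻¹ :=
    continuousOn_matrix_inv.comp_continuous (by fun_prop) fun X => X.2.1
  have h2 : Continuous fun X : cayleyDomain ι => (1 - X.1)⁻¹ :=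
    continuousOn_matrix_inv.comp_continuous (by fun_prop) fun X => X.2.2
  constructor
  · refine (h1.mul (by fun_prop : Continuous fun X : cayleyDomain ι => 1 - X.1)).congr fun X => ?_
    simp [cayley_val X.2]
  · refine (h2.mul (by fun_prop : Continuous fun X : cayleyDomain ι => 1 + X.1)).congr fun X => ?_
    simp [cayley_inv_val X.2]

/-- The inverse of the Cayley transform, which is given by the same formula. -/
noncomputable def invCayley (g : Matrix ι ι ℂ) : Matrix ι ι ℂ := (1 + g)⁻¹ * (1 - g)

theorem one_add_mul_invCayley {g : Matrix ι ι ℂ} (hg : (1 + g).det ≠ 0) :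
    (1 + g) * invCayley g = 1 - g := by
  rw [invCayley, Matrix.mul_nonsing_inv_cancel_left _ _ (isUnit_iff_ne_zero.2 hg)]

theorem commute_invCayley {A g : Matrix ι ι ℂ} (h : Commute A g) : Commute A (invCayley g) := by
  exact (commute_matrix_inv ((Commute.one_right _).add_right h)).mul_right
    ((Commute.one_right _).sub_right h)

theorem invCayley_mem_cayleyDomain {g : (Matrix ι ι ℂ)ˣ}
    (hg : (1 + g.val).det ≠ 0) : invCayley g.val ∈ cayleyDomain ι := by
  have h := one_add_mul_invCayley hg
  have h1 : (1 + g.val) * (1 + invCayley g.val) = (2 : ℂ) • 1 := by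
    rw [mul_add, h, mul_one, two_smul]
    abel
  have h2 : (1 + g.val) * (1 - invCayley g.val) = (2 : ℂ) • g := by
    rw [mul_sub, h, mul_one, two_smul]
    abel
  have hgd : g.val.det ≠ 0 :=
    isUnit_iff_ne_zero.1 ((Matrix.isUnit_iff_isUnit_det _).1 g.isUnit)
  constructor
  · intro h0
    have := congrArg Matrix.det h1
    rw [Matrix.det_mul, h0, mul_zero, Matrix.det_smul] at this
    exact pow_ne_zero (Fintype.card ι) (two_ne_zero (α := ℂ)) (by simpa using this.symm)
  · intro h0
    have := congrArg Matrix.det h2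
    rw [Matrix.det_mul, h0, mul_zero, Matrix.det_smul] at this
    simp [hgd] at this

theorem cayley_invCayley {g : (Matrix ι ι ℂ)ˣ} (hg : (1 + g.val).det ≠ 0) :
    cayley (invCayley g.val) = g := by
  refine (eq_cayley (invCayley_mem_cayleyDomain hg) ?_).symm
  have h := one_add_mul_invCayley hg
  have hc : Commute g.val (invCayley g.val) :=
    commute_invCayley (Commute.refl _)
  rw [add_mul, one_mul, ← hc.eq]
  rw [add_mul, one_mul, eq_sub_iff_add_eq] at h
  rw [← h]
  abel

theorem one_add_cayley {X : Matrix ι ι ℂ} (hX : X ∈ cayleyDomain ι) :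
    (1 + X) * (1 + (cayley X).val) = (2 : ℂ) • 1 := by
  rw [mul_add, one_add_mul_cayley hX, mul_one, two_smul]
  abel

theorem det_one_add_cayley_ne_zero {X : Matrix ι ι ℂ} (hX : X ∈ cayleyDomain ι) :
    (1 + (cayley X).val).det ≠ 0 := by
  intro h0
  have := congrArg Matrix.det (one_add_cayley hX)
  rw [Matrix.det_mul, h0, mul_zero, Matrix.det_smul] at this
  exact pow_ne_zero (Fintype.card ι) (two_ne_zero (α := ℂ)) (by simpa using this.symm)

theorem invCayley_cayley {X : Matrix ι ι ℂ} (hX : X ∈ cayleyDomain ι) :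
    invCayley (cayley X).val = X := by
  have h := cayley_mul_one_add hX
  rw [invCayley]
  have h2 : (1 - (cayley X).val) = (1 + (cayley X).val) * X := by
    rw [add_mul, one_mul]
    rw [mul_add, mul_one, eq_sub_iff_add_eq] at h
    rw [← h]
    abel
  rw [h2, Matrix.nonsing_inv_mul_cancel_left _ _
    (isUnit_iff_ne_zero.2 (det_one_add_cayley_ne_zero hX))]

theorem continuousOn_invCayley :
    ContinuousOn (invCayley : Matrix ι ι ℂ → Matrix ι ι ℂ) {g | (1 + g).det ≠ 0} :=
  (continuousOn_matrix_inv.comp (f := fun g : Matrix ι ι ℂ => 1 + g) (by fun_prop)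
    fun _ hg => hg).mul (by fun_prop)

end Cayley

/-! ### Symmetric pairs and centralizers of nilpotent elements -/

section SymmetricPair

variable {ι : Type*} [Fintype ι] [DecidableEq ι]

/-- The common features of the three symmetric spaces: `S` is the space of all self-adjoint
matrices (without trace condition), `lie` the Lie algebra of skew-adjoint matrices and `K` the
group of isometries. All Jordan blocks of nilpotent elements of `S` occur with a multiplicity that
is divisible by `d`. -/
structure SymmetricPair (ι : Type*) [Fintype ι] [DecidableEq ι] where
  S : Submodule ℂ (Matrix ι ι ℂ)
  lie : Submodule ℂ (Matrix ι ι ℂ)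
  K : Subgroup (Matrix ι ι ℂ)ˣ
  d : ℕ
  d_pos : 0 < d
  one_mem : 1 ∈ S
  mul_mem : ∀ {X Y}, X ∈ S → Y ∈ S → Commute X Y → X * Y ∈ S
  conj_mem : ∀ {g : (Matrix ι ι ℂ)ˣ} {X : Matrix ι ι ℂ}, g ∈ K → X ∈ S →
    g.val * X * g⁻¹.val ∈ S
  cayley_mem : ∀ {X}, X ∈ lie → X ∈ cayleyDomain ι → cayley X ∈ K
  invCayley_mem : ∀ {g : (Matrix ι ι ℂ)ˣ}, g ∈ K → (1 + g.val).det ≠ 0 →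
    invCayley g.val ∈ lie
  sq_mem : ∀ {X}, X ∈ lie → X * X ∈ S
  add_inv_mem : ∀ {g : (Matrix ι ι ℂ)ˣ}, g ∈ K →
    g.val + g⁻¹.val ∈ S
  /-- Conjugations that keep a set of self-adjoint matrices self-adjoint are, near the identity,
  induced by isometries: this is a polar decomposition. -/
  polar : ∀ T ⊆ (S : Set (Matrix ι ι ℂ)), ∃ κ : (Matrix ι ι ℂ)ˣ → (Matrix ι ι ℂ)ˣ, κ 1 = 1 ∧
    ∃ U ∈ 𝓝 (1 : (Matrix ι ι ℂ)ˣ),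
      ContinuousOn κ (U ∩ {g | ∀ t ∈ T, g.val * t * g⁻¹.val ∈ S}) ∧
      ∀ g ∈ U, (∀ t ∈ T, g.val * t * g⁻¹.val ∈ S) →
        κ g ∈ K ∧ ∀ t ∈ T, (κ g).val * t * (κ g)⁻¹.val =
          g.val * t * g⁻¹.val
  /-- The top power of a nilpotent element has rank at least `d`. -/
  indep : ∀ {A e : Matrix ι ι ℂ} {q : ℕ}, A ∈ S → e ∈ S → e * e = e → Commute A e →
    A ^ (q + 1) * e = 0 → A ^ q * e ≠ 0 →
    ∃ x : Fin d → ι → ℂ, LinearIndependent ℂ fun a => (A ^ q * e).mulVec (x a)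

namespace SymmetricPair

variable (P : SymmetricPair ι) {A : Matrix ι ι ℂ}

theorem pow_mem {B : Matrix ι ι ℂ} (hB : B ∈ P.S) (n : ℕ) : B ^ n ∈ P.S := by
  induction n with
  | zero => simpa using P.one_mem
  | succ n ih => exact pow_succ B n ▸ P.mul_mem ih hB ((Commute.refl B).pow_left n)

theorem aeval_mem {B : Matrix ι ι ℂ} (hB : B ∈ P.S) (p : Polynomial ℂ) :
    Polynomial.aeval B p ∈ P.S := by
  rw [Polynomial.aeval_eq_sum_range]
  exact P.S.sum_mem fun i _ => P.S.smul_mem _ (P.pow_mem hB i)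

theorem specIdem_mem {m : ℕ} {B : Matrix ι ι ℂ} (hB : B ∈ P.S) (u : Fin m → ℂ) (i : Fin m) :
    specIdem u B i ∈ P.S := P.aeval_mem hB _

/-- The last nonzero power of `A` on the range of `e` has rank at least `d`. -/
theorem exists_linearIndependent {e : Matrix ι ι ℂ} (hA : A ∈ P.S) (hn : IsNilpotent A)
    (he : e ∈ P.S) (hee : e * e = e) (hc : Commute A e) (h0 : e ≠ 0) :
    ∃ q, A ^ (q + 1) * e = 0 ∧
      ∃ x : Fin P.d → ι → ℂ, LinearIndependent ℂ fun a => (A ^ q * e).mulVec (x a) := by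
  classical
  have hex : ∃ n, A ^ n * e = 0 := hn.imp fun n h => by rw [h, zero_mul]
  obtain ⟨q, hq⟩ : ∃ q, Nat.find hex = q + 1 := Nat.exists_eq_succ_of_ne_zero fun h => by
    have := Nat.find_spec hex
    rw [h, pow_zero, one_mul] at this
    exact h0 this
  have h1 : A ^ (q + 1) * e = 0 := hq ▸ Nat.find_spec hex
  exact ⟨q, h1, P.indep hA he hee hc h1 (Nat.find_min hex (hq ▸ Nat.lt_succ_self q))⟩

/-- Orthogonal idempotents that commute with `A` split off blocks of `A`. -/
theorem mul_le_finrank_ker {m : ℕ} {e : Fin m → Matrix ι ι ℂ} (hA : A ∈ P.S)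
    (hn : IsNilpotent A) (he : ∀ i, e i ∈ P.S)
    (hmul : ∀ i j, e i * e j = if i = j then e i else 0) (hc : ∀ i, Commute A (e i))
    (h0 : ∀ i, e i ≠ 0) : m * P.d ≤ Module.finrank ℂ (LinearMap.ker (Matrix.toLin' A)) := by
  choose q hq x hx using fun i =>
    P.exists_linearIndependent hA hn (he i) (by simpa using hmul i i) (hc i) (h0 i)
  let f : Fin m × Fin P.d → LinearMap.ker (Matrix.toLin' A) := fun p =>
    ⟨(A ^ q p.1 * e p.1).mulVec (x p.1 p.2), by
      rw [LinearMap.mem_ker, Matrix.toLin'_apply, Matrix.mulVec_mulVec, ← mul_assoc, ← pow_succ',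
        hq, Matrix.zero_mulVec]⟩
  have hf : LinearIndependent ℂ f := by
    rw [Fintype.linearIndependent_iff]
    rintro g hg ⟨j, a⟩
    have h1 := congrArg (fun y : LinearMap.ker (Matrix.toLin' A) => (e j).mulVec y.1) hg
    simp only [Submodule.coe_sum, Submodule.coe_smul, ZeroMemClass.coe_zero, Matrix.mulVec_zero,
      Matrix.mulVec_sum, Matrix.mulVec_smul, f, Matrix.mulVec_mulVec] at h1
    have h2 : ∀ i, e j * (A ^ q i * e i) = if i = j then A ^ q j * e j else 0 := by
      intro i
      rw [← mul_assoc, ← ((hc j).pow_left _).eq, mul_assoc, hmul]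
      by_cases h : i = j
      · subst h; simp
      · simp [h, Ne.symm h]
    rw [Fintype.sum_prod_type, Finset.sum_eq_single j] at h1
    · simp only [h2, if_true] at h1
      exact Fintype.linearIndependent_iff.1 (hx j) _ h1 a
    · intro i _ hi
      simp [h2, hi]
    · simp
  simpa using hf.fintype_card_le_finrank

/-- If a block has the smallest possible rank `d * n`, its nilpotency index is at most `n`: otherwise
the ranks of the powers of `A` on it would take more than `n` steps of at least `d` to reach zero. -/
theorem pow_mul_eq_zero {e : Matrix ι ι ℂ} {n : ℕ} (hA : A ∈ P.S) (hn : IsNilpotent A)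
    (he : e ∈ P.S) (hee : e * e = e) (hc : Commute A e) (hr : e.rank ≤ P.d * n) :
    A ^ n * e = 0 := by
  by_cases h0 : e = 0
  · simp [h0]
  obtain ⟨q, hq, x, hx⟩ := P.exists_linearIndependent hA hn he hee hc h0
  -- each application of `A` up to the `q + 1`-st one lowers the rank by at least `d`
  have hstep : ∀ y ≤ q, (A ^ (y + 1) * e).rank + P.d ≤ (A ^ y * e).rank := by
    intro y hy
    let W := LinearMap.range (A ^ y * e).mulVecLin
    let f : W →ₗ[ℂ] ι → ℂ := A.mulVecLin.domRestrict W
    have h1 : LinearMap.range f = LinearMap.range (A ^ (y + 1) * e).mulVecLin := by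
      rw [LinearMap.range_domRestrict, pow_succ', mul_assoc, Matrix.mulVecLin_mul,
        LinearMap.range_comp]
    have h2 : P.d ≤ Module.finrank ℂ (LinearMap.ker f) := by
      have hmem : ∀ a, (A ^ q * e).mulVec (x a) ∈ W := fun a => by
        refine ⟨(A ^ (q - y)).mulVec (x a), ?_⟩
        rw [Matrix.mulVecLin_apply, Matrix.mulVec_mulVec, mul_assoc,
          ← (hc.pow_left (q - y)).eq, ← mul_assoc, ← pow_add, Nat.add_sub_cancel' hy]
      let g : Fin P.d → LinearMap.ker f := fun a => ⟨⟨_, hmem a⟩, by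
        rw [LinearMap.mem_ker]
        show A.mulVec ((A ^ q * e).mulVec (x a)) = 0
        rw [Matrix.mulVec_mulVec, ← mul_assoc, ← pow_succ', hq, Matrix.zero_mulVec]⟩
      have hg : LinearIndependent ℂ g :=
        LinearIndependent.of_comp (W.subtype.comp (LinearMap.ker f).subtype) hx
      simpa using hg.fintype_card_le_finrank
    have h3 := f.finrank_range_add_finrank_ker
    rw [h1] at h3
    have h4 : Module.finrank ℂ W = (A ^ y * e).rank := rfl
    rw [← h4, ← h3]
    exact Nat.add_le_add_left h2 _
  have hsum : ∀ y ≤ q + 1, (A ^ y * e).rank + P.d * y ≤ e.rank := by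
    intro y
    induction y with
    | zero => simp
    | succ y ih =>
      intro hy
      have h1 := hstep y (by omega)
      have h2 := ih (by omega)
      rw [mul_add, mul_one]
      omega
  have h1 := hsum (q + 1) le_rfl
  have h2 : q + 1 ≤ n := Nat.le_of_mul_le_mul_left (by omega) P.d_pos
  rw [← Nat.sub_add_cancel h2, pow_add, mul_assoc, hq, mul_zero]

/-- A self-adjoint matrix that commutes with `A` has at most `k` eigenvalues: its spectral
idempotents are orthogonal, self-adjoint and commute with `A`. -/
theorem ncard_spectrum_le {B : Matrix ι ι ℂ} {k : ℕ} (hA : A ∈ P.S) (hn : IsNilpotent A)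
    (hB : B ∈ P.S) (hAB : Commute A B)
    (hker : Module.finrank ℂ (LinearMap.ker (Matrix.toLin' A)) ≤ P.d * k) :
    (spectrum ℂ B).ncard ≤ k := by
  obtain ⟨u, m, hu, hm, h⟩ := exists_hasRoots_of_ncard (B := B) rfl
  have hd := h.isSpecDecomp hu
  have := P.mul_le_finrank_ker hA hn (fun i => P.specIdem_mem hB u i) hd.mul_eq
    (hd.commute_of_commute hu hAB) fun i h0 => by
      have := hd.rootMultiplicity_eq hu i
      rw [h0, Matrix.rank_zero, h.rootMultiplicity_eq hu] at this
      exact (hm i).ne' this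
  exact Nat.le_of_mul_le_mul_left (by rw [mul_comm]; exact this.trans hker) P.d_pos

/-- The conormal space at `A`, as a subspace of the centralizer of `A`. -/
def conormal (A : Matrix ι ι ℂ) : Submodule ℂ (Matrix ι ι ℂ) where
  carrier := {B | B ∈ P.S ∧ Commute A B ∧ B.trace = 0}
  add_mem' := fun h h' => ⟨P.S.add_mem h.1 h'.1, h.2.1.add_right h'.2.1, by
    rw [Matrix.trace_add, h.2.2, h'.2.2, add_zero]⟩
  zero_mem' := ⟨P.S.zero_mem, Commute.zero_right _, by simp⟩
  smul_mem' := fun c _ h => ⟨P.S.smul_mem c h.1, h.2.1.smul_right c, by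
    rw [Matrix.trace_smul, h.2.2, smul_zero]⟩

/-- The conormals at `A` with exactly `k` distinct eigenvalues. -/
def distinct (A : Matrix ι ι ℂ) (k : ℕ) : Set (Matrix ι ι ℂ) :=
  {B | B ∈ P.conormal A ∧ (spectrum ℂ B).ncard = k}

end SymmetricPair

/-- A nilpotent `A ∈ S` in normal form: the projections `e i` to the sums of the Jordan blocks
with the index `i` (there are `d` of them), generators `v i a` of these blocks, and skew-adjoint
matrices that commute with `A` and interchange isomorphic blocks. -/
structure AdaptedData (P : SymmetricPair ι) {k : ℕ} (parts : Fin k → ℕ) (A : Matrix ι ι ℂ) where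
  mem : A ∈ P.S
  nilpotent : IsNilpotent A
  pos : ∀ i, 0 < parts i
  finrank_ker : Module.finrank ℂ (LinearMap.ker (Matrix.toLin' A)) ≤ P.d * k
  e : Fin k → Matrix ι ι ℂ
  v : Fin k → Fin P.d → ι → ℂ
  mul_eq : ∀ i j, e i * e j = if i = j then e i else 0
  sum_eq : ∑ i, e i = 1
  e_mem : ∀ i, e i ∈ P.S
  e_comm : ∀ i, Commute A (e i)
  rank_e : ∀ i, (e i).rank = P.d * parts i
  e_mulVec : ∀ i a, (e i).mulVec (v i a) = v i a
  linearIndependent : LinearIndependent ℂ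
    fun p : Σ a : Fin k × Fin P.d, Fin (parts a.1) => (A ^ (p.2 : ℕ)).mulVec (v p.1.1 p.1.2)
  swap : ∀ i j, i ≠ j → parts i = parts j → ∃ X ∈ P.lie, Commute A X ∧ X * X = -(e i + e j) ∧
    X * e i = e j * X ∧ X * e j = e i * X ∧
    ∀ l, l ≠ i → l ≠ j → X * e l = 0 ∧ e l * X = 0

namespace AdaptedData

variable {P : SymmetricPair ι} {k : ℕ} {parts : Fin k → ℕ} {A : Matrix ι ι ℂ}
  (D : AdaptedData P parts A)

include D in
theorem ncard_spectrum_le {B : Matrix ι ι ℂ} (hB : B ∈ P.S) (hAB : Commute A B) :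
    (spectrum ℂ B).ncard ≤ k := P.ncard_spectrum_le D.mem D.nilpotent hB hAB D.finrank_ker

/-- The semisimple matrix with the eigenvalue `u i` on the `i`-th block. -/
noncomputable def diag (u : Fin k → ℂ) : Matrix ι ι ℂ := ∑ i, u i • D.e i

theorem isSpecDecomp_diag (u : Fin k → ℂ) : IsSpecDecomp (D.diag u) u D.e := by
  have h0 : IsSpecDecomp 0 0 D.e := by
    refine ⟨D.mul_eq, D.sum_eq, fun i => Commute.zero_right _, fun i => ?_⟩
    rcases isEmpty_or_nonempty ι with h | h
    · exact Subsingleton.elim _ _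
    · simp
  simpa [diag] using h0.shift u

theorem hasRoots_diag {u : Fin k → ℂ} (hu : Function.Injective u) :
    HasRoots (D.diag u) u fun i => P.d * parts i := by
  simpa only [D.rank_e] using (D.isSpecDecomp_diag u).hasRoots hu

theorem diag_mem (u : Fin k → ℂ) : D.diag u ∈ P.S :=
  P.S.sum_mem fun i _ => P.S.smul_mem _ (D.e_mem i)

theorem commute_diag (u : Fin k → ℂ) : Commute A (D.diag u) :=
  Commute.sum_right _ _ _ fun i _ => (D.e_comm i).smul_right _

end AdaptedData

/-- The rank of an idempotent matrix is its trace. -/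
theorem trace_eq_rank_of_idem {e : Matrix ι ι ℂ} (he : e * e = e) : e.trace = e.rank := by
  have h1 : IsIdempotentElem (Matrix.toLin' e) := by
    show Matrix.toLin' e * Matrix.toLin' e = _
    rw [Module.End.mul_eq_comp, ← Matrix.toLin'_mul, he]
  rw [← Matrix.trace_toLin'_eq, (LinearMap.IsIdempotentElem.isProj_range _ h1).trace]
  rfl

/-- Subtracting a weighted mean, so that the sum of the eigenvalues with multiplicities becomes
zero. -/
noncomputable def center {k : ℕ} (parts : Fin k → ℕ) (u : Fin k → ℂ) : Fin k → ℂ :=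
  fun i => u i - (∑ j, (parts j : ℂ) * u j) / ∑ j, (parts j : ℂ)

theorem center_injective {k : ℕ} (parts : Fin k → ℕ) {u : Fin k → ℂ} (hu : Function.Injective u) :
    Function.Injective (center parts u) := fun _ _ h => hu (sub_left_injective h)

theorem continuous_center {k : ℕ} (parts : Fin k → ℕ) : Continuous (center parts) := by
  unfold center
  fun_prop

theorem sum_mul_center {k : ℕ} {parts : Fin k → ℕ} (hpos : ∀ i, 0 < parts i) (u : Fin k → ℂ) :
    ∑ i, (parts i : ℂ) * center parts u i = 0 := by
  rcases isEmpty_or_nonempty (Fin k) with h | h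
  · simp
  · have h0 : (∑ j, (parts j : ℂ)) ≠ 0 := by
      rw [← Nat.cast_sum]
      exact Nat.cast_ne_zero.2 (Finset.sum_pos (fun i _ => hpos i) Finset.univ_nonempty).ne'
    simp only [center, mul_sub, Finset.sum_sub_distrib, ← Finset.sum_mul]
    rw [mul_div_cancel₀ _ h0, sub_self]

theorem center_eq_self {k : ℕ} {parts : Fin k → ℕ} {u : Fin k → ℂ}
    (h : ∑ i, (parts i : ℂ) * u i = 0) : center parts u = u := by
  ext i
  simp [center, h]

theorem HasRoots.trace_eq {k : ℕ} {B : Matrix ι ι ℂ} {u : Fin k → ℂ} {m : Fin k → ℕ}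
    (h : HasRoots B u m) (hu : Function.Injective u) : B.trace = ∑ i, u i * m i := by
  have hd := h.isSpecDecomp hu
  have := trace_pow_mul_of_isSpecDecomp hd 1
  simp only [pow_one] at this
  rw [this]
  refine Finset.sum_congr rfl fun i _ => ?_
  rw [trace_eq_rank_of_idem (hd.idem i), ← hd.rootMultiplicity_eq hu, h.rootMultiplicity_eq hu]

/-- Continuity of the colored spectrum, in terms of an ultrafilter. -/
theorem exists_tendsto_hasRoots {T : Type*} {k : ℕ} (l : Ultrafilter T) {B : T → Matrix ι ι ℂ}
    {B₀ : Matrix ι ι ℂ} (hB : Filter.Tendsto B l (𝓝 B₀))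
    (hk : ∀ᶠ t in l, (spectrum ℂ (B t)).ncard = k) {v : Fin k → ℂ} {m : Fin k → ℕ}
    (h₀ : HasRoots B₀ v m) (hv : Function.Injective v) (hm : ∀ i, 0 < m i) :
    ∃ u : T → Fin k → ℂ, Filter.Tendsto u l (𝓝 v) ∧
      ∀ᶠ t in l, Function.Injective (u t) ∧ HasRoots (B t) (u t) m := by
  classical
  have hex : ∀ t, ∃ (u : Fin k → ℂ) (n : Fin k → ℕ), (spectrum ℂ (B t)).ncard = k →
      Function.Injective u ∧ (∀ i, 0 < n i) ∧ HasRoots (B t) u n := by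
    intro t
    by_cases h : (spectrum ℂ (B t)).ncard = k
    · obtain ⟨u, n, h'⟩ := exists_hasRoots_of_ncard h
      exact ⟨u, n, fun _ => h'⟩
    · exact ⟨0, 0, fun h' => (h h').elim⟩
  choose u n hun using hex
  -- the multiplicities take only finitely many values, so they are constant along `l`
  have hfin : {f : Fin k → ℕ | ∀ i, f i ≤ Fintype.card ι}.Finite :=
    (Set.finite_Iic fun _ : Fin k => Fintype.card ι)
  obtain ⟨n₀, -, hn₀⟩ := (l.map n).eq_pure_of_finite_mem hfin (by
    rw [Ultrafilter.mem_map]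
    show _ ∈ (l : Filter T)
    filter_upwards [hk] with t ht i
    rw [← (hun t ht).2.2.sum_eq]
    exact Finset.single_le_sum (f := n t) (fun _ _ => Nat.zero_le _) (Finset.mem_univ i))
  have hconst : ∀ᶠ t in l, n t = n₀ := by
    have : {n₀} ∈ l.map n := by
      rw [hn₀]
      exact Set.mem_singleton n₀
    exact this
  have hpos : ∀ i, 0 < n₀ i := by
    obtain ⟨t, ht, ht'⟩ := (hk.and hconst).exists
    exact ht' ▸ (hun t ht).2.1
  obtain ⟨v', hv', h'⟩ := exists_tendsto_roots l hB (u := u) hpos (by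
    filter_upwards [hk, hconst] with t ht ht'
    exact ht' ▸ (hun t ht).2.2)
  have hinj := h'.injective_of_ncard hpos (h₀.ncard_spectrum hm hv)
  obtain ⟨w, hw, hvw⟩ := h'.exists_perm h₀ hinj hv hpos hm
  refine ⟨fun t i => u t (w i), ?_, ?_⟩
  · rw [tendsto_pi_nhds] at hv' ⊢
    intro i
    rw [hvw]
    exact hv' (w i)
  · filter_upwards [hk, hconst] with t ht ht'
    refine ⟨(hun t ht).1.comp w.injective, ?_⟩
    rw [HasRoots, (hun t ht).2.2, ht', ← Equiv.prod_comp w]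
    simp only [hw]

end SymmetricPair

/-! ### The spectrum map -/

section Spectrum

variable {ι : Type*} [Fintype ι] [DecidableEq ι] {k : ℕ}

/-- The result of moving the eigenvalues `u` of `B` to `v`, without changing the generalized
eigenspaces and the nilpotent part of `B`. -/
noncomputable def moveRoots (u v : Fin k → ℂ) (B : Matrix ι ι ℂ) : Matrix ι ι ℂ :=
  B + ∑ i, (v i - u i) • specIdem u B i

theorem moveRoots_self (u : Fin k → ℂ) (B : Matrix ι ι ℂ) : moveRoots u u B = B := by
  simp [moveRoots]

theorem continuous_moveRoots {T : Type*} [TopologicalSpace T] {u v : T → Fin k → ℂ}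
    {B : T → Matrix ι ι ℂ} (hu : Continuous u) (hv : Continuous v) (hB : Continuous B)
    (hinj : ∀ t, Function.Injective (u t)) : Continuous fun t => moveRoots (u t) (v t) (B t) := by
  unfold moveRoots
  have h := fun i => continuous_specIdem hu hB hinj i
  fun_prop

theorem HasRoots.moveRoots {B : Matrix ι ι ℂ} {u v : Fin k → ℂ} {m : Fin k → ℕ}
    (h : HasRoots B u m) (hu : Function.Injective u) (hv : Function.Injective v) :
    HasRoots (moveRoots u v B) v m := by
  have hd := h.isSpecDecomp hu
  have := (hd.shift v).hasRoots hv
  simp only [← hd.rootMultiplicity_eq hu, h.rootMultiplicity_eq hu] at this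
  exact this

theorem HasRoots.moveRoots_moveRoots {B : Matrix ι ι ℂ} {u v : Fin k → ℂ} {m : Fin k → ℕ}
    (h : HasRoots B u m) (hu : Function.Injective u) (hv : Function.Injective v) :
    NilconeSymmetric.moveRoots v u (NilconeSymmetric.moveRoots u v B) = B := by
  have hd := (h.isSpecDecomp hu).shift v
  rw [NilconeSymmetric.moveRoots]
  simp only [show ∀ i, specIdem v (NilconeSymmetric.moveRoots u v B) i = specIdem u B i from
    hd.specIdem_eq hv]
  rw [NilconeSymmetric.moveRoots, add_assoc, ← Finset.sum_add_distrib]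
  simp [← add_smul]

theorem HasRoots.comp_perm {B : Matrix ι ι ℂ} {u : Fin k → ℂ} {m : Fin k → ℕ}
    (h : HasRoots B u m) (w : Equiv.Perm (Fin k)) (hw : ∀ i, m (w i) = m i) :
    HasRoots B (fun i => u (w i)) m := by
  rw [HasRoots, h, ← Equiv.prod_comp w]
  simp only [hw]

theorem HasRoots.conj {B : Matrix ι ι ℂ} {u : Fin k → ℂ} {m : Fin k → ℕ}
    (h : HasRoots B u m) (g : (Matrix ι ι ℂ)ˣ) :
    HasRoots (g.val * B * g⁻¹.val) u m := by
  rw [HasRoots, Matrix.coe_units_inv, Matrix.charpoly_units_conj, h]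

namespace AdaptedData

variable {P : SymmetricPair ι} {parts : Fin k → ℕ} {A : Matrix ι ι ℂ} (D : AdaptedData P parts A)

include D in
theorem mul_pos (i : Fin k) : 0 < P.d * parts i := Nat.mul_pos P.d_pos (D.pos i)

/-- The trace condition on a conormal is a linear condition on its eigenvalues. -/
theorem mem_conormal_of_hasRoots {B : Matrix ι ι ℂ} {u : Fin k → ℂ} (hB : B ∈ P.S)
    (hAB : Commute A B) (h : HasRoots B u fun i => P.d * parts i) (hu : Function.Injective u)
    (h0 : ∑ i, (parts i : ℂ) * u i = 0) : B ∈ P.conormal A := by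
  refine ⟨hB, hAB, ?_⟩
  rw [h.trace_eq hu]
  have : ∑ i, u i * ((P.d * parts i : ℕ) : ℂ) = P.d * ∑ i, (parts i : ℂ) * u i := by
    rw [Finset.mul_sum]
    refine Finset.sum_congr rfl fun i _ => ?_
    push_cast
    ring
  rw [this, h0, mul_zero]

theorem sum_eq_zero_of_hasRoots {B : Matrix ι ι ℂ} {u : Fin k → ℂ} (hB : B ∈ P.conormal A)
    (h : HasRoots B u fun i => P.d * parts i) (hu : Function.Injective u) :
    ∑ i, (parts i : ℂ) * u i = 0 := by
  have h1 := hB.2.2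
  rw [h.trace_eq hu] at h1
  have : ∑ i, u i * ((P.d * parts i : ℕ) : ℂ) = P.d * ∑ i, (parts i : ℂ) * u i := by
    rw [Finset.mul_sum]
    refine Finset.sum_congr rfl fun i _ => ?_
    push_cast
    ring
  rw [this] at h1
  exact (mul_eq_zero.1 h1).resolve_left (Nat.cast_ne_zero.2 P.d_pos.ne')

theorem moveRoots_mem_conormal {B : Matrix ι ι ℂ} {u v : Fin k → ℂ} (hB : B ∈ P.conormal A)
    (h : HasRoots B u fun i => P.d * parts i) (hu : Function.Injective u)
    (hv : Function.Injective v) (h0 : ∑ i, (parts i : ℂ) * v i = 0) :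
    moveRoots u v B ∈ P.conormal A := by
  refine mem_conormal_of_hasRoots ?_ ?_ (h.moveRoots hu hv) hv h0
  · exact P.S.add_mem hB.1 (P.S.sum_mem fun i _ => P.S.smul_mem _ (P.specIdem_mem hB.1 u i))
  · exact hB.2.1.add_right (Commute.sum_right _ _ _ fun i _ =>
      ((h.isSpecDecomp hu).commute_of_commute hu hB.2.1 i).smul_right _)

include D in
theorem mem_distinct_of_hasRoots {B : Matrix ι ι ℂ} {u : Fin k → ℂ} (hB : B ∈ P.conormal A)
    (h : HasRoots B u fun i => P.d * parts i) (hu : Function.Injective u) :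
    B ∈ P.distinct A k := ⟨hB, h.ncard_spectrum D.mul_pos hu⟩

theorem diag_mem_conormal {u : Fin k → ℂ} (hu : Function.Injective u)
    (h0 : ∑ i, (parts i : ℂ) * u i = 0) : D.diag u ∈ P.conormal A :=
  mem_conormal_of_hasRoots (D.diag_mem u) (D.commute_diag u) (D.hasRoots_diag hu) hu h0

theorem diag_mem_distinct {u : Fin k → ℂ} (hu : Function.Injective u)
    (h0 : ∑ i, (parts i : ℂ) * u i = 0) : D.diag u ∈ P.distinct A k :=
  D.mem_distinct_of_hasRoots (D.diag_mem_conormal hu h0) (D.hasRoots_diag hu) hu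

include D in
/-- The scalars `0, …, k - 1` on the blocks, shifted to trace zero. -/
theorem nonempty_distinct : (P.distinct A k).Nonempty := by
  let u : Fin k → ℂ := fun i => ((i : ℕ) : ℂ)
  have hu : Function.Injective u := fun i j h => Fin.ext (Nat.cast_injective h)
  exact ⟨_, D.diag_mem_distinct (center_injective parts hu) (sum_mul_center D.pos u)⟩

include D in
/-- Among the conormals at `A`, those with `k` eigenvalues are the complement of a hypersurface,
since there are never more than `k` eigenvalues. -/
theorem exists_distinct_eq : ∃ p : MvPolynomial (ι × ι) ℂ,
    P.distinct A k = {B | B ∈ P.conormal A ∧ evalEntries p B ≠ 0} := by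
  obtain ⟨p, hp⟩ := exists_evalEntries_eq_hankel (ι := ι) k
  refine ⟨p, Set.ext fun B => and_congr_right fun hB => ?_⟩
  rw [hp, hankel_ne_zero_iff (D.ncard_spectrum_le hB.1 hB.2.1)]

include D in
theorem isPathConnected_distinct : IsPathConnected (P.distinct A k) := by
  obtain ⟨B, hB⟩ := D.nonempty_distinct
  obtain ⟨p, hp⟩ := D.exists_distinct_eq
  refine ⟨B, hB, fun {C} hC => ?_⟩
  rw [hp] at hB hC ⊢
  exact joinedIn_evalEntries_ne_zero _ p hB.1 hC.1 hB.2 hC.2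

include D in
/-- The multiplicities are the same for all conormals with `k` eigenvalues: the locus where they have
the prescribed values is open and closed, because eigenvalues depend continuously on the matrix. -/
theorem exists_hasRoots {B : Matrix ι ι ℂ} (hB : B ∈ P.distinct A k) :
    ∃ u : OrderedConfig k, HasRoots B u.1 fun i => P.d * parts i := by
  let T : Set (P.distinct A k) := {B | ∃ u : OrderedConfig k, HasRoots B.1 u.1 fun i => P.d * parts i}
  have hT : IsClopen T := by
    constructor
    · rw [isClosed_iff_ultrafilter]
      intro B l hl hT
      have hex : ∀ C : P.distinct A k, ∃ u : Fin k → ℂ, C ∈ T →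
          HasRoots C.1 u fun i => P.d * parts i := by
        intro C
        by_cases h : C ∈ T
        · exact ⟨h.choose.1, fun _ => h.choose_spec⟩
        · exact ⟨0, fun h' => (h h').elim⟩
      choose u hu using hex
      obtain ⟨v, -, hv⟩ := exists_tendsto_roots l (B := Subtype.val)
        ((continuous_subtype_val.tendsto B).mono_left hl) (u := u) D.mul_pos
        (Filter.mem_of_superset hT hu)
      exact ⟨⟨v, hv.injective_of_ncard D.mul_pos B.2.2⟩, hv⟩
    · rw [isOpen_iff_ultrafilter]
      rintro B ⟨v, hv⟩ l hl
      obtain ⟨u, -, hu⟩ := exists_tendsto_hasRoots l (B := Subtype.val)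
        ((continuous_subtype_val.tendsto B).mono_left hl)
        (Filter.Eventually.of_forall fun C => C.2.2) hv v.2 D.mul_pos
      exact Filter.mem_of_superset hu fun C hC => ⟨⟨u C, hC.1⟩, hC.2⟩
  obtain ⟨C, hC⟩ : T.Nonempty := by
    let u : Fin k → ℂ := fun i => ((i : ℕ) : ℂ)
    have hu : Function.Injective u := fun i j h => Fin.ext (Nat.cast_injective h)
    exact ⟨⟨_, D.diag_mem_distinct (center_injective parts hu) (sum_mul_center D.pos u)⟩,
      ⟨_, center_injective parts hu⟩, D.hasRoots_diag (center_injective parts hu)⟩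
  have : ConnectedSpace (P.distinct A k) :=
    isConnected_iff_connectedSpace.1 D.isPathConnected_distinct.isConnected
  have h := hT.eq_univ ⟨C, hC⟩
  exact (h ▸ Set.mem_univ (⟨B, hB⟩ : P.distinct A k) : _ ∈ T)

/-- The colored spectrum. -/
noncomputable def spectrumMap : C(P.distinct A k, ColoredConfig parts) where
  toFun B := ColoredConfig.mk parts (D.exists_hasRoots B.2).choose
  continuous_toFun := by
    rw [continuous_iff_ultrafilter]
    intro B l hl
    have hB := (D.exists_hasRoots B.2).choose_spec
    set v := (D.exists_hasRoots B.2).choose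
    obtain ⟨u, hu, hu'⟩ := exists_tendsto_hasRoots l (B := Subtype.val)
      ((continuous_subtype_val.tendsto B).mono_left hl)
      (Filter.Eventually.of_forall fun C => C.2.2) hB v.2 D.mul_pos
    classical
    let u' : P.distinct A k → OrderedConfig k := fun C =>
      if h : Function.Injective (u C) then ⟨u C, h⟩ else v
    have h1 : Filter.Tendsto u' l (𝓝 v) := by
      rw [tendsto_subtype_rng]
      refine hu.congr' ?_
      filter_upwards [hu'] with C hC
      simp [u', hC.1]
    refine ((continuous_quotient_mk'.tendsto v).comp h1).congr' ?_
    filter_upwards [hu'] with C hC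
    obtain ⟨w, hw, hw'⟩ := hC.2.exists_perm (D.exists_hasRoots C.2).choose_spec hC.1
      (D.exists_hasRoots C.2).choose.2 D.mul_pos D.mul_pos
    refine Quotient.sound ⟨w, fun i => Nat.eq_of_mul_eq_mul_left P.d_pos (hw i), fun i => ?_⟩
    simp [u', hC.1, hw']

theorem spectrumMap_eq_iff (B : P.distinct A k) (u : OrderedConfig k) :
    D.spectrumMap B = ColoredConfig.mk parts u ↔ HasRoots B.1 u.1 fun i => P.d * parts i := by
  have hB := (D.exists_hasRoots B.2).choose_spec
  show ColoredConfig.mk parts (D.exists_hasRoots B.2).choose = _ ↔ _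
  rw [Quotient.eq]
  constructor
  · rintro ⟨w, hw, h⟩
    have := hB.comp_perm w fun i => by rw [hw]
    simpa only [← h] using this
  · intro h
    obtain ⟨w, hw, hw'⟩ := hB.exists_perm h (D.exists_hasRoots B.2).choose.2 u.2 D.mul_pos D.mul_pos
    exact ⟨w, fun i => Nat.eq_of_mul_eq_mul_left P.d_pos (hw i), hw'⟩

end AdaptedData

end Spectrum

/-! ### The fibres of the spectrum map -/

section Fibre

variable {ι : Type*} [Fintype ι] [DecidableEq ι] {k : ℕ}

/-- If `X² = -p` with an idempotent `p`, then `(1 + s X) (1 - s X) = 1 + s² p` is invertible unless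
`s² = -1`. -/
theorem smul_mem_cayleyDomain {X p : Matrix ι ι ℂ} (hX : X * X = -p) (hp : p * p = p) {s : ℂ}
    (hs : 1 + s ^ 2 ≠ 0) : s • X ∈ cayleyDomain ι := by
  have h1 : (1 + s • X) * (1 - s • X) = 1 + s ^ 2 • p := by
    simp only [add_mul, mul_sub, one_mul, mul_one, smul_mul_assoc, mul_smul_comm, hX]
    module
  have h2 : (1 + s ^ 2 • p) * (1 - (s ^ 2 / (1 + s ^ 2)) • p) = 1 := by
    have h3 : s ^ 2 - s ^ 2 / (1 + s ^ 2) - s ^ 2 / (1 + s ^ 2) * s ^ 2 = 0 := by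
      field_simp
      ring
    simp only [add_mul, mul_sub, one_mul, mul_one, smul_mul_assoc, mul_smul_comm, hp]
    have h4 := congrArg (fun c : ℂ => c • p) h3
    simp only [zero_smul] at h4
    rw [← sub_eq_zero, ← h4]
    module
  have h3 := congrArg Matrix.det h2
  rw [← h1, Matrix.det_mul, Matrix.det_mul, Matrix.det_one] at h3
  constructor
  · intro h0
    rw [h0, zero_mul, zero_mul] at h3
    exact zero_ne_one h3
  · intro h0
    rw [h0, mul_zero, zero_mul] at h3
    exact zero_ne_one h3

theorem one_add_real_sq_ne_zero (t : I) : 1 + (((t : ℝ) : ℂ)) ^ 2 ≠ 0 := by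
  have : (0 : ℝ) < 1 + (t : ℝ) ^ 2 := by positivity
  exact_mod_cast this.ne'

theorem continuous_conj {T : Type*} [TopologicalSpace T] {g : T → (Matrix ι ι ℂ)ˣ}
    {B : T → Matrix ι ι ℂ} (hg : Continuous g) (hB : Continuous B) :
    Continuous fun t => (g t).val * B t * (g t)⁻¹.val :=
  ((Units.continuous_val.comp hg).mul hB).mul (Units.continuous_val.comp hg.inv)

theorem commute_units_inv {A : Matrix ι ι ℂ} {g : (Matrix ι ι ℂ)ˣ} (h : Commute A g.val) :
    Commute A g⁻¹.val := Commute.units_inv_right h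

theorem conj_eq_self_of_commute {A : Matrix ι ι ℂ} {g : (Matrix ι ι ℂ)ˣ} (h : Commute A g.val) :
    g.val * A * g⁻¹.val = A := by
  rw [← h.eq, Units.mul_inv_cancel_right]

theorem commute_conj {A B : Matrix ι ι ℂ} {g : (Matrix ι ι ℂ)ˣ} (h : Commute A g.val)
    (hB : Commute A B) : Commute A (g.val * B * g⁻¹.val) :=
  (h.mul_right hB).mul_right (commute_units_inv h)

namespace AdaptedData

variable {P : SymmetricPair ι} {parts : Fin k → ℕ} {A : Matrix ι ι ℂ} (D : AdaptedData P parts A)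

variable (P A parts) in
/-- The conormals at `A` with the eigenvalues `u i`. -/
def fibre (u : Fin k → ℂ) : Set (Matrix ι ι ℂ) :=
  {B | B ∈ P.conormal A ∧ HasRoots B u fun i => P.d * parts i}

variable (P A) in
/-- The isometries that commute with `A`. -/
def centralizer : Subgroup (Matrix ι ι ℂ)ˣ where
  carrier := {g | g ∈ P.K ∧ Commute A g.val}
  mul_mem' h h' := ⟨P.K.mul_mem h.1 h'.1, h.2.mul_right h'.2⟩
  one_mem' := ⟨P.K.one_mem, Commute.one_right _⟩
  inv_mem' h := ⟨P.K.inv_mem h.1, commute_units_inv h.2⟩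

theorem conj_mem_fibre {g : (Matrix ι ι ℂ)ˣ} (hg : g ∈ centralizer P A) {u : Fin k → ℂ}
    {B : Matrix ι ι ℂ} (hB : B ∈ fibre P parts A u) :
    g.val * B * g⁻¹.val ∈ fibre P parts A u := by
  refine ⟨⟨P.conj_mem hg.1 hB.1.1, commute_conj hg.2 hB.1.2.1, ?_⟩, hB.2.conj g⟩
  rw [Matrix.trace_mul_comm, ← mul_assoc, Units.inv_mul, one_mul, hB.1.2.2]

theorem cayley_mem_centralizer {X : Matrix ι ι ℂ} (hX : X ∈ P.lie) (hA : Commute A X)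
    (h : X ∈ cayleyDomain ι) : cayley X ∈ centralizer P A :=
  ⟨P.cayley_mem hX h, commute_cayley hA⟩

include D in
theorem fibre_subset {u : Fin k → ℂ} (hu : Function.Injective u) :
    fibre P parts A u ⊆ P.distinct A k := fun _ hB => D.mem_distinct_of_hasRoots hB.1 hB.2 hu

theorem diag_mem_fibre {u : Fin k → ℂ} (hu : Function.Injective u)
    (h0 : ∑ i, (parts i : ℂ) * u i = 0) : D.diag u ∈ fibre P parts A u :=
  ⟨D.diag_mem_conormal hu h0, D.hasRoots_diag hu⟩

/-- The path `cayley (t X)` interchanges two blocks. -/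
theorem joinedIn_fibre_swap {u x : Fin k → ℂ} (hx : D.diag x ∈ fibre P parts A u) (i j : Fin k)
    (hij : i ≠ j) (hp : parts i = parts j) :
    JoinedIn (fibre P parts A u) (D.diag x) (D.diag fun l => x (Equiv.swap i j l)) := by
  obtain ⟨X, hX, hAX, hXX, hXi, hXj, hXl⟩ := D.swap i j hij hp
  have hpp : (D.e i + D.e j) * (D.e i + D.e j) = D.e i + D.e j := by
    simp [add_mul, mul_add, D.mul_eq, hij, hij.symm]
  have hdom : ∀ t : I, ((t : ℝ) : ℂ) • X ∈ cayleyDomain ι := fun t =>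
    smul_mem_cayleyDomain hXX hpp (one_add_real_sq_ne_zero t)
  have hXe : ∀ l, X * D.e l = D.e (Equiv.swap i j l) * X := by
    intro l
    by_cases hi : l = i
    · subst hi; rw [Equiv.swap_apply_left, hXi]
    by_cases hj : l = j
    · subst hj; rw [Equiv.swap_apply_right, hXj]
    rw [Equiv.swap_apply_of_ne_of_ne hi hj, (hXl l hi hj).1, (hXl l hi hj).2]
  have hXp : X * (D.e i + D.e j) = X := by
    have : X * ∑ l, D.e l = X * (D.e i + D.e j) := by
      rw [Finset.mul_sum, mul_add, ← Finset.sum_pair (f := fun l => X * D.e l) hij]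
      refine (Finset.sum_subset (Finset.subset_univ _) fun l _ hl => ?_).symm
      simp only [Finset.mem_insert, Finset.mem_singleton, not_or] at hl
      exact (hXl l hl.1 hl.2).1
    rw [← this, D.sum_eq, mul_one]
  have hdom1 : X ∈ cayleyDomain ι := by simpa using hdom 1
  have hc : (cayley X).val = 1 - (D.e i + D.e j) - X := by
    have h1 : (1 + X) * (1 - (D.e i + D.e j) - X) = 1 - X := by
      rw [add_mul, mul_sub X, mul_sub X, mul_one, one_mul, hXX, hXp]
      abel
    have h2 := one_add_mul_cayley hdom1
    rw [← h1] at h2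
    exact ((Matrix.isUnit_iff_isUnit_det _).2 (isUnit_iff_ne_zero.2 hdom1.1)).mul_left_cancel h2
  have hce : ∀ l, (1 - (D.e i + D.e j) - X) * D.e l =
      D.e (Equiv.swap i j l) * (1 - (D.e i + D.e j) - X) := by
    intro l
    have h1 : (1 - (D.e i + D.e j)) * D.e l =
        D.e (Equiv.swap i j l) * (1 - (D.e i + D.e j)) := by
      by_cases hi : l = i
      · subst hi; simp [sub_mul, mul_sub, add_mul, mul_add, D.mul_eq, hij.symm]
      by_cases hj : l = j
      · subst hj; simp [sub_mul, mul_sub, add_mul, mul_add, D.mul_eq, hij]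
      simp [Equiv.swap_apply_of_ne_of_ne hi hj, sub_mul, mul_sub, add_mul, mul_add, D.mul_eq, hi,
        hj, Ne.symm hi, Ne.symm hj]
    rw [sub_mul, mul_sub, h1, hXe]
  have hcont : Continuous fun t : I => cayley (((t : ℝ) : ℂ) • X) :=
    continuousOn_cayley.comp_continuous (by fun_prop) hdom
  refine ⟨⟨⟨fun t => (cayley (((t : ℝ) : ℂ) • X)).val * D.diag x *
    (cayley (((t : ℝ) : ℂ) • X))⁻¹.val, continuous_conj hcont continuous_const⟩, ?_, ?_⟩,
    fun t => ?_⟩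
  · simp
  · simp only [Set.Icc.coe_one, Complex.ofReal_one, one_smul]
    rw [Units.mul_inv_eq_iff_eq_mul, hc]
    simp only [diag, Finset.mul_sum, Finset.sum_mul, mul_smul_comm, smul_mul_assoc, hce]
    rw [← Equiv.sum_comp (Equiv.swap i j)]
    simp
  · exact conj_mem_fibre (cayley_mem_centralizer (P.lie.smul_mem _ hX) (hAX.smul_right _) (hdom t))
      hx

/-- Permutations of the eigenvalues of `D.diag x` that preserve the sizes of the blocks are realized
by paths in the fibre, because they are products of transpositions of that kind. -/
theorem joinedIn_fibre_perm {u : Fin k → ℂ} (w : Equiv.Perm (Fin k))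
    (hw : ∀ i, parts (w i) = parts i) :
    ∀ x : Fin k → ℂ, D.diag x ∈ fibre P parts A u →
      JoinedIn (fibre P parts A u) (D.diag x) (D.diag fun l => x (w l)) := by
  induction hn : w.support.card using Nat.strong_induction_on generalizing w with
  | _ n ih =>
    intro x hx
    by_cases h1 : w = 1
    · subst h1
      exact JoinedIn.refl hx
    · obtain ⟨i, hi⟩ := not_forall.1 fun h => h1 (Equiv.ext h)
      rw [Equiv.Perm.one_apply] at hi
      let w' := Equiv.swap i (w i) * w
      have hw' : ∀ l, parts (w' l) = parts l := by
        intro l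
        rw [← hw l, Equiv.Perm.mul_apply]
        by_cases h2 : w l = i
        · rw [h2, Equiv.swap_apply_left, hw]
        by_cases h3 : w l = w i
        · rw [h3, Equiv.swap_apply_right, hw]
        rw [Equiv.swap_apply_of_ne_of_ne h2 h3]
      have hs := D.joinedIn_fibre_swap hx i (w i) (Ne.symm hi) (hw i).symm
      have h2 := ih _ (hn ▸ Equiv.Perm.card_support_swap_mul hi) w' hw' rfl _ hs.target_mem
      have h3 : (fun l => x (Equiv.swap i (w i) (w' l))) = fun l => x (w l) := by
        ext l
        simp [w', Equiv.Perm.mul_apply]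
      rw [h3] at h2
      exact hs.trans h2

/-- Moving the eigenvalues back along a path of conormals gives a path in a fibre. -/
theorem joinedIn_fibre_diag {u : Fin k → ℂ} (hu : Function.Injective u) {B : Matrix ι ι ℂ}
    (hB : B ∈ fibre P parts A u) : JoinedIn (fibre P parts A u) B (D.diag u) := by
  have h0 := sum_eq_zero_of_hasRoots hB.1 hB.2 hu
  have hd := D.diag_mem_fibre hu h0
  obtain ⟨γ, hγ⟩ := D.isPathConnected_distinct.joinedIn B (D.fibre_subset hu hB) _
    (D.fibre_subset hu hd)
  let β : C(I, P.distinct A k) := ⟨fun t => ⟨γ t, hγ t⟩, by fun_prop⟩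
  obtain ⟨v, hv, hv0⟩ := exists_orderedConfig_lift (D.spectrumMap.comp β) ⟨u, hu⟩ (by
    rw [ContinuousMap.comp_apply, D.spectrumMap_eq_iff]
    simpa [β] using hB.2)
  have hv' : ∀ t, HasRoots (γ t) (v t).1 fun i => P.d * parts i := fun t =>
    (D.spectrumMap_eq_iff (β t) (v t)).1 (hv t).symm
  have h1 := hv' 1
  rw [γ.target] at h1
  obtain ⟨w, hw, hvw⟩ := hd.2.exists_perm h1 hu (v 1).2 D.mul_pos D.mul_pos
  have hw' : ∀ i, parts (w i) = parts i := fun i => Nat.eq_of_mul_eq_mul_left P.d_pos (hw i)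
  have hwi : ∀ i, parts (w⁻¹ i) = parts i := fun i => by simpa using (hw' (w⁻¹ i)).symm
  have hjoin : JoinedIn (fibre P parts A u) B (D.diag fun i => u (w⁻¹ i)) := by
    refine ⟨⟨⟨fun t => moveRoots (v t).1 u (γ t), continuous_moveRoots (by fun_prop)
      continuous_const γ.continuous fun t => (v t).2⟩, ?_, ?_⟩, fun t => ?_⟩
    · simp [hv0, moveRoots_self]
    · show moveRoots (v 1).1 u (γ 1) = _
      have hdec : IsSpecDecomp (D.diag u) (v 1).1 fun i => D.e (w i) := by
        have h := D.isSpecDecomp_diag u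
        refine ⟨fun i j => ?_, ?_, fun i => h.comm _, fun i => ?_⟩
        · rw [h.mul_eq]
          simp
        · rw [Equiv.sum_comp w, h.sum_eq]
        · rw [hvw]
          exact h.nil (w i)
      rw [γ.target, moveRoots]
      simp only [hdec.specIdem_eq (v 1).2, hvw]
      rw [diag, ← Equiv.sum_comp w, ← Finset.sum_add_distrib, diag,
        ← Equiv.sum_comp w fun i => u (w⁻¹ i) • D.e i]
      refine Finset.sum_congr rfl fun i _ => ?_
      rw [← add_smul, show w⁻¹ (w i) = i by simp]
      congr 1
      ring
    · exact ⟨moveRoots_mem_conormal (hγ t).1 (hv' t) (v t).2 hu h0, (hv' t).moveRoots (v t).2 hu⟩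
  refine hjoin.trans ?_
  have := D.joinedIn_fibre_perm w hw' _ hjoin.target_mem
  simpa using this

end AdaptedData

end Fibre

/-! ### The homomorphism to the colored braid group -/

section Braid

variable {ι : Type*} [Fintype ι] [DecidableEq ι] {k : ℕ}

/-- The lift of a null-homotopic loop of colored configurations is a null-homotopic loop. -/
theorem lift_eq_of_pathClass_eq_refl {c : Fin k → ℕ} {x : ColoredConfig c} (γ : Path x x)
    (hγ : pathClass γ = Path.Homotopic.Quotient.refl x) (v : C(I, OrderedConfig k))
    (hv : ∀ t, ColoredConfig.mk c (v t) = γ t) :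
    ∃ h : v 1 = v 0, pathClass (⟨v, rfl, h⟩ : Path (v 0) (v 0)) =
      Path.Homotopic.Quotient.refl (v 0) := by
  have cov := isCoveringMap_coloredConfigMk c
  have hx : x = ColoredConfig.mk c (v 0) := by rw [hv, γ.source]
  have h1 : γ.toContinuousMap.HomotopicRel (ContinuousMap.const I x) {0, 1} :=
    Path.Homotopic.Quotient.eq.1 hγ
  have h2 := cov.homotopicRel_liftPath h1 (v 0) (by rw [hv]; rfl) hx
  rw [cov.liftPath_const hx, ← (cov.eq_liftPath_iff' (Γ := v) _).2 ⟨funext hv, rfl⟩] at h2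
  have h3 : v 1 = v 0 := by
    obtain ⟨H⟩ := h2
    rw [← H.eq_fst 0 (.inr rfl), H.eq_snd 0 (.inr rfl)]
    rfl
  exact ⟨h3, Path.Homotopic.Quotient.eq.2 h2⟩

/-- The homotopy from `center` to the identity. -/
noncomputable def centering (parts : Fin k → ℕ) : C(OrderedConfig k × I, OrderedConfig k) where
  toFun z := ⟨fun i => z.1.1 i + (1 - ((z.2 : ℝ) : ℂ)) * (center parts z.1.1 i - z.1.1 i), by
    intro i j h
    simp only [center, sub_sub_cancel_left] at h
    exact z.1.2 (add_right_cancel h)⟩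
  continuous_toFun := by
    refine Continuous.subtype_mk (continuous_pi fun i => ?_) _
    have h0 : Continuous fun z : OrderedConfig k × I => z.1.1 :=
      continuous_subtype_val.comp continuous_fst
    have h1 : Continuous fun z : OrderedConfig k × I => z.1.1 i := (continuous_apply i).comp h0
    have h2 : Continuous fun z : OrderedConfig k × I => center parts z.1.1 i :=
      (continuous_apply i).comp ((continuous_center parts).comp h0)
    have h3 : Continuous fun z : OrderedConfig k × I => (1 - ((z.2 : ℝ) : ℂ)) := by fun_prop
    exact h1.add (h3.mul (h2.sub h1))

theorem centering_zero (parts : Fin k → ℕ) (u : OrderedConfig k) :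
    centering parts (u, 0) = ⟨center parts u.1, center_injective parts u.2⟩ := by
  ext i
  simp [centering]

theorem centering_one (parts : Fin k → ℕ) (u : OrderedConfig k) : centering parts (u, 1) = u := by
  ext i
  simp [centering]

theorem centering_eq_self {parts : Fin k → ℕ} {u : OrderedConfig k}
    (h : ∑ i, (parts i : ℂ) * u.1 i = 0) (t : I) : centering parts (u, t) = u := by
  ext i
  simp [centering, center_eq_self h]

/-- Centering a path of configurations does not change its homotopy class, if the two ends are
centered already. -/
theorem pathClass_centering {c : Fin k → ℕ} {a b d : ColoredConfig c} (v : C(I, OrderedConfig k))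
    (h1 : ∑ i, (c i : ℂ) * (v 1).1 i = 0) (h0 : ∑ i, (c i : ℂ) * (v 0).1 i = 0)
    (p : Path a b) (q : Path b d) (q' : Path a d)
    (hp : ∀ t, p t = ColoredConfig.mk c ⟨center c (v t).1, center_injective c (v t).2⟩)
    (hq : ∀ t, q t = ColoredConfig.mk c (v 1)) (hq' : ∀ t, q' t = ColoredConfig.mk c (v t)) :
    (pathClass p).trans (pathClass q) = pathClass q' := by
  let Q : C(I × I, ColoredConfig c) :=
    (⟨ColoredConfig.mk c, continuous_quotient_mk'⟩ : C(OrderedConfig k, ColoredConfig c)).comp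
      ((centering c).comp ((v.comp ContinuousMap.fst).prodMk ContinuousMap.snd))
  have hQ : ∀ s t, Q (s, t) = ColoredConfig.mk c (centering c (v s, t)) := fun _ _ => rfl
  refine pathClass_square_left _ _ _ Q (fun s => ?_) (fun t => ?_) (fun t => ?_) fun s => ?_
  · rw [hQ, centering_zero, hp]
  · rw [hQ, centering_eq_self h1, hq]
  · rw [hQ, centering_eq_self h0, ← hq', q'.source]
  · rw [hQ, centering_one, hq']

namespace AdaptedData

variable {P : SymmetricPair ι} {parts : Fin k → ℕ} {A : Matrix ι ι ℂ} (D : AdaptedData P parts A)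

/-- A loop of colored configurations lifts to a path of conormals, obtained by moving the
eigenvalues of a given conormal. The path is closed up in a fibre. -/
theorem surjective_map_spectrumMap (ξ : P.distinct A k) :
    Function.Surjective (FundamentalGroup.map D.spectrumMap ξ) := by
  intro γ
  obtain ⟨γ, rfl⟩ := Quotient.exists_rep γ
  change Path (D.spectrumMap ξ) (D.spectrumMap ξ) at γ
  obtain ⟨u, hu⟩ := D.exists_hasRoots ξ.2
  have hu0 := sum_eq_zero_of_hasRoots ξ.2.1 hu u.2
  have hξu := (D.spectrumMap_eq_iff ξ u).2 hu
  obtain ⟨v, hv, hv0⟩ := exists_orderedConfig_lift γ.toContinuousMap u (γ.source.trans hξu)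
  have hv1 : HasRoots ξ.1 (v 1).1 fun i => P.d * parts i := by
    rw [← D.spectrumMap_eq_iff, hv]
    exact γ.target.symm
  have hc : ∀ w : OrderedConfig k, HasRoots ξ.1 w.1 (fun i => P.d * parts i) →
      center parts w.1 = w.1 := fun w hw =>
    center_eq_self (sum_eq_zero_of_hasRoots ξ.2.1 hw w.2)
  have hcont : Continuous fun t => (v t).1 := continuous_subtype_val.comp v.continuous
  -- the centering keeps the trace equal to zero along the path
  let Θ : C(I, P.distinct A k) := ⟨fun t => ⟨moveRoots u.1 (center parts (v t).1) ξ.1,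
    D.mem_distinct_of_hasRoots (moveRoots_mem_conormal ξ.2.1 hu u.2
      (center_injective parts (v t).2) (sum_mul_center D.pos _))
      (hu.moveRoots u.2 (center_injective parts (v t).2)) (center_injective parts (v t).2)⟩,
    (continuous_moveRoots continuous_const ((continuous_center parts).comp hcont)
      continuous_const fun _ => u.2).subtype_mk _⟩
  have hΘ : ∀ t, D.spectrumMap (Θ t) =
      ColoredConfig.mk parts ⟨center parts (v t).1, center_injective parts (v t).2⟩ := fun t =>
    (D.spectrumMap_eq_iff _ _).2 (hu.moveRoots u.2 (center_injective parts (v t).2))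
  have hΘ0 : Θ 0 = ξ := by
    ext1
    show moveRoots u.1 (center parts (v 0).1) ξ.1 = _
    rw [hv0, hc u hu, moveRoots_self]
  have hΘ1 : (Θ 1).1 ∈ fibre P parts A u.1 := by
    refine ⟨(Θ 1).2.1, ?_⟩
    rw [← D.spectrumMap_eq_iff _ u, hΘ, ← hξu, eq_comm, D.spectrumMap_eq_iff]
    show HasRoots ξ.1 (center parts (v 1).1) _
    rw [hc _ hv1]
    exact hv1
  obtain ⟨δ, hδ⟩ := (D.joinedIn_fibre_diag u.2 hΘ1).trans
    (D.joinedIn_fibre_diag u.2 (⟨ξ.2.1, hu⟩ : ξ.1 ∈ fibre P parts A u.1)).symm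
  let p : Path ξ (Θ 1) := ⟨Θ, hΘ0, rfl⟩
  let q : Path (Θ 1) ξ := ⟨⟨fun t => ⟨δ t, D.fibre_subset u.2 (hδ t)⟩, by fun_prop⟩,
    Subtype.ext δ.source, Subtype.ext δ.target⟩
  refine ⟨pathClass (p.trans q), ?_⟩
  have hmap : pathClass ((p.trans q).map D.spectrumMap.continuous) = pathClass γ := by
    rw [Path.map_trans]
    refine pathClass_centering v (sum_eq_zero_of_hasRoots ξ.2.1 hv1 (v 1).2)
      (hv0 ▸ hu0) _ _ _ hΘ (fun t => ?_) (fun t => (hv t).symm)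
    rw [hv]
    refine Eq.trans ?_ (hξu.symm.trans γ.target.symm)
    exact (D.spectrumMap_eq_iff _ u).2 (hδ t).2
  exact hmap

/-- If the fibres of the spectrum map have trivial fundamental groups, a loop of conormals whose
spectrum is a null-homotopic loop is null-homotopic. -/
theorem injective_map_spectrumMap
    (hnull : ∀ (u : Fin k → ℂ), Function.Injective u → ∀ (B : fibre P parts A u) (γ : Path B B),
      pathClass γ = Path.Homotopic.Quotient.refl B) (ξ : P.distinct A k) :
    Function.Injective (FundamentalGroup.map D.spectrumMap ξ) := by
  rw [injective_iff_map_eq_one]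
  intro β hβ
  obtain ⟨β, rfl⟩ := Quotient.exists_rep β
  change Path ξ ξ at β
  have hβ' : pathClass (β.map D.spectrumMap.continuous) = Path.Homotopic.Quotient.refl _ := hβ
  show pathClass β = Path.Homotopic.Quotient.refl ξ
  obtain ⟨u, hu⟩ := D.exists_hasRoots ξ.2
  have hu0 := sum_eq_zero_of_hasRoots ξ.2.1 hu u.2
  have hξu := (D.spectrumMap_eq_iff ξ u).2 hu
  obtain ⟨v, hv, rfl⟩ := exists_orderedConfig_lift
    (β.map D.spectrumMap.continuous).toContinuousMap u
    ((β.map D.spectrumMap.continuous).source.trans hξu)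
  obtain ⟨hv1, hvn⟩ := lift_eq_of_pathClass_eq_refl _ hβ' v hv
  have hvr : ∀ t, HasRoots (β t).1 (v t).1 fun i => P.d * parts i := fun t =>
    (D.spectrumMap_eq_iff _ _).1 (hv t).symm
  have hcont : Continuous fun t => (v t).1 := continuous_subtype_val.comp v.continuous
  let y₀ : fibre P parts A (v 0).1 := ⟨ξ.1, ξ.2.1, hu⟩
  -- `β` is the image under `Ψ` of the product of the loop `v` of eigenvalues and of a loop `y` in a
  -- single fibre, both of which are null-homotopic
  let y : Path y₀ y₀ := ⟨⟨fun t => ⟨moveRoots (v t).1 (v 0).1 (β t).1,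
      moveRoots_mem_conormal (β t).2.1 (hvr t) (v t).2 (v 0).2 hu0,
      (hvr t).moveRoots (v t).2 (v 0).2⟩,
    (continuous_moveRoots hcont continuous_const (by fun_prop)
      fun t => (v t).2).subtype_mk _⟩,
    by simp [moveRoots_self, y₀], by simp [moveRoots_self, y₀, hv1]⟩
  let Ψ : C(OrderedConfig k × fibre P parts A (v 0).1, P.distinct A k) :=
    ⟨fun z => ⟨moveRoots (v 0).1 (center parts z.1.1) z.2.1,
      D.mem_distinct_of_hasRoots (moveRoots_mem_conormal z.2.2.1 z.2.2.2 (v 0).2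
        (center_injective parts z.1.2) (sum_mul_center D.pos _))
        (z.2.2.2.moveRoots (v 0).2 (center_injective parts z.1.2)) (center_injective parts z.1.2)⟩,
      (continuous_moveRoots continuous_const ((continuous_center parts).comp
        (continuous_subtype_val.comp continuous_fst)) (by fun_prop) fun _ => (v 0).2).subtype_mk _⟩
  have hΨ : ∀ t, Ψ (v t, y t) = β t := by
    intro t
    ext1
    show moveRoots (v 0).1 (center parts (v t).1) (moveRoots (v t).1 (v 0).1 (β t).1) = _
    rw [center_eq_self (sum_eq_zero_of_hasRoots (β t).2.1 (hvr t) (v t).2),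
      (hvr t).moveRoots_moveRoots (v t).2 (v 0).2]
  have h0 : Ψ (v 0, y₀) = ξ := by
    have := hΨ 0
    rwa [y.source, β.source] at this
  let p : Path (v 0) (v 0) := ⟨v, rfl, hv1⟩
  have h1 : β = ((p.prod y).map Ψ.continuous).cast h0.symm h0.symm := by
    ext1
    funext t
    exact (hΨ t).symm
  have h2 : pathClass ((p.prod y).map Ψ.continuous) = Path.Homotopic.Quotient.refl _ := by
    have h3 : pathClass (p.prod y) = Path.Homotopic.Quotient.refl _ := by
      show Path.Homotopic.Quotient.mk (p.prod y) = _
      rw [← Path.Homotopic.prod_lift, show Path.Homotopic.Quotient.mk p = _ from hvn,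
        show Path.Homotopic.Quotient.mk y = _ from hnull _ (v 0).2 _ y]
      rfl
    show Path.Homotopic.Quotient.mk ((p.prod y).map Ψ.continuous) = _
    rw [Path.Homotopic.Quotient.mk_map, show Path.Homotopic.Quotient.mk (p.prod y) = _ from h3]
    rfl
  have hgen : ∀ (b c : P.distinct A k) (hbc : b = c) (q : Path c c),
      pathClass q = Path.Homotopic.Quotient.refl c →
        pathClass (q.cast hbc hbc) = Path.Homotopic.Quotient.refl b := by
    rintro b c rfl q hq
    exact hq
  rw [h1]
  exact hgen _ _ h0.symm _ h2

end AdaptedData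

end Braid

/-! ### Lifting paths in a fibre to the centralizer -/

section Lifting

/-- Homotopy lifting along a map `F` that need not be injective: if short subpaths of `γ` lift
from any given point, then `γ` is homotopic to the image of a path. -/
theorem exists_lift_pathClass {X Z : Type*} [TopologicalSpace X] [TopologicalSpace Z] (F : C(X, Z))
    {z₀ z₁ : Z} (γ : Path z₀ z₁) (x₀ : X) (hx₀ : F x₀ = z₀)
    (hloc : ∀ t₀, ∀ᶠ t in 𝓝 t₀,
      (∀ x, F x = γ t₀ → ∃ q : C(I, X), q 0 = x ∧ ∀ s, F (q s) = γ.subpath t₀ t s) ∧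
      (∀ x, F x = γ t → ∃ q : C(I, X), q 0 = x ∧ ∀ s, F (q s) = γ.subpath t t₀ s)) :
    ∃ (x₁ : X) (p : Path x₀ x₁) (h : F x₁ = z₁),
      pathClass ((p.map F.continuous).cast hx₀.symm h.symm) = pathClass γ := by
  have h0 : F x₀ = γ 0 := by rw [hx₀, γ.source]
  let G : I → Prop := fun t => ∃ (x₁ : X) (p : Path x₀ x₁) (h : F x₁ = γ t),
    pathClass ((p.map F.continuous).cast h0.symm h.symm) = pathClass (γ.subpath 0 t)
  have hstep : ∀ a b, (∀ x, F x = γ a → ∃ q : C(I, X), q 0 = x ∧ ∀ s, F (q s) = γ.subpath a b s) →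
      G a → G b := by
    rintro a b hab ⟨x₁, p, h, hp⟩
    obtain ⟨q, hq0, hq⟩ := hab x₁ h
    have hq1 : F (q 1) = γ b := by rw [hq]; simp
    refine ⟨q 1, p.trans ⟨q, hq0, rfl⟩, hq1, ?_⟩
    rw [← pathClass_subpath_trans γ 0 a b, ← hp, ← pathClass_trans]
    congr 1
    ext s
    simp only [Path.cast_coe, Path.map_coe, Path.trans_apply, Function.comp_apply]
    split_ifs
    · rfl
    · exact hq _
  have h1 : G 1 := by
    refine unitInterval_induction (P := G) ⟨x₀, Path.refl x₀, h0, ?_⟩ (fun t₀ => ?_) 1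
    · congr 1
      ext s
      rw [Path.subpath_self]
      exact h0
    · filter_upwards [hloc t₀] with t ht
      exact ⟨hstep t t₀ ht.2, hstep t₀ t ht.1⟩
  obtain ⟨x₁, p, h, hp⟩ := h1
  refine ⟨x₁, p, by rw [h, γ.target], ?_⟩
  have h2 : γ = (γ.subpath 0 1).cast γ.source.symm γ.target.symm := by
    ext s
    simp
  exact (congrArg (fun α => Path.Homotopic.Quotient.cast α γ.source.symm γ.target.symm) hp).trans
    (congrArg pathClass h2.symm)

variable {ι : Type*} [Fintype ι] [DecidableEq ι] {k : ℕ}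

open Classical in
/-- An invertible matrix as a unit. A singular matrix is sent to `1`. -/
noncomputable def unitOf (M : Matrix ι ι ℂ) : (Matrix ι ι ℂ)ˣ :=
  if h : IsUnit M.det then Matrix.nonsingInvUnit M h else 1

theorem unitOf_val {M : Matrix ι ι ℂ} (h : M.det ≠ 0) : (unitOf M).val = M := by
  rw [unitOf, dif_pos (isUnit_iff_ne_zero.2 h)]
  rfl

theorem unitOf_one : unitOf (1 : Matrix ι ι ℂ) = 1 := Units.ext (unitOf_val (by simp))

theorem continuousOn_unitOf :
    ContinuousOn (unitOf : Matrix ι ι ℂ → (Matrix ι ι ℂ)ˣ) {M | M.det ≠ 0} := by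
  rw [continuousOn_iff_continuous_domRestrict, Units.continuous_iff]
  constructor
  · exact continuous_subtype_val.congr fun M => (unitOf_val M.2).symm
  · refine (continuousOn_matrix_inv.comp_continuous continuous_subtype_val
      fun M => M.2).congr fun M => ?_
    show _ = ((unitOf M.1)⁻¹).val
    rw [Matrix.coe_units_inv, unitOf_val M.2]
    rfl

/-- The semisimple part of a matrix with the eigenvalues `u i`. -/
noncomputable def semisimplePart (u : Fin k → ℂ) (B : Matrix ι ι ℂ) : Matrix ι ι ℂ :=
  ∑ i, u i • specIdem u B i

/-- The semisimple part is continuous because the eigenvalues `u i` are fixed. -/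
theorem continuous_semisimplePart {u : Fin k → ℂ} (hu : Function.Injective u) :
    Continuous fun B : Matrix ι ι ℂ => semisimplePart u B := by
  have h := fun i => continuous_specIdem (u := fun _ : Matrix ι ι ℂ => u) continuous_const
    continuous_id (fun _ => hu) i
  unfold semisimplePart
  exact continuous_finsetSum _ fun i _ => (h i).const_smul (u i)

/-- Scaling the nilpotent part of `B` by `c` does not change the spectral decomposition. -/
theorem IsSpecDecomp.scale {B : Matrix ι ι ℂ} {u : Fin k → ℂ} {e : Fin k → Matrix ι ι ℂ}
    (h : IsSpecDecomp B u e) (c : ℂ) :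
    IsSpecDecomp ((∑ i, u i • e i) + c • (B - ∑ i, u i • e i)) u e := by
  have hce : ∀ i j, Commute (e i) (e j) := fun i j => by
    show e i * e j = e j * e i
    rw [h.mul_eq, h.mul_eq]
    by_cases hij : i = j
    · simp [hij]
    · simp [hij, Ne.symm hij]
  have hcs : ∀ i, Commute (e i) (∑ j, u j • e j) := fun i =>
    Commute.sum_right _ _ _ fun j _ => (hce i j).smul_right _
  have hc : ∀ i, Commute (e i) ((∑ i, u i • e i) + c • (B - ∑ i, u i • e i)) := fun i =>
    (hcs i).add_right (((h.comm i).sub_right (hcs i)).smul_right c)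
  refine ⟨h.mul_eq, h.sum_eq, hc, fun i => ?_⟩
  have key : ((∑ i, u i • e i) + c • (B - ∑ i, u i • e i) - u i • 1) * e i =
      c • ((B - u i • 1) * e i) := by
    have : (∑ j, u j • e j) * e i = u i • e i := by
      rw [Finset.sum_mul]
      simp [h.mul_eq]
    simp only [sub_mul, add_mul, smul_mul_assoc, this, one_mul]
    module
  have c1 := ((hc i).symm.sub_left ((Commute.one_left (e i)).smul_left (u i)))
  have c2 : Commute (B - u i • 1) (e i) :=
    (h.comm i).symm.sub_left ((Commute.one_left _).smul_left _)
  rcases Nat.eq_zero_or_pos (Fintype.card ι) with h0 | h0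
  · have := h.nil i
    rw [h0] at this ⊢
    simpa using this
  · have e1 : ∀ X : Matrix ι ι ℂ, Commute X (e i) →
        X ^ Fintype.card ι * e i = (X * e i) ^ Fintype.card ι := by
      intro X hX
      rw [hX.mul_pow, (show IsIdempotentElem (e i) from h.idem i).pow_eq h0.ne']
    rw [e1 _ c1, key, _root_.smul_pow, ← e1 _ c2, h.nil i, smul_zero]

namespace AdaptedData

variable {P : SymmetricPair ι} {parts : Fin k → ℕ} {A : Matrix ι ι ℂ} (D : AdaptedData P parts A)

/-- A local section of the orbit map at a semisimple point `y₀` of a fibre. The matrix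
`∑ i, specIdem u y i * specIdem u y₀ i` commutes with `A` and carries the eigenspaces of `y₀` to the
generalized eigenspaces of `y`; its polar part is an isometry with the same properties. -/
theorem exists_local_section {u : Fin k → ℂ} (hu : Function.Injective u) {y₀ : Matrix ι ι ℂ}
    (hA : A ∈ P.S) (hy₀ : y₀ ∈ fibre P parts A u) (hs : semisimplePart u y₀ = y₀) :
    ∃ V ∈ 𝓝 y₀, ∃ s : Matrix ι ι ℂ → (Matrix ι ι ℂ)ˣ, ContinuousOn s (V ∩ fibre P parts A u) ∧
      ∀ y ∈ V ∩ fibre P parts A u, s y ∈ centralizer P A ∧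
        (s y).val * y₀ * (s y)⁻¹.val = semisimplePart u y := by
  let f := specIdem u y₀
  have hf := hy₀.2.isSpecDecomp hu
  have hAf : ∀ i, Commute A (f i) := hf.commute_of_commute hu hy₀.1.2.1
  let T : Set (Matrix ι ι ℂ) := insert A (Set.range f)
  obtain ⟨κ, -, U, hU, hκ, hκK⟩ := P.polar T (by
    rintro t (rfl | ⟨i, rfl⟩)
    · exact hA
    · exact P.specIdem_mem hy₀.1.1 u i)
  -- `g y` maps the generalized eigenspaces of `y₀` to those of `y`
  let g : Matrix ι ι ℂ → Matrix ι ι ℂ := fun y => ∑ i, specIdem u y i * f i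
  have hgc : Continuous g := continuous_finsetSum _ fun i _ =>
    (continuous_specIdem (u := fun _ : Matrix ι ι ℂ => u) continuous_const continuous_id
      (fun _ => hu) i).mul continuous_const
  have hg0 : g y₀ = 1 := by
    show ∑ i, f i * f i = 1
    simp only [f, hf.idem, hf.sum_eq]
  have hdet : ∀ᶠ y in 𝓝 y₀, (g y).det ≠ 0 :=
    (hgc.matrix_det.tendsto y₀).eventually_ne (by simp [hg0])
  have hUy : ∀ᶠ y in 𝓝 y₀, unitOf (g y) ∈ U := by
    have h1 : ContinuousAt (fun y => unitOf (g y)) y₀ := by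
      have h2 : ContinuousAt unitOf (g y₀) := continuousOn_unitOf.continuousAt
        ((isOpen_ne_fun (by fun_prop : Continuous fun M : Matrix ι ι ℂ => M.det)
          continuous_const).mem_nhds (by simp [hg0]))
      exact ContinuousAt.comp (f := g) h2 hgc.continuousAt
    rw [ContinuousAt, hg0, unitOf_one] at h1
    exact h1.eventually hU
  have hgf : ∀ y ∈ fibre P parts A u, ∀ i, g y * f i = specIdem u y i * g y := by
    intro y hy i
    have hy' := hy.2.isSpecDecomp hu
    simp only [g, Finset.sum_mul, Finset.mul_sum, mul_assoc, f, hf.mul_eq,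
      ← mul_assoc _ _ (specIdem u y₀ _), hy'.mul_eq]
    simp only [mul_ite, mul_zero, ite_mul, zero_mul, Finset.sum_ite_eq, Finset.sum_ite_eq',
      Finset.mem_univ, if_true]
  have hgA : ∀ y ∈ fibre P parts A u, Commute A (g y) := fun y hy =>
    Commute.sum_right _ _ _ fun i _ =>
      ((hy.2.isSpecDecomp hu).commute_of_commute hu hy.1.2.1 i).mul_right (hAf i)
  have hcA : ∀ y ∈ fibre P parts A u, (g y).det ≠ 0 →
      (unitOf (g y)).val * A * (unitOf (g y))⁻¹.val = A := fun y hy hy' =>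
    conj_eq_self_of_commute (by rw [unitOf_val hy']; exact hgA y hy)
  have hcf : ∀ y ∈ fibre P parts A u, (g y).det ≠ 0 → ∀ i,
      (unitOf (g y)).val * f i * (unitOf (g y))⁻¹.val = specIdem u y i := fun y hy hy' i => by
    rw [Units.mul_inv_eq_iff_eq_mul, unitOf_val hy', hgf y hy]
  have hT : ∀ y ∈ fibre P parts A u, (g y).det ≠ 0 → ∀ t ∈ T,
      (unitOf (g y)).val * t * (unitOf (g y))⁻¹.val ∈ P.S := by
    rintro y hy hy' t (rfl | ⟨i, rfl⟩)
    · rw [hcA y hy hy']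
      exact hA
    · rw [hcf y hy hy']
      exact P.specIdem_mem hy.1.1 u i
  refine ⟨_, hdet.and hUy, fun y => κ (unitOf (g y)), ?_, ?_⟩
  · refine hκ.comp ((continuousOn_unitOf.comp hgc.continuousOn fun y (hy : y ∈ {y | (g y).det ≠ 0})
      => hy).mono fun y hy => hy.1.1) fun y hy => ⟨hy.1.2, hT y hy.2 hy.1.1⟩
  · rintro y ⟨⟨hy1, hy2⟩, hy⟩
    obtain ⟨h1, h2⟩ := hκK _ hy2 (hT y hy hy1)
    refine ⟨⟨h1, ?_⟩, ?_⟩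
    · have := h2 A (Set.mem_insert _ _)
      rw [hcA y hy hy1, Units.mul_inv_eq_iff_eq_mul] at this
      exact this.symm
    · rw [← hs, semisimplePart, Finset.mul_sum, Finset.sum_mul, semisimplePart]
      refine Finset.sum_congr rfl fun i _ => ?_
      rw [mul_smul_comm, smul_mul_assoc, h2 _ (Set.mem_insert_of_mem _ ⟨i, rfl⟩), hcf y hy hy1]

/-- The orbit map of the centralizer of `A` in a fibre. -/
def orbitMap {u : Fin k → ℂ} (y₀ : fibre P parts A u) :
    C(centralizer P A, fibre P parts A u) where
  toFun h := ⟨h.1.val * y₀.1 * h.1⁻¹.val, conj_mem_fibre h.2 y₀.2⟩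
  continuous_toFun := (continuous_conj continuous_subtype_val continuous_const).subtype_mk _

theorem orbitMap_apply {u : Fin k → ℂ} (y₀ : fibre P parts A u) (h : centralizer P A) :
    (orbitMap y₀ h).1 = h.1.val * y₀.1 * h.1⁻¹.val := rfl

theorem orbitMap_one {u : Fin k → ℂ} (y₀ : fibre P parts A u) : orbitMap y₀ 1 = y₀ := by
  ext1
  simp [orbitMap_apply]

/-- Paths of semisimple elements in a fibre are homotopic to paths in an orbit. -/
theorem exists_orbitMap_pathClass {u : Fin k → ℂ} (hu : Function.Injective u) (hA : A ∈ P.S)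
    {y₀ y₁ : fibre P parts A u} (γ : Path y₀ y₁)
    (hγ : ∀ t, semisimplePart u (γ t).1 = (γ t).1) :
    ∃ (h : centralizer P A) (p : Path 1 h) (hh : orbitMap y₀ h = y₁),
      pathClass ((p.map (orbitMap y₀).continuous).cast (orbitMap_one y₀).symm hh.symm) =
        pathClass γ := by
  refine exists_lift_pathClass (orbitMap y₀) γ 1 (orbitMap_one y₀) fun t₀ => ?_
  obtain ⟨V, hV, s, hsc, hs⟩ := exists_local_section hu hA (γ t₀).2 (hγ t₀)
  have key : ∀ a b, (∀ c, (γ.subpath a b c).1 ∈ V) → ∀ x, orbitMap y₀ x = γ a →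
      ∃ q : C(I, centralizer P A), q 0 = x ∧ ∀ c, orbitMap y₀ (q c) = γ.subpath a b c := by
    intro a b hab x hx
    have ha : (γ a).1 ∈ V := by simpa using hab 0
    have hsa := hs _ ⟨ha, (γ a).2⟩
    rw [hγ] at hsa
    have hmem : ∀ c, s (γ.subpath a b c).1 ∈ centralizer P A := fun c =>
      (hs _ ⟨hab c, (γ.subpath a b c).2⟩).1
    have hcont : Continuous fun c => s (γ.subpath a b c).1 :=
      hsc.comp_continuous (by fun_prop) fun c => ⟨hab c, (γ.subpath a b c).2⟩
    let r : C(I, centralizer P A) := ⟨fun c => ⟨_, hmem c⟩, hcont.subtype_mk hmem⟩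
    let w : centralizer P A := ⟨_, hsa.1⟩
    have hr : ∀ c, (r c).1 = s (γ.subpath a b c).1 := fun _ => rfl
    have hw : w.1 = s (γ a).1 := rfl
    -- translating the section makes the lift start at the given point `x`
    refine ⟨⟨fun c => r c * (w⁻¹ * x), r.continuous.mul continuous_const⟩, ?_, fun c => ?_⟩
    · have : r 0 = w := Subtype.ext (by rw [hr, hw, Path.source])
      show r 0 * (w⁻¹ * x) = x
      rw [this, mul_inv_cancel_left]
    · have h1 := (hs _ ⟨hab c, (γ.subpath a b c).2⟩).2
      have h2 : semisimplePart u (γ.subpath a b c).1 = (γ.subpath a b c).1 := hγ _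
      rw [h2] at h1
      have hx' := congrArg Subtype.val hx
      rw [orbitMap_apply] at hx'
      have h3 : (γ t₀).1 = w.1⁻¹.val * ((γ a).1 * w.1.val) := by
        rw [Units.eq_inv_mul_iff_mul_eq]
        exact (Units.mul_inv_eq_iff_eq_mul _).1 hsa.2
      ext1
      rw [← h1, orbitMap_apply, h3, ← hx']
      simp only [ContinuousMap.coe_mk, Subgroup.coe_mul, Subgroup.coe_inv, Units.val_mul,
        mul_inv_rev, inv_inv, mul_assoc, hr]
  have hnear : ∀ᶠ t in 𝓝 t₀, (γ t).1 ∈ V :=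
    ((continuous_subtype_val.comp γ.continuous).tendsto t₀).eventually hV
  filter_upwards [eventually_forall_convexComb hnear] with t ht
  refine ⟨key t₀ t ht, key t t₀ fun c => ?_⟩
  rw [← Path.symm_subpath]
  exact ht _

end AdaptedData

end Lifting

/-! ### Loops in the centralizer: complex lines in the Lie algebra -/

section LinePolynomials

open Polynomial

variable {ι : Type*} [Fintype ι] [DecidableEq ι] {k : ℕ}

/-- The matrix of polynomials `x + X y`. -/
noncomputable def linePoly (x y : Matrix ι ι ℂ) : Matrix ι ι ℂ[X] := x.map C + (X : ℂ[X]) • y.map C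

theorem linePoly_map (x y : Matrix ι ι ℂ) (z : ℂ) :
    (Polynomial.evalRingHom z).mapMatrix (linePoly x y) = x + z • y := by
  ext i j
  simp [linePoly]
  exact mul_comm _ _

theorem linePoly_det_eval (x y : Matrix ι ι ℂ) (z : ℂ) :
    (linePoly x y).det.eval z = (x + z • y).det := by
  rw [← linePoly_map, ← RingHom.map_det, Polynomial.coe_evalRingHom]

/-- On a line of matrices, the Hankel determinant of the square is a polynomial. -/
theorem exists_eval_eq_hankel_sq (k : ℕ) (x y : Matrix ι ι ℂ) :
    ∃ q : ℂ[X], ∀ z, q.eval z = hankel k ((x + z • y) * (x + z • y)) := by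
  refine ⟨(Matrix.of fun a b : Fin k =>
    ((linePoly x y * linePoly x y) ^ (a + b : ℕ)).trace).det, fun z => ?_⟩
  rw [← Polynomial.coe_evalRingHom, RingHom.map_det, hankel]
  congr 1
  ext a b
  rw [RingHom.mapMatrix_apply, Matrix.map_apply, Matrix.of_apply, Matrix.of_apply,
    AddMonoidHom.map_trace, ← linePoly_map, ← map_mul, ← map_pow]
  rfl

theorem eventually_eval_ne_zero {q : ℂ[X]} (hq : q ≠ 0) (z₀ : ℂ) :
    ∀ᶠ z in 𝓝[≠] z₀, q.eval z ≠ 0 := by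
  have hfin := (q.finite_setOfPred_isRoot hq).subset (Set.sdiff_subset (t := {z₀}))
  filter_upwards [nhdsWithin_le_nhds (hfin.isClosed.isOpen_compl.mem_nhds (x := z₀) (by simp)),
    self_mem_nhdsWithin] with z hz hz' h0
  exact hz ⟨h0, hz'⟩

/-- Each `X` in the Cayley domain is joined to `0` within its complex line, since that line meets
the complement of the domain in finitely many points. -/
theorem exists_smul_path_mem_cayleyDomain {X : Matrix ι ι ℂ} (hX : X ∈ cayleyDomain ι) :
    ∃ ζ : Path (0 : ℂ) 1, ∀ s, ζ s • X ∈ cayleyDomain ι := by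
  have he : ∀ z, ((linePoly 1 X).det * (linePoly 1 (-X)).det).eval z =
      (1 + z • X).det * (1 - z • X).det := fun z => by
    rw [eval_mul, linePoly_det_eval, linePoly_det_eval, smul_neg, sub_eq_add_neg]
  obtain ⟨ε, -, hε⟩ := exists_arc_eval_ne_zero ((linePoly 1 X).det * (linePoly 1 (-X)).det)
    (by simp [he]) (by rw [he, one_smul]; exact mul_ne_zero hX.1 hX.2) one_pos
  refine ⟨arc ε, fun s => ?_⟩
  have := hε s
  rw [he] at this
  exact ⟨left_ne_zero_of_mul this, right_ne_zero_of_mul this⟩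

/-- The condition that `1 + g * cayley X` is invertible is polynomial in `X`. -/
theorem det_one_add_mul_cayley {g X : Matrix ι ι ℂ} (hX : X ∈ cayleyDomain ι) :
    (1 + g * (cayley X).val).det ≠ 0 ↔ ((1 + g) + (X - g * X)).det ≠ 0 := by
  have : (1 + g * (cayley X).val) * (1 + X) = (1 + g) + (X - g * X) := by
    rw [add_mul, one_mul, mul_assoc, cayley_mul_one_add hX, mul_sub, mul_one]
    abel
  rw [← this, Matrix.det_mul]
  simp [hX.1]

end LinePolynomials

section CentralizerLoops

variable {ι : Type*} [Fintype ι] [DecidableEq ι] {k : ℕ}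

namespace AdaptedData

variable {P : SymmetricPair ι} {parts : Fin k → ℕ} {A : Matrix ι ι ℂ} (D : AdaptedData P parts A)

variable (P A) in
/-- The Lie algebra of `centralizer P A`. -/
def centralizerLie : Submodule ℂ (Matrix ι ι ℂ) where
  carrier := {X | X ∈ P.lie ∧ Commute A X}
  add_mem' h h' := ⟨P.lie.add_mem h.1 h'.1, h.2.add_right h'.2⟩
  zero_mem' := ⟨P.lie.zero_mem, Commute.zero_right _⟩
  smul_mem' c _ h := ⟨P.lie.smul_mem c h.1, h.2.smul_right c⟩

theorem invCayley_mem_centralizerLie {g : (Matrix ι ι ℂ)ˣ} (hg : g ∈ centralizer P A)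
    (h : (1 + g.val).det ≠ 0) : invCayley g.val ∈ centralizerLie P A :=
  ⟨P.invCayley_mem hg.1 h, commute_invCayley hg.2⟩

variable (P A) in
/-- The elements of the Lie algebra whose Cayley transform is defined. -/
def cayleySet : Set (centralizerLie P A) := {X | X.1 ∈ cayleyDomain ι}

theorem isOpen_cayleySet : IsOpen (cayleySet P A) :=
  isOpen_cayleyDomain.preimage continuous_subtype_val

theorem zero_mem_cayleySet : (0 : centralizerLie P A) ∈ cayleySet P A := zero_mem_cayleyDomain

variable (P A) in
/-- The Cayley transform as a map to the centralizer of `A`. -/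
noncomputable def cayleyMap : C(cayleySet P A, centralizer P A) where
  toFun X := ⟨cayley X.1.1, cayley_mem_centralizer X.1.2.1 X.1.2.2 X.2⟩
  continuous_toFun := (continuousOn_cayley.comp_continuous (by fun_prop)
    fun X : cayleySet P A => X.2).subtype_mk _

theorem cayleyMap_apply (X : cayleySet P A) : (cayleyMap P A X).1 = cayley X.1.1 := rfl

theorem exists_cayleyMap_eq {g : centralizer P A} (h : (1 + g.1.val).det ≠ 0) :
    ∃ X : cayleySet P A, X.1.1 = invCayley g.1.val ∧ cayleyMap P A X = g :=
  ⟨⟨⟨_, invCayley_mem_centralizerLie g.2 h⟩, invCayley_mem_cayleyDomain h⟩, rfl,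
    Subtype.ext (cayley_invCayley h)⟩

/-- Skew-adjoint square roots of `-e i` that commute with `A`. -/
def HasRotations : Prop :=
  ∀ i, ∃ X ∈ P.lie, Commute A X ∧ D.e i * X = X ∧ X * D.e i = X ∧ X * X = -D.e i

/-- With rotations `J i` of the blocks, `∑ i, i • J i` is an element of the Lie algebra whose square
has the `k` distinct eigenvalues `-i²`. -/
theorem exists_hankel_sq_ne_zero (hD : D.HasRotations) :
    ∃ Z ∈ centralizerLie P A, hankel k (Z * Z) ≠ 0 := by
  choose J hJ hAJ heJ hJe hJJ using hD
  let w : Fin k → ℂ := fun i => ((i : ℕ) : ℂ)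
  have hZZ : (∑ i, w i • J i) * (∑ i, w i • J i) = D.diag fun i => -(w i ^ 2) := by
    rw [Finset.sum_mul, diag]
    refine Finset.sum_congr rfl fun i _ => ?_
    rw [Finset.mul_sum, Finset.sum_eq_single i]
    · rw [smul_mul_assoc, mul_smul_comm, smul_smul, hJJ, smul_neg, neg_smul, sq]
    · intro j _ hj
      rw [← hJe i, ← heJ j, smul_mul_assoc, mul_smul_comm, mul_assoc, ← mul_assoc (D.e i),
        D.mul_eq, if_neg (Ne.symm hj)]
      simp
    · simp
  have hinj : Function.Injective fun i => -(w i ^ 2) := by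
    intro i j h
    have h1 : ((i : ℕ) : ℂ) ^ 2 = ((j : ℕ) : ℂ) ^ 2 := neg_injective h
    have h2 : (i : ℕ) ^ 2 = (j : ℕ) ^ 2 := by exact_mod_cast h1
    exact Fin.ext (Nat.pow_left_injective two_ne_zero h2)
  refine ⟨∑ i, w i • J i, ⟨P.lie.sum_mem fun i _ => P.lie.smul_mem _ (hJ i),
    Commute.sum_right _ _ _ fun i _ => (hAJ i).smul_right _⟩, ?_⟩
  have h := (D.hasRoots_diag hinj).ncard_spectrum D.mul_pos hinj
  rw [hZZ, hankel_ne_zero_iff h.le, h]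

include D in
/-- If `X²` has `k` distinct eigenvalues, then `X` commutes with a point of every fibre. -/
theorem exists_commute_mem_fibre {u : Fin k → ℂ} (hu : Function.Injective u)
    (h0 : ∑ i, (parts i : ℂ) * u i = 0) {X : Matrix ι ι ℂ} (hX : X ∈ centralizerLie P A)
    (hk : hankel k (X * X) ≠ 0) : ∃ B ∈ fibre P parts A u, Commute X B := by
  have hS : X * X ∈ P.S := P.sq_mem hX.1
  have hAX : Commute A (X * X) := hX.2.mul_right hX.2
  rw [hankel_ne_zero_iff (D.ncard_spectrum_le hS hAX)] at hk
  obtain ⟨v, m, hv, hm, h⟩ := exists_hasRoots_of_ncard hk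
  have hc := center_injective m hv
  have h1 := h.moveRoots hv hc
  have hXX : Commute X (X * X) := (Commute.refl X).mul_right (Commute.refl X)
  have hXB : Commute X (moveRoots v (center m v) (X * X)) := hXX.add_right
    (Commute.sum_right _ _ _ fun i _ =>
      ((h.isSpecDecomp hv).commute_of_commute hv hXX i).smul_right _)
  have hB : moveRoots v (center m v) (X * X) ∈ P.distinct A k := by
    refine ⟨⟨?_, ?_, ?_⟩, h1.ncard_spectrum hm hc⟩
    · exact P.S.add_mem hS (P.S.sum_mem fun i _ => P.S.smul_mem _ (P.specIdem_mem hS v i))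
    · exact hAX.add_right (Commute.sum_right _ _ _ fun i _ =>
        ((h.isSpecDecomp hv).commute_of_commute hv hAX i).smul_right _)
    · rw [h1.trace_eq hc, ← sum_mul_center hm v]
      exact Finset.sum_congr rfl fun i _ => mul_comm _ _
  obtain ⟨v', hv'⟩ := D.exists_hasRoots hB
  exact ⟨_, ⟨moveRoots_mem_conormal hB.1 hv' v'.2 hu h0, hv'.moveRoots v'.2 hu⟩,
    hXB.add_right (Commute.sum_right _ _ _ fun i _ =>
      ((hv'.isSpecDecomp v'.2).commute_of_commute v'.2 hXB i).smul_right _)⟩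

include D in
/-- A loop in a complex line of the Lie algebra, if the line contains an element that commutes
with a point of the fibre: the homotopy moves the base point of the orbit to that point. -/
theorem pathClass_rayLoop_of_hankel {u : Fin k → ℂ} (hu : Function.Injective u)
    (y₀ : fibre P parts A u) (X : cayleySet P A) (hk : hankel k (X.1.1 * X.1.1) ≠ 0)
    (ζ : Path (0 : ℂ) 0) (h : ∀ s, ζ s • X.1 ∈ cayleySet P A) :
    pathClass ((rayLoop zero_mem_cayleySet X ζ h).map
      ((orbitMap y₀).comp (cayleyMap P A)).continuous) = Path.Homotopic.Quotient.refl _ := by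
  obtain ⟨B, hB, hXB⟩ := D.exists_commute_mem_fibre hu
    (sum_eq_zero_of_hasRoots y₀.2.1 y₀.2.2 hu) X.1.2 hk
  obtain ⟨y, hy⟩ := (D.joinedIn_fibre_diag hu y₀.2).trans (D.joinedIn_fibre_diag hu hB).symm
  have hcomm : ∀ s, Commute B (cayley (ζ s • X.1.1)).val := fun s =>
    commute_cayley (hXB.symm.smul_right _)
  have hone : orbitMap y₀ (cayleyMap P A ⟨0, zero_mem_cayleySet⟩) = y₀ := by
    ext1
    simp [orbitMap_apply, cayleyMap_apply]
  let p : Path (orbitMap y₀ (cayleyMap P A ⟨0, zero_mem_cayleySet⟩)) (⟨B, hB⟩ : fibre P parts A u) :=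
    ⟨⟨fun t => ⟨y t, hy t⟩, by fun_prop⟩, by rw [hone]; exact Subtype.ext y.source,
      Subtype.ext y.target⟩
  -- the loop acts trivially on `B`, so the square joins the given loop to a constant one
  let Q : C(I × I, fibre P parts A u) := ⟨fun z =>
    ⟨(cayley (ζ z.1 • X.1.1)).val * y z.2 * (cayley (ζ z.1 • X.1.1))⁻¹.val,
      conj_mem_fibre (cayleyMap P A ⟨_, h z.1⟩).2 (hy z.2)⟩,
    (continuous_conj (continuousOn_cayley.comp_continuous (by fun_prop) fun z => h z.1)
      (by fun_prop)).subtype_mk _⟩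
  have hQ : ∀ s t, (Q (s, t)).1 =
    (cayley (ζ s • X.1.1)).val * y t * (cayley (ζ s • X.1.1))⁻¹.val := fun _ _ => rfl
  have h1 := pathClass_square ((rayLoop zero_mem_cayleySet X ζ h).map
    ((orbitMap y₀).comp (cayleyMap P A)).continuous) p p (Path.refl _) Q (fun s => by
      ext1
      rw [hQ, y.source]
      rfl) (fun t => by
      ext1
      rw [hQ, ζ.target]
      simp [p]) (fun t => by
      ext1
      rw [hQ, ζ.source]
      simp [p]) (fun s => by
      ext1
      rw [hQ, y.target]
      exact conj_eq_self_of_commute (hcomm s))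
  refine pathClass_trans_cancel_right (pathClass p) ?_
  rw [h1, Path.Homotopic.Quotient.refl_trans]
  exact Path.Homotopic.Quotient.trans_refl _

/-- A loop in any complex line is deformed into a nearby line that is generic in the sense of
`pathClass_rayLoop_of_hankel`. -/
theorem pathClass_rayLoop (hD : D.HasRotations) {u : Fin k → ℂ} (hu : Function.Injective u)
    (y₀ : fibre P parts A u) (X : cayleySet P A)
    (ζ : Path (0 : ℂ) 0) (h : ∀ s, ζ s • X.1 ∈ cayleySet P A) :
    pathClass ((rayLoop zero_mem_cayleySet X ζ h).map
      ((orbitMap y₀).comp (cayleyMap P A)).continuous) = Path.Homotopic.Quotient.refl _ := by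
  obtain ⟨Z, hZ, hZk⟩ := D.exists_hankel_sq_ne_zero hD
  let Y : centralizerLie P A := ⟨Z, hZ⟩ - X.1
  obtain ⟨q, hq⟩ := exists_eval_eq_hankel_sq k X.1.1 Y.1
  have hq0 : q ≠ 0 := by
    rintro rfl
    apply hZk
    have := hq 1
    simpa [Y] using this.symm
  -- a generic line near the given one contains elements whose square has `k` eigenvalues
  have hev : ∀ᶠ c : ℂ in 𝓝 0, ∀ z : I × I,
      ζ z.1 • (X.1 + (((z.2 : ℝ) : ℂ) * c) • Y) ∈ cayleySet P A := by
    have := isCompact_univ.eventually_forall_of_forall_eventually (x₀ := (0 : ℂ))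
      (K := (Set.univ : Set (I × I)))
      (P := fun c z => ζ z.1 • (X.1 + (((z.2 : ℝ) : ℂ) * c) • Y) ∈ cayleySet P A) (by
        intro z _
        have hc : Continuous fun z : ℂ × I × I =>
          ζ z.2.1 • (X.1 + (((z.2.2 : ℝ) : ℂ) * z.1) • Y) := by fun_prop
        refine hc.continuousAt.eventually_mem (isOpen_cayleySet.mem_nhds ?_)
        simpa using h z.1)
    filter_upwards [this] with c hc z using hc z trivial
  have hev1 : ∀ᶠ c : ℂ in 𝓝 0, X.1 + c • Y ∈ cayleySet P A := by
    have hc : Continuous fun c : ℂ => X.1 + c • Y := by fun_prop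
    refine hc.continuousAt.eventually_mem (isOpen_cayleySet.mem_nhds ?_)
    simp
  obtain ⟨c, ⟨hc, hc1⟩, hck⟩ := ((((hev.and hev1).filter_mono nhdsWithin_le_nhds).and
    (eventually_eval_ne_zero hq0 0))).exists
  rw [hq] at hck
  rw [← D.pathClass_rayLoop_of_hankel hu y₀ ⟨_, hc1⟩ hck ζ fun s => by simpa using hc (s, 1)]
  refine pathClass_eq_of_square _ _ (((orbitMap y₀).comp (cayleyMap P A)).comp
    ⟨fun z => ⟨_, hc z⟩, by fun_prop⟩) (fun s => ?_) (fun t => ?_) (fun t => ?_) fun s => ?_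
  · exact congrArg ((orbitMap y₀).comp (cayleyMap P A)) (Subtype.ext (by simp [rayLoop]))
  · exact congrArg ((orbitMap y₀).comp (cayleyMap P A)) (Subtype.ext (by simp))
  · exact congrArg ((orbitMap y₀).comp (cayleyMap P A)) (Subtype.ext (by simp))
  · exact congrArg ((orbitMap y₀).comp (cayleyMap P A)) (Subtype.ext (by simp [rayLoop]))

/-- After the Cayley transform and the orbit map, any two paths in the Lie algebra from `0` to the
same point become homotopic. -/
theorem pathClass_cayleyMap_eq (hD : D.HasRotations) {u : Fin k → ℂ} (hu : Function.Injective u)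
    (y₀ : fibre P parts A u) {x : cayleySet P A}
    (p q : Path (⟨0, zero_mem_cayleySet⟩ : cayleySet P A) x) :
    pathClass (p.map ((orbitMap y₀).comp (cayleyMap P A)).continuous) =
      pathClass (q.map ((orbitMap y₀).comp (cayleyMap P A)).continuous) :=
  pathClass_map_eq_of_rayLoop isOpen_cayleySet zero_mem_cayleySet _
    (fun x => exists_smul_path_mem_cayleyDomain x.2)
    (fun x ζ h => D.pathClass_rayLoop hD hu y₀ x ζ h) p q

end AdaptedData

end CentralizerLoops

/-! ### Loops in the centralizer: general position -/

section GeneralPosition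

variable {ι : Type*} [Fintype ι] [DecidableEq ι] {k : ℕ}

attribute [local instance] Matrix.normedAddCommGroup Matrix.normedSpace

theorem add_smul_mem_ball {E : Type*} [NormedAddCommGroup E] [NormedSpace ℂ E] {x y : E} {r : ℝ}
    (hx : x ∈ Metric.ball 0 r) (hy : y ∈ Metric.ball 0 r) (t : I) :
    x + ((t : ℝ) : ℂ) • (y - x) ∈ Metric.ball 0 r := by
  have h := (convex_ball (0 : E) r) hx hy (sub_nonneg.2 t.2.2) t.2.1 (sub_add_cancel 1 (t : ℝ))
  convert h using 1
  rw [Complex.coe_smul]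
  module

/-- Flat arcs between two points of a ball stay in the ball. -/
theorem norm_add_arc_smul_lt {E : Type*} [NormedAddCommGroup E] [NormedSpace ℂ E] {x y : E} {r : ℝ}
    (hx : ‖x‖ < r) (hy : ‖y‖ < r) :
    ∃ δ > 0, ∀ ε ∈ Set.Ioo 0 δ, ∀ t : I, ‖x + arc ε t • (y - x)‖ < r := by
  let f : ℝ × I → E := fun z => x + arc z.1 z.2 • (y - x)
  have hf : Continuous f := by
    have : Continuous fun z : ℝ × I => arc z.1 z.2 := by
      simp only [arc_apply]
      fun_prop
    fun_prop
  have h := isCompact_univ.eventually_forall_of_forall_eventually (x₀ := (0 : ℝ))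
    (K := (Set.univ : Set I)) (P := fun ε t => ‖x + arc ε t • (y - x)‖ < r) (by
      intro t _
      refine hf.norm.continuousAt.eventually_lt continuousAt_const ?_
      have h1 : x + arc 0 t • (y - x) = (1 - (t : ℝ)) • x + (t : ℝ) • y := by
        rw [arc_apply]
        simp only [zero_mul, Complex.ofReal_zero, mul_zero, add_zero, Complex.coe_smul]
        module
      show ‖x + arc 0 t • (y - x)‖ < r
      rw [h1]
      have hb := (convex_ball (0 : E) r) (mem_ball_zero_iff.2 hx) (mem_ball_zero_iff.2 hy)
        (sub_nonneg.2 t.2.2) t.2.1 (sub_add_cancel 1 (t : ℝ))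
      exact mem_ball_zero_iff.1 hb)
  obtain ⟨δ, hδ, h'⟩ := Metric.eventually_nhds_iff.1 h
  exact ⟨δ, hδ, fun ε hε t => h' (by simpa [abs_of_pos hε.1] using hε.2) t trivial⟩

namespace AdaptedData

variable {P : SymmetricPair ι} {parts : Fin k → ℕ} {A : Matrix ι ι ℂ} (D : AdaptedData P parts A)

theorem cayleyMap_zero : cayleyMap P A ⟨0, zero_mem_cayleySet⟩ = 1 :=
  Subtype.ext (by simp [cayleyMap_apply])

/-- The elements `g` such that `1 + g * cayley X` is invertible for some `X` in the Lie algebra, so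
that the translate of the image of `cayleyMap` by `g` meets the open set `{h | 1 + h invertible}`.
The complement of this set, pulled back to the Lie algebra, is then a proper hypersurface. -/
def Accessible (g : centralizer P A) : Prop :=
  ∃ X : cayleySet P A, (1 + g.1.val * (cayley X.1.1).val).det ≠ 0

/-- On the line through `X`, both `1 + g * cayley Z * cayley (z X)` and `1 + cayley Z * cayley (z X)`
are invertible for generic `z`; in the second case, `cayley Z * cayley (z X)` is itself a Cayley
transform. -/
theorem Accessible.of_mul_cayleyMap {g : centralizer P A} {Z : cayleySet P A}
    (h : Accessible (g * cayleyMap P A Z)) : Accessible g := by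
  obtain ⟨X, hX⟩ := h
  rw [det_one_add_mul_cayley X.2] at hX
  have e : ∀ (M Y : Matrix ι ι ℂ) (z : ℂ), (linePoly (1 + M) (Y - M * Y)).det.eval z =
      ((1 + M) + (z • Y - M * (z • Y))).det := fun M Y z => by
    rw [linePoly_det_eval, mul_smul_comm, smul_sub]
  let q₁ := (linePoly (1 + (g * cayleyMap P A Z).1.val)
    (X.1.1 - (g * cayleyMap P A Z).1.val * X.1.1)).det
  let q₂ := (linePoly (1 + (cayley Z.1.1).val) (X.1.1 - (cayley Z.1.1).val * X.1.1)).det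
  have h1 : q₁ ≠ 0 := by
    intro h0
    have := e (g * cayleyMap P A Z).1.val X.1.1 1
    rw [show (linePoly _ _).det = q₁ from rfl, h0, Polynomial.eval_zero, one_smul] at this
    exact hX this.symm
  have h2 : q₂ ≠ 0 := by
    intro h0
    have := e (cayley Z.1.1).val X.1.1 0
    rw [show (linePoly _ _).det = q₂ from rfl, h0, Polynomial.eval_zero] at this
    simp only [zero_smul, mul_zero, sub_zero, add_zero] at this
    exact det_one_add_cayley_ne_zero Z.2 this.symm
  have hev : ∀ᶠ z : ℂ in 𝓝 0, z • X.1 ∈ cayleySet P A := by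
    have hc : Continuous fun z : ℂ => z • X.1 := by fun_prop
    refine hc.continuousAt.eventually_mem (isOpen_cayleySet.mem_nhds ?_)
    simpa using zero_mem_cayleySet (P := P) (A := A)
  obtain ⟨z, hz, hz1, hz2⟩ := ((hev.filter_mono nhdsWithin_le_nhds).and
    ((eventually_eval_ne_zero h1 0).and (eventually_eval_ne_zero h2 0))).exists
  have hz2' := (det_one_add_mul_cayley (g := (cayley Z.1.1).val) hz).2 (by
    rw [show (z • X.1).1 = z • X.1.1 from rfl, ← e]; exact hz2)
  have hz1' := (det_one_add_mul_cayley (g := (g * cayleyMap P A Z).1.val) hz).2 (by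
    rw [show (z • X.1).1 = z • X.1.1 from rfl, ← e]; exact hz1)
  obtain ⟨Y, -, hY⟩ := exists_cayleyMap_eq (g := cayleyMap P A Z * cayleyMap P A ⟨_, hz⟩) hz2'
  refine ⟨Y, ?_⟩
  have hY' := congrArg (fun h => h.1.val) hY
  simp only [cayleyMap_apply, Subgroup.coe_mul, Units.val_mul] at hY'
  rw [hY', ← mul_assoc]
  exact hz1'

/-- All elements of the identity component of the centralizer are accessible. -/
theorem accessible_path {g : centralizer P A} (γ : Path 1 g) (t : I) : Accessible (γ t) := by
  refine unitInterval_induction (P := fun t => Accessible (γ t)) ?_ (fun t₀ => ?_) t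
  · refine ⟨⟨0, zero_mem_cayleySet⟩, ?_⟩
    rw [γ.source]
    have := det_one_add_cayley_ne_zero (zero_mem_cayleyDomain (ι := ι))
    simpa using this
  · have hc : Continuous fun t => (1 + ((γ t₀)⁻¹ * γ t).1.val).det := by
      have h1 : Continuous fun t => ((γ t₀)⁻¹ * γ t).1.val :=
        Units.continuous_val.comp (continuous_subtype_val.comp (by fun_prop))
      fun_prop
    have hne : (1 + ((γ t₀)⁻¹ * γ t₀).1.val).det ≠ 0 := by
      have := det_one_add_cayley_ne_zero (zero_mem_cayleyDomain (ι := ι))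
      simpa using this
    filter_upwards [(hc.tendsto t₀).eventually_ne hne] with t ht
    obtain ⟨Z, -, hZ⟩ := exists_cayleyMap_eq ht
    have hZ' : (cayleyMap P A Z)⁻¹ = cayleyMap P A ⟨-Z.1, neg_mem_cayleyDomain Z.2⟩ :=
      Subtype.ext (cayley_inv Z.2)
    constructor
    · intro h
      refine Accessible.of_mul_cayleyMap (Z := Z) ?_
      rwa [hZ, mul_inv_cancel_left]
    · intro h
      refine Accessible.of_mul_cayleyMap (Z := ⟨-Z.1, neg_mem_cayleyDomain Z.2⟩) ?_
      rwa [← hZ', hZ, mul_inv_rev, inv_inv, mul_inv_cancel_left]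

/-- Small neighborhoods of `g` in the centralizer: the images of balls in the Lie algebra under
`X ↦ g * cayley X`. They are contractible, and the open set `{h | 1 + h invertible}` is in each of
them the nonempty complement of a hypersurface, hence path connected. -/
theorem exists_nhds_cayleyMap {Z : Type*} [TopologicalSpace Z] (F : C(centralizer P A, Z))
    {g : centralizer P A} (hg : Accessible g) {O : Set (centralizer P A)} (hO : IsOpen O)
    (hgO : g ∈ O) : ∃ N ⊆ O, N ∈ 𝓝 g ∧
      (∀ x ∈ N, ∀ y ∈ N, JoinedIn N x y) ∧
      (∀ (x y : centralizer P A) (p q : Path x y), (∀ t, p t ∈ N) → (∀ t, q t ∈ N) →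
        pathClass (p.map F.continuous) = pathClass (q.map F.continuous)) ∧
      (N ∩ {h | (1 + h.1.val).det ≠ 0}).Nonempty ∧
      ∀ x ∈ N ∩ {h | (1 + h.1.val).det ≠ 0}, ∀ y ∈ N ∩ {h | (1 + h.1.val).det ≠ 0},
        JoinedIn (N ∩ {h | (1 + h.1.val).det ≠ 0}) x y := by
  have hβ : Continuous fun X : cayleySet P A => g * cayleyMap P A X :=
    continuous_const.mul (cayleyMap P A).continuous
  have hopen : IsOpen (Subtype.val '' ((fun X : cayleySet P A => g * cayleyMap P A X) ⁻¹' O)) :=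
    isOpen_cayleySet.isOpenMap_subtype_val _ (hO.preimage hβ)
  obtain ⟨r, hr, hball⟩ := Metric.isOpen_iff.1 hopen 0
    ⟨⟨0, zero_mem_cayleySet⟩, by simpa [cayleyMap_zero] using hgO, rfl⟩
  have hdom : ∀ X ∈ Metric.ball (0 : centralizerLie P A) r, X ∈ cayleySet P A := fun X hX => by
    obtain ⟨Y, -, rfl⟩ := hball hX
    exact Y.2
  obtain ⟨β, hβX⟩ : ∃ β : C(Metric.ball (0 : centralizerLie P A) r, centralizer P A),
      ∀ X, ∃ h, β X = g * cayleyMap P A ⟨X.1, h⟩ :=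
    ⟨⟨fun X => g * cayleyMap P A ⟨X.1, hdom X.1 X.2⟩,
      hβ.comp (Continuous.subtype_mk continuous_subtype_val _)⟩, fun X => ⟨hdom X.1 X.2, rfl⟩⟩
  have hinv : ∀ X, X.1.1 = invCayley (g⁻¹ * β X).1.val := fun X => by
    obtain ⟨h, h'⟩ := hβX X
    rw [h', inv_mul_cancel_left, cayleyMap_apply, invCayley_cayley h]
  have hdet : ∀ X, (1 + (g⁻¹ * β X).1.val).det ≠ 0 := fun X => by
    obtain ⟨h, h'⟩ := hβX X
    rw [h', inv_mul_cancel_left, cayleyMap_apply]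
    exact det_one_add_cayley_ne_zero h
  have hU : ∀ X, (1 + (β X).1.val).det ≠ 0 ↔
      ((1 + g.1.val) + (X.1.1 - g.1.val * X.1.1)).det ≠ 0 := fun X => by
    obtain ⟨h, h'⟩ := hβX X
    rw [h']
    exact det_one_add_mul_cayley (g := g.1.val) h
  have hjoin : ∀ (U : Set (centralizer P A)) (X Y : Metric.ball (0 : centralizerLie P A) r)
      (f : C(I, centralizerLie P A)) (hf : ∀ t, f t ∈ Metric.ball 0 r), f 0 = X.1 → f 1 = Y.1 →
      (∀ t, β ⟨f t, hf t⟩ ∈ U) → JoinedIn U (β X) (β Y) := by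
    intro U X Y f hf h0 h1 hfU
    refine ⟨⟨⟨fun t => β ⟨f t, hf t⟩, β.continuous.comp (f.continuous.subtype_mk hf)⟩, ?_, ?_⟩, hfU⟩
    · exact congrArg β (Subtype.ext h0)
    · exact congrArg β (Subtype.ext h1)
  -- the neighborhood is the range of `β : X ↦ g * cayley X` on a ball
  refine ⟨Set.range β, ?_, ?_, ?_, ?_, ?_, ?_⟩
  · rintro _ ⟨X, rfl⟩
    obtain ⟨Y, hY, hYX⟩ := hball X.2
    obtain ⟨h, h'⟩ := hβX X
    rw [h', show (⟨X.1, h⟩ : cayleySet P A) = Y from Subtype.ext hYX.symm]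
    exact hY
  · have hc : Continuous fun h : centralizer P A => (g⁻¹ * h).1.val :=
      Units.continuous_val.comp (continuous_subtype_val.comp (by fun_prop))
    have h0 : (1 + (g⁻¹ * g).1.val).det ≠ 0 := by
      have := det_one_add_cayley_ne_zero (zero_mem_cayleyDomain (ι := ι))
      simpa using this
    have hc1 : Continuous fun h : centralizer P A => (1 + (g⁻¹ * h).1.val).det := by fun_prop
    have hc2 : ContinuousAt (fun h : centralizer P A => ‖invCayley (g⁻¹ * h).1.val‖) g := by
      refine ContinuousAt.norm (ContinuousAt.comp (f := fun h : centralizer P A => (g⁻¹ * h).1.val)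
        (continuousOn_invCayley.continuousAt (IsOpen.mem_nhds ?_ h0)) hc.continuousAt)
      exact isOpen_ne_fun (by fun_prop) continuous_const
    filter_upwards [(hc1.tendsto g).eventually_ne h0,
      hc2.eventually_lt (continuousAt_const (y := r)) (by simpa [invCayley] using hr)] with h hh hh'
    obtain ⟨X, hX, hXg⟩ := exists_cayleyMap_eq hh
    have hXr : X.1 ∈ Metric.ball (0 : centralizerLie P A) r := by
      rw [mem_ball_zero_iff]
      show ‖X.1.1‖ < r
      rw [hX]
      exact hh'
    obtain ⟨h1, h2⟩ := hβX ⟨X.1, hXr⟩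
    exact ⟨⟨X.1, hXr⟩, by rw [h2, hXg, mul_inv_cancel_left]⟩
  · rintro _ ⟨X, rfl⟩ _ ⟨Y, rfl⟩
    exact hjoin _ X Y ⟨fun t => X.1 + ((t : ℝ) : ℂ) • (Y.1 - X.1), by fun_prop⟩
      (fun t => add_smul_mem_ball X.2 Y.2 t) (by simp) (by simp) fun t => ⟨_, rfl⟩
  · intro x y p q hp hq
    have hlog : ∀ {x y : centralizer P A} (p : Path x y), (∀ t, p t ∈ Set.range β) →
        ∃ f : C(I, Metric.ball (0 : centralizerLie P A) r), ∀ t, p t = β (f t) := by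
      intro x y p hp
      choose X hX using hp
      have hc : Continuous fun t => (g⁻¹ * p t).1.val :=
        Units.continuous_val.comp (continuous_subtype_val.comp (by fun_prop))
      have hcont : Continuous X := by
        refine Continuous.subtype_mk (f := fun t => (X t).1) (Continuous.subtype_mk
          (f := fun t => (X t).1.1) ?_ fun t => (X t).1.2) fun t => (X t).2
        simp only [hinv, hX]
        refine continuousOn_invCayley.comp_continuous hc fun t => ?_
        rw [← hX]
        exact hdet _
      exact ⟨⟨X, hcont⟩, fun t => (hX t).symm⟩
    obtain ⟨f, hf⟩ := hlog p hp
    obtain ⟨f', hf'⟩ := hlog q hq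
    have hβinj : Function.Injective β := fun X Y h =>
      Subtype.ext (Subtype.ext (by rw [hinv, hinv, h]))
    have hends : ∀ s, p s = q s → (f s).1 = (f' s).1 := fun s hs => by
      rw [hβinj (((hf s).symm.trans hs).trans (hf' s))]
    obtain ⟨Q, hQ⟩ : ∃ Q : C(I × I, Metric.ball (0 : centralizerLie P A) r), ∀ z,
        (Q z).1 = (f z.1).1 + ((z.2 : ℝ) : ℂ) • ((f' z.1).1 - (f z.1).1) :=
      ⟨⟨fun z => ⟨(f z.1).1 + ((z.2 : ℝ) : ℂ) • ((f' z.1).1 - (f z.1).1),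
        add_smul_mem_ball (f z.1).2 (f' z.1).2 z.2⟩, Continuous.subtype_mk (by fun_prop) _⟩,
        fun z => rfl⟩
    have hconst : ∀ s t, p s = q s → β (Q (s, t)) = p s := fun s t hs => by
      rw [hf s]
      refine congrArg β (Subtype.ext ?_)
      rw [hQ, ← hends s hs, sub_self, smul_zero, add_zero]
    refine pathClass_eq_of_square _ _ (F.comp (β.comp Q)) (fun s => ?_) (fun t => ?_) (fun t => ?_)
      fun s => ?_
    · refine congrArg F (Eq.trans (congrArg β (Subtype.ext ?_)) (hf s).symm)
      rw [hQ]
      simp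
    · exact congrArg F ((hconst 1 t (by simp)).trans p.target)
    · exact congrArg F ((hconst 0 t (by simp)).trans p.source)
    · refine congrArg F (Eq.trans (congrArg β (Subtype.ext ?_)) (hf' s).symm)
      rw [hQ]
      simp
  · obtain ⟨X, hX⟩ := hg
    rw [det_one_add_mul_cayley X.2] at hX
    have e : ∀ z, (linePoly (1 + g.1.val) (X.1.1 - g.1.val * X.1.1)).det.eval z =
        ((1 + g.1.val) + (z • X.1.1 - g.1.val * (z • X.1.1))).det := fun z => by
      rw [linePoly_det_eval, mul_smul_comm, smul_sub]
    have h1 : (linePoly (1 + g.1.val) (X.1.1 - g.1.val * X.1.1)).det ≠ 0 := by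
      intro h0
      have := e 1
      rw [h0, Polynomial.eval_zero, one_smul] at this
      exact hX this.symm
    have hev : ∀ᶠ z : ℂ in 𝓝 0, ‖z • X.1‖ < r := by
      have hc : Continuous fun z : ℂ => ‖z • X.1‖ := by fun_prop
      exact hc.continuousAt.eventually_lt continuousAt_const (by simpa using hr)
    obtain ⟨z, hz, hz1⟩ := ((hev.filter_mono nhdsWithin_le_nhds).and
      (eventually_eval_ne_zero h1 0)).exists
    rw [e] at hz1
    exact ⟨β ⟨z • X.1, mem_ball_zero_iff.2 hz⟩, ⟨_, rfl⟩, (hU _).2 hz1⟩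
  · rintro _ ⟨⟨X, rfl⟩, hXU⟩ _ ⟨⟨Y, rfl⟩, hYU⟩
    have hXU' := (hU X).1 hXU
    have hYU' := (hU Y).1 hYU
    obtain ⟨δ, hδ, hb⟩ := norm_add_arc_smul_lt (mem_ball_zero_iff.1 X.2) (mem_ball_zero_iff.1 Y.2)
    have e : ∀ z, (linePoly ((1 + g.1.val) + (X.1.1 - g.1.val * X.1.1))
        ((Y.1 - X.1).1 - g.1.val * (Y.1 - X.1).1)).det.eval z =
        ((1 + g.1.val) + ((X.1 + z • (Y.1 - X.1)).1 - g.1.val * (X.1 + z • (Y.1 - X.1)).1)).det :=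
      fun z => by
        rw [linePoly_det_eval]
        congr 1
        generalize Y.1 - X.1 = W
        simp only [Submodule.coe_add, Submodule.coe_smul, mul_add, mul_smul_comm, smul_sub]
        abel
    obtain ⟨ε, hε, hne⟩ := exists_arc_eval_ne_zero (p := (linePoly ((1 + g.1.val) +
      (X.1.1 - g.1.val * X.1.1)) ((Y.1 - X.1).1 - g.1.val * (Y.1 - X.1).1)).det)
      (by rw [e]; simpa using hXU') (by rw [e]; simpa using hYU') hδ
    have harc : Continuous fun t : I => X.1 + arc ε t • (Y.1 - X.1) := by
      simp only [arc_apply]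
      fun_prop
    refine hjoin _ X Y ⟨_, harc⟩ (fun t => mem_ball_zero_iff.2 (hb ε hε t)) (by simp) (by simp)
      fun t => ⟨⟨_, rfl⟩, (hU _).2 ?_⟩
    have := hne t
    rwa [e] at this

/-- The orbit map kills the fundamental group of the centralizer: by general position a loop can be
moved into the image of the Cayley transform, where it comes from the Lie algebra. -/
theorem pathClass_orbitMap_eq_refl (hD : D.HasRotations) {u : Fin k → ℂ}
    (hu : Function.Injective u) (y₀ : fibre P parts A u) (γ : Path (1 : centralizer P A) 1) :
    pathClass (γ.map (orbitMap y₀).continuous) = Path.Homotopic.Quotient.refl _ := by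
  have h1U : ∀ X : cayleySet P A, (1 + (cayleyMap P A X).1.val).det ≠ 0 := fun X =>
    det_one_add_cayley_ne_zero X.2
  -- a path of elements `h` with `1 + h` invertible is the Cayley transform of a path in the Lie
  -- algebra
  have hlift : ∀ {x : cayleySet P A} (p : Path (cayleyMap P A ⟨0, zero_mem_cayleySet⟩)
      (cayleyMap P A x)), (∀ t, (1 + (p t).1.val).det ≠ 0) →
      ∃ p' : Path (⟨0, zero_mem_cayleySet⟩ : cayleySet P A) x,
        p = p'.map (cayleyMap P A).continuous := by
    intro x p hp
    have hX := fun t => exists_cayleyMap_eq (hp t)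
    choose X hX hXp using hX
    have hXi : ∀ t, ∀ Y : cayleySet P A, p t = cayleyMap P A Y → X t = Y := by
      intro t Y h
      refine Subtype.ext (Subtype.ext ?_)
      rw [hX, h, cayleyMap_apply, invCayley_cayley Y.2]
    have hcont : Continuous X := by
      refine Continuous.subtype_mk (f := fun t => (X t).1) (Continuous.subtype_mk
        (f := fun t => (X t).1.1) ?_ fun t => (X t).1.2) fun t => (X t).2
      simp only [hX]
      exact continuousOn_invCayley.comp_continuous
        (Units.continuous_val.comp (continuous_subtype_val.comp p.continuous)) hp
    refine ⟨⟨⟨X, hcont⟩, hXi 0 _ p.source, hXi 1 _ p.target⟩, ?_⟩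
    ext1
    funext t
    exact (hXp t).symm
  have key : ∀ (x : centralizer P A) (hx : x = 1) (hx' : x = cayleyMap P A ⟨0, zero_mem_cayleySet⟩)
      (γ : Path x x), pathClass (γ.map (orbitMap y₀).continuous) =
        Path.Homotopic.Quotient.refl _ := by
    rintro x hx rfl γ
    refine pathClass_map_eq_of_generalPosition (orbitMap y₀) {h | (1 + h.1.val).det ≠ 0} γ
      (h1U _) (h1U _) (fun t O hO ht => ?_) (fun y p q hp hq => ?_) (fun y hy => ?_)
      (Path.refl _) fun t => h1U _
    · exact exists_nhds_cayleyMap (orbitMap y₀) (accessible_path (γ.cast hx.symm rfl) t) hO ht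
    · have hy : (1 + y.1.val).det ≠ 0 := by simpa using hp 1
      obtain ⟨Y, -, rfl⟩ := exists_cayleyMap_eq hy
      obtain ⟨p', rfl⟩ := hlift p hp
      obtain ⟨q', rfl⟩ := hlift q hq
      exact D.pathClass_cayleyMap_eq hD hu y₀ p' q'
    · obtain ⟨Y, -, rfl⟩ := exists_cayleyMap_eq hy
      obtain ⟨ζ, hζ⟩ := exists_smul_path_mem_cayleyDomain Y.2
      exact ⟨(rayPath zero_mem_cayleySet Y ζ hζ).map (cayleyMap P A).continuous, fun t => h1U _⟩
  exact key 1 rfl cayleyMap_zero.symm γ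

end AdaptedData

end GeneralPosition

/-! ### Simple connectedness of the fibres -/

section Stabilizer

variable {ι : Type*} [Fintype ι] [DecidableEq ι] {k : ℕ}

namespace AdaptedData

variable {P : SymmetricPair ι} {parts : Fin k → ℕ} {A : Matrix ι ι ℂ} (D : AdaptedData P parts A)

include D in
/-- A block with the index `i` cannot be split any further by self-adjoint idempotents that
commute with `A`. -/
theorem mul_e_eq_zero_or {f : Matrix ι ι ℂ} (hf : f ∈ P.S) (hff : f * f = f) (hAf : Commute A f)
    {i : Fin k} (hfe : Commute f (D.e i)) : f * D.e i = 0 ∨ f * D.e i = D.e i := by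
  by_contra! h
  have hee : D.e i * D.e i = D.e i := by simpa using D.mul_eq i i
  have hfee : f * D.e i * D.e i = f * D.e i := by rw [mul_assoc, hee]
  have hffe : f * (f * D.e i) = f * D.e i := by rw [← mul_assoc, hff]
  have hefe : D.e i * (f * D.e i) = f * D.e i := by rw [hfe.eq, ← mul_assoc, hee]
  have hfefe : f * D.e i * (f * D.e i) = f * D.e i := by rw [mul_assoc, hefe, hffe]
  have hmem : f * D.e i ∈ P.S := P.mul_mem hf (D.e_mem i) hfe
  have hne : ∀ j, j ≠ i → D.e j * (f * D.e i) = 0 ∧ f * D.e i * D.e j = 0 := fun j hj => by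
    constructor
    · rw [hfe.eq, ← mul_assoc, D.mul_eq, if_neg hj, zero_mul]
    · rw [mul_assoc, D.mul_eq, if_neg hj.symm, mul_zero]
  have h1 := P.mul_le_finrank_ker (m := k + 1)
    (e := Fin.cons (f * D.e i) fun j => if j = i then D.e i - f * D.e i else D.e j)
    D.mem D.nilpotent (fun j => ?_) (fun a b => ?_) (fun j => ?_) fun j => ?_
  · have h2 := h1.trans D.finrank_ker
    rw [mul_comm] at h2
    exact absurd (Nat.le_of_mul_le_mul_left h2 P.d_pos) (by omega)
  · refine Fin.cases hmem (fun j => ?_) j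
    rw [Fin.cons_succ]
    split_ifs
    · exact P.S.sub_mem (D.e_mem i) hmem
    · exact D.e_mem j
  · refine Fin.cases ?_ (fun a => ?_) a <;> refine Fin.cases ?_ (fun b => ?_) b
    · simpa using hfefe
    · rw [Fin.cons_zero, Fin.cons_succ, if_neg (Fin.succ_ne_zero b).symm]
      split_ifs with hb
      · rw [mul_sub, hfefe, hfee, sub_self]
      · exact (hne b hb).2
    · rw [Fin.cons_zero, Fin.cons_succ, if_neg (Fin.succ_ne_zero a)]
      split_ifs with ha
      · rw [sub_mul, hfefe, hefe, sub_self]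
      · exact (hne a ha).1
    · simp only [Fin.cons_succ, Fin.succ_inj]
      by_cases ha : a = i <;> by_cases hb : b = i
      · simp [ha, hb, sub_mul, mul_sub, hee, hfee, hefe, hfefe]
      · simp [ha, hb, Ne.symm hb, sub_mul, D.mul_eq, (hne b hb).2]
      · simp [ha, hb, mul_sub, D.mul_eq, (hne a ha).1]
      · simp [ha, hb, D.mul_eq]
  · refine Fin.cases (hAf.mul_right (D.e_comm i)) (fun j => ?_) j
    rw [Fin.cons_succ]
    split_ifs
    · exact (D.e_comm i).sub_right (hAf.mul_right (D.e_comm i))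
    · exact D.e_comm j
  · refine Fin.cases h.1 (fun j => ?_) j
    rw [Fin.cons_succ]
    split_ifs
    · exact sub_ne_zero.2 h.2.symm
    · intro h0
      have h3 := D.rank_e j
      rw [h0, Matrix.rank_zero] at h3
      exact (Nat.mul_pos P.d_pos (D.pos j)).ne h3

/-- On each block, a self-adjoint matrix that commutes with `A` and preserves the blocks has only
one eigenvalue. -/
theorem exists_pow_mul_e_eq_zero {a : Matrix ι ι ℂ} (ha : a ∈ P.S) (hAa : Commute A a)
    (hae : ∀ i, Commute a (D.e i)) (i : Fin k) :
    ∃ z : ℂ, (a - z • 1) ^ Fintype.card ι * D.e i = 0 := by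
  obtain ⟨u, m, hu, -, h⟩ := exists_hasRoots_of_ncard (B := a) rfl
  have hd := h.isSpecDecomp hu
  have hor := fun j => D.mul_e_eq_zero_or (P.specIdem_mem ha u j) (hd.idem j)
    (hd.commute_of_commute hu hAa j) (hd.commute_of_commute hu (hae i).symm j).symm
  by_cases hex : ∃ j, specIdem u a j * D.e i = D.e i
  · obtain ⟨j, hj⟩ := hex
    exact ⟨u j, by rw [← hj, ← mul_assoc, hd.nil, zero_mul]⟩
  · have h0 : D.e i = 0 := by
      rw [← one_mul (D.e i), ← hd.sum_eq, Finset.sum_mul]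
      exact Finset.sum_eq_zero fun j _ => (hor j).resolve_right fun h' => hex ⟨j, h'⟩
    exact ⟨0, by rw [h0, mul_zero]⟩

variable (P A) in
/-- The elements of the centralizer that commute with `y`. -/
def stabilizer (y : Matrix ι ι ℂ) : Set (centralizer P A) := {g | Commute y g.1.val}

theorem joinedIn_stabilizer_mul {y : Matrix ι ι ℂ} {g h : centralizer P A}
    (hg : JoinedIn (stabilizer P A y) 1 g) (hh : JoinedIn (stabilizer P A y) 1 h) :
    JoinedIn (stabilizer P A y) 1 (g * h) := by
  obtain ⟨p, hp⟩ := hg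
  obtain ⟨q, hq⟩ := hh
  refine ⟨⟨⟨fun t => p t * q t, p.continuous.mul q.continuous⟩, by simp, by simp⟩, fun t => ?_⟩
  exact (hp t).mul_right (hq t)

/-- The Cayley transform of a multiple of `X` commutes with everything that `X` commutes with. -/
theorem joinedIn_stabilizer_cayleyMap {y : Matrix ι ι ℂ} (X : cayleySet P A)
    (hX : Commute y X.1.1) : JoinedIn (stabilizer P A y) 1 (cayleyMap P A X) := by
  obtain ⟨ζ, hζ⟩ := exists_smul_path_mem_cayleyDomain X.2
  have hmem : ∀ s, ζ s • X.1 ∈ cayleySet P A := hζ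
  refine ⟨⟨⟨fun s => cayleyMap P A ⟨ζ s • X.1, hmem s⟩,
    (cayleyMap P A).continuous.comp (Continuous.subtype_mk (by fun_prop) hmem)⟩, ?_, ?_⟩,
    fun s => ?_⟩
  · refine Eq.trans (congrArg (cayleyMap P A) (Subtype.ext ?_)) cayleyMap_zero
    show ζ 0 • X.1 = 0
    rw [ζ.source, zero_smul]
  · refine congrArg (cayleyMap P A) (Subtype.ext ?_)
    show ζ 1 • X.1 = X.1
    rw [ζ.target, one_smul]
  · show Commute y (cayleyMap P A ⟨ζ s • X.1, hmem s⟩).1.val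
    rw [cayleyMap_apply]
    exact commute_cayley (hX.smul_right _)

/-- The reflection in the `i`-th block is the square of `cayley J`, where `J` is a rotation of the
block, and so it is joined to `1`. -/
theorem exists_joinedIn_stabilizer_sign (hD : D.HasRotations) (u : Fin k → ℂ)
    (s : Finset (Fin k)) : ∃ g : centralizer P A, g.1.val = 1 - (2 : ℂ) • ∑ i ∈ s, D.e i ∧
      JoinedIn (stabilizer P A (D.diag u)) 1 g := by
  induction s using Finset.induction_on with
  | empty => exact ⟨1, by simp, JoinedIn.refl (Commute.one_right _)⟩
  | insert i s hi ih =>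
    obtain ⟨g, hg, hj⟩ := ih
    obtain ⟨J, hJ, hAJ, heJ, hJe, hJJ⟩ := hD i
    have hee : D.e i * D.e i = D.e i := by simpa using D.mul_eq i i
    have hdom : J ∈ cayleyDomain ι := by
      simpa using smul_mem_cayleyDomain hJJ hee (s := 1) (by norm_num)
    let X : cayleySet P A := ⟨⟨J, hJ, hAJ⟩, hdom⟩
    have hc : (cayley J).val = 1 - D.e i - J := by
      have h1 : (1 + J) * (1 - D.e i - J) = 1 - J := by
        simp only [add_mul, mul_sub, one_mul, mul_one, hJe, hJJ]
        abel
      refine ((Matrix.isUnit_iff_isUnit_det _).2 (isUnit_iff_ne_zero.2 hdom.1)).mul_left_cancel ?_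
      rw [h1, one_add_mul_cayley hdom]
    have hy : Commute (D.diag u) J := by
      refine Commute.sum_left _ _ _ fun j _ => Commute.smul_left ?_ _
      by_cases h : j = i
      · subst h
        rw [commute_iff_eq, heJ, hJe]
      · rw [commute_iff_eq, ← heJ, ← mul_assoc, D.mul_eq, if_neg h, zero_mul, heJ, ← hJe,
          mul_assoc, D.mul_eq, if_neg (Ne.symm h), mul_zero]
    refine ⟨cayleyMap P A X * cayleyMap P A X * g, ?_, joinedIn_stabilizer_mul
      (joinedIn_stabilizer_mul (joinedIn_stabilizer_cayleyMap X hy)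
        (joinedIn_stabilizer_cayleyMap X hy)) hj⟩
    have h0 : D.e i * ∑ j ∈ s, D.e j = 0 := by
      rw [Finset.mul_sum]
      refine Finset.sum_eq_zero fun j hj => ?_
      rw [D.mul_eq, if_neg]
      rintro rfl
      exact hi hj
    have h2 : (1 - D.e i - J) * (1 - D.e i - J) = 1 - (2 : ℂ) • D.e i := by
      simp only [sub_mul, mul_sub, one_mul, mul_one, hJe, hJJ, heJ, hee]
      module
    rw [Subgroup.coe_mul, Subgroup.coe_mul, Units.val_mul, Units.val_mul, cayleyMap_apply,
      show X.1.1 = J from rfl, hc, h2, hg, Finset.sum_insert hi]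
    simp only [sub_mul, mul_sub, one_mul, mul_one, smul_mul_assoc, mul_smul_comm, h0]
    module

/-- The stabilizer of `D.diag u` in the centralizer is connected. After multiplication by a sign
matrix, which is joined to `1`, an element of the stabilizer is a Cayley transform. -/
theorem joinedIn_stabilizer (hD : D.HasRotations) {u : Fin k → ℂ} (hu : Function.Injective u)
    {h : centralizer P A} (hh : h ∈ stabilizer P A (D.diag u)) :
    JoinedIn (stabilizer P A (D.diag u)) 1 h := by
  classical
  have hhe : ∀ i, Commute h.1.val (D.e i) := fun i =>
    (D.isSpecDecomp_diag u).commute_of_commute hu hh.symm i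
  set a := h.1.val + h.1⁻¹.val with ha
  have haS : a ∈ P.S := P.add_inv_mem h.2.1
  have hAa : Commute A a := h.2.2.add_right (commute_units_inv h.2.2)
  have hae : ∀ i, Commute a (D.e i) := fun i =>
    (hhe i).add_left (commute_units_inv (hhe i).symm).symm
  choose z hz using D.exists_pow_mul_e_eq_zero haS hAa hae
  -- the signs are chosen such that `-2` is no eigenvalue of `R * a`
  let s := Finset.univ.filter fun i => z i = -2
  obtain ⟨R, hR, hRj⟩ := D.exists_joinedIn_stabilizer_sign hD u s
  let ε : Fin k → ℂ := fun i => if i ∈ s then -1 else 1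
  have hε2 : ∀ i, ε i * ε i = 1 := fun i => by simp only [ε]; split_ifs <;> norm_num
  have hεz : ∀ i, -2 * ε i - z i ≠ 0 := fun i => by
    by_cases hi : z i = -2
    · have : ε i = -1 := if_pos (Finset.mem_filter.2 ⟨Finset.mem_univ i, hi⟩)
      rw [this, hi]
      norm_num
    · have : ε i = 1 := if_neg fun h' : i ∈ s => hi (Finset.mem_filter.1 h').2
      rw [this]
      intro h0
      exact hi (by linear_combination -h0)
  have hRe : ∀ i, R.1.val * D.e i = ε i • D.e i := fun i => by
    rw [hR, sub_mul, one_mul, smul_mul_assoc, Finset.sum_mul]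
    simp only [D.mul_eq, Finset.sum_ite_eq', ε]
    split_ifs <;> module
  have hRsum : R.1.val = ∑ i, ε i • D.e i := by
    rw [← mul_one R.1.val, ← D.sum_eq, Finset.mul_sum]
    exact Finset.sum_congr rfl fun i _ => hRe i
  have hRR : R.1.val * R.1.val = 1 := by
    rw [hRsum, ← D.sum_eq, Finset.sum_mul_sum]
    refine Finset.sum_congr rfl fun i _ => ?_
    rw [Finset.sum_eq_single i]
    · rw [smul_mul_smul_comm, hε2, one_smul, D.mul_eq, if_pos rfl]
    · intro j _ hj
      rw [smul_mul_smul_comm, D.mul_eq, if_neg hj.symm, smul_zero]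
    · simp
  have hhR : Commute h.1.val R.1.val := by
    rw [hRsum]
    exact Commute.sum_right _ _ _ fun i _ => (hhe i).smul_right _
  -- on the `i`-th block, `a` has the only eigenvalue `z i` and `R` is the sign `ε i`
  have hdet : ((2 : ℂ) • 1 + R.1.val * a).det ≠ 0 := by
    intro h0
    obtain ⟨x, hx, hx0⟩ := Matrix.exists_mulVec_eq_zero_iff.2 h0
    refine hx ?_
    rw [← Matrix.one_mulVec x, ← D.sum_eq, Matrix.sum_mulVec]
    refine Finset.sum_eq_zero fun i _ => ?_
    have h1 : (a - z i • 1).mulVec ((D.e i).mulVec x) = (-2 * ε i - z i) • (D.e i).mulVec x := by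
      have h2 : ε i • D.e i * ((2 : ℂ) • 1 + R.1.val * a) = (2 * ε i) • D.e i + a * D.e i := by
        have h3 : D.e i * R.1.val = ε i • D.e i := by
          rw [← hRe, hRsum, Finset.mul_sum, Finset.sum_mul]
          refine Finset.sum_congr rfl fun j _ => ?_
          rw [mul_smul_comm, smul_mul_assoc, D.mul_eq, D.mul_eq]
          by_cases hij : i = j
          · simp [hij]
          · simp [hij, Ne.symm hij]
        rw [smul_mul_assoc, mul_add, ← mul_assoc, h3, smul_mul_assoc, smul_add, smul_smul, hε2,
          one_smul, (hae i).eq, mul_smul_comm, mul_one, smul_smul, mul_comm (ε i)]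
      have h4 := congrArg (fun M => M.mulVec x) h2
      simp only [← Matrix.mulVec_mulVec, hx0, Matrix.mulVec_zero, Matrix.add_mulVec,
        Matrix.smul_mulVec] at h4
      rw [Matrix.sub_mulVec, Matrix.smul_mulVec, Matrix.one_mulVec,
        eq_neg_of_add_eq_zero_right h4.symm]
      module
    have h5 : ∀ n : ℕ, ((a - z i • 1) ^ n).mulVec ((D.e i).mulVec x) =
        (-2 * ε i - z i) ^ n • (D.e i).mulVec x := by
      intro n
      induction n with
      | zero => simp
      | succ n ih => rw [pow_succ', ← Matrix.mulVec_mulVec, ih, Matrix.mulVec_smul, h1, smul_smul,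
          pow_succ]
    have h6 := h5 (Fintype.card ι)
    rw [Matrix.mulVec_mulVec, hz, Matrix.zero_mulVec] at h6
    exact (smul_eq_zero.1 h6.symm).resolve_left (pow_ne_zero _ (hεz i))
  -- since `R² = 1`, the matrix `2 + R a` is a multiple of `1 + R h`
  have hdet' : (1 + (R * h).1.val).det ≠ 0 := by
    have h1 : R.1.val * (1 + (R * h).1.val) * (R.1.val + h.1⁻¹.val) =
        (2 : ℂ) • 1 + R.1.val * a := by
      have h2 : R.1.val * (1 + (R * h).1.val) = R.1.val + h.1.val := by
        rw [Subgroup.coe_mul, Units.val_mul, mul_add, mul_one, ← mul_assoc, hRR, one_mul]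
      rw [h2, add_mul, mul_add, mul_add, hRR, Units.mul_inv, hhR.eq, ha, mul_add]
      module
    intro h0
    rw [← h1, Matrix.det_mul, Matrix.det_mul, h0, mul_zero, zero_mul] at hdet
    exact hdet rfl
  obtain ⟨X, hX, hXR⟩ := exists_cayleyMap_eq hdet'
  have hyR : Commute (D.diag u) R.1.val := by
    have := hRj.target_mem
    exact this
  have hj := joinedIn_stabilizer_cayleyMap (y := D.diag u) X (by
    rw [hX]
    exact commute_invCayley (hyR.mul_right hh))
  rw [hXR] at hj
  have hR1 : R * (R * h) = h := by
    rw [← mul_assoc, show R * R = 1 from Subtype.ext (Units.ext hRR), one_mul]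
  rw [← hR1]
  exact joinedIn_stabilizer_mul hRj hj

/-- A loop of semisimple elements is the image of a path in the centralizer, which ends in the
connected stabilizer and can be closed up there. The orbit map kills the resulting loop. -/
theorem pathClass_eq_refl_of_semisimple (hD : D.HasRotations) {u : Fin k → ℂ}
    (hu : Function.Injective u) {y : fibre P parts A u} (hy : y.1 = D.diag u) (γ : Path y y)
    (hγ : ∀ t, semisimplePart u (γ t).1 = (γ t).1) :
    pathClass γ = Path.Homotopic.Quotient.refl y := by
  obtain ⟨h, p, hh, hp⟩ := exists_orbitMap_pathClass hu D.mem γ hγ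
  have hst : h ∈ stabilizer P A (D.diag u) := by
    have h1 := congrArg Subtype.val hh
    rw [orbitMap_apply, Units.mul_inv_eq_iff_eq_mul, hy] at h1
    exact h1.symm
  obtain ⟨l, hl⟩ := D.joinedIn_stabilizer hD hu hst
  have hl' : ∀ t, orbitMap y (l t) = y := fun t => by
    refine Subtype.ext ?_
    rw [orbitMap_apply]
    exact conj_eq_self_of_commute (by rw [hy]; exact hl t)
  have hl0 : pathClass (l.map (orbitMap y).continuous) =
      (Path.Homotopic.Quotient.refl y).cast (orbitMap_one y) hh := by
    congr 1
    ext1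
    funext t
    exact hl' t
  have h1 := D.pathClass_orbitMap_eq_refl hD hu y (p.trans l.symm)
  have h2 : pathClass (p.map (orbitMap y).continuous) =
      pathClass (l.map (orbitMap y).continuous) := by
    rw [Path.map_trans, pathClass_trans] at h1
    refine pathClass_trans_cancel_right (pathClass (l.symm.map (orbitMap y).continuous)) ?_
    rw [h1, ← pathClass_trans, ← Path.map_trans]
    have h3 := D.pathClass_orbitMap_eq_refl hD hu y (l.trans l.symm)
    exact h3.symm
  rw [← hp]
  have h4 : (pathClass (p.map (orbitMap y).continuous)).cast (orbitMap_one y).symm hh.symm =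
      Path.Homotopic.Quotient.refl y := by
    rw [h2, hl0]
    rfl
  exact h4

/-- The nilpotent part of an element of a fibre can be scaled by any `c`; for `c = 0` this is a
retraction to the semisimple elements. -/
theorem scale_mem_fibre {u : Fin k → ℂ} (hu : Function.Injective u) {B : Matrix ι ι ℂ}
    (hB : B ∈ fibre P parts A u) (c : ℂ) :
    semisimplePart u B + c • (B - semisimplePart u B) ∈ fibre P parts A u := by
  have hd := hB.2.isSpecDecomp hu
  have h1 : HasRoots (semisimplePart u B + c • (B - semisimplePart u B)) u
      fun i => P.d * parts i := by
    have h2 := (hd.scale c).hasRoots hu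
    have h3 : ∀ i, (specIdem u B i).rank = P.d * parts i := fun i => by
      rw [← hd.rootMultiplicity_eq hu, hB.2.rootMultiplicity_eq hu]
    simp only [h3] at h2
    exact h2
  have hS : semisimplePart u B ∈ P.S :=
    P.S.sum_mem fun i _ => P.S.smul_mem _ (P.specIdem_mem hB.1.1 u i)
  have hA : Commute A (semisimplePart u B) :=
    Commute.sum_right _ _ _ fun i _ => (hd.commute_of_commute hu hB.1.2.1 i).smul_right _
  exact ⟨mem_conormal_of_hasRoots (P.S.add_mem hS (P.S.smul_mem _ (P.S.sub_mem hB.1.1 hS)))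
    (hA.add_right ((hB.1.2.1.sub_right hA).smul_right _)) h1 hu
    (sum_eq_zero_of_hasRoots hB.1 hB.2 hu), h1⟩

theorem specIdem_scale {u : Fin k → ℂ} (hu : Function.Injective u) {B : Matrix ι ι ℂ}
    (hB : B ∈ fibre P parts A u) (c : ℂ) (i : Fin k) :
    specIdem u (semisimplePart u B + c • (B - semisimplePart u B)) i = specIdem u B i :=
  ((hB.2.isSpecDecomp hu).scale c).specIdem_eq hu i

theorem semisimplePart_scale {u : Fin k → ℂ} (hu : Function.Injective u) {B : Matrix ι ι ℂ}
    (hB : B ∈ fibre P parts A u) (c : ℂ) :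
    semisimplePart u (semisimplePart u B + c • (B - semisimplePart u B)) = semisimplePart u B :=
  Finset.sum_congr rfl fun i _ => by rw [specIdem_scale hu hB]

theorem semisimplePart_diag {u : Fin k → ℂ} (hu : Function.Injective u) :
    semisimplePart u (D.diag u) = D.diag u :=
  Finset.sum_congr rfl fun i _ => by rw [(D.isSpecDecomp_diag u).specIdem_eq hu]

/-- If all blocks admit rotations, then a loop in a fibre that is based at `D.diag u` is
null-homotopic: it is deformed into a loop of semisimple elements. -/
theorem pathClass_eq_refl_of_diag (hD : D.HasRotations) {u : Fin k → ℂ}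
    (hu : Function.Injective u) {y : fibre P parts A u} (hy : y.1 = D.diag u) (γ : Path y y) :
    pathClass γ = Path.Homotopic.Quotient.refl y := by
  -- the nilpotent parts are scaled down to zero
  let F : I × I → Matrix ι ι ℂ := fun z => semisimplePart u (γ z.1).1 +
    (((unitInterval.symm z.2 : I) : ℝ) : ℂ) • ((γ z.1).1 - semisimplePart u (γ z.1).1)
  have hFc : Continuous F := by
    have h1 : Continuous fun z : I × I => semisimplePart u (γ z.1).1 :=
      (continuous_semisimplePart hu).comp (by fun_prop)
    have h2 : Continuous fun z : I × I => (γ z.1).1 := by fun_prop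
    fun_prop
  have hmem : ∀ z, F z ∈ fibre P parts A u := fun z => scale_mem_fibre hu (γ z.1).2 _
  have hyy : semisimplePart u y.1 = y.1 := by rw [hy, D.semisimplePart_diag hu]
  have hend : ∀ z, γ z.1 = y → F z = y := fun z hz => by
    simp only [F, hz, hyy, sub_self, smul_zero, add_zero]
  let Q : C(I × I, fibre P parts A u) := ⟨fun z => ⟨F z, hmem z⟩, hFc.subtype_mk hmem⟩
  let γ' : Path y y := ⟨⟨fun t => Q (t, 1), by fun_prop⟩,
    Subtype.ext (hend (0, 1) γ.source), Subtype.ext (hend (1, 1) γ.target)⟩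
  have h1 : pathClass γ = pathClass γ' := by
    refine pathClass_eq_of_square γ γ' Q (fun s => Subtype.ext ?_)
      (fun t => Subtype.ext (hend (1, t) γ.target)) (fun t => Subtype.ext (hend (0, t) γ.source))
      fun s => rfl
    show F (s, 0) = (γ s).1
    simp [F]
  rw [h1]
  refine D.pathClass_eq_refl_of_semisimple hD hu hy γ' fun t => ?_
  show semisimplePart u (F (t, 1)) = F (t, 1)
  rw [semisimplePart_scale hu (γ t).2]
  simp [F]

/-- Since the fibres are path connected, the choice of the base point `D.diag u` is no restriction. -/
theorem bijective_map_spectrumMap (hD : D.HasRotations) (ξ : P.distinct A k) :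
    Function.Bijective (FundamentalGroup.map D.spectrumMap ξ) := by
  refine ⟨D.injective_map_spectrumMap (fun u hu B γ => ?_) ξ, D.surjective_map_spectrumMap ξ⟩
  obtain ⟨q⟩ := (D.joinedIn_fibre_diag hu B.2).joined_subtype
  have h1 := D.pathClass_eq_refl_of_diag hD hu rfl (q.symm.trans (γ.trans q))
  have h2 := D.pathClass_eq_refl_of_diag hD hu rfl (q.symm.trans q)
  rw [← h2, pathClass_trans, pathClass_trans] at h1
  have h3 := congrArg (fun c => (pathClass q).trans c) h1
  simp only [pathClass_trans, ← Path.Homotopic.Quotient.trans_assoc] at h3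
  have h4 : (pathClass q).trans (pathClass q.symm) = Path.Homotopic.Quotient.refl _ := by
    exact Path.Homotopic.Quotient.trans_symm (pathClass q)
  rw [h4, Path.Homotopic.Quotient.refl_trans, Path.Homotopic.Quotient.refl_trans] at h3
  refine pathClass_trans_cancel_right (pathClass q) ?_
  rw [h3, Path.Homotopic.Quotient.refl_trans]

end AdaptedData

end Stabilizer

/-! ### Parametrizations and smooth points -/

section Smooth

/-- A set that is locally the image of a holomorphic immersion, in the strong sense that points of
the set near `p` have preimages near `x₀`, is smooth at `p`. -/
theorem isSmoothPoint_of_parametrization {U E : Type*} [NormedAddCommGroup U] [NormedSpace ℂ U]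
    [FiniteDimensional ℂ U] [NormedAddCommGroup E] [NormedSpace ℂ E] [FiniteDimensional ℂ E]
    {Z : Set E} {φ : U → E} {x₀ : U} (hφ : AnalyticAt ℂ φ x₀)
    (hinj : Function.Injective (fderiv ℂ φ x₀)) (hZ : ∀ᶠ x in 𝓝 x₀, φ x ∈ Z)
    (hsurj : ∀ W ∈ 𝓝 x₀, ∀ᶠ q in 𝓝 (φ x₀), q ∈ Z → ∃ x ∈ W, φ x = q) :
    IsSmoothPoint Z (φ x₀) := by
  have : CompleteSpace U := FiniteDimensional.complete ℂ U
  have : CompleteSpace E := FiniteDimensional.complete ℂ E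
  let L : U →ₗ[ℂ] E := (fderiv ℂ φ x₀).toLinearMap
  -- extend `φ` to a local diffeomorphism by adding a complement `W` of the tangent space; the
  -- equations of `Z` are then the `W`-coordinates of the inverse
  obtain ⟨W, hW⟩ := (LinearMap.range L).exists_isCompl
  let Φ : U × W → E := fun z => φ z.1 + z.2
  have hΦ : AnalyticAt ℂ Φ (x₀, 0) :=
    (AnalyticAt.comp (g := φ) (f := Prod.fst) hφ analyticAt_fst).add
      ((W.subtypeL.comp (ContinuousLinearMap.snd ℂ U W)).analyticAt _)
  have hder : fderiv ℂ Φ (x₀, 0) = (fderiv ℂ φ x₀).comp (ContinuousLinearMap.fst ℂ U W) +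
      W.subtypeL.comp (ContinuousLinearMap.snd ℂ U W) := by
    have h1 : HasFDerivAt (fun z : U × W => φ z.1)
        ((fderiv ℂ φ x₀).comp (ContinuousLinearMap.fst ℂ U W)) (x₀, 0) :=
      HasFDerivAt.comp (x₀, (0 : W)) (f := Prod.fst) hφ.differentiableAt.hasFDerivAt hasFDerivAt_fst
    exact (h1.add (W.subtypeL.comp (ContinuousLinearMap.snd ℂ U W)).hasFDerivAt).fderiv
  have hbij : Function.Bijective (fderiv ℂ Φ (x₀, 0)) := by
    rw [hder]
    constructor
    · rw [injective_iff_map_eq_zero]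
      rintro ⟨x, w⟩ h
      have h1 : L x + w.1 = 0 := h
      have h2 : w.1 ∈ LinearMap.range L ⊓ W :=
        ⟨⟨-x, by rw [map_neg]; exact neg_eq_of_add_eq_zero_right h1⟩, w.2⟩
      rw [hW.inf_eq_bot, Submodule.mem_bot] at h2
      rw [h2, add_zero] at h1
      have h3 : x = 0 := hinj (by rw [map_zero]; exact h1)
      exact Prod.ext h3 (Subtype.ext h2)
    · intro y
      have hy : y ∈ LinearMap.range L ⊔ W := by rw [hW.sup_eq_top]; trivial
      obtain ⟨_, ⟨x, rfl⟩, w, hw, rfl⟩ := Submodule.mem_sup.1 hy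
      exact ⟨(x, ⟨w, hw⟩), rfl⟩
  let e : (U × W) ≃L[ℂ] E := (LinearEquiv.ofBijective
    (fderiv ℂ Φ (x₀, 0)).toLinearMap hbij).toContinuousLinearEquiv
  have he : fderiv ℂ Φ (x₀, 0) = e := rfl
  have hstrict : HasStrictFDerivAt Φ (e : (U × W) →L[ℂ] E) (x₀, 0) := he ▸ hΦ.hasStrictFDerivAt
  let Ψ := hstrict.toOpenPartialHomeomorph Φ
  have hΨ : ∀ z, Ψ z = Φ z := fun z => congrFun hstrict.toOpenPartialHomeomorph_coe z
  have hsrc : (x₀, (0 : W)) ∈ Ψ.source := hstrict.mem_toOpenPartialHomeomorph_source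
  have hΦ0 : Φ (x₀, 0) = φ x₀ := by simp [Φ]
  have hΨ0 : Ψ (x₀, 0) = φ x₀ := (hΨ _).trans hΦ0
  have htgt : φ x₀ ∈ Ψ.target := hΨ0 ▸ Ψ.map_source hsrc
  have hsymm0 : Ψ.symm (φ x₀) = (x₀, 0) := by rw [← hΨ0, Ψ.left_inv hsrc]
  have hΨan : AnalyticAt ℂ Ψ (x₀, 0) := hΦ.congr (Filter.Eventually.of_forall fun z => (hΨ z).symm)
  have hsymm : AnalyticAt ℂ Ψ.symm (φ x₀) := by
    rw [← hΨ0]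
    refine Ψ.analyticAt_symm' (i := e) hsrc hΨan ?_
    rw [← he]
    exact congrArg (fun f => fderiv ℂ f (x₀, 0)) (funext hΨ)
  let ε : W ≃L[ℂ] (Fin (Module.finrank ℂ W) → ℂ) :=
    (Module.finBasis ℂ W).equivFun.toContinuousLinearEquiv
  let π : (U × W) →L[ℂ] (Fin (Module.finrank ℂ W) → ℂ) :=
    ε.toContinuousLinearMap.comp (ContinuousLinearMap.snd ℂ U W)
  have hmem : φ x₀ ∈ Z := hZ.self_of_nhds
  refine ⟨hmem, Module.finrank ℂ W, fun q => ε (Ψ.symm q).2, ?_, ?_, ?_⟩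
  · exact AnalyticAt.comp (g := π) (f := Ψ.symm) (π.analyticAt _) hsymm
  · have h1 : HasFDerivAt Ψ.symm (e.symm : E →L[ℂ] U × W) (φ x₀) := by
      refine Ψ.hasFDerivAt_symm htgt ?_
      rw [hsymm0]
      exact hstrict.hasFDerivAt
    have h2 : HasFDerivAt (fun q => ε (Ψ.symm q).2) (π.comp (e.symm : E →L[ℂ] U × W)) (φ x₀) :=
      HasFDerivAt.comp _ (g := π) (f := Ψ.symm) π.hasFDerivAt h1
    rw [h2.fderiv]
    intro y
    exact ⟨e (0, ε.symm y), by simp [π]⟩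
  · have hc : Filter.Tendsto (fun q => (Ψ.symm q).1) (𝓝 (φ x₀)) (𝓝 x₀) := by
      have := (Ψ.continuousAt_symm htgt).fst
      rwa [ContinuousAt, hsymm0] at this
    have hW0 : {x | (x, (0 : W)) ∈ Ψ.source} ∈ 𝓝 x₀ :=
      (Continuous.prodMk_left (0 : W)).continuousAt.preimage_mem_nhds
        (Ψ.open_source.mem_nhds hsrc)
    filter_upwards [hsurj _ hW0, Ψ.open_target.mem_nhds htgt, hc.eventually hZ] with q h1 h2 h3
    constructor
    · intro hq
      obtain ⟨x, hx, rfl⟩ := h1 hq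
      have : Ψ.symm (φ x) = (x, 0) := by
        rw [← Ψ.left_inv hx, hΨ]
        simp [Φ]
      simp [this]
    · intro hq
      have h4 : (Ψ.symm q).2 = 0 := by simpa using hq
      have h5 := Ψ.right_inv h2
      rw [hΨ] at h5
      simp only [Φ, h4, ZeroMemClass.coe_zero, add_zero] at h5
      rwa [h5] at h3

attribute [local instance] Matrix.normedAddCommGroup Matrix.normedSpace

variable {ι : Type*} [Fintype ι] {E : Type*} [NormedAddCommGroup E] [NormedSpace ℂ E]

theorem analyticAt_matrix_iff {f : E → Matrix ι ι ℂ} {x : E} :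
    AnalyticAt ℂ f x ↔ ∀ i j, AnalyticAt ℂ (fun y => f y i j) x := by
  have h1 : AnalyticAt ℂ f x ↔ ∀ i, AnalyticAt ℂ (fun y => f y i) x :=
    analyticAt_pi_iff (Fm := fun _ => ι → ℂ)
  rw [h1]
  exact forall_congr' fun i => analyticAt_pi_iff

theorem analyticAt_matrix_mul {f g : E → Matrix ι ι ℂ} {x : E} (hf : AnalyticAt ℂ f x)
    (hg : AnalyticAt ℂ g x) : AnalyticAt ℂ (fun y => f y * g y) x := by
  rw [analyticAt_matrix_iff] at hf hg ⊢
  intro i j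
  simp only [Matrix.mul_apply]
  exact Finset.analyticAt_fun_sum _ fun l _ => (hf i l).mul (hg l j)

variable [DecidableEq ι]

theorem analyticAt_matrix_det {f : E → Matrix ι ι ℂ} {x : E} (hf : AnalyticAt ℂ f x) :
    AnalyticAt ℂ (fun y => (f y).det) x := by
  rw [analyticAt_matrix_iff] at hf
  simp only [Matrix.det_apply']
  exact Finset.analyticAt_fun_sum _ fun w _ => analyticAt_const.mul
    (Finset.analyticAt_fun_prod _ fun i _ => hf _ _)

theorem analyticAt_matrix_inv {f : E → Matrix ι ι ℂ} {x : E} (hf : AnalyticAt ℂ f x)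
    (h0 : (f x).det ≠ 0) : AnalyticAt ℂ (fun y => (f y)⁻¹) x := by
  rw [analyticAt_matrix_iff]
  intro i j
  simp only [Matrix.inv_def, Ring.inverse_eq_inv', Matrix.smul_apply, smul_eq_mul,
    Matrix.adjugate_apply]
  refine ((analyticAt_matrix_det hf).inv h0).mul (analyticAt_matrix_det ?_)
  rw [analyticAt_matrix_iff] at hf ⊢
  intro a b
  by_cases h : a = j
  · subst h
    simpa using analyticAt_const
  · simpa [Matrix.updateRow_ne h] using hf a b

omit [DecidableEq ι] in
theorem hasDerivAt_matrix_iff {f : ℂ → Matrix ι ι ℂ} {f' : Matrix ι ι ℂ} {x : ℂ} :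
    HasDerivAt f f' x ↔ ∀ i j, HasDerivAt (fun y => f y i j) (f' i j) x := by
  have h1 : HasDerivAt f f' x ↔ ∀ i, HasDerivAt (fun y => f y i) (f' i) x :=
    hasDerivAt_pi (φ := f) (φ' := f') (E' := fun _ => ι → ℂ)
  rw [h1]
  exact forall_congr' fun i => hasDerivAt_pi

omit [DecidableEq ι] in
theorem hasDerivAt_matrix_mul {f g : ℂ → Matrix ι ι ℂ} {f' g' : Matrix ι ι ℂ} {x : ℂ}
    (hf : HasDerivAt f f' x) (hg : HasDerivAt g g' x) :
    HasDerivAt (fun y => f y * g y) (f' * g x + f x * g') x := by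
  rw [hasDerivAt_matrix_iff] at hf hg ⊢
  intro i j
  simp only [Matrix.mul_apply, Matrix.add_apply, ← Finset.sum_add_distrib]
  exact HasDerivAt.fun_sum fun l _ => (hf i l).mul (hg l j)

theorem analyticAt_invCayley {f : E → Matrix ι ι ℂ} {x : E} (hf : AnalyticAt ℂ f x)
    (h0 : (1 + f x).det ≠ 0) : AnalyticAt ℂ (fun y => invCayley (f y)) x := by
  exact analyticAt_matrix_mul (analyticAt_matrix_inv (analyticAt_const.add hf) h0)
    (analyticAt_const.sub hf)

theorem hasDerivAt_invCayley {f : ℂ → Matrix ι ι ℂ} {f' : Matrix ι ι ℂ}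
    (hf : HasDerivAt f f' 0) (h0 : (1 + f 0).det ≠ 0) :
    ∃ v, HasDerivAt (fun t => invCayley (f t)) v 0 ∧
      f' * invCayley (f 0) + (1 + f 0) * v = -f' := by
  have h1 : AnalyticAt ℂ (invCayley : Matrix ι ι ℂ → Matrix ι ι ℂ) (f 0) :=
    analyticAt_invCayley (f := id) analyticAt_id h0
  have h2 := h1.differentiableAt.hasFDerivAt.comp_hasDerivAt (0 : ℂ) hf
  refine ⟨_, h2, ?_⟩
  have h3 := hasDerivAt_matrix_mul (hf.const_add 1) h2
  refine h3.unique (((hf.const_sub 1)).congr_of_eventuallyEq ?_)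
  have h4 : ContinuousAt (fun t => (1 + f t).det) 0 :=
    ContinuousAt.comp (f := f) (g := fun M => (1 + M).det)
      (by fun_prop) hf.continuousAt
  filter_upwards [h4.eventually_ne h0] with t ht
  exact one_add_mul_invCayley ht

theorem hasDerivAt_invCayley_zero {f : ℂ → Matrix ι ι ℂ} {f' : Matrix ι ι ℂ}
    (hf : HasDerivAt f f' 0) (h0 : f 0 = 0) :
    HasDerivAt (fun t => invCayley (f t)) (-(2 : ℂ) • f') 0 := by
  obtain ⟨v, hv, h⟩ := hasDerivAt_invCayley hf (by simp [h0])
  have h1 : v = -(2 : ℂ) • f' := by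
    rw [h0, add_zero, one_mul, show invCayley (0 : Matrix ι ι ℂ) = 1 by simp [invCayley],
      mul_one] at h
    rw [← add_right_inj f', h]
    module
  exact h1 ▸ hv

theorem hasDerivAt_invCayley_one {f : ℂ → Matrix ι ι ℂ} {f' : Matrix ι ι ℂ}
    (hf : HasDerivAt f f' 0) (h0 : f 0 = 1) :
    HasDerivAt (fun t => invCayley (f t)) (-(1 / 2 : ℂ) • f') 0 := by
  obtain ⟨v, hv, h⟩ := hasDerivAt_invCayley hf (by
    rw [h0]
    simpa using det_one_add_cayley_ne_zero (zero_mem_cayleyDomain (ι := ι)))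
  have h1 : v = -(1 / 2 : ℂ) • f' := by
    rw [h0, show invCayley (1 : Matrix ι ι ℂ) = 0 by simp [invCayley], mul_zero, zero_add,
      add_mul, one_mul] at h
    rw [neg_smul, ← smul_neg, ← h]
    module
  exact h1 ▸ hv

end Smooth

/-! ### Conjugacy of nearby points of the conormal variety -/

section Smooth

variable {ι : Type*} [Fintype ι] [DecidableEq ι] {k : ℕ}

theorem IsSpecDecomp.conj {B : Matrix ι ι ℂ} {u : Fin k → ℂ} {e : Fin k → Matrix ι ι ℂ}
    (h : IsSpecDecomp B u e) (g : (Matrix ι ι ℂ)ˣ) :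
    IsSpecDecomp (g.val * B * g⁻¹.val) u fun i => g.val * e i * g⁻¹.val := by
  have hmul : ∀ X Y : Matrix ι ι ℂ, g.val * X * g⁻¹.val * (g.val * Y * g⁻¹.val) =
      g.val * (X * Y) * g⁻¹.val := fun X Y => by
    simp only [mul_assoc, Units.inv_mul_cancel_left]
  refine ⟨fun i j => ?_, ?_, fun i => ?_, fun i => ?_⟩
  · rw [hmul, h.mul_eq]
    split_ifs <;> simp
  · rw [← Finset.sum_mul, ← Finset.mul_sum, h.sum_eq, mul_one, Units.mul_inv]
  · rw [commute_iff_eq, hmul, hmul, (h.comm i).eq]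
  · have h1 : g.val * B * g⁻¹.val - u i • 1 = g.val * (B - u i • 1) * g⁻¹.val := by
      rw [mul_sub, sub_mul, mul_smul_comm, mul_one, smul_mul_assoc, Units.mul_inv]
    rw [h1, Units.conj_pow, hmul, h.nil, mul_zero, zero_mul]

namespace AdaptedData

variable {P : SymmetricPair ι} {parts : Fin k → ℕ} {A : Matrix ι ι ℂ} (D : AdaptedData P parts A)

/-- The spectral idempotents of the elements of a fibre are all conjugate under the centralizer. -/
theorem exists_conj_specIdem {u : Fin k → ℂ} (hu : Function.Injective u) {B : Matrix ι ι ℂ}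
    (hB : B ∈ fibre P parts A u) : ∃ h ∈ centralizer P A, ∀ i,
      h.val * specIdem u B i * h⁻¹.val = D.e i := by
  obtain ⟨q⟩ := (D.joinedIn_fibre_diag hu hB).joined_subtype
  have hs : ∀ M ∈ fibre P parts A u, semisimplePart u M ∈ fibre P parts A u := fun M hM => by
    simpa using scale_mem_fibre hu hM 0
  have hss : ∀ M ∈ fibre P parts A u,
      semisimplePart u (semisimplePart u M) = semisimplePart u M := fun M hM => by
    simpa using semisimplePart_scale hu hM 0
  have hmem : ∀ t, semisimplePart u (q t).1 ∈ fibre P parts A u := fun t => hs _ (q t).2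
  let γ : C(I, fibre P parts A u) := ⟨fun t => ⟨semisimplePart u (q t).1, hmem t⟩,
    Continuous.subtype_mk ((continuous_semisimplePart hu).comp (by fun_prop)) hmem⟩
  let γ' : Path (γ 0) (γ 1) := ⟨γ, rfl, rfl⟩
  obtain ⟨h, -, hh, -⟩ := exists_orbitMap_pathClass hu D.mem γ' fun t => hss _ (q t).2
  refine ⟨h.1, h.2, fun i => ?_⟩
  have h1 := congrArg Subtype.val hh
  have h0 : (γ 0).1 = semisimplePart u B := by
    show semisimplePart u (q 0).1 = _
    rw [q.source]
  have h2 : (γ 1).1 = D.diag u := by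
    show semisimplePart u (q 1).1 = _
    rw [q.target, D.semisimplePart_diag hu]
  rw [orbitMap_apply, h0, h2] at h1
  have h3 : IsSpecDecomp (semisimplePart u B) u (specIdem u B) := by
    simpa [semisimplePart] using (hB.2.isSpecDecomp hu).scale 0
  have h4 := h3.conj h.1
  rw [h1] at h4
  rw [← h4.specIdem_eq hu, (D.isSpecDecomp_diag u).specIdem_eq hu]

attribute [local instance] Matrix.normedAddCommGroup Matrix.normedSpace

theorem continuous_hankel (k : ℕ) : Continuous (hankel k : Matrix ι ι ℂ → ℂ) := by
  unfold hankel
  fun_prop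

/-- The dimension of the kernel is upper semicontinuous. -/
theorem eventually_finrank_ker_le (A : Matrix ι ι ℂ) : ∀ᶠ A' in 𝓝 A,
    Module.finrank ℂ (LinearMap.ker (Matrix.toLin' A')) ≤
      Module.finrank ℂ (LinearMap.ker (Matrix.toLin' A)) := by
  let T : Matrix ι ι ℂ →ₗ[ℂ] (ι → ℂ) →L[ℂ] (ι → ℂ) :=
    LinearMap.toContinuousLinearMap.toLinearMap ∘ₗ Matrix.toLin'.toLinearMap
  have hT : Continuous T := T.continuous_of_finiteDimensional
  have hrank : ∀ M, LinearMap.rank (T M).toLinearMap = (M.rank : Cardinal) := fun M => by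
    rw [LinearMap.rank, ← Module.finrank_eq_rank]
    rfl
  have hopen := (isOpen_setOfPred_nat_le_rank (𝕜 := ℂ) (E := ι → ℂ) (F := ι → ℂ) A.rank).preimage hT
  filter_upwards [hopen.mem_nhds (show (A.rank : Cardinal) ≤ LinearMap.rank (T A).toLinearMap by
    rw [hrank])] with M hM
  have h1 : A.rank ≤ M.rank := by
    have h2 : (A.rank : Cardinal) ≤ LinearMap.rank (T M).toLinearMap := hM
    rwa [hrank, Nat.cast_le] at h2
  have h3 : ∀ M : Matrix ι ι ℂ, M.rank + Module.finrank ℂ (LinearMap.ker (Matrix.toLin' M)) =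
      Fintype.card ι := fun M => by
    rw [← Module.finrank_fintype_fun_eq_card (η := ι) ℂ]
    exact (Matrix.toLin' M).finrank_range_add_finrank_ker
  have h4 := h3 A
  have h5 := h3 M
  omega

/-- A perturbation of a basis is the image of the basis under a matrix close to the identity. -/
theorem exists_tendsto_mulVec_basis {T κ : Type*} [Finite κ] {l : Filter T}
    (b : Module.Basis κ ℂ (ι → ℂ)) {f : T → κ → ι → ℂ} (hf : Filter.Tendsto f l (𝓝 b)) :
    ∃ g : T → (Matrix ι ι ℂ)ˣ, Filter.Tendsto g l (𝓝 1) ∧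
      ∀ᶠ q in l, ∀ p, (g q).val.mulVec (b p) = f q p := by
  have := Fintype.ofFinite κ
  let L : (κ → ι → ℂ) →ₗ[ℂ] Matrix ι ι ℂ :=
    LinearMap.toMatrix'.toLinearMap ∘ₗ (b.constr ℂ).toLinearMap
  have hL : ∀ f p, (L f).mulVec (b p) = f p := fun f p => by
    show (LinearMap.toMatrix' (b.constr ℂ f)).mulVec (b p) = f p
    rw [LinearMap.toMatrix'_mulVec, Module.Basis.constr_basis]
  have hg : Filter.Tendsto (fun q => L (f q)) l (𝓝 1) := by
    have h1 : L b = 1 := Matrix.toLin'.injective (b.ext fun p => by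
      rw [Matrix.toLin'_apply, hL, Matrix.toLin'_one, LinearMap.id_apply])
    rw [← h1]
    exact (L.continuous_of_finiteDimensional.tendsto _).comp hf
  have hdet : ∀ᶠ q in l, (L (f q)).det ≠ 0 := by
    have h1 : Filter.Tendsto (fun q => (L (f q)).det) l (𝓝 (1 : Matrix ι ι ℂ).det) :=
      ((continuous_id.matrix_det).tendsto _).comp hg
    exact h1.eventually_ne (by simp)
  refine ⟨fun q => unitOf (L (f q)), ?_, ?_⟩
  · have h1 := (continuousOn_unitOf.continuousAt (x := (1 : Matrix ι ι ℂ))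
      (IsOpen.mem_nhds (isOpen_ne_fun (by fun_prop) continuous_const) (by simp)))
    rw [ContinuousAt, unitOf_one] at h1
    exact h1.comp hg
  · filter_upwards [hdet] with q hq p
    rw [unitOf_val hq, hL]

include D in
/-- Generators of the Jordan blocks of `A` that are compatible with the generalized eigenspaces of
a conormal. -/
theorem exists_basis_pow_mulVec {u : Fin k → ℂ} (hu : Function.Injective u) {B : Matrix ι ι ℂ}
    (hB : B ∈ fibre P parts A u) : ∃ (v : Fin k → Fin P.d → ι → ℂ)
      (b : Module.Basis (Σ a : Fin k × Fin P.d, Fin (parts a.1)) ℂ (ι → ℂ)),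
      (∀ p, b p = (A ^ (p.2 : ℕ)).mulVec (v p.1.1 p.1.2)) ∧
      ∀ i a, (specIdem u B i).mulVec (v i a) = v i a := by
  obtain ⟨h, hh, hhe⟩ := D.exists_conj_specIdem hu hB
  let v : Fin k → Fin P.d → ι → ℂ := fun i a => h⁻¹.val.mulVec (D.v i a)
  let b₀ : (Σ a : Fin k × Fin P.d, Fin (parts a.1)) → ι → ℂ :=
    fun p => (A ^ (p.2 : ℕ)).mulVec (v p.1.1 p.1.2)
  have hb₀ : LinearIndependent ℂ b₀ := by
    have h1 : b₀ = fun p => Matrix.toLin' h⁻¹.val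
        ((A ^ (p.2 : ℕ)).mulVec (D.v p.1.1 p.1.2)) := by
      funext p
      rw [Matrix.toLin'_apply, Matrix.mulVec_mulVec,
        ← ((commute_units_inv hh.2).pow_left _).eq, ← Matrix.mulVec_mulVec]
    rw [h1]
    refine D.linearIndependent.map' _ (LinearMap.ker_eq_bot.2 ?_)
    exact Matrix.mulVec_injective_of_invertible _
  have hcard : Fintype.card (Σ a : Fin k × Fin P.d, Fin (parts a.1)) = Fintype.card ι := by
    rw [← hB.2.sum_eq, Fintype.card_sigma, Fintype.sum_prod_type]
    simp
  refine ⟨v, basisOfLinearIndependentOfCardEqFinrank' b₀ hb₀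
    (by rw [hcard, Module.finrank_fintype_fun_eq_card]), fun p => by simp [b₀], fun i a => ?_⟩
  have h1 : specIdem u B i * h⁻¹.val = h⁻¹.val * D.e i := by
    rw [← hhe, mul_assoc, Units.inv_mul_cancel_left]
  rw [Matrix.mulVec_mulVec, h1, ← Matrix.mulVec_mulVec, D.e_mulVec]

include D in
/-- Nearby points of the conormal variety are conjugate in their first component, by matrices
close to the identity. -/
theorem exists_tendsto_conj_units {T : Type*} (l : Ultrafilter T) {A' B' : T → Matrix ι ι ℂ}
    {B : Matrix ι ι ℂ} (hB : B ∈ P.distinct A k) (hl1 : Filter.Tendsto A' l (𝓝 A))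
    (hl2 : Filter.Tendsto B' l (𝓝 B))
    (hZ : ∀ᶠ q in l, A' q ∈ P.S ∧ IsNilpotent (A' q) ∧ B' q ∈ P.conormal (A' q)) :
    ∃ g : T → (Matrix ι ι ℂ)ˣ, Filter.Tendsto g l (𝓝 1) ∧
      ∀ᶠ q in l, (g q).val * A * (g q)⁻¹.val = A' q := by
  obtain ⟨u₀, hu₀⟩ := D.exists_hasRoots hB
  -- the number of eigenvalues is constant
  have hhank : Filter.Tendsto (fun q => hankel k (B' q)) l
      (𝓝 (hankel k B)) := ((continuous_hankel k).tendsto B).comp hl2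
  have hhB : hankel k B ≠ 0 := (hankel_ne_zero_iff hB.2.le).2 hB.2
  have hcard : ∀ᶠ q in l, (spectrum ℂ (B' q)).ncard = k := by
    filter_upwards [hZ, hl1.eventually (eventually_finrank_ker_le A),
      hhank.eventually_ne hhB] with q hq h1 h2
    exact (hankel_ne_zero_iff (P.ncard_spectrum_le hq.1 hq.2.1 hq.2.2.1 hq.2.2.2.1
      (h1.trans D.finrank_ker))).1 h2
  obtain ⟨u, hu, huq⟩ := exists_tendsto_hasRoots l hl2 hcard hu₀ u₀.2 D.mul_pos
  obtain ⟨v, b, hb, hv⟩ := D.exists_basis_pow_mulVec u₀.2 (B := B) ⟨hB.1, hu₀⟩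
  let f : T → (Σ a : Fin k × Fin P.d, Fin (parts a.1)) → ι → ℂ := fun q p =>
    ((A' q) ^ (p.2 : ℕ)).mulVec ((specIdem (u q) (B' q) p.1.1).mulVec (v p.1.1 p.1.2))
  have hf : Filter.Tendsto f l (𝓝 b) := by
    rw [tendsto_pi_nhds]
    intro p
    have h1 := tendsto_specIdem hu hl2 (huq.mono fun q hq => hq.1) u₀.2 p.1.1
    have hc : Continuous fun z : Matrix ι ι ℂ × Matrix ι ι ℂ =>
      (z.1 ^ (p.2 : ℕ)).mulVec (z.2.mulVec (v p.1.1 p.1.2)) := by fun_prop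
    have h2 := (hc.tendsto (A, specIdem u₀.1 B p.1.1)).comp (hl1.prodMk_nhds h1)
    simp only [hv] at h2
    rw [hb]
    exact h2
  obtain ⟨g, hg1, hg⟩ := exists_tendsto_mulVec_basis b hf
  refine ⟨g, hg1, ?_⟩
  filter_upwards [hZ, huq, hg] with q hq hqu hgq
  have hd := hqu.2.isSpecDecomp hqu.1
  have hd₀ := hu₀.isSpecDecomp u₀.2
  rw [Units.mul_inv_eq_iff_eq_mul]
  -- `g q` maps the Jordan basis of `A` to cyclic vectors of `A' q`; at the ends of the blocks both
  -- sides vanish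
  refine Matrix.toLin'.injective (b.ext fun p => ?_)
  rw [Matrix.toLin'_apply, Matrix.toLin'_apply, ← Matrix.mulVec_mulVec, ← Matrix.mulVec_mulVec,
    hgq]
  have h1 : A.mulVec (b p) = (A ^ ((p.2 : ℕ) + 1)).mulVec (v p.1.1 p.1.2) := by
    rw [hb, pow_succ', ← Matrix.mulVec_mulVec]
  have h2 : (A' q).mulVec (f q p) = ((A' q) ^ ((p.2 : ℕ) + 1)).mulVec
      ((specIdem (u q) (B' q) p.1.1).mulVec (v p.1.1 p.1.2)) := by
    rw [pow_succ', ← Matrix.mulVec_mulVec]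
  rw [h1, h2]
  by_cases hp : (p.2 : ℕ) + 1 < parts p.1.1
  · exact (congrArg _ (hb ⟨p.1, ⟨(p.2 : ℕ) + 1, hp⟩⟩).symm).trans (hgq _)
  · have hp' : (p.2 : ℕ) + 1 = parts p.1.1 := le_antisymm p.2.2 (not_lt.1 hp)
    have h3 : A ^ parts p.1.1 * specIdem u₀.1 B p.1.1 = 0 :=
      P.pow_mul_eq_zero D.mem D.nilpotent (P.specIdem_mem hB.1.1 _ _) (hd₀.idem _)
        (hd₀.commute_of_commute u₀.2 hB.1.2.1 _) (by
          rw [← hd₀.rootMultiplicity_eq u₀.2, hu₀.rootMultiplicity_eq u₀.2])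
    have h4 : (A' q) ^ parts p.1.1 * specIdem (u q) (B' q) p.1.1 = 0 :=
      P.pow_mul_eq_zero hq.1 hq.2.1 (P.specIdem_mem hq.2.2.1 _ _) (hd.idem _)
        (hd.commute_of_commute hqu.1 hq.2.2.2.1 _) (by
          rw [← hd.rootMultiplicity_eq hqu.1, hqu.2.rootMultiplicity_eq hqu.1])
    have h5 : (A ^ parts p.1.1).mulVec (v p.1.1 p.1.2) = 0 := by
      rw [← hv, Matrix.mulVec_mulVec, h3, Matrix.zero_mulVec]
    rw [hp', h5, Matrix.mulVec_mulVec, h4, Matrix.zero_mulVec, Matrix.mulVec_zero]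

include D in
/-- The conjugating matrices can be chosen to be isometries. -/
theorem exists_tendsto_conj {T : Type*} (l : Ultrafilter T) {A' B' : T → Matrix ι ι ℂ}
    {B : Matrix ι ι ℂ} (hB : B ∈ P.distinct A k) (hl1 : Filter.Tendsto A' l (𝓝 A))
    (hl2 : Filter.Tendsto B' l (𝓝 B))
    (hZ : ∀ᶠ q in l, A' q ∈ P.S ∧ IsNilpotent (A' q) ∧ B' q ∈ P.conormal (A' q)) :
    ∃ κ : T → (Matrix ι ι ℂ)ˣ, Filter.Tendsto κ l (𝓝 1) ∧
      ∀ᶠ q in l, κ q ∈ P.K ∧ (κ q).val * A * (κ q)⁻¹.val = A' q := by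
  obtain ⟨g, hg1, hgA⟩ := D.exists_tendsto_conj_units l hB hl1 hl2 hZ
  obtain ⟨κ, hκ1, U, hU, hκc, hκ⟩ := P.polar {A} (by simpa using D.mem)
  have hgS : ∀ᶠ q in l, g q ∈ U ∩ {g | ∀ t ∈ ({A} : Set (Matrix ι ι ℂ)),
      g.val * t * g⁻¹.val ∈ P.S} := by
    filter_upwards [hg1.eventually hU, hgA, hZ] with q h1 h2 h3
    refine ⟨h1, ?_⟩
    rintro t rfl
    rw [h2]
    exact h3.1
  refine ⟨fun q => κ (g q), ?_, ?_⟩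
  · have h1 := hκc 1 ⟨mem_of_mem_nhds hU, by rintro t rfl; simpa using D.mem⟩
    rw [ContinuousWithinAt, hκ1] at h1
    exact h1.comp (tendsto_nhdsWithin_iff.2 ⟨hg1, hgS⟩)
  · filter_upwards [hgS, hgA] with q h1 h2
    obtain ⟨h3, h4⟩ := hκ _ h1.1 h1.2
    exact ⟨h3, (h4 A rfl).trans h2⟩

end AdaptedData

end Smooth

/-! ### Smoothness of the conormal variety -/

section Smooth

variable {ι : Type*} [Fintype ι] [DecidableEq ι] {k : ℕ}

attribute [local instance] Matrix.normedAddCommGroup Matrix.normedSpace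

theorem exists_nhds_prod_subtype {X Y : Type*} [TopologicalSpace X] [TopologicalSpace Y] {C : Set Y}
    {f : X × Y → Y} {x₀ : X} {y₀ : Y} (hy₀ : y₀ ∈ C) (hf : ContinuousAt f (x₀, y₀))
    (h0 : f (x₀, y₀) = y₀) {W : Set (X × C)} (hW : W ∈ 𝓝 (x₀, (⟨y₀, hy₀⟩ : C))) :
    ∃ V₁ ∈ 𝓝 x₀, ∃ V₂ ∈ 𝓝 y₀, ∀ x ∈ V₁, ∀ y ∈ V₂, ∀ h : f (x, y) ∈ C, (x, ⟨f (x, y), h⟩) ∈ W := by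
  obtain ⟨W₁, hW₁, W₂, hW₂, hW₁₂⟩ := mem_nhds_prod_iff.1 hW
  obtain ⟨W₃, hW₃, hW₃₂⟩ := (mem_nhds_subtype _ _ _).1 hW₂
  obtain ⟨V₁, hV₁, V₂, hV₂, hV⟩ := mem_nhds_prod_iff.1
    (hf.preimage_mem_nhds (t := W₃) (by rw [h0]; exact hW₃))
  exact ⟨W₁ ∩ V₁, Filter.inter_mem hW₁ hV₁, V₂, hV₂, fun x hx y hy h =>
    hW₁₂ (Set.mk_mem_prod hx.1 (hW₃₂ (hV (Set.mk_mem_prod hx.2 hy))))⟩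

theorem eventually_exists_eq_of_surjective {E F : Type*} [NormedAddCommGroup E] [NormedSpace ℂ E]
    [CompleteSpace E] [NormedAddCommGroup F] [NormedSpace ℂ F] [CompleteSpace F] {f : E → F}
    {x₀ : E} (hf : AnalyticAt ℂ f x₀) (hsurj : Function.Surjective (fderiv ℂ f x₀)) {p : E → Prop}
    (hp : ∀ᶠ x in 𝓝 x₀, p x) : ∀ᶠ y in 𝓝 (f x₀), ∃ x, p x ∧ f x = y := by
  rw [← hf.hasStrictFDerivAt.map_nhds_eq_of_surj (LinearMap.range_eq_top.2 hsurj),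
    Filter.eventually_map]
  exact hp.mono fun x hx => ⟨x, hx, rfl⟩

theorem cayley_val_eq_invCayley {X : Matrix ι ι ℂ} (hX : X ∈ cayleyDomain ι) :
    (cayley X).val = invCayley X := cayley_val hX

theorem cayley_inv_val_eq_invCayley {X : Matrix ι ι ℂ} (hX : X ∈ cayleyDomain ι) :
    (cayley X)⁻¹.val = invCayley (-X) := by
  rw [cayley_inv hX, cayley_val_eq_invCayley (neg_mem_cayleyDomain hX)]

/-- Conjugation by the Cayley transform of `X`, written as an everywhere defined function. -/
noncomputable def cayleyConj (X Y : Matrix ι ι ℂ) : Matrix ι ι ℂ :=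
  invCayley X * Y * invCayley (-X)

theorem cayleyConj_eq {X : Matrix ι ι ℂ} (hX : X ∈ cayleyDomain ι) (Y : Matrix ι ι ℂ) :
    cayleyConj X Y = (cayley X).val * Y * (cayley X)⁻¹.val := by
  rw [cayleyConj, cayley_val_eq_invCayley hX, cayley_inv_val_eq_invCayley hX]

theorem invCayley_zero : invCayley (0 : Matrix ι ι ℂ) = 1 := by simp [invCayley]

theorem cayleyConj_zero (Y : Matrix ι ι ℂ) : cayleyConj 0 Y = Y := by
  simp [cayleyConj, invCayley_zero]

theorem analyticAt_cayleyConj {E : Type*} [NormedAddCommGroup E] [NormedSpace ℂ E]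
    {f g : E → Matrix ι ι ℂ} {x : E} (hf : AnalyticAt ℂ f x) (hg : AnalyticAt ℂ g x)
    (h0 : f x ∈ cayleyDomain ι) : AnalyticAt ℂ (fun y => cayleyConj (f y) (g y)) x :=
  analyticAt_matrix_mul (analyticAt_matrix_mul (analyticAt_invCayley hf h0.1) hg)
    (analyticAt_invCayley hf.neg (neg_mem_cayleyDomain h0).1)

theorem hasDerivAt_cayleyConj {f g : ℂ → Matrix ι ι ℂ} {f' g' : Matrix ι ι ℂ}
    (hf : HasDerivAt f f' 0) (h0 : f 0 = 0) (hg : HasDerivAt g g' 0) :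
    HasDerivAt (fun t => cayleyConj (f t) (g t))
      (g' - (2 : ℂ) • (f' * g 0 - g 0 * f')) 0 := by
  have h1 := hasDerivAt_matrix_mul (hasDerivAt_matrix_mul (hasDerivAt_invCayley_zero hf h0) hg)
    (hasDerivAt_invCayley_zero hf.neg (by simp [h0]))
  refine HasDerivAt.congr_deriv h1 ?_
  simp only [Pi.neg_apply, h0, neg_zero, invCayley_zero, one_mul, mul_one, neg_mul,
    smul_mul_assoc, mul_smul_comm, smul_neg, neg_smul, neg_neg]
  module

namespace AdaptedData

variable {P : SymmetricPair ι} {parts : Fin k → ℕ} {A : Matrix ι ι ℂ} (D : AdaptedData P parts A)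

variable (P A) in
/-- A complement `M` of the Lie algebra of the centralizer of `A`. It is a transversal slice that
parametrizes the orbit of `A` near `A`. -/
theorem exists_complement_centralizerLie : ∃ M ≤ P.lie, M ⊓ centralizerLie P A = ⊥ ∧
    M ⊔ centralizerLie P A = P.lie := by
  have hle : centralizerLie P A ≤ P.lie := fun X hX => hX.1
  obtain ⟨C, hC⟩ := (centralizerLie P A).exists_isCompl
  refine ⟨C ⊓ P.lie, inf_le_right, ?_, ?_⟩
  · rw [eq_bot_iff, ← hC.inf_eq_bot]
    exact fun X hX => ⟨hX.2, hX.1.1⟩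
  · rw [sup_comm, ← sup_inf_assoc_of_le C hle, hC.sup_eq_top, top_inf_eq]

/-- Isometries close to the identity are products of Cayley transforms. -/
theorem eventually_exists_cayley_mul {M : Submodule ℂ (Matrix ι ι ℂ)} (hM : M ≤ P.lie)
    (hsup : M ⊔ centralizerLie P A = P.lie) {W : Set (M × centralizerLie P A)} (hW : W ∈ 𝓝 0) :
    ∀ᶠ Y in 𝓝 (0 : Matrix ι ι ℂ), Y ∈ P.lie → ∃ x ∈ W, x.1.1 ∈ cayleyDomain ι ∧
      x.2.1 ∈ cayleyDomain ι ∧ cayley Y = cayley x.1.1 * cayley x.2.1 := by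
  let G : M × centralizerLie P A → Matrix ι ι ℂ := fun x => invCayley x.1.1 * invCayley x.2.1
  have hG0 : G 0 = 1 := by simp [G, invCayley_zero]
  let p₁ : M × centralizerLie P A →L[ℂ] Matrix ι ι ℂ :=
    M.subtypeL.comp (ContinuousLinearMap.fst ℂ _ _)
  let p₂ : M × centralizerLie P A →L[ℂ] Matrix ι ι ℂ :=
    (centralizerLie P A).subtypeL.comp (ContinuousLinearMap.snd ℂ _ _)
  have hp₁ : p₁ 0 = 0 := map_zero _
  have hp₂ : p₂ 0 = 0 := map_zero _
  have hG : AnalyticAt ℂ G 0 := analyticAt_matrix_mul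
    (analyticAt_invCayley (p₁.analyticAt 0) (by simp))
    (analyticAt_invCayley (p₂.analyticAt 0) (by simp))
  have hdet : (1 + G 0).det ≠ 0 := by
    rw [hG0]
    simpa using det_one_add_cayley_ne_zero (zero_mem_cayleyDomain (ι := ι))
  have hΘ : AnalyticAt ℂ (fun x => invCayley (G x)) 0 := analyticAt_invCayley hG hdet
  obtain ⟨π, hπ⟩ := P.lie.subtype.exists_leftInverse_of_injective P.lie.ker_subtype
  have hπ' : ∀ X : P.lie, π X.1 = X := fun X => LinearMap.congr_fun hπ X
  let πc : Matrix ι ι ℂ →L[ℂ] P.lie := LinearMap.toContinuousLinearMap π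
  have hΘ' : AnalyticAt ℂ (fun x => πc (invCayley (G x))) 0 :=
    AnalyticAt.comp (g := πc) (πc.analyticAt _) hΘ
  have hder : ∀ z : M × centralizerLie P A,
      fderiv ℂ (fun x => πc (invCayley (G x))) 0 z = πc (z.1.1 + z.2.1) := by
    intro z
    have h1 := hΘ'.differentiableAt.hasFDerivAt.hasLineDerivAt z
    have hz1 : HasDerivAt (fun t : ℂ => p₁ (0 + t • z)) z.1.1 0 :=
      p₁.hasFDerivAt.hasLineDerivAt z
    have hz2 : HasDerivAt (fun t : ℂ => p₂ (0 + t • z)) z.2.1 0 :=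
      p₂.hasFDerivAt.hasLineDerivAt z
    have h2 := hasDerivAt_matrix_mul (hasDerivAt_invCayley_zero hz1 (by simp))
      (hasDerivAt_invCayley_zero hz2 (by simp))
    have h3 := hasDerivAt_invCayley_one h2 (by simp [invCayley_zero])
    have h4 := πc.hasFDerivAt.comp_hasDerivAt (0 : ℂ) h3
    refine h1.unique (h4.congr_deriv ?_)
    congr 1
    simp only [zero_smul, add_zero, map_zero, invCayley_zero, one_mul, mul_one]
    module
  have hrange : Function.Surjective (fderiv ℂ (fun x => πc (invCayley (G x))) 0) := by
    intro Y
    have hY : Y.1 ∈ M ⊔ centralizerLie P A := by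
      rw [hsup]
      exact Y.2
    obtain ⟨X, hX, Z, hZ, hXZ⟩ := Submodule.mem_sup.1 hY
    refine ⟨(⟨X, hX⟩, ⟨Z, hZ⟩), ?_⟩
    refine (hder _).trans ?_
    show πc (X + Z) = Y
    rw [hXZ]
    exact hπ' Y
  have h00 : πc (invCayley (G 0)) = 0 := by
    rw [hG0, show invCayley (1 : Matrix ι ι ℂ) = 0 by simp [invCayley], map_zero]
  have hd1 : ∀ᶠ x : M × centralizerLie P A in 𝓝 0, x.1.1 ∈ cayleyDomain ι :=
    p₁.continuous.continuousAt.eventually_mem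
      (isOpen_cayleyDomain.mem_nhds (by rw [hp₁]; exact zero_mem_cayleyDomain))
  have hd2 : ∀ᶠ x : M × centralizerLie P A in 𝓝 0, x.2.1 ∈ cayleyDomain ι :=
    p₂.continuous.continuousAt.eventually_mem
      (isOpen_cayleyDomain.mem_nhds (by rw [hp₂]; exact zero_mem_cayleyDomain))
  have hd3 : ∀ᶠ x in 𝓝 0, (1 + G x).det ≠ 0 :=
    (analyticAt_matrix_det (analyticAt_const.add hG)).continuousAt.eventually_ne hdet
  have himage : ∀ᶠ Y in 𝓝 (0 : P.lie), ∃ x,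
      (x ∈ W ∧ x.1.1 ∈ cayleyDomain ι ∧ x.2.1 ∈ cayleyDomain ι ∧ (1 + G x).det ≠ 0) ∧
        πc (invCayley (G x)) = Y := by
    have hW' : ∀ᶠ x in 𝓝 0, x ∈ W := hW
    have h1 := eventually_exists_eq_of_surjective hΘ' hrange (hW'.and (hd1.and (hd2.and hd3)))
    rw [h00] at h1
    exact h1
  rw [nhds_subtype_eq_comap, Filter.eventually_comap] at himage
  filter_upwards [himage] with Y hY hYl
  obtain ⟨x, ⟨hxW, hx1, hx2, hx3⟩, hxY⟩ := hY ⟨Y, hYl⟩ rfl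
  have hGc : G x = (cayley x.1.1 * cayley x.2.1).val := by
    rw [Units.val_mul, cayley_val_eq_invCayley hx1, cayley_val_eq_invCayley hx2]
  rw [hGc] at hxY hx3
  have hl : invCayley (cayley x.1.1 * cayley x.2.1).val ∈ P.lie := P.invCayley_mem
    (P.K.mul_mem (P.cayley_mem (hM x.1.2) hx1) (P.cayley_mem x.2.2.1 hx2)) hx3
  have h5 : invCayley (cayley x.1.1 * cayley x.2.1).val = Y :=
    congrArg Subtype.val ((hπ' ⟨_, hl⟩).symm.trans hxY)
  exact ⟨x, hxW, hx1, hx2, by rw [← h5, cayley_invCayley hx3]⟩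

variable (P) in
/-- The conormal variety, without the trace condition on the first component, which holds
automatically. -/
def conormalPairs : Set (Matrix ι ι ℂ × Matrix ι ι ℂ) :=
  {q | q.1 ∈ P.S ∧ IsNilpotent q.1 ∧ q.2 ∈ P.conormal q.1}

theorem conj_mem_conormal {g : (Matrix ι ι ℂ)ˣ} (hg : g ∈ P.K) {A B : Matrix ι ι ℂ}
    (hB : B ∈ P.conormal A) :
    g.val * B * g⁻¹.val ∈ P.conormal (g.val * A * g⁻¹.val) := by
  refine ⟨P.conj_mem hg hB.1, ?_, ?_⟩
  · rw [commute_iff_eq]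
    simp only [mul_assoc, Units.inv_mul_cancel_left]
    rw [← mul_assoc A, ← mul_assoc B, hB.2.1.eq]
  · rw [Matrix.trace_mul_comm, ← mul_assoc, Units.inv_mul, one_mul, hB.2.2]

theorem conj_mem_conormalPairs {g : (Matrix ι ι ℂ)ˣ} (hg : g ∈ P.K) {A B : Matrix ι ι ℂ}
    (h : (A, B) ∈ conormalPairs P) :
    (g.val * A * g⁻¹.val, g.val * B * g⁻¹.val) ∈ conormalPairs P := by
  refine ⟨P.conj_mem hg h.1, ?_, conj_mem_conormal hg h.2.2⟩
  obtain ⟨n, hn⟩ := h.2.1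
  exact ⟨n, by
    show (g.val * A * g⁻¹.val) ^ n = 0
    rw [Units.conj_pow, hn, mul_zero, zero_mul]⟩

/-- Conjugation by `cayley X` is an isomorphism of the conormal space at `A` to the one at its
conjugate, with the inverse given by `-X`. -/
theorem cayleyConj_neg_mem_conormal {X A A' B : Matrix ι ι ℂ} (hX : X ∈ P.lie)
    (hdom : X ∈ cayleyDomain ι) (hB : B ∈ P.conormal A')
    (hA : (cayley X).val * A * (cayley X)⁻¹.val = A') :
    cayleyConj (-X) B ∈ P.conormal A ∧ cayleyConj X (cayleyConj (-X) B) = B := by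
  have hb : cayleyConj (-X) B = (cayley X)⁻¹.val * B * (cayley X).val := by
    rw [cayleyConj_eq (neg_mem_cayleyDomain hdom), ← cayley_inv hdom, inv_inv]
  constructor
  · have h6 := conj_mem_conormal (P.K.inv_mem (P.cayley_mem hX hdom)) hB
    rw [inv_inv, ← hA] at h6
    rw [hb]
    simpa only [mul_assoc, Units.inv_mul_cancel_left, Units.inv_mul, mul_one] using h6
  · rw [cayleyConj_eq hdom, hb]
    simp only [mul_assoc, Units.mul_inv_cancel_left, Units.mul_inv, mul_one]

theorem tendsto_invCayley_one {T : Type*} {l : Filter T} {κ : T → (Matrix ι ι ℂ)ˣ}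
    (hκ : Filter.Tendsto κ l (𝓝 1)) : Filter.Tendsto (fun q => invCayley (κ q).val) l (𝓝 0) ∧
      ∀ᶠ q in l, (1 + (κ q).val).det ≠ 0 := by
  have hκ' : Filter.Tendsto (fun q => (κ q).val) l (𝓝 1) :=
    (Units.continuous_val.tendsto _).comp hκ
  have hdet1 : (1 + (1 : Matrix ι ι ℂ)).det ≠ 0 := by
    simpa using det_one_add_cayley_ne_zero (zero_mem_cayleyDomain (ι := ι))
  have hopen : IsOpen {g : Matrix ι ι ℂ | (1 + g).det ≠ 0} :=
    isOpen_ne_fun (by fun_prop) continuous_const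
  refine ⟨?_, hκ'.eventually (hopen.mem_nhds hdet1)⟩
  have h1 := continuousOn_invCayley.continuousAt (hopen.mem_nhds hdet1)
  rw [ContinuousAt, show invCayley (1 : Matrix ι ι ℂ) = 0 by simp [invCayley]] at h1
  exact h1.comp hκ'

include D in
/-- Every point of the conormal variety near `(A, B)` has a first component that is the conjugate of
`A` by the Cayley transform of a small element of the slice `M`. -/
theorem eventually_exists_conj {B : Matrix ι ι ℂ} (hB : B ∈ P.distinct A k)
    {M : Submodule ℂ (Matrix ι ι ℂ)} (hM : M ≤ P.lie) (hsup : M ⊔ centralizerLie P A = P.lie)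
    {V : Set M} (hV : V ∈ 𝓝 0) :
    ∀ᶠ q in 𝓝 (A, B), q ∈ conormalPairs P →
      ∃ X ∈ V, X.1 ∈ cayleyDomain ι ∧ (cayley X.1).val * A * (cayley X.1)⁻¹.val = q.1 := by
  by_contra hbad
  rw [Filter.not_eventually] at hbad
  have := Filter.frequently_iff_neBot.1 hbad
  obtain ⟨l, hl⟩ := @Ultrafilter.exists_le _ _ this
  have hl1 := hl.trans inf_le_left
  have hlb := Filter.le_principal_iff.1 (hl.trans inf_le_right)
  obtain ⟨κ, hκ, hκA⟩ := D.exists_tendsto_conj l (A' := Prod.fst) (B' := Prod.snd) hB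
    ((continuous_fst.tendsto (A, B)).mono_left hl1)
    ((continuous_snd.tendsto (A, B)).mono_left hl1) (by
      filter_upwards [hlb] with q hq
      exact (not_forall.1 hq).1)
  obtain ⟨hi, hdet⟩ := tendsto_invCayley_one hκ
  -- the conjugating isometry is `cayley X * cayley Z` with `X` in the slice and `Z` in the
  -- centralizer, which does not move `A`
  have hfac := hi.eventually (eventually_exists_cayley_mul hM hsup (W := Prod.fst ⁻¹' V)
    (continuous_fst.continuousAt.preimage_mem_nhds hV))
  obtain ⟨q, hq, h1, h2, h4⟩ := (hdet.and (hfac.and (hκA.and hlb))).exists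
  obtain ⟨x, hxV, hx1, hx2, hx⟩ := h1 (P.invCayley_mem h2.1 hq)
  rw [cayley_invCayley hq] at hx
  obtain ⟨hqZ, hqbad⟩ := not_forall.1 h4
  refine hqbad ⟨x.1, hxV, hx1, ?_⟩
  rw [← h2.2, hx, Units.val_mul, mul_inv_rev, Units.val_mul]
  have h5 := conj_eq_self_of_commute (commute_cayley (x.2.2.2))
  calc _ = (cayley x.1.1).val * ((cayley x.2.1).val * A * (cayley x.2.1)⁻¹.val) *
        (cayley x.1.1)⁻¹.val := by rw [h5]
    _ = _ := by simp only [mul_assoc]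

theorem continuousAt_cayleyConj_neg (M : Submodule ℂ (Matrix ι ι ℂ)) (B : Matrix ι ι ℂ) :
    ContinuousAt (fun z : M × Matrix ι ι ℂ => cayleyConj (-z.1.1) z.2) (0, B) := by
  refine (analyticAt_cayleyConj
    (((M.subtypeL.comp (ContinuousLinearMap.fst ℂ M (Matrix ι ι ℂ))).analyticAt (0, B)).neg)
    ((ContinuousLinearMap.snd ℂ M (Matrix ι ι ℂ)).analyticAt (0, B)) ?_).continuousAt
  exact neg_mem_cayleyDomain zero_mem_cayleyDomain

include D in
/-- Points of the conormal variety near `(A, B)` have preimages near `(0, B)` under the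
parametrization `(X, b) ↦ (cayley X * A * (cayley X)⁻¹, cayley X * b * (cayley X)⁻¹)`. -/
theorem eventually_exists_cayleyConj {B : Matrix ι ι ℂ} (hB : B ∈ P.distinct A k)
    {M : Submodule ℂ (Matrix ι ι ℂ)} (hM : M ≤ P.lie) (hsup : M ⊔ centralizerLie P A = P.lie)
    {W : Set (M × P.conormal A)} (hW : W ∈ 𝓝 (0, ⟨B, hB.1⟩)) :
    ∀ᶠ q in 𝓝 (A, B), q ∈ conormalPairs P →
      ∃ x ∈ W, (cayleyConj x.1.1 A, cayleyConj x.1.1 x.2.1) = q := by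
  -- the second coordinate of the preimage depends continuously on the point
  obtain ⟨V₁, hV₁, V₂, hV₂, hV⟩ := exists_nhds_prod_subtype hB.1 (continuousAt_cayleyConj_neg M B)
    (by rw [ZeroMemClass.coe_zero, neg_zero, cayleyConj_zero]) hW
  have hV₂' : ∀ᶠ q in 𝓝 (A, B), q.2 ∈ V₂ :=
    (continuous_snd.tendsto (A, B)).eventually (p := fun b => b ∈ V₂) hV₂
  refine ((D.eventually_exists_conj hB hM hsup hV₁).and hV₂').mono ?_
  rintro q ⟨hq, hq2⟩ hqZ
  obtain ⟨X, hXV, hX, hXA⟩ := hq hqZ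
  obtain ⟨hbc, hbc'⟩ := cayleyConj_neg_mem_conormal (hM X.2) hX hqZ.2.2 hXA
  exact ⟨_, hV X hXV q.2 hq2 hbc, Prod.ext ((cayleyConj_eq hX A).trans hXA) hbc'⟩

include D in
/-- The conormal variety is parametrized near `(A, B)` by the product of the slice `M` and the
conormal space at `A`. The differential `(X, b) ↦ (-2 [X, A], b - 2 [X, B])` of the parametrization
is injective because `M` does not meet the centralizer of `A`. -/
theorem isSmoothPoint_conormalPairs {B : Matrix ι ι ℂ} (hB : B ∈ P.distinct A k) :
    IsSmoothPoint (conormalPairs P) (A, B) := by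
  obtain ⟨M, hM, hinf, hsup⟩ := exists_complement_centralizerLie P A
  let x₀ : M × P.conormal A := (0, ⟨B, hB.1⟩)
  let φ : M × P.conormal A → Matrix ι ι ℂ × Matrix ι ι ℂ := fun x =>
    (cayleyConj x.1.1 A, cayleyConj x.1.1 x.2.1)
  have hφ0 : φ x₀ = (A, B) := Prod.ext (cayleyConj_zero A) (cayleyConj_zero B)
  let p₁ : M × P.conormal A →L[ℂ] Matrix ι ι ℂ :=
    M.subtypeL.comp (ContinuousLinearMap.fst ℂ _ _)
  let p₂ : M × P.conormal A →L[ℂ] Matrix ι ι ℂ :=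
    (P.conormal A).subtypeL.comp (ContinuousLinearMap.snd ℂ _ _)
  have hp₁ : p₁ x₀ ∈ cayleyDomain ι := zero_mem_cayleyDomain
  have hφ : AnalyticAt ℂ φ x₀ :=
    (analyticAt_cayleyConj (p₁.analyticAt x₀) analyticAt_const hp₁).prod
      (analyticAt_cayleyConj (p₁.analyticAt x₀) (p₂.analyticAt x₀) hp₁)
  rw [← hφ0]
  refine isSmoothPoint_of_parametrization hφ ?_ ?_ fun W hW => ?_
  · rw [injective_iff_map_eq_zero]
    intro z hz
    have h1 := hφ.differentiableAt.hasFDerivAt.hasLineDerivAt z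
    rw [hz] at h1
    have hz1 : HasDerivAt (fun t : ℂ => (x₀ + t • z).1.1) z.1.1 0 :=
      p₁.hasFDerivAt.hasLineDerivAt z
    have hz2 : HasDerivAt (fun t : ℂ => (x₀ + t • z).2.1) z.2.1 0 :=
      p₂.hasFDerivAt.hasLineDerivAt z
    have hz0 : (x₀ + (0 : ℂ) • z).1.1 = 0 := by simp [x₀]
    have h1A : HasDerivAt (fun t : ℂ => (φ (x₀ + t • z)).1) 0 0 :=
      (ContinuousLinearMap.fst ℂ (Matrix ι ι ℂ) (Matrix ι ι ℂ)).hasFDerivAt.comp_hasDerivAt 0 h1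
    have h1B : HasDerivAt (fun t : ℂ => (φ (x₀ + t • z)).2) 0 0 :=
      (ContinuousLinearMap.snd ℂ (Matrix ι ι ℂ) (Matrix ι ι ℂ)).hasFDerivAt.comp_hasDerivAt 0 h1
    have hA := (hasDerivAt_cayleyConj hz1 hz0 (hasDerivAt_const 0 A)).unique h1A
    have hBz := (hasDerivAt_cayleyConj hz1 hz0 hz2).unique h1B
    have hA' : z.1.1 * A - A * z.1.1 = 0 := by
      have h2 : (0 : Matrix ι ι ℂ) - (2 : ℂ) • (z.1.1 * A - A * z.1.1) = 0 := hA
      rw [zero_sub, neg_eq_zero] at h2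
      exact (smul_eq_zero.1 h2).resolve_left two_ne_zero
    have h3 : z.1.1 ∈ M ⊓ centralizerLie P A :=
      ⟨z.1.2, hM z.1.2, (sub_eq_zero.1 hA').symm⟩
    rw [hinf, Submodule.mem_bot] at h3
    have h4 : z.2.1 = 0 := by
      have h5 : z.2.1 - (2 : ℂ) • (z.1.1 * (x₀ + (0 : ℂ) • z).2.1 -
        (x₀ + (0 : ℂ) • z).2.1 * z.1.1) = 0 := hBz
      rw [h3] at h5
      simpa using h5
    exact Prod.ext (Subtype.ext h3) (Subtype.ext h4)
  · have hd : ∀ᶠ x : M × P.conormal A in 𝓝 x₀, x.1.1 ∈ cayleyDomain ι :=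
      p₁.continuous.continuousAt.eventually_mem (isOpen_cayleyDomain.mem_nhds hp₁)
    filter_upwards [hd] with x hx
    show (cayleyConj x.1.1 A, cayleyConj x.1.1 x.2.1) ∈ _
    rw [cayleyConj_eq hx, cayleyConj_eq hx]
    exact conj_mem_conormalPairs (P.cayley_mem (hM x.1.2) hx) ⟨D.mem, D.nilpotent, x.2.2⟩
  · rw [hφ0]
    exact D.eventually_exists_cayleyConj hB hM hsup hW

end AdaptedData

end Smooth

/-! ### Anti-involutions and their symmetric pairs -/

section Instances

variable {ι : Type*} [Fintype ι] [DecidableEq ι]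

/-- An anti-involution of the algebra of matrices, such as the passage to the adjoint with respect
to a symmetric or alternating form. -/
structure AntiInvolution (ι : Type*) [Fintype ι] [DecidableEq ι] where
  map : Matrix ι ι ℂ →ₗ[ℂ] Matrix ι ι ℂ
  map_mul : ∀ X Y, map (X * Y) = map Y * map X
  map_map : ∀ X, map (map X) = X

namespace AntiInvolution

variable (τ : AntiInvolution ι)

theorem map_one : τ.map 1 = 1 := by
  have h := τ.map_mul 1 (τ.map 1)
  rw [one_mul, τ.map_map, one_mul] at h
  exact h.symm

theorem continuous : Continuous τ.map := τ.map.continuous_of_finiteDimensional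

/-- The self-adjoint matrices. -/
def S : Submodule ℂ (Matrix ι ι ℂ) := LinearMap.eqLocus τ.map LinearMap.id

/-- The skew-adjoint matrices. -/
def lie : Submodule ℂ (Matrix ι ι ℂ) := LinearMap.eqLocus τ.map (-LinearMap.id)

theorem mem_S {X : Matrix ι ι ℂ} : X ∈ τ.S ↔ τ.map X = X := Iff.rfl

theorem mem_lie {X : Matrix ι ι ℂ} : X ∈ τ.lie ↔ τ.map X = -X := Iff.rfl

theorem map_inv_val {g : (Matrix ι ι ℂ)ˣ} (h : τ.map g.val = g⁻¹.val) :
    τ.map g⁻¹.val = g.val := by rw [← h, τ.map_map]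

/-- The isometries. -/
def K : Subgroup (Matrix ι ι ℂ)ˣ where
  carrier := {g | τ.map g.val = g⁻¹.val}
  mul_mem' {g h} hg hh := by
    show τ.map (g * h).val = (g * h)⁻¹.val
    rw [Units.val_mul, τ.map_mul, mul_inv_rev, Units.val_mul]
    exact congrArg₂ _ hh hg
  one_mem' := by
    show τ.map (1 : (Matrix ι ι ℂ)ˣ).val = _
    simp [τ.map_one]
  inv_mem' {g} hg := by
    show τ.map g⁻¹.val = g⁻¹⁻¹.val
    rw [inv_inv, τ.map_inv_val hg]

theorem mem_K {g : (Matrix ι ι ℂ)ˣ} : g ∈ τ.K ↔ τ.map g.val = g⁻¹.val := Iff.rfl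

theorem cayley_mem {X : Matrix ι ι ℂ} (hX : X ∈ τ.lie) (h : X ∈ cayleyDomain ι) :
    cayley X ∈ τ.K := by
  rw [mem_K, cayley_inv h]
  have h1 := congrArg τ.map (one_add_mul_cayley h)
  rw [τ.map_mul, map_add, map_sub, τ.map_one, τ.mem_lie.1 hX, ← sub_eq_add_neg,
    sub_neg_eq_add] at h1
  have h2 := cayley_mul_one_add (neg_mem_cayleyDomain h)
  rw [← sub_eq_add_neg, sub_neg_eq_add] at h2
  exact ((Matrix.isUnit_iff_isUnit_det _).2 (isUnit_iff_ne_zero.2 h.2)).mul_right_cancel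
    (h1.trans h2.symm)

theorem invCayley_mem {g : (Matrix ι ι ℂ)ˣ} (hg : g ∈ τ.K) (h : (1 + g.val).det ≠ 0) :
    invCayley g.val ∈ τ.lie := by
  rw [mem_lie]
  have h1 := congrArg τ.map (one_add_mul_invCayley h)
  rw [τ.map_mul, map_add, map_sub, τ.map_one, τ.mem_K.1 hg] at h1
  have h2 : τ.map (invCayley g.val) * (1 + g.val) = -(invCayley g.val * (1 + g.val)) := by
    have h3 := congrArg (fun M => M * g.val) h1
    simp only [mul_assoc, add_mul, sub_mul, one_mul, Units.inv_mul] at h3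
    have h4 : Commute (1 + g.val) (invCayley g.val) :=
      commute_invCayley ((Commute.one_left _).add_left (Commute.refl _))
    rw [← h4.eq, one_add_mul_invCayley h, neg_sub, ← h3, add_comm]
  rw [← neg_mul] at h2
  exact ((Matrix.isUnit_iff_isUnit_det _).2 (isUnit_iff_ne_zero.2 h)).mul_right_cancel h2

theorem conj_mem_S {g : (Matrix ι ι ℂ)ˣ} {X : Matrix ι ι ℂ} (hg : g ∈ τ.K) (hX : X ∈ τ.S) :
    g.val * X * g⁻¹.val ∈ τ.S := by
  rw [mem_S, τ.map_mul, τ.map_mul, τ.mem_S.1 hX, τ.mem_K.1 hg, τ.map_inv_val hg, mul_assoc]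

section Polar

attribute [local instance] Matrix.normedAddCommGroup Matrix.normedSpace

/-- Squaring is a local homeomorphism at `1` on each linear space of matrices that contains `1`
and is closed under squaring. -/
theorem exists_sqrt (W : Submodule ℂ (Matrix ι ι ℂ)) (h1 : 1 ∈ W) (hsq : ∀ X ∈ W, X * X ∈ W) :
    ∃ s : Matrix ι ι ℂ → Matrix ι ι ℂ, ∃ V ∈ 𝓝 (1 : Matrix ι ι ℂ), ContinuousOn s V ∧ s 1 = 1 ∧
      ∀ X ∈ V, s X ∈ W ∧ (X ∈ W → s X * s X = X) := by
  obtain ⟨π, hπ⟩ := W.subtype.exists_leftInverse_of_injective W.ker_subtype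
  have hπ' : ∀ X : W, π X.1 = X := fun X => LinearMap.congr_fun hπ X
  let πc : Matrix ι ι ℂ →L[ℂ] W := LinearMap.toContinuousLinearMap π
  let f : W → W := fun X => πc (X.1 * X.1)
  let o : W := ⟨1, h1⟩
  have hf : AnalyticAt ℂ f o := AnalyticAt.comp (g := πc) (πc.analyticAt _)
    (analyticAt_matrix_mul (W.subtypeL.analyticAt o) (W.subtypeL.analyticAt o))
  have hfo : f o = o := by
    show πc (1 * 1) = o
    rw [one_mul]
    exact hπ' o
  have hder : ∀ Z : W, fderiv ℂ f o Z = (2 : ℂ) • Z := by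
    intro Z
    have h2 := hf.differentiableAt.hasFDerivAt.hasLineDerivAt Z
    have h3 : HasDerivAt (fun t : ℂ => W.subtypeL (o + t • Z)) Z.1 0 :=
      W.subtypeL.hasFDerivAt.hasLineDerivAt Z
    have h4 := πc.hasFDerivAt.comp_hasDerivAt (0 : ℂ) (hasDerivAt_matrix_mul h3 h3)
    refine h2.unique (h4.congr_deriv ?_)
    rw [← hπ' ((2 : ℂ) • Z)]
    refine congrArg πc ?_
    show Z.1 * (o + (0 : ℂ) • Z).1 + (o + (0 : ℂ) • Z).1 * Z.1 = (2 : ℂ) • Z.1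
    rw [zero_smul, add_zero, mul_one, one_mul, two_smul]
  have hbij : Function.Bijective (fderiv ℂ f o) := by
    have h2 : ⇑(fderiv ℂ f o) = fun Z => (2 : ℂ) • Z := funext hder
    rw [h2]
    exact ⟨smul_right_injective _ two_ne_zero, fun Z => ⟨(2 : ℂ)⁻¹ • Z,
      smul_inv_smul₀ two_ne_zero Z⟩⟩
  let e : W ≃L[ℂ] W := (LinearEquiv.ofBijective
    (fderiv ℂ f o).toLinearMap hbij).toContinuousLinearEquiv
  have he : fderiv ℂ f o = e := rfl
  have hstrict : HasStrictFDerivAt f (e : W →L[ℂ] W) o := he ▸ hf.hasStrictFDerivAt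
  let Ψ := hstrict.toOpenPartialHomeomorph f
  have hΨ : ∀ z, Ψ z = f z := fun z => congrFun hstrict.toOpenPartialHomeomorph_coe z
  have hsrc : o ∈ Ψ.source := hstrict.mem_toOpenPartialHomeomorph_source
  have hΨo : Ψ o = o := (hΨ o).trans hfo
  have htgt : o ∈ Ψ.target := by
    have := Ψ.map_source hsrc
    rwa [hΨo] at this
  have hπ1 : πc 1 = o := hπ' o
  refine ⟨fun X => (Ψ.symm (πc X)).1, πc ⁻¹' Ψ.target,
    (Ψ.open_target.preimage πc.continuous).mem_nhds (by rwa [Set.mem_preimage, hπ1]), ?_, ?_,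
    fun X hX => ⟨(Ψ.symm (πc X)).2, fun hXW => ?_⟩⟩
  · exact continuous_subtype_val.comp_continuousOn
      (Ψ.continuousOn_symm.comp πc.continuous.continuousOn fun X hX => hX)
  · exact congrArg Subtype.val
      ((congrArg Ψ.symm (hπ1.trans hΨo.symm)).trans (Ψ.left_inv hsrc) : Ψ.symm (πc 1) = o)
  · have h2 := Ψ.right_inv (x := πc X) hX
    rw [hΨ] at h2
    have h3 : πc X = ⟨X, hXW⟩ := hπ' ⟨X, hXW⟩
    have h4 : f (Ψ.symm (πc X)) = ⟨_, hsq _ (Ψ.symm (πc X)).2⟩ :=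
      hπ' ⟨_, hsq _ (Ψ.symm (πc X)).2⟩
    exact congrArg Subtype.val (h4.symm.trans (h2.trans h3))

/-- With `σ = √(g* g)`, which is self-adjoint and commutes with `T`, the matrix `g σ⁻¹` is an isometry
and induces the same conjugation of `T` as `g`. Here `g*` is the adjoint `τ.map g`. -/
theorem polar {T : Set (Matrix ι ι ℂ)} (hT : T ⊆ τ.S) :
    ∃ κ : (Matrix ι ι ℂ)ˣ → (Matrix ι ι ℂ)ˣ, κ 1 = 1 ∧ ∃ U ∈ 𝓝 (1 : (Matrix ι ι ℂ)ˣ),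
      ContinuousOn κ (U ∩ {g | ∀ t ∈ T, g.val * t * g⁻¹.val ∈ τ.S}) ∧
      ∀ g ∈ U, (∀ t ∈ T, g.val * t * g⁻¹.val ∈ τ.S) →
        κ g ∈ τ.K ∧ ∀ t ∈ T, (κ g).val * t * (κ g)⁻¹.val = g.val * t * g⁻¹.val := by
  let W : Submodule ℂ (Matrix ι ι ℂ) :=
    { carrier := {X | X ∈ τ.S ∧ ∀ t ∈ T, Commute t X}
      add_mem' := fun h h' => ⟨τ.S.add_mem h.1 h'.1, fun t ht => (h.2 t ht).add_right (h'.2 t ht)⟩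
      zero_mem' := ⟨τ.S.zero_mem, fun t _ => Commute.zero_right t⟩
      smul_mem' := fun c _ h => ⟨τ.S.smul_mem c h.1, fun t ht => (h.2 t ht).smul_right c⟩ }
  obtain ⟨s, V, hV, hs, hs1, hsW⟩ := exists_sqrt W ⟨τ.map_one, fun t _ => Commute.one_right t⟩
    fun X hX => ⟨by rw [mem_S, τ.map_mul, τ.mem_S.1 hX.1], fun t ht =>
      (hX.2 t ht).mul_right (hX.2 t ht)⟩
  let h : (Matrix ι ι ℂ)ˣ → Matrix ι ι ℂ := fun g => τ.map g.val * g.val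
  have hh : Continuous h := (τ.continuous.comp Units.continuous_val).mul Units.continuous_val
  have hh1 : h 1 = 1 := by simp [h, τ.map_one]
  have hhV : h ⁻¹' V ∈ 𝓝 1 := hh.continuousAt.preimage_mem_nhds (by rwa [hh1])
  have hdet : ∀ᶠ g in 𝓝 1, (s (h g)).det ≠ 0 := by
    have hc : ContinuousAt (fun g => (s (h g)).det) 1 := by
      refine ContinuousAt.comp (g := fun M : Matrix ι ι ℂ => M.det) (f := fun g => s (h g))
        (by fun_prop) (ContinuousAt.comp (g := s) (f := h) ?_ hh.continuousAt)
      rw [hh1]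
      exact hs.continuousAt hV
    exact hc.eventually_ne (by rw [hh1, hs1, Matrix.det_one]; exact one_ne_zero)
  refine ⟨fun g => g * (unitOf (s (h g)))⁻¹, ?_, _, Filter.inter_mem hhV hdet, ?_, ?_⟩
  · show 1 * (unitOf (s (h 1)))⁻¹ = 1
    rw [hh1, hs1, unitOf_one, inv_one, one_mul]
  · refine ContinuousOn.mono (s := h ⁻¹' V ∩ {g | (s (h g)).det ≠ 0}) ?_ Set.inter_subset_left
    refine continuousOn_id.mul (ContinuousOn.inv ?_)
    refine continuousOn_unitOf.comp (hs.comp hh.continuousOn fun g hg => hg.1) fun g hg => hg.2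
  · rintro g ⟨hg, hgd⟩ hgT
    have hgd' : (s (h g)).det ≠ 0 := hgd
    -- the hermitian square of `g` commutes with `T`
    have hW : h g ∈ W := by
      refine ⟨?_, fun t ht => ?_⟩
      · rw [mem_S, τ.map_mul, τ.map_map]
      · have h2 := τ.mem_S.1 (hgT t ht)
        rw [τ.map_mul, τ.map_mul, τ.mem_S.1 (hT ht)] at h2
        have h3 : τ.map g.val * τ.map g⁻¹.val = 1 := by
          rw [← τ.map_mul, Units.inv_mul, τ.map_one]
        have h4 := congrArg (fun M => τ.map g.val * M * g.val) h2
        simp only [mul_assoc, Units.inv_mul, mul_one] at h4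
        rw [← mul_assoc (τ.map g.val) (τ.map g⁻¹.val), h3, one_mul] at h4
        rw [commute_iff_eq]
        simp only [h, mul_assoc]
        exact h4
    obtain ⟨hsS, hss⟩ := hsW _ hg
    set σ' := unitOf (s (h g)) with hσ
    have hv : σ'.val = s (h g) := unitOf_val hgd'
    have hcomm : ∀ t ∈ T, Commute t σ'⁻¹.val := fun t ht =>
      commute_units_inv (by rw [hv]; exact hsS.2 t ht)
    constructor
    · rw [mem_K, Units.val_mul, τ.map_mul, mul_inv_rev, inv_inv, Units.val_mul]
      have h2 : τ.map σ'⁻¹.val = σ'⁻¹.val := by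
        have h3 := congrArg τ.map (σ'.mul_inv)
        rw [τ.map_mul, τ.map_one, hv, τ.mem_S.1 hsS.1, ← hv] at h3
        exact (Units.mul_eq_one_iff_eq_inv.1 h3)
      have h5 : τ.map g.val = σ'.val * σ'.val * g⁻¹.val := by
        rw [hv, hss hW, mul_assoc, Units.mul_inv, mul_one]
      rw [h2, h5, mul_assoc, Units.inv_mul_cancel_left]
    · intro t ht
      rw [mul_inv_rev, inv_inv, Units.val_mul, Units.val_mul, mul_assoc g.val, ← (hcomm t ht).eq]
      simp only [← hσ, mul_assoc, Units.inv_mul_cancel_left]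

end Polar

/-- The symmetric pair defined by an anti-involution, if nonzero self-adjoint matrices have rank at
least `d`. -/
def symmetricPair (d : ℕ) (hd : 0 < d)
    (hτ : ∀ N ∈ τ.S, N ≠ 0 → ∃ x : Fin d → ι → ℂ, LinearIndependent ℂ fun a => N.mulVec (x a)) :
    SymmetricPair ι where
  S := τ.S
  lie := τ.lie
  K := τ.K
  d := d
  d_pos := hd
  one_mem := τ.map_one
  mul_mem hX hY h := by rw [mem_S, τ.map_mul, τ.mem_S.1 hX, τ.mem_S.1 hY, h.eq]
  conj_mem := τ.conj_mem_S
  cayley_mem := τ.cayley_mem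
  invCayley_mem := τ.invCayley_mem
  sq_mem hX := by rw [mem_S, τ.map_mul, τ.mem_lie.1 hX, neg_mul_neg]
  add_inv_mem hg := by
    rw [mem_S, map_add, τ.mem_K.1 hg, τ.map_inv_val hg, add_comm]
  polar _ hT := τ.polar hT
  indep {A e q} hA he _ hc _ h0 := by
    refine hτ _ ?_ h0
    have h1 : ∀ n, A ^ n ∈ τ.S := fun n => by
      induction n with
      | zero => rw [pow_zero]; exact τ.map_one
      | succ n ih => rw [pow_succ, mem_S, τ.map_mul, τ.mem_S.1 hA, τ.mem_S.1 ih, ← pow_succ',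
          pow_succ]
    rw [mem_S, τ.map_mul, τ.mem_S.1 he, τ.mem_S.1 (h1 q), (hc.pow_left q).eq]

end AntiInvolution

theorem exists_linearIndependent_mulVec_one {N : Matrix ι ι ℂ} (h0 : N ≠ 0) :
    ∃ x : Fin 1 → ι → ℂ, LinearIndependent ℂ fun a => N.mulVec (x a) := by
  obtain ⟨x, hx⟩ : ∃ x, N.mulVec x ≠ 0 := by
    by_contra! h
    exact h0 (Matrix.toLin'.injective (LinearMap.ext fun x => by simpa using h x))
  exact ⟨fun _ => x, by simpa [linearIndependent_unique_iff] using hx⟩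

/-- The symmetric pair of the general linear group. The scalar matrices, which are not contained in
`𝔰𝔩ₙ`, act trivially by commutators and do no harm. -/
def generalLinearPair (ι : Type*) [Fintype ι] [DecidableEq ι] : SymmetricPair ι where
  S := ⊤
  lie := ⊤
  K := ⊤
  d := 1
  d_pos := one_pos
  one_mem := trivial
  mul_mem _ _ _ := trivial
  conj_mem _ _ := trivial
  cayley_mem _ _ := trivial
  invCayley_mem _ _ := trivial
  sq_mem _ := trivial
  add_inv_mem _ := trivial
  polar _ _ := ⟨id, rfl, Set.univ, Filter.univ_mem, continuousOn_id, fun _ _ _ =>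
    ⟨trivial, fun _ _ => rfl⟩⟩
  indep _ _ _ _ _ h0 := exists_linearIndependent_mulVec_one h0

/-- The adjoint with respect to the bilinear form with the Gram matrix `J`. -/
noncomputable def adjointInvolution (J : Matrix ι ι ℂ) (hJ : IsUnit J.det) (η : ℂ)
    (hη : J.transpose = η • J) : AntiInvolution ι where
  map :=
    { toFun := fun X => J⁻¹ * X.transpose * J
      map_add' := fun X Y => by rw [Matrix.transpose_add, mul_add, add_mul]
      map_smul' := fun c X => by
        rw [Matrix.transpose_smul, mul_smul_comm, smul_mul_assoc, RingHom.id_apply] }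
  map_mul X Y := by
    show J⁻¹ * (X * Y).transpose * J = J⁻¹ * Y.transpose * J * (J⁻¹ * X.transpose * J)
    rw [Matrix.transpose_mul]
    simp only [mul_assoc, Matrix.mul_nonsing_inv_cancel_left _ _ hJ]
  map_map X := by
    show J⁻¹ * (J⁻¹ * X.transpose * J).transpose * J = X
    have h1 : J.transpose⁻¹ * J.transpose = 1 :=
      Matrix.nonsing_inv_mul _ (by rwa [Matrix.det_transpose])
    have h2 : J⁻¹ * J.transpose = η • 1 := by
      rw [hη, mul_smul_comm, Matrix.nonsing_inv_mul _ hJ]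
    have h3 : η • (J.transpose⁻¹ * J) = 1 := by rw [← mul_smul_comm, ← hη, h1]
    calc J⁻¹ * (J⁻¹ * X.transpose * J).transpose * J
        = J⁻¹ * J.transpose * X * (J.transpose⁻¹ * J) := by
          rw [Matrix.transpose_mul, Matrix.transpose_mul, Matrix.transpose_transpose,
            Matrix.transpose_nonsing_inv]
          simp only [mul_assoc]
      _ = X * (η • (J.transpose⁻¹ * J)) := by
          rw [h2, smul_mul_assoc, one_mul, smul_mul_assoc, mul_smul_comm]
      _ = X := by rw [h3, mul_one]

theorem mem_S_adjointInvolution {J : Matrix ι ι ℂ} (hJ : IsUnit J.det) {η : ℂ}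
    (hη : J.transpose = η • J) {X : Matrix ι ι ℂ} :
    X ∈ (adjointInvolution J hJ η hη).S ↔ X.transpose * J = J * X := by
  show J⁻¹ * X.transpose * J = X ↔ _
  rw [mul_assoc]
  constructor <;> intro h
  · rw [← Matrix.mul_nonsing_inv_cancel_left J (X.transpose * J) hJ, h]
  · rw [h, Matrix.nonsing_inv_mul_cancel_left _ _ hJ]

theorem mem_lie_adjointInvolution {J : Matrix ι ι ℂ} (hJ : IsUnit J.det) {η : ℂ}
    (hη : J.transpose = η • J) {X : Matrix ι ι ℂ} :
    X ∈ (adjointInvolution J hJ η hη).lie ↔ X.transpose * J = -(J * X) := by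
  show J⁻¹ * X.transpose * J = -X ↔ _
  rw [mul_assoc]
  constructor <;> intro h
  · rw [← Matrix.mul_nonsing_inv_cancel_left J (X.transpose * J) hJ, h, mul_neg]
  · rw [h, mul_neg, Matrix.nonsing_inv_mul_cancel_left _ _ hJ]

/-- If `N` is self-adjoint for the alternating form `J`, then `J * N` is alternating, so the rank of
`N` is even. -/
theorem exists_linearIndependent_mulVec_two {J N : Matrix ι ι ℂ} (hJ : IsUnit J.det)
    (hη : J.transpose = (-1 : ℂ) • J) (hN : N.transpose * J = J * N) (h0 : N ≠ 0) :
    ∃ x : Fin 2 → ι → ℂ, LinearIndependent ℂ fun a => N.mulVec (x a) := by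
  have hM : (J * N).transpose = -(J * N) := by
    rw [Matrix.transpose_mul, hη, mul_smul_comm, hN, neg_one_smul]
  have halt : ∀ x y, dotProduct x ((J * N).mulVec y) = -dotProduct y ((J * N).mulVec x) := by
    intro x y
    rw [Matrix.dotProduct_mulVec, ← Matrix.mulVec_transpose, hM, Matrix.neg_mulVec, neg_dotProduct,
      dotProduct_comm]
  obtain ⟨i, j, hij⟩ : ∃ i j, (J * N) i j ≠ 0 := by
    by_contra! h
    refine h0 ?_
    rw [← Matrix.nonsing_inv_mul_cancel_left J N hJ, show J * N = 0 from Matrix.ext h, mul_zero]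
  have hxy : dotProduct (Pi.single i 1 : ι → ℂ) ((J * N).mulVec (Pi.single j 1)) ≠ 0 := by
    simpa using hij
  generalize (Pi.single i 1 : ι → ℂ) = x at hxy
  generalize (Pi.single j 1 : ι → ℂ) = y at hxy
  refine ⟨![x, y], Fintype.linearIndependent_iff.2 fun c hc => ?_⟩
  have h1 : ∀ z, dotProduct z ((J * N).mulVec z) = 0 := fun z => self_eq_neg.1 (halt z z)
  have h2 : ∀ z, c 0 * dotProduct z ((J * N).mulVec x) + c 1 * dotProduct z ((J * N).mulVec y)
      = 0 := by
    intro z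
    have := congrArg (fun w => dotProduct z (J.mulVec w)) hc
    simpa [Fin.sum_univ_two, Matrix.mulVec_add, Matrix.mulVec_smul, dotProduct_add,
      dotProduct_smul, Matrix.mulVec_mulVec] using this
  have h3 := h2 x
  have h4 := h2 y
  rw [h1, mul_zero, zero_add] at h3
  rw [h1, mul_zero, add_zero, halt] at h4
  rw [Fin.forall_fin_two]
  exact ⟨(mul_eq_zero.1 h4).resolve_right (neg_ne_zero.2 hxy),
    (mul_eq_zero.1 h3).resolve_right hxy⟩

end Instances

/-! ### Matrices that permute the blocks of a Jordan basis -/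

section Jordan

open scoped Kronecker

variable {ι : Type*} [Fintype ι] [DecidableEq ι] {α : Type*} [Fintype α] [DecidableEq α]
  {A : Matrix ι ι ℂ} {s : α → ℕ}

/-- A basis `A ^ x v_a`, `x < s a`, that is generated by vectors `v_a` with `A ^ (s a) v_a = 0`. -/
structure CyclicBasis (A : Matrix ι ι ℂ) (s : α → ℕ) where
  v : α → ι → ℂ
  basis : Module.Basis (Σ a : α, Fin (s a)) ℂ (ι → ℂ)
  basis_apply : ∀ p, basis p = (A ^ (p.2 : ℕ)).mulVec (v p.1)
  pow_mulVec : ∀ a, (A ^ s a).mulVec (v a) = 0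

omit [Fintype α] [DecidableEq α] in
/-- The last vector of a Jordan block generates the block. -/
theorem HasJordanType.nonempty_cyclicBasis (h : HasJordanType A s) :
    Nonempty (CyclicBasis A s) := by
  obtain ⟨b, h0, h1⟩ := h
  let v : α → ι → ℂ := fun a => if h : 0 < s a then b ⟨a, ⟨s a - 1, by omega⟩⟩ else 0
  have key : ∀ a x (hx : x < s a), (A ^ x).mulVec (v a) = b ⟨a, ⟨s a - (x + 1), by omega⟩⟩ := by
    intro a x
    induction x with
    | zero => intro hx; simp [v, hx]
    | succ x ih =>
      intro hx
      rw [pow_succ', ← Matrix.mulVec_mulVec, ih (by omega)]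
      have := h1 a (s a - (x + 1 + 1)) (by omega)
      rw [← this]
      congr 5
      omega
  refine ⟨⟨v, b.reindex (Equiv.sigmaCongrRight fun a => Fin.revPerm), fun p => ?_, fun a => ?_⟩⟩
  · rw [key p.1 _ p.2.2, Module.Basis.reindex_apply]
    rfl
  · rcases Nat.eq_zero_or_pos (s a) with h | h
    · simp [v, h]
    · obtain ⟨x, hx⟩ := Nat.exists_eq_succ_of_ne_zero h.ne'
      have h2 := key a x (by omega)
      rw [hx, Nat.succ_eq_add_one, pow_succ', ← Matrix.mulVec_mulVec, h2]
      have h3 := h0 a h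
      rw [← h3]
      congr 5
      omega

namespace CyclicBasis

variable (D : CyclicBasis A s)

omit [Fintype α] [DecidableEq α] in
theorem pow_mulVec_eq_zero {a : α} {x : ℕ} (h : s a ≤ x) : (A ^ x).mulVec (D.v a) = 0 := by
  rw [← Nat.sub_add_cancel h, pow_add, ← Matrix.mulVec_mulVec, D.pow_mulVec, Matrix.mulVec_zero]

section

include D

omit [Fintype α] [DecidableEq α] in
theorem ext_mulVec {X Y : Matrix ι ι ℂ}
    (h : ∀ a x, X.mulVec ((A ^ x).mulVec (D.v a)) = Y.mulVec ((A ^ x).mulVec (D.v a))) :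
    X = Y :=
  Matrix.toLin'.injective (D.basis.ext fun p => by
    simpa only [Matrix.toLin'_apply, D.basis_apply] using h p.1 p.2)

omit [DecidableEq α] in
theorem isNilpotent : IsNilpotent A := by
  refine ⟨∑ a, s a, D.ext_mulVec fun a x => ?_⟩
  rw [Matrix.mulVec_mulVec, ← pow_add, D.pow_mulVec_eq_zero, Matrix.zero_mulVec]
  exact (Finset.single_le_sum (fun a _ => Nat.zero_le (s a)) (Finset.mem_univ a)).trans
    (Nat.le_add_right _ _)

omit [Fintype α] [DecidableEq α] in
theorem repr_mulVec {a : α} {j : ℕ} (hj : j + 1 < s a) (y : ι → ℂ) :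
    D.basis.repr (A.mulVec y) ⟨a, ⟨j + 1, hj⟩⟩ = D.basis.repr y ⟨a, ⟨j, by omega⟩⟩ := by
  have : D.basis.coord ⟨a, ⟨j + 1, hj⟩⟩ ∘ₗ A.mulVecLin = D.basis.coord ⟨a, ⟨j, by omega⟩⟩ := by
    refine D.basis.ext fun p => ?_
    classical
    rw [LinearMap.comp_apply, Matrix.mulVecLin_apply]
    obtain ⟨a', x⟩ := p
    by_cases hx : (x : ℕ) + 1 < s a'
    · have h1 : A.mulVec (D.basis ⟨a', x⟩) = D.basis ⟨a', ⟨x + 1, hx⟩⟩ := by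
        rw [D.basis_apply, D.basis_apply, Matrix.mulVec_mulVec, ← pow_succ']
      rw [h1, Module.Basis.coord_apply, Module.Basis.coord_apply, Module.Basis.repr_self,
        Module.Basis.repr_self, Finsupp.single_apply, Finsupp.single_apply]
      refine if_congr ⟨fun h => ?_, fun h => ?_⟩ rfl rfl
      · obtain ⟨rfl, h⟩ := Sigma.mk.inj_iff.1 h
        have := Fin.mk.inj_iff.1 (eq_of_heq h)
        congr 1
        ext
        simpa using this
      · obtain ⟨rfl, h⟩ := Sigma.mk.inj_iff.1 h
        have h2 := congrArg Fin.val (eq_of_heq h)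
        simp only [h2]
    · have h1 : A.mulVec (D.basis ⟨a', x⟩) = 0 := by
        rw [D.basis_apply, Matrix.mulVec_mulVec, ← pow_succ', D.pow_mulVec_eq_zero (not_lt.1 hx)]
      rw [h1, map_zero, Module.Basis.coord_apply, Module.Basis.repr_self, Finsupp.single_apply,
        if_neg]
      intro h
      obtain ⟨rfl, h⟩ := Sigma.mk.inj_iff.1 h
      have h2 := congrArg Fin.val (eq_of_heq h)
      simp only at h2
      omega
  exact LinearMap.congr_fun this y

omit [DecidableEq α] in
/-- The dimension of the kernel is at most the number of blocks. -/
theorem finrank_ker_le (hs : ∀ a, 0 < s a) :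
    Module.finrank ℂ (LinearMap.ker (Matrix.toLin' A)) ≤ Fintype.card α := by
  -- an element of the kernel is determined by its coordinates at the ends of the blocks
  let φ : LinearMap.ker (Matrix.toLin' A) →ₗ[ℂ] α → ℂ :=
    (LinearMap.pi fun a => D.basis.coord ⟨a, ⟨s a - 1, by have := hs a; omega⟩⟩) ∘ₗ
      Submodule.subtype _
  have hφ : Function.Injective φ := by
    rw [injective_iff_map_eq_zero]
    intro y hy
    refine Subtype.ext (D.basis.ext_elem fun p => ?_)
    obtain ⟨a, x⟩ := p
    rw [ZeroMemClass.coe_zero, map_zero, Finsupp.zero_apply]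
    by_cases hx : (x : ℕ) + 1 < s a
    · rw [← D.repr_mulVec hx, ← Matrix.toLin'_apply, LinearMap.mem_ker.1 y.2, map_zero,
        Finsupp.zero_apply]
    · have h1 := congrFun hy a
      have h2 : x = ⟨s a - 1, by have := hs a; omega⟩ := Fin.ext (by have := x.2; simp; omega)
      rw [h2]
      exact h1
  simpa using LinearMap.finrank_le_finrank_of_injective hφ

end

/-- The matrix that maps each `v_a'` to `∑ a, c a a' • v_a` and commutes with `A`, if `c` does not
mix blocks of different sizes. -/
noncomputable def blockOp : Matrix α α ℂ →ₗ[ℂ] Matrix ι ι ℂ where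
  toFun c := LinearMap.toMatrix' (D.basis.constr ℂ fun p =>
    ∑ a, c a p.1 • (A ^ (p.2 : ℕ)).mulVec (D.v a))
  map_add' c c' := by
    rw [← map_add]
    congr 1
    refine D.basis.ext fun p => ?_
    rw [LinearMap.add_apply, Module.Basis.constr_basis, Module.Basis.constr_basis,
      Module.Basis.constr_basis, ← Finset.sum_add_distrib]
    exact Finset.sum_congr rfl fun a _ => by rw [Matrix.add_apply, add_smul]
  map_smul' r c := by
    rw [RingHom.id_apply, ← map_smul]
    congr 1
    refine D.basis.ext fun p => ?_
    rw [LinearMap.smul_apply, Module.Basis.constr_basis, Module.Basis.constr_basis,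
      Finset.smul_sum]
    exact Finset.sum_congr rfl fun a _ => by rw [Matrix.smul_apply, smul_assoc]

/-- The matrix `c` does not mix indices with different values of `s`. -/
def Respects (s : α → ℕ) (c : Matrix α α ℂ) : Prop := ∀ a a', c a a' ≠ 0 → s a = s a'

omit [Fintype α] in
theorem respects_one : Respects s 1 := fun a a' h => by
  by_contra h'
  exact h (Matrix.one_apply_ne fun h'' => h' (congrArg s h''))

omit [DecidableEq α] in
theorem Respects.mul {c c' : Matrix α α ℂ} (h : Respects s c) (h' : Respects s c') :
    Respects s (c * c') := fun a a' h0 => by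
  obtain ⟨a'', _, h1⟩ := Finset.exists_ne_zero_of_sum_ne_zero h0
  exact (h _ _ (left_ne_zero_of_mul h1)).trans (h' _ _ (right_ne_zero_of_mul h1))

omit [DecidableEq α] in
theorem blockOp_mulVec {c : Matrix α α ℂ} (hc : Respects s c) (a : α) (x : ℕ) :
    (D.blockOp c).mulVec ((A ^ x).mulVec (D.v a)) =
      ∑ a', c a' a • (A ^ x).mulVec (D.v a') := by
  by_cases hx : x < s a
  · have h1 : (A ^ x).mulVec (D.v a) = D.basis ⟨a, ⟨x, hx⟩⟩ :=
      (D.basis_apply ⟨a, ⟨x, hx⟩⟩).symm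
    rw [h1, ← Matrix.toLin'_apply]
    show Matrix.toLin' (LinearMap.toMatrix' _) _ = _
    rw [Matrix.toLin'_toMatrix', Module.Basis.constr_basis]
  · rw [D.pow_mulVec_eq_zero (not_lt.1 hx), Matrix.mulVec_zero, Finset.sum_eq_zero]
    intro a' _
    by_cases h0 : c a' a = 0
    · rw [h0, zero_smul]
    · rw [D.pow_mulVec_eq_zero ((hc _ _ h0).trans_le (not_lt.1 hx)), smul_zero]

omit [DecidableEq α] in
theorem commute_blockOp {c : Matrix α α ℂ} (hc : Respects s c) : Commute A (D.blockOp c) := by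
  refine D.ext_mulVec fun a x => ?_
  rw [← Matrix.mulVec_mulVec, ← Matrix.mulVec_mulVec, D.blockOp_mulVec hc, Matrix.mulVec_sum,
    Matrix.mulVec_mulVec _ A, ← pow_succ', D.blockOp_mulVec hc]
  exact Finset.sum_congr rfl fun a' _ => by
    rw [Matrix.mulVec_smul, Matrix.mulVec_mulVec, ← pow_succ']

omit [DecidableEq α] in
theorem blockOp_mul {c c' : Matrix α α ℂ} (hc : Respects s c) (hc' : Respects s c') :
    D.blockOp (c * c') = D.blockOp c * D.blockOp c' := by
  refine D.ext_mulVec fun a x => ?_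
  rw [D.blockOp_mulVec (hc.mul hc'), ← Matrix.mulVec_mulVec, D.blockOp_mulVec hc',
    Matrix.mulVec_sum]
  simp only [Matrix.mulVec_smul, D.blockOp_mulVec hc, Finset.smul_sum, smul_smul]
  rw [Finset.sum_comm]
  refine Finset.sum_congr rfl fun a' _ => ?_
  rw [← Finset.sum_smul, Matrix.mul_apply]
  exact congrArg₂ _ (Finset.sum_congr rfl fun _ _ => mul_comm _ _) rfl

theorem blockOp_one : D.blockOp 1 = 1 := by
  refine D.ext_mulVec fun a x => ?_
  rw [D.blockOp_mulVec respects_one, Matrix.one_mulVec, Finset.sum_eq_single a]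
  · simp
  · intro a' _ h
    simp [Matrix.one_apply_ne h]
  · simp

include D in
omit [Fintype α] [DecidableEq α] in
theorem eq_of_dotProduct {Z Z' : Matrix ι ι ℂ} (h : ∀ a a' x y,
    dotProduct ((A ^ x).mulVec (D.v a)) (Z.mulVec ((A ^ y).mulVec (D.v a'))) =
      dotProduct ((A ^ x).mulVec (D.v a)) (Z'.mulVec ((A ^ y).mulVec (D.v a')))) : Z = Z' := by
  refine (Matrix.toLinearMap₂' ℂ).injective (LinearMap.ext_basis D.basis D.basis fun p q => ?_)
  rw [Matrix.toLinearMap₂'_apply', Matrix.toLinearMap₂'_apply', D.basis_apply, D.basis_apply]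
  exact h _ _ _ _

omit [DecidableEq α] in
/-- The adjoint of `blockOp c` for a form whose Gram matrix in the Jordan basis is determined by the
matrix `G`. -/
theorem transpose_blockOp_mul {J : Matrix ι ι ℂ} {G c : Matrix α α ℂ}
    (hgram : ∀ a a' x y, dotProduct ((A ^ x).mulVec (D.v a))
      (J.mulVec ((A ^ y).mulVec (D.v a'))) = if x + y + 1 = s a then G a a' else 0)
    (hc : Respects s c) {η : ℂ} (hη : c.transpose * G = η • (G * c)) :
    (D.blockOp c).transpose * J = η • (J * D.blockOp c) := by
  refine D.eq_of_dotProduct fun a a' x y => ?_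
  have h1 : ∀ X Z : Matrix ι ι ℂ, ∀ y z : ι → ℂ,
      dotProduct y ((X.transpose * Z).mulVec z) = dotProduct (X.mulVec y) (Z.mulVec z) := by
    intro X Z y z
    rw [← Matrix.mulVec_mulVec, Matrix.dotProduct_mulVec, Matrix.vecMul_transpose]
  rw [h1, D.blockOp_mulVec hc, Matrix.smul_mulVec, dotProduct_smul, ← Matrix.mulVec_mulVec,
    D.blockOp_mulVec hc, Matrix.mulVec_sum, dotProduct_sum, sum_dotProduct]
  simp only [Matrix.mulVec_smul, dotProduct_smul, smul_dotProduct, hgram, smul_eq_mul]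
  have h2 : ∀ b, c b a * (if x + y + 1 = s b then G b a' else 0) =
      if x + y + 1 = s a then c.transpose a b * G b a' else 0 := by
    intro b
    by_cases h0 : c b a = 0
    · simp [h0]
    · rw [hc _ _ h0, mul_ite, mul_zero, Matrix.transpose_apply]
  have h3 : ∀ b, c b a' * (if x + y + 1 = s a then G a b else 0) =
      if x + y + 1 = s a then G a b * c b a' else 0 := by
    intro b
    rw [mul_ite, mul_zero, mul_comm]
  simp only [h2, h3]
  split_ifs with h
  · exact congrFun (congrFun hη a) a'
  · simp

end CyclicBasis

end Jordan

section Adapted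

open scoped Kronecker

variable {ι : Type*} [Fintype ι] [DecidableEq ι] {k d : ℕ} {parts : Fin k → ℕ}
  {A : Matrix ι ι ℂ}

namespace CyclicBasis

theorem Respects.kronecker {m : Matrix (Fin k) (Fin k) ℂ} (hm : Respects parts m)
    (w : Matrix (Fin d) (Fin d) ℂ) :
    Respects (fun a : Fin k × Fin d => parts a.1) (m ⊗ₖ w) := fun _ _ h =>
  hm _ _ (left_ne_zero_of_mul h)

theorem respects_single {i j : Fin k} (h : parts i = parts j) (z : ℂ) :
    Respects parts (Matrix.single i j z) := by
  intro a a' h0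
  rw [Matrix.single_apply] at h0
  obtain ⟨rfl, rfl⟩ := (ite_ne_right_iff.1 h0).1
  exact h

variable (D : CyclicBasis A fun a : Fin k × Fin d => parts a.1)

/-- The action on the Jordan blocks, up to the multiplicity `d`. -/
noncomputable def blockMap : Matrix (Fin k) (Fin k) ℂ →ₗ[ℂ] Matrix ι ι ℂ where
  toFun m := D.blockOp (m ⊗ₖ 1)
  map_add' m m' := by rw [Matrix.add_kronecker, map_add]
  map_smul' c m := by rw [Matrix.smul_kronecker, map_smul, RingHom.id_apply]

theorem blockMap_mul {m m' : Matrix (Fin k) (Fin k) ℂ} (h : Respects parts m)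
    (h' : Respects parts m') : D.blockMap (m * m') = D.blockMap m * D.blockMap m' := by
  show D.blockOp _ = D.blockOp _ * D.blockOp _
  rw [← D.blockOp_mul (h.kronecker 1) (h'.kronecker 1), ← Matrix.mul_kronecker_mul, one_mul]

theorem blockMap_one : D.blockMap 1 = 1 := by
  show D.blockOp (1 ⊗ₖ 1) = 1
  rw [Matrix.one_kronecker_one, D.blockOp_one]

theorem commute_blockMap {m : Matrix (Fin k) (Fin k) ℂ} (h : Respects parts m) :
    Commute A (D.blockMap m) := D.commute_blockOp (h.kronecker 1)

theorem blockMap_single_mulVec (i : Fin k) (a : Fin k × Fin d) (x : ℕ) :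
    (D.blockMap (Matrix.single i i 1)).mulVec ((A ^ x).mulVec (D.v a)) =
      if a.1 = i then (A ^ x).mulVec (D.v a) else 0 := by
  show (D.blockOp _).mulVec _ = _
  rw [D.blockOp_mulVec ((respects_single rfl 1).kronecker 1), Finset.sum_eq_single a]
  · rw [Matrix.kroneckerMap_apply, Matrix.one_apply_eq, mul_one, Matrix.single_apply]
    by_cases h : a.1 = i
    · simp [h]
    · simp [h, Ne.symm h]
  · intro a' _ ha
    rw [Matrix.kroneckerMap_apply, Matrix.single_apply]
    by_cases h : i = a'.1 ∧ i = a.1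
    · rw [Matrix.one_apply_ne fun h' => ha (Prod.ext (h.1.symm.trans h.2) h'), mul_zero, zero_smul]
    · rw [if_neg h, zero_mul, zero_smul]
  · simp

theorem blockMap_single_mul_single {i j : Fin k} (h : parts i = parts j) {i' j' : Fin k}
    (h' : parts i' = parts j') :
    D.blockMap (Matrix.single i j 1) * D.blockMap (Matrix.single i' j' 1) =
      if j = i' then D.blockMap (Matrix.single i j' 1) else 0 := by
  rw [← D.blockMap_mul (respects_single h 1) (respects_single h' 1)]
  split_ifs with hj
  · subst hj
    rw [Matrix.single_mul_single_same, mul_one]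
  · rw [Matrix.single_mul_single_of_ne _ _ _ _ hj, map_zero]

theorem trace_blockMap_single (i : Fin k) :
    (D.blockMap (Matrix.single i i 1)).trace = (d * parts i : ℕ) := by
  rw [← Matrix.trace_toLin'_eq, LinearMap.trace_eq_matrix_trace ℂ D.basis, Matrix.trace]
  have h : ∀ p, (LinearMap.toMatrix D.basis D.basis
      (Matrix.toLin' (D.blockMap (Matrix.single i i 1)))).diag p = if p.1.1 = i then 1 else 0 := by
    intro p
    rw [Matrix.diag_apply, LinearMap.toMatrix_apply, Matrix.toLin'_apply, D.basis_apply,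
      D.blockMap_single_mulVec, ← D.basis_apply]
    split_ifs <;> simp
  rw [Finset.sum_congr rfl fun p _ => h p, Fintype.sum_sigma, Fintype.sum_prod_type,
    Finset.sum_eq_single i]
  · simp
  · intro j _ hj
    simp [hj]
  · simp

/-- A Jordan basis gives adapted data, provided that the projections to the blocks are self-adjoint
and the infinitesimal rotations of the blocks are skew-adjoint. -/
noncomputable def adaptedData (P : SymmetricPair ι)
    (D : CyclicBasis A fun a : Fin k × Fin P.d => parts a.1) (hA : A ∈ P.S)
    (hpos : ∀ i, 0 < parts i) (hS : ∀ i, D.blockMap (Matrix.single i i 1) ∈ P.S)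
    (hlie : ∀ i j, parts i = parts j →
      D.blockMap (Matrix.single j i 1 - Matrix.single i j 1) ∈ P.lie) :
    AdaptedData P parts A where
  mem := hA
  nilpotent := D.isNilpotent
  pos := hpos
  finrank_ker := by
    have := D.finrank_ker_le fun a => hpos a.1
    rwa [Fintype.card_prod, Fintype.card_fin, Fintype.card_fin, mul_comm] at this
  e i := D.blockMap (Matrix.single i i 1)
  v i a := D.v (i, a)
  mul_eq i j := by
    rw [D.blockMap_single_mul_single rfl rfl]
    split_ifs with h
    · rw [h]
    · rfl
  sum_eq := by
    rw [← map_sum, ← D.blockMap_one]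
    congr 1
    ext a b
    rw [Matrix.sum_apply, Finset.sum_eq_single a]
    · simp [Matrix.single_apply, Matrix.one_apply]
    · intro i _ hi
      simp [hi]
    · simp
  e_mem := hS
  e_comm i := D.commute_blockMap (respects_single rfl 1)
  rank_e i := by
    have h := trace_eq_rank_of_idem (e := D.blockMap (Matrix.single i i 1)) (by
      rw [D.blockMap_single_mul_single rfl rfl, if_pos rfl])
    rw [D.trace_blockMap_single] at h
    exact_mod_cast h.symm
  e_mulVec i a := by
    have := D.blockMap_single_mulVec i (i, a) 0
    simpa using this
  linearIndependent := by
    have := D.basis.linearIndependent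
    rwa [show (D.basis : _ → ι → ℂ) = _ from funext D.basis_apply] at this
  swap i j hij h := by
    refine ⟨_, hlie i j h, ?_, ?_, ?_, ?_, fun l hi hj => ?_⟩
    · rw [map_sub]
      exact (D.commute_blockMap (respects_single h.symm 1)).sub_right
        (D.commute_blockMap (respects_single h 1))
    · simp only [map_sub, sub_mul, mul_sub, D.blockMap_single_mul_single h h,
        D.blockMap_single_mul_single h h.symm, D.blockMap_single_mul_single h.symm h,
        D.blockMap_single_mul_single h.symm h.symm, hij, hij.symm, if_true, if_false]
      abel
    · simp only [map_sub, sub_mul, mul_sub, D.blockMap_single_mul_single h rfl,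
        D.blockMap_single_mul_single h.symm rfl, D.blockMap_single_mul_single rfl h,
        D.blockMap_single_mul_single rfl h.symm, hij.symm, if_true, if_false]
    · simp only [map_sub, sub_mul, mul_sub, D.blockMap_single_mul_single h rfl,
        D.blockMap_single_mul_single h.symm rfl, D.blockMap_single_mul_single rfl h,
        D.blockMap_single_mul_single rfl h.symm, hij, if_true, if_false]
    · simp only [map_sub, sub_mul, mul_sub, D.blockMap_single_mul_single h rfl,
        D.blockMap_single_mul_single h.symm rfl, D.blockMap_single_mul_single rfl h,
        D.blockMap_single_mul_single rfl h.symm, hi, hj, hi.symm, hj.symm, if_false, sub_self,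
        and_self]

end CyclicBasis

end Adapted

/-! ### Normal forms of bilinear forms on Jordan bases -/

section SquareRoot

open Polynomial

variable {ι : Type*} [Fintype ι] [DecidableEq ι]

/-- An invertible matrix has a square root that is a polynomial in it: choose square roots of the
eigenvalues, and correct the nilpotent error with Newton's method. -/
theorem exists_aeval_mul_aeval_eq {h : Matrix ι ι ℂ} (hh : IsUnit h.det) :
    ∃ p : ℂ[X], aeval h p * aeval h p = h := by
  obtain ⟨u, m, hu, hm, hroots⟩ := exists_hasRoots_of_ncard (B := h) rfl
  have hspec := hroots.spectrum_eq hm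
  have hu0 : ∀ i, u i ≠ 0 := fun i h0 => by
    have h1 : u i ∈ spectrum ℂ h := hspec ▸ Set.mem_range_self i
    rw [h0, spectrum.zero_mem_iff] at h1
    exact h1 ((Matrix.isUnit_iff_isUnit_det _).2 hh)
  let q := Lagrange.interpolate Finset.univ u fun i => (u i) ^ (2⁻¹ : ℂ)
  have hq : ∀ i, q.eval (u i) ^ 2 = u i := fun i => by
    rw [Lagrange.eval_interpolate_at_node _ hu.injOn (Finset.mem_univ i)]
    exact_mod_cast Complex.cpow_nat_inv_pow (u i) two_ne_zero
  let y := AdjoinRoot.root h.charpoly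
  let x := AdjoinRoot.mk h.charpoly q
  have hnil : IsNilpotent (aeval x (X ^ 2 - C y)) := by
    refine ⟨Fintype.card ι, ?_⟩
    have h1 : aeval x (X ^ 2 - C y) = AdjoinRoot.mk h.charpoly (q ^ 2 - X) := by
      simp [x, y]
    rw [h1, ← map_pow, AdjoinRoot.mk_eq_zero, hroots]
    have h2 : ∏ i, (X - C (u i)) ∣ q ^ 2 - X := by
      refine Finset.prod_dvd_of_coprime (fun i _ j _ hij =>
        pairwise_coprime_X_sub_C hu hij) fun i _ => ?_
      rw [dvd_iff_isRoot, IsRoot, eval_sub, eval_pow, hq, eval_X, sub_self]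
    refine dvd_trans ?_ (pow_dvd_pow_of_dvd h2 _)
    rw [← Finset.prod_pow]
    refine Finset.prod_dvd_prod_of_dvd _ _ fun i _ => pow_dvd_pow _ ?_
    rw [← hroots.sum_eq]
    exact Finset.single_le_sum (fun i _ => Nat.zero_le (m i)) (Finset.mem_univ i)
  have hunit : IsUnit (aeval x (derivative (X ^ 2 - C y))) := by
    have h1 : aeval x (derivative (X ^ 2 - C y)) = 2 * x := by
      simp [one_add_one_eq_two]
    have h2 : IsUnit x := by
      have h3 : IsCoprime q h.charpoly := by
        rw [hroots]
        refine IsCoprime.prod_right fun i _ => IsCoprime.pow_right ?_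
        refine IsCoprime.symm (((irreducible_X_sub_C (u i)).coprime_iff_not_dvd).2 fun h3 => ?_)
        have h4 := hq i
        rw [dvd_iff_isRoot.1 h3] at h4
        exact hu0 i (by rw [← h4]; simp)
      obtain ⟨a, b, hab⟩ := h3
      have h4 := congrArg (AdjoinRoot.mk h.charpoly) hab
      rw [map_add, map_mul, map_mul, AdjoinRoot.mk_self, mul_zero, add_zero, map_one] at h4
      exact IsUnit.of_mul_eq_one_right _ h4
    rw [h1]
    refine IsUnit.mul ?_ h2
    have h5 : IsUnit (algebraMap ℂ (AdjoinRoot h.charpoly) 2) :=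
      (isUnit_iff_ne_zero.2 two_ne_zero).map _
    rwa [map_ofNat] at h5
  obtain ⟨r, ⟨-, hr⟩, -⟩ := existsUnique_nilpotent_sub_and_aeval_eq_zero hnil hunit
  obtain ⟨p, rfl⟩ := AdjoinRoot.mk_surjective r
  refine ⟨p, ?_⟩
  have h1 : AdjoinRoot.mk h.charpoly (p ^ 2 - X) = 0 := by
    rw [← hr]
    simp [y]
  obtain ⟨c, hc⟩ := AdjoinRoot.mk_eq_zero.1 h1
  have h2 := congrArg (aeval h) hc
  rw [map_mul, Matrix.aeval_self_charpoly, zero_mul, map_sub, map_pow, aeval_X, sub_eq_zero, sq]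
    at h2
  exact h2

end SquareRoot

section Gram

theorem transpose_aeval_mul {ι : Type*} [Fintype ι] [DecidableEq ι] {h J : Matrix ι ι ℂ}
    (hJ : h.transpose * J = J * h) (p : Polynomial ℂ) :
    (Polynomial.aeval h p).transpose * J = J * Polynomial.aeval h p := by
  induction p using Polynomial.induction_on' with
  | add p q hp hq => rw [map_add, Matrix.transpose_add, add_mul, mul_add, hp, hq]
  | monomial n a =>
    have h1 : J * h ^ n = h.transpose ^ n * J := SemiconjBy.pow_right hJ.symm n
    rw [Polynomial.aeval_monomial, ← Algebra.smul_def, Matrix.transpose_smul,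
      Matrix.transpose_pow, smul_mul_assoc, mul_smul_comm, h1]

theorem commute_aeval {ι : Type*} [Fintype ι] [DecidableEq ι] {A h : Matrix ι ι ℂ}
    (hA : Commute A h) (p : Polynomial ℂ) : Commute A (Polynomial.aeval h p) := by
  induction p using Polynomial.induction_on' with
  | add p q hp hq => rw [map_add]; exact hp.add_right hq
  | monomial n a =>
    rw [Polynomial.aeval_monomial, ← Algebra.smul_def]
    exact (hA.pow_right n).smul_right a

open scoped Kronecker

variable {ι : Type*} [Fintype ι] [DecidableEq ι] {k d : ℕ} {parts : Fin k → ℕ}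
  {A : Matrix ι ι ℂ}

namespace CyclicBasis

variable (D : CyclicBasis A fun a : Fin k × Fin d => parts a.1)

/-- The Gram matrix of the standard form on a Jordan basis, which pairs the `x`-th vector of each
block with the `x`-th vector from the end. -/
def stdGram (parts : Fin k → ℕ) (w : Matrix (Fin d) (Fin d) ℂ) :
    Matrix (Σ a : Fin k × Fin d, Fin (parts a.1)) (Σ a : Fin k × Fin d, Fin (parts a.1)) ℂ :=
  fun p q => if (p.2 : ℕ) + q.2 + 1 = parts p.1.1 then ((1 : Matrix (Fin k) (Fin k) ℂ) ⊗ₖ w)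
    p.1 q.1 else 0

theorem stdGram_apply (w : Matrix (Fin d) (Fin d) ℂ) {i j : Fin k} (a b : Fin d)
    (x : Fin (parts i)) (y : Fin (parts j)) :
    stdGram parts w ⟨(i, a), x⟩ ⟨(j, b), y⟩ =
      if (x : ℕ) + y + 1 = parts i ∧ i = j then w a b else 0 := by
  rw [stdGram, Matrix.kroneckerMap_apply, Matrix.one_apply, ite_and, ite_mul, one_mul, zero_mul]

/-- The standard Gram matrix is orthogonal if `w` is. -/
theorem stdGram_transpose_mul {w : Matrix (Fin d) (Fin d) ℂ} (hw : w.transpose * w = 1) :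
    (stdGram parts w).transpose * stdGram parts w = 1 := by
  ext ⟨⟨i, b⟩, x⟩ ⟨⟨i', b'⟩, x'⟩
  change Fin (parts i) at x
  change Fin (parts i') at x'
  have hx := x.2
  have h1 : ∀ (a : Fin d), ∑ z : Fin (parts i), (stdGram parts w).transpose ⟨(i, b), x⟩
      ⟨(i, a), z⟩ * stdGram parts w ⟨(i, a), z⟩ ⟨(i', b'), x'⟩ =
        if i = i' ∧ (x : ℕ) = x' then w.transpose b a * w a b' else 0 := by
    intro a
    rw [Finset.sum_eq_single (Fin.rev x)]
    · rw [Matrix.transpose_apply, stdGram_apply, stdGram_apply, Fin.val_rev, if_pos ⟨by omega, rfl⟩,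
        mul_ite, mul_zero, Matrix.transpose_apply]
      refine if_congr ⟨fun h => ⟨h.2, by omega⟩, fun h => ⟨by omega, h.1⟩⟩ rfl rfl
    · intro z _ hz
      rw [Matrix.transpose_apply, stdGram_apply, if_neg, zero_mul]
      rintro ⟨h, -⟩
      refine hz (Fin.ext ?_)
      rw [Fin.val_rev]
      omega
    · simp
  rw [Matrix.mul_apply, Fintype.sum_sigma, Fintype.sum_prod_type, Finset.sum_eq_single i]
  · refine (Finset.sum_congr rfl fun a _ => h1 a).trans ?_
    by_cases h : i = i' ∧ (x : ℕ) = x'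
    · obtain ⟨rfl, hx⟩ := h
      obtain rfl := Fin.ext hx
      simp only [and_self, if_true, ← Matrix.mul_apply, hw]
      by_cases hb : b = b'
      · subst hb; simp
      · rw [Matrix.one_apply_ne hb, Matrix.one_apply_ne fun h => hb ?_]
        exact congrArg (fun p => p.1.2) h
    · simp only [h, if_false, Finset.sum_const_zero]
      rw [Matrix.one_apply_ne]
      intro h'
      obtain ⟨h1, h2⟩ := Sigma.mk.inj_iff.1 h'
      obtain ⟨rfl, rfl⟩ := Prod.mk_inj.1 h1
      exact h ⟨rfl, congrArg Fin.val (eq_of_heq h2)⟩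
  · intro j _ hj
    refine Finset.sum_eq_zero fun a _ => Finset.sum_eq_zero fun z _ => ?_
    have h2 := stdGram_apply w a b z x
    rw [if_neg fun h => hj h.2] at h2
    rw [Matrix.transpose_apply, h2, zero_mul]
  · simp

/-- The form that has the standard Gram matrix with respect to the Jordan basis `D`. -/
theorem exists_stdForm {w : Matrix (Fin d) (Fin d) ℂ} (hw : w.transpose * w = 1) :
    ∃ J₀ : Matrix ι ι ℂ, IsUnit J₀.det ∧ ∀ a a' x y, dotProduct ((A ^ x).mulVec (D.v a))
      (J₀.mulVec ((A ^ y).mulVec (D.v a'))) =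
        if x + y + 1 = parts a.1 then ((1 : Matrix (Fin k) (Fin k) ℂ) ⊗ₖ w) a a' else 0 := by
  let R := LinearMap.toMatrix' D.basis.equivFun.toLinearMap
  let R' := LinearMap.toMatrix' D.basis.equivFun.symm.toLinearMap
  have hRR : R' * R = 1 := by
    rw [← LinearMap.toMatrix'_comp, LinearEquiv.comp_coe, LinearEquiv.self_trans_symm]
    exact LinearMap.toMatrix'_id
  have hRR' : R * R' = 1 := by
    rw [← LinearMap.toMatrix'_comp, LinearEquiv.comp_coe, LinearEquiv.symm_trans_self]
    exact LinearMap.toMatrix'_id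
  have hR : ∀ p, R.mulVec (D.basis p) = Pi.single p 1 := by
    intro p
    rw [LinearMap.toMatrix'_mulVec]
    ext q
    rw [LinearEquiv.coe_coe, D.basis.equivFun_self, Pi.single_apply]
    exact if_congr eq_comm rfl rfl
  refine ⟨R.transpose * stdGram parts w * R, ?_, fun a a' x y => ?_⟩
  · refine Matrix.isUnit_det_of_left_inverse
      (B := R' * (stdGram parts w).transpose * R'.transpose) ?_
    calc R' * (stdGram parts w).transpose * R'.transpose * (R.transpose * stdGram parts w * R)
        = R' * (stdGram parts w).transpose * (R * R').transpose * stdGram parts w * R := by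
          rw [Matrix.transpose_mul]; simp only [Matrix.mul_assoc]
      _ = R' * ((stdGram parts w).transpose * stdGram parts w) * R := by
          rw [hRR', Matrix.transpose_one, Matrix.mul_one]; simp only [Matrix.mul_assoc]
      _ = 1 := by rw [stdGram_transpose_mul hw, Matrix.mul_one, hRR]
  · by_cases hx : x < parts a.1
    · by_cases hy : y < parts a'.1
      · have h1 : (A ^ x).mulVec (D.v a) = D.basis ⟨a, ⟨x, hx⟩⟩ :=
          (D.basis_apply ⟨a, ⟨x, hx⟩⟩).symm
        have h2 : (A ^ y).mulVec (D.v a') = D.basis ⟨a', ⟨y, hy⟩⟩ :=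
          (D.basis_apply ⟨a', ⟨y, hy⟩⟩).symm
        rw [h1, h2, ← Matrix.mulVec_mulVec, ← Matrix.mulVec_mulVec, hR,
          Matrix.dotProduct_mulVec, Matrix.vecMul_transpose, hR]
        simp [stdGram]
      · rw [D.pow_mulVec_eq_zero (not_lt.1 hy), Matrix.mulVec_zero, dotProduct_zero]
        split_ifs with h
        · have h3 : a.1 ≠ a'.1 := fun h3 => by rw [h3] at h; omega
          rw [Matrix.kroneckerMap_apply, Matrix.one_apply_ne h3, zero_mul]
        · rfl
    · rw [D.pow_mulVec_eq_zero (not_lt.1 hx), zero_dotProduct, if_neg]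
      omega

/-- The image of a Jordan basis under an invertible matrix that commutes with `A`. -/
noncomputable def mapCommute {g : Matrix ι ι ℂ} (hg : IsUnit g) (hA : Commute A g) :
    CyclicBasis A fun a : Fin k × Fin d => parts a.1 where
  v a := g.mulVec (D.v a)
  basis := D.basis.map (LinearEquiv.ofBijective g.mulVecLin
    ⟨Matrix.mulVec_injective_iff_isUnit.2 hg, Matrix.mulVec_surjective_iff_isUnit.2 hg⟩)
  basis_apply p := by
    show g.mulVec (D.basis p) = _
    rw [D.basis_apply, Matrix.mulVec_mulVec, Matrix.mulVec_mulVec, (hA.pow_left _).eq]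
  pow_mulVec a := by
    rw [Matrix.mulVec_mulVec, (hA.pow_left _).eq, ← Matrix.mulVec_mulVec, D.pow_mulVec,
      Matrix.mulVec_zero]

include D in
/-- Every form `J` for which `A` is self-adjoint has the standard Gram matrix in some Jordan basis.
If `J₀` is the form that is standard in a given Jordan basis, then `h = J⁻¹ * J₀` commutes with `A`
and is self-adjoint for `J`. A square root `g` of `h` that is a polynomial in `h` inherits both
properties, and satisfies `gᵀ * J * g = J * h = J₀`: it maps the given basis to the desired one. -/
theorem exists_gram_eq {J : Matrix ι ι ℂ} (hJ : IsUnit J.det) {η : ℂ} (hη : η * η = 1)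
    (hJη : J.transpose = η • J) (hAJ : A.transpose * J = J * A) {w : Matrix (Fin d) (Fin d) ℂ}
    (hw : w.transpose * w = 1) (hwη : w.transpose = η • w) :
    ∃ D' : CyclicBasis A fun a : Fin k × Fin d => parts a.1,
      ∀ a a' x y, dotProduct ((A ^ x).mulVec (D'.v a))
      (J.mulVec ((A ^ y).mulVec (D'.v a'))) =
        if x + y + 1 = parts a.1 then ((1 : Matrix (Fin k) (Fin k) ℂ) ⊗ₖ w) a a' else 0 := by
  obtain ⟨J₀, hJ₀, hgram⟩ := D.exists_stdForm hw
  have hdot : ∀ (X : Matrix ι ι ℂ) (y z : ι → ℂ), dotProduct y (X.transpose.mulVec z) =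
      dotProduct (X.mulVec y) z := fun X y z => by
    rw [Matrix.dotProduct_mulVec, Matrix.vecMul_transpose]
  have hG : ∀ a a', ((1 : Matrix (Fin k) (Fin k) ℂ) ⊗ₖ w) a' a =
      η * ((1 : Matrix (Fin k) (Fin k) ℂ) ⊗ₖ w) a a' := by
    intro a a'
    have h1 : w a'.2 a.2 = η * w a.2 a'.2 := congrFun (congrFun hwη a.2) a'.2
    rw [Matrix.kroneckerMap_apply, Matrix.kroneckerMap_apply, h1, Matrix.one_apply,
      Matrix.one_apply]
    by_cases h : a.1 = a'.1
    · simp [h]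
    · simp [h, Ne.symm h]
  have hJ₀η : J₀.transpose = η • J₀ := by
    refine D.eq_of_dotProduct fun a a' x y => ?_
    rw [hdot, dotProduct_comm, hgram, Matrix.smul_mulVec, dotProduct_smul, hgram, hG a a',
      smul_eq_mul, mul_ite, mul_zero]
    by_cases h : a.1 = a'.1
    · rw [h, add_comm y x]
    · rw [Matrix.kroneckerMap_apply, Matrix.one_apply_ne h]
      simp
  have hAJ₀ : A.transpose * J₀ = J₀ * A := by
    refine D.eq_of_dotProduct fun a a' x y => ?_
    rw [← Matrix.mulVec_mulVec, hdot, ← Matrix.mulVec_mulVec, Matrix.mulVec_mulVec _ A,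
      Matrix.mulVec_mulVec _ A, ← pow_succ', ← pow_succ', hgram, hgram, add_right_comm x 1 y,
      add_assoc x y 1]
  let h := J⁻¹ * J₀
  have hJh : J * h = J₀ := Matrix.mul_nonsing_inv_cancel_left _ _ hJ
  have hh : IsUnit h.det := by
    rw [Matrix.det_mul]
    exact (Matrix.isUnit_nonsing_inv_det _ hJ).mul hJ₀
  have hunit : IsUnit J := (Matrix.isUnit_iff_isUnit_det _).2 hJ
  have hAh : Commute A h := by
    refine hunit.mul_left_cancel ?_
    rw [← mul_assoc, ← hAJ, mul_assoc, hJh, hAJ₀, ← mul_assoc, hJh]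
  have hhJ : h.transpose * J = J * h := by
    have h1 := congrArg Matrix.transpose hJh
    rw [Matrix.transpose_mul, hJη, hJ₀η, mul_smul_comm] at h1
    have h2 := congrArg (fun M => η • M) h1
    simp only [smul_smul, hη, one_smul] at h2
    rw [h2, hJh]
  obtain ⟨p, hp⟩ := exists_aeval_mul_aeval_eq hh
  set g := Polynomial.aeval h p
  have hgJ : g.transpose * J = J * g :=
    transpose_aeval_mul hhJ p
  have hAg : Commute A g := commute_aeval hAh p
  have hg : IsUnit g := by
    rw [Matrix.isUnit_iff_isUnit_det]
    have h1 := congrArg Matrix.det hp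
    rw [Matrix.det_mul] at h1
    exact isUnit_of_mul_isUnit_left (h1 ▸ hh)
  refine ⟨D.mapCommute hg hAg, fun a a' x y => ?_⟩
  rw [← hgram]
  show dotProduct ((A ^ x).mulVec (g.mulVec (D.v a))) (J.mulVec ((A ^ y).mulVec
    (g.mulVec (D.v a')))) = _
  have h1 : ∀ n b, (A ^ n).mulVec (g.mulVec (D.v b)) = g.mulVec ((A ^ n).mulVec (D.v b)) :=
    fun n b => by rw [Matrix.mulVec_mulVec, (hAg.pow_left n).eq, ← Matrix.mulVec_mulVec]
  rw [h1, h1, ← hdot, Matrix.mulVec_mulVec, Matrix.mulVec_mulVec, hgJ, mul_assoc, hp,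
    hJh]

end CyclicBasis

end Gram

/-! ### Conormal spaces and Jordan bases adapted to a form -/

section Conormal

variable {ι : Type*} [Fintype ι] [DecidableEq ι]

open ComplexOrder in
/-- The conormals at `A` are the elements of `V` that commute with `A`: the form `tr (Xᴴ * X)` is
definite, and `𝔨` contains the conjugate transposes of the commutators. -/
theorem conormalSpace_eq (P : SymmetricPair ι) {V 𝔨 : Submodule ℂ (Matrix ι ι ℂ)}
    (hV : ∀ B, B ∈ V ↔ B ∈ P.S ∧ B.trace = 0)
    (h𝔨 : ∀ A ∈ P.S, ∀ B ∈ P.S, (A * B - B * A).conjTranspose ∈ 𝔨) {A : Matrix ι ι ℂ}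
    (hA : A ∈ P.S) : conormalSpace V 𝔨 A = P.conormal A := by
  have key : ∀ X B : Matrix ι ι ℂ,
      ((X * A - A * X) * B).trace = (X * (A * B - B * A)).trace := by
    intro X B
    rw [sub_mul, mul_sub, Matrix.trace_sub, Matrix.trace_sub, mul_assoc, mul_assoc A X B,
      Matrix.trace_mul_comm A, mul_assoc]
  ext B
  constructor
  · rintro ⟨hB, h⟩
    obtain ⟨hBS, htr⟩ := (hV B).1 hB
    have h1 := h _ (h𝔨 A hA B hBS)
    rw [key, Matrix.trace_conjTranspose_mul_self_eq_zero_iff, sub_eq_zero] at h1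
    exact ⟨hBS, h1, htr⟩
  · rintro ⟨hBS, hc, htr⟩
    refine ⟨(hV B).2 ⟨hBS, htr⟩, fun X _ => ?_⟩
    rw [key, hc.eq, sub_self, mul_zero, Matrix.trace_zero]

theorem conormalVariety_eq (P : SymmetricPair ι) {V 𝔨 : Submodule ℂ (Matrix ι ι ℂ)}
    (hV : ∀ B, B ∈ V ↔ B ∈ P.S ∧ B.trace = 0)
    (h𝔨 : ∀ A ∈ P.S, ∀ B ∈ P.S, (A * B - B * A).conjTranspose ∈ 𝔨) :
    conormalVariety V 𝔨 = AdaptedData.conormalPairs P := by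
  ext ⟨A, B⟩
  constructor
  · rintro ⟨hA, hn, hB⟩
    have hAS := ((hV A).1 hA).1
    exact ⟨hAS, hn, by rwa [conormalSpace_eq P hV h𝔨 hAS] at hB⟩
  · rintro ⟨hA, hn, hB⟩
    refine ⟨(hV A).2 ⟨hA, (Matrix.isNilpotent_trace_of_isNilpotent hn).eq_zero⟩, hn, ?_⟩
    rw [conormalSpace_eq P hV h𝔨 hA]
    exact hB

theorem distinctConormals_eq (P : SymmetricPair ι) {V 𝔨 : Submodule ℂ (Matrix ι ι ℂ)}
    (hV : ∀ B, B ∈ V ↔ B ∈ P.S ∧ B.trace = 0)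
    (h𝔨 : ∀ A ∈ P.S, ∀ B ∈ P.S, (A * B - B * A).conjTranspose ∈ 𝔨) {A : Matrix ι ι ℂ}
    (hA : A ∈ P.S) (k : ℕ) : distinctConormals V 𝔨 A k = P.distinct A k := by
  rw [distinctConormals, conormalSpace_eq P hV h𝔨 hA]
  rfl

/-- The assertions of the theorem, for any space `V` and Lie algebra `𝔨` that belong to a symmetric
pair, at a nilpotent element in normal form. -/
theorem AdaptedData.distinctConormals_properties {P : SymmetricPair ι}
    {V 𝔨 : Submodule ℂ (Matrix ι ι ℂ)}
    (hV : ∀ B, B ∈ V ↔ B ∈ P.S ∧ B.trace = 0)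
    (h𝔨 : ∀ A ∈ P.S, ∀ B ∈ P.S, (A * B - B * A).conjTranspose ∈ 𝔨) {A : Matrix ι ι ℂ} {k : ℕ}
    {parts : Fin k → ℕ} (D : AdaptedData P parts A) :
    IsZariskiOpenIn (distinctConormals V 𝔨 A k) (genericConormals V 𝔨 A) ∧
    IsPathConnected (distinctConormals V 𝔨 A k) ∧
    ∃ r : C(distinctConormals V 𝔨 A k, ColoredConfig parts),
      (∀ B u, r B = ColoredConfig.mk parts u ↔ IsColoredSpectrum P.d parts B.1 u) ∧
      (∀ ξ, Function.Surjective (FundamentalGroup.map r ξ)) ∧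
      (D.HasRotations → ∀ ξ, Function.Bijective (FundamentalGroup.map r ξ)) := by
  have hΛ := conormalVariety_eq P hV h𝔨
  rw [distinctConormals_eq P hV h𝔨 D.mem]
  refine ⟨⟨fun B hB => ?_, ?_⟩, D.isPathConnected_distinct, D.spectrumMap, fun B u => ?_,
    D.surjective_map_spectrumMap, D.bijective_map_spectrumMap⟩
  · rw [genericConormals, hΛ]
    exact D.isSmoothPoint_conormalPairs hB
  · obtain ⟨p, hp⟩ := D.exists_distinct_eq
    refine ⟨{p}, fun B hB => ?_⟩
    rw [genericConormals, hΛ] at hB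
    have hB' : B ∈ P.conormal A := hB.1.2.2
    rw [hp]
    simp only [Set.mem_singleton_iff, exists_eq_left]
    exact and_iff_right hB'
  · rw [D.spectrumMap_eq_iff, isColoredSpectrum_iff P.d_pos D.pos]

end Conormal

section Cases

open scoped Kronecker

variable {ι : Type*} [Fintype ι] [DecidableEq ι] {k : ℕ} {parts : Fin k → ℕ} {A : Matrix ι ι ℂ}

omit [DecidableEq ι] in
/-- The index of multiplicities is `Fin 1` if the blocks are not doubled. -/
theorem HasJordanType.prodUnique (h : HasJordanType A parts) :
    HasJordanType A fun a : Fin k × Fin 1 => parts a.1 := by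
  obtain ⟨b, h0, h1⟩ := h
  refine ⟨b.reindex
    { toFun := fun p => ⟨(p.1, 0), p.2⟩
      invFun := fun p => ⟨p.1.1, p.2⟩
      left_inv := fun _ => rfl
      right_inv := by
        rintro ⟨⟨i, a⟩, x⟩
        obtain rfl := Subsingleton.elim 0 a
        rfl }, fun a h => ?_, fun a j h => ?_⟩
  · rw [Module.Basis.reindex_apply]
    exact h0 a.1 h
  · rw [Module.Basis.reindex_apply, Module.Basis.reindex_apply]
    exact h1 a.1 j h

/-- A square root `j` of `-1` on the multiplicity space `ℂᵈ` acts on each block as a rotation. -/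
theorem CyclicBasis.hasRotations (P : SymmetricPair ι)
    (D : CyclicBasis A fun a : Fin k × Fin P.d => parts a.1) (hA : A ∈ P.S)
    (hpos : ∀ i, 0 < parts i) (hS : ∀ i, D.blockMap (Matrix.single i i 1) ∈ P.S)
    (hlie : ∀ i j, parts i = parts j →
      D.blockMap (Matrix.single j i 1 - Matrix.single i j 1) ∈ P.lie)
    {j : Matrix (Fin P.d) (Fin P.d) ℂ} (hj : j * j = -1)
    (hrot : ∀ i, D.blockOp (Matrix.single i i 1 ⊗ₖ j) ∈ P.lie) :
    (D.adaptedData P hA hpos hS hlie).HasRotations := by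
  have hr : ∀ i : Fin k, Respects parts (Matrix.single i i 1) := fun i => respects_single rfl 1
  have hm : ∀ (i : Fin k) (w w' : Matrix (Fin P.d) (Fin P.d) ℂ),
      D.blockOp (Matrix.single i i 1 ⊗ₖ w) * D.blockOp (Matrix.single i i 1 ⊗ₖ w') =
        D.blockOp (Matrix.single i i 1 ⊗ₖ (w * w')) := by
    intro i w w'
    rw [← D.blockOp_mul ((hr i).kronecker w) ((hr i).kronecker w'), ← Matrix.mul_kronecker_mul,
      Matrix.single_mul_single_same, mul_one]
  intro i
  refine ⟨_, hrot i, D.commute_blockOp ((hr i).kronecker j), ?_, ?_, ?_⟩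
  · exact (hm i 1 j).trans (by rw [one_mul])
  · exact (hm i j 1).trans (by rw [mul_one])
  · rw [hm, hj, ← neg_one_smul ℂ (1 : Matrix (Fin P.d) (Fin P.d) ℂ), Matrix.kronecker_smul, map_smul,
      neg_one_smul]
    rfl

/-- Here the rotations of the blocks are the multiples of the projections by `√-1`. -/
theorem exists_adaptedData_generalLinear (h : HasJordanType A parts) (hpos : ∀ i, 0 < parts i) :
    ∃ D : AdaptedData (generalLinearPair ι) parts A, D.HasRotations := by
  obtain ⟨D⟩ := h.prodUnique.nonempty_cyclicBasis
  refine ⟨_, CyclicBasis.hasRotations (generalLinearPair ι) D trivial hpos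
    (fun _ => trivial) (fun _ _ _ => trivial) (j := Complex.I • 1) ?_ fun _ => trivial⟩
  rw [smul_mul_smul_comm, Complex.I_mul_I, one_mul, neg_one_smul]

theorem CyclicBasis.Respects.sub {m m' : Matrix (Fin k) (Fin k) ℂ} (h : Respects parts m)
    (h' : Respects parts m') : Respects parts (m - m') := fun a a' h0 => by
  by_contra hne
  refine h0 ?_
  rw [Matrix.sub_apply, by_contra fun h1 => hne (h a a' h1), by_contra fun h1 => hne (h' a a' h1),
    sub_zero]

section StandardGram

variable {d : ℕ} {J : Matrix ι ι ℂ} {w : Matrix (Fin d) (Fin d) ℂ}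
  (D : CyclicBasis A fun a : Fin k × Fin d => parts a.1)
  (hD : ∀ a a' x y, dotProduct ((A ^ x).mulVec (D.v a)) (J.mulVec ((A ^ y).mulVec (D.v a'))) =
    if x + y + 1 = parts a.1 then ((1 : Matrix (Fin k) (Fin k) ℂ) ⊗ₖ w) a a' else 0)

include hD

/-- For a form with the standard Gram matrix, taking adjoints of block operators amounts to taking
adjoints of the matrices of their coefficients. -/
theorem CyclicBasis.transpose_blockOp_kronecker_mul {m : Matrix (Fin k) (Fin k) ℂ}
    (hm : Respects parts m) {z : Matrix (Fin d) (Fin d) ℂ} {ε : ℂ}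
    (he : m.transpose ⊗ₖ (z.transpose * w) = ε • (m ⊗ₖ (w * z))) :
    (D.blockOp (m ⊗ₖ z)).transpose * J = ε • (J * D.blockOp (m ⊗ₖ z)) := by
  refine D.transpose_blockOp_mul hD (hm.kronecker z) ?_
  rw [← Matrix.mul_kronecker_mul, one_mul, ← he, ← Matrix.kroneckerMap_transpose,
    ← Matrix.mul_kronecker_mul, mul_one]

theorem CyclicBasis.transpose_blockMap_single_mul (i : Fin k) :
    (D.blockMap (Matrix.single i i 1)).transpose * J = J * D.blockMap (Matrix.single i i 1) := by
  refine (D.transpose_blockOp_kronecker_mul hD (m := Matrix.single i i 1) (z := 1) (ε := 1)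
    (respects_single rfl 1) ?_).trans (one_smul ℂ _)
  rw [Matrix.transpose_single, Matrix.transpose_one, one_mul, mul_one, one_smul]

theorem CyclicBasis.transpose_blockMap_sub_mul {i j : Fin k} (hij : parts i = parts j) :
    (D.blockMap (Matrix.single j i 1 - Matrix.single i j 1)).transpose * J =
      -(J * D.blockMap (Matrix.single j i 1 - Matrix.single i j 1)) := by
  refine (D.transpose_blockOp_kronecker_mul hD (m := Matrix.single j i 1 - Matrix.single i j 1)
    (z := 1) (ε := -1) ((respects_single hij.symm 1).sub (respects_single hij 1)) ?_).trans
      (neg_one_smul ℂ _)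
  rw [Matrix.transpose_sub, Matrix.transpose_single, Matrix.transpose_single,
    Matrix.transpose_one, one_mul, mul_one, ← Matrix.smul_kronecker, neg_one_smul, neg_sub]

theorem CyclicBasis.transpose_blockOp_rotation_mul (hw : w.transpose = -w) (i : Fin k) :
    (D.blockOp (Matrix.single i i 1 ⊗ₖ w)).transpose * J =
      -(J * D.blockOp (Matrix.single i i 1 ⊗ₖ w)) := by
  refine (D.transpose_blockOp_kronecker_mul hD (m := Matrix.single i i 1)
    (z := w) (ε := -1) (respects_single rfl 1) ?_).trans (neg_one_smul ℂ _)
  rw [Matrix.transpose_single, hw, neg_mul, ← neg_one_smul ℂ (w * w), Matrix.kronecker_smul]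

end StandardGram

/-- Adapted data for the pair that is defined by a form. In the alternating case the Gram matrix `w`
of the multiplicity space is itself a square root of `-1`, which yields the rotations. -/
theorem exists_adaptedData_adjoint {d : ℕ} (hd : 0 < d) {J : Matrix ι ι ℂ} (hJ : IsUnit J.det)
    {η : ℂ} (hη : η * η = 1) (hJη : J.transpose = η • J)
    (hτ : ∀ N ∈ (adjointInvolution J hJ η hJη).S, N ≠ 0 →
      ∃ x : Fin d → ι → ℂ, LinearIndependent ℂ fun a => N.mulVec (x a))
    {w : Matrix (Fin d) (Fin d) ℂ} (hw : w.transpose * w = 1) (hwη : w.transpose = η • w)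
    (h : HasJordanType A fun a : Fin k × Fin d => parts a.1) (hpos : ∀ i, 0 < parts i)
    (hA : A.transpose * J = J * A) :
    ∃ D : AdaptedData ((adjointInvolution J hJ η hJη).symmetricPair d hd hτ) parts A,
      η = -1 → D.HasRotations := by
  obtain ⟨D₀⟩ := h.nonempty_cyclicBasis
  obtain ⟨D, hD⟩ := D₀.exists_gram_eq hJ hη hJη hA hw hwη
  have hS := fun i => (mem_S_adjointInvolution hJ hJη).2 (D.transpose_blockMap_single_mul hD i)
  have hlie := fun i j hij => (mem_lie_adjointInvolution hJ hJη).2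
    (D.transpose_blockMap_sub_mul (i := i) (j := j) hD hij)
  have hA' := (mem_S_adjointInvolution hJ hJη).2 hA
  generalize hP : (adjointInvolution J hJ η hJη).symmetricPair d hd hτ = P
  obtain rfl : P.d = d := by rw [← hP]; rfl
  have hPS : P.S = (adjointInvolution J hJ η hJη).S := by rw [← hP]; rfl
  have hPl : P.lie = (adjointInvolution J hJ η hJη).lie := by rw [← hP]; rfl
  rw [← hPS] at hS hA'
  rw [← hPl] at hlie
  refine ⟨D.adaptedData P hA' hpos hS hlie, ?_⟩
  rintro rfl
  rw [neg_one_smul] at hwη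
  rw [hwη, neg_mul] at hw
  refine CyclicBasis.hasRotations P D hA' hpos hS hlie (neg_eq_iff_eq_neg.1 hw) fun i => ?_
  rw [hPl]
  exact (mem_lie_adjointInvolution hJ hJη).2 (D.transpose_blockOp_rotation_mul hD hwη i)

/-- The conjugate transposes of commutators of self-adjoint matrices are skew-adjoint, because `J` is
real and `J² = ±1`. -/
theorem conjTranspose_commutator {J : Matrix ι ι ℂ} (hJJ : J * J = 1 ∨ J * J = -1)
    (hJc : J.map star = J) {A B : Matrix ι ι ℂ} (hA : A.transpose * J = J * A)
    (hB : B.transpose * J = J * B) :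
    (A * B - B * A).conjTranspose.transpose * J = -(J * (A * B - B * A).conjTranspose) := by
  have h1 : (A * B - B * A).transpose * J = -(J * (A * B - B * A)) := by
    rw [Matrix.transpose_sub, Matrix.transpose_mul, Matrix.transpose_mul, sub_mul, mul_assoc, hA,
      ← mul_assoc, hB, mul_assoc A.transpose, hB, ← mul_assoc A.transpose, hA]
    noncomm_ring
  generalize A * B - B * A = M at h1 ⊢
  have h2 : M.conjTranspose * J = -(J * M.conjTranspose.transpose) := by
    have h3 := congrArg (fun M => M.map star) h1
    have h4 : ∀ X Y : Matrix ι ι ℂ, (X * Y).map star = X.map star * Y.map star := fun X Y =>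
      Matrix.map_mul (f := starRingEnd ℂ)
    have h5 : (-(J * M)).map star = -(J * M).map star := Matrix.map_neg star (by simp) _
    simp only [h5, h4, hJc] at h3
    exact h3
  have h3 := congrArg (fun X => J * X * J) h2
  simp only [mul_neg, neg_mul, mul_assoc] at h3
  simp only [← mul_assoc J J] at h3
  rcases hJJ with h | h
  · rw [h, mul_one, one_mul] at h3
    rw [h3, neg_neg]
  · rw [h] at h3
    simp only [mul_neg, neg_mul, mul_one, one_mul, neg_neg] at h3
    rw [← h3]

end Cases

/-! ### General linear, orthogonal and symplectic groups -/

section Final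

/-- The symmetric pair of the orthogonal group. -/
noncomputable def orthogonalPair (n : ℕ) : SymmetricPair (Fin n) :=
  (adjointInvolution 1 (by simp) 1 (by simp)).symmetricPair 1 one_pos fun _ _ h0 =>
    exists_linearIndependent_mulVec_one h0

/-- The symmetric pair of the symplectic group. Jordan blocks come in pairs. -/
noncomputable def symplecticPair (n : ℕ) : SymmetricPair (Fin n ⊕ Fin n) :=
  (adjointInvolution (Matrix.J (Fin n) ℂ) (Matrix.isUnit_det_J _ _) (-1)
    (by rw [Matrix.J_transpose, neg_one_smul])).symmetricPair 2 two_pos fun _ hN h0 =>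
      exists_linearIndependent_mulVec_two (Matrix.isUnit_det_J _ _)
        (by rw [Matrix.J_transpose, neg_one_smul]) ((mem_S_adjointInvolution _ _).1 hN) h0

variable (n : ℕ)

theorem mem_spaceI (B : Matrix (Fin n) (Fin n) ℂ) :
    B ∈ spaceI n ↔ B ∈ (generalLinearPair (Fin n)).S ∧ B.trace = 0 :=
  ⟨fun h => ⟨trivial, h⟩, fun h => h.2⟩

theorem mem_spaceII (B : Matrix (Fin n) (Fin n) ℂ) :
    B ∈ spaceII n ↔ B ∈ (orthogonalPair n).S ∧ B.trace = 0 := by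
  have h : B ∈ (orthogonalPair n).S ↔ B.transpose * 1 = 1 * B := mem_S_adjointInvolution _ _
  rw [spaceII, Submodule.mem_inf, mem_selfAdjointMatricesSubmodule, h, and_comm]
  rfl

theorem mem_spaceIII (B : Matrix (Fin n ⊕ Fin n) (Fin n ⊕ Fin n) ℂ) :
    B ∈ spaceIII n ↔ B ∈ (symplecticPair n).S ∧ B.trace = 0 := by
  have h : B ∈ (symplecticPair n).S ↔
      B.transpose * Matrix.J (Fin n) ℂ = Matrix.J (Fin n) ℂ * B := mem_S_adjointInvolution _ _
  rw [spaceIII, Submodule.mem_inf, mem_selfAdjointMatricesSubmodule, h, and_comm]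
  rfl

theorem conjTranspose_commutator_mem_lieI (A B : Matrix (Fin n) (Fin n) ℂ) :
    (A * B - B * A).conjTranspose ∈ lieI n := by
  show (A * B - B * A).conjTranspose.trace = 0
  rw [Matrix.trace_conjTranspose, Matrix.trace_sub, Matrix.trace_mul_comm, sub_self, star_zero]

theorem conjTranspose_commutator_mem_lieII {A B : Matrix (Fin n) (Fin n) ℂ}
    (hA : A ∈ (orthogonalPair n).S) (hB : B ∈ (orthogonalPair n).S) :
    (A * B - B * A).conjTranspose ∈ lieII n := by
  rw [lieII, mem_skewAdjointMatricesSubmodule]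
  show _ = _ * -_
  rw [mul_neg]
  refine conjTranspose_commutator (Or.inl (one_mul 1)) ?_ ((mem_S_adjointInvolution _ _).1 hA)
    ((mem_S_adjointInvolution _ _).1 hB)
  exact Matrix.map_one star (star_zero _) (star_one _)

theorem conjTranspose_commutator_mem_lieIII {A B : Matrix (Fin n ⊕ Fin n) (Fin n ⊕ Fin n) ℂ}
    (hA : A ∈ (symplecticPair n).S) (hB : B ∈ (symplecticPair n).S) :
    (A * B - B * A).conjTranspose ∈ lieIII n := by
  rw [lieIII, mem_skewAdjointMatricesSubmodule]
  show _ = _ * -_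
  rw [mul_neg]
  refine conjTranspose_commutator (Or.inr (Matrix.J_squared _ _)) ?_
    ((mem_S_adjointInvolution _ _).1 hA) ((mem_S_adjointInvolution _ _).1 hB)
  rw [Matrix.J, Matrix.fromBlocks_map]
  simp [Matrix.map_neg, Matrix.map_one]

variable {n} {k : ℕ} {parts : Fin k → ℕ}

/-- There are no rotations here, because a symmetric form on the one-dimensional multiplicity space
has no infinitesimal isometries. -/
theorem exists_adaptedData_orthogonal {A : Matrix (Fin n) (Fin n) ℂ}
    (h : HasJordanType A parts) (hpos : ∀ i, 0 < parts i) (hA : A ∈ (orthogonalPair n).S) :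
    Nonempty (AdaptedData (orthogonalPair n) parts A) := by
  obtain ⟨D, -⟩ := exists_adaptedData_adjoint (w := 1) one_pos (by simp) (one_mul 1) (by simp)
    (fun _ _ h0 => exists_linearIndependent_mulVec_one h0) (by simp) (by simp) h.prodUnique hpos
    ((mem_S_adjointInvolution _ _).1 hA)
  exact ⟨D⟩

theorem exists_adaptedData_symplectic {A : Matrix (Fin n ⊕ Fin n) (Fin n ⊕ Fin n) ℂ}
    (h : HasJordanType A fun a : Fin k × Fin 2 => parts a.1) (hpos : ∀ i, 0 < parts i)
    (hA : A ∈ (symplecticPair n).S) :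
    ∃ D : AdaptedData (symplecticPair n) parts A, D.HasRotations := by
  obtain ⟨D, hD⟩ := exists_adaptedData_adjoint (η := -1) (w := !![0, 1; -1, 0]) two_pos
    (Matrix.isUnit_det_J _ _) (by norm_num) (by rw [Matrix.J_transpose, neg_one_smul])
    (fun _ hN h0 => exists_linearIndependent_mulVec_two (Matrix.isUnit_det_J _ _)
        (by rw [Matrix.J_transpose, neg_one_smul]) ((mem_S_adjointInvolution _ _).1 hN) h0)
    (by ext i j; fin_cases i <;> fin_cases j <;> simp [Matrix.mul_apply])
    (by ext i j; fin_cases i <;> fin_cases j <;> simp) h hpos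
    ((mem_S_adjointInvolution _ _).1 hA)
  exact ⟨D, hD rfl⟩

end Final

end NilconeSymmetric

open NilconeSymmetric in
theorem lemma1p1 (n k : ℕ) (parts : Fin k → ℕ) (hpos : ∀ i, 0 < parts i)
    (hsum : ∑ i, parts i = n) :
    -- the case `V = 𝔰𝔩ₙ`
    (∀ A ∈ spaceI n, HasJordanType A parts →
      IsZariskiOpenIn (distinctConormals (spaceI n) (lieI n) A k)
        (genericConormals (spaceI n) (lieI n) A) ∧
      IsPathConnected (distinctConormals (spaceI n) (lieI n) A k) ∧
      ∃ r : C(distinctConormals (spaceI n) (lieI n) A k, ColoredConfig parts),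
        (∀ B u, r B = ColoredConfig.mk parts u ↔ IsColoredSpectrum 1 parts B.1 u) ∧
        ∀ ξ, Function.Bijective
          (FundamentalGroup.map r ξ :
            FundamentalGroup (distinctConormals (spaceI n) (lieI n) A k) ξ →*
              ColoredBraidGroup parts (r ξ))) ∧
    -- the case `V = 𝔰𝔩ₙ / 𝔰𝔬ₙ`
    (∀ A ∈ spaceII n, HasJordanType A parts →
      IsZariskiOpenIn (distinctConormals (spaceII n) (lieII n) A k)
        (genericConormals (spaceII n) (lieII n) A) ∧
      IsPathConnected (distinctConormals (spaceII n) (lieII n) A k) ∧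
      ∃ r : C(distinctConormals (spaceII n) (lieII n) A k, ColoredConfig parts),
        (∀ B u, r B = ColoredConfig.mk parts u ↔ IsColoredSpectrum 1 parts B.1 u) ∧
        ∀ ξ, Function.Surjective
          (FundamentalGroup.map r ξ :
            FundamentalGroup (distinctConormals (spaceII n) (lieII n) A k) ξ →*
              ColoredBraidGroup parts (r ξ))) ∧
    -- the case `V = 𝔰𝔩₂ₙ / 𝔰𝔭₂ₙ`, where all Jordan blocks and eigenvalues are doubled
    (∀ A ∈ spaceIII n, HasJordanType A (fun a : Fin k × Fin 2 => parts a.1) →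
      IsZariskiOpenIn (distinctConormals (spaceIII n) (lieIII n) A k)
        (genericConormals (spaceIII n) (lieIII n) A) ∧
      IsPathConnected (distinctConormals (spaceIII n) (lieIII n) A k) ∧
      ∃ r : C(distinctConormals (spaceIII n) (lieIII n) A k, ColoredConfig parts),
        (∀ B u, r B = ColoredConfig.mk parts u ↔ IsColoredSpectrum 2 parts B.1 u) ∧
        ∀ ξ, Function.Bijective
          (FundamentalGroup.map r ξ :
            FundamentalGroup (distinctConormals (spaceIII n) (lieIII n) A k) ξ →*
              ColoredBraidGroup parts (r ξ))) := by
  refine ⟨fun A _ hJ => ?_, fun A hA hJ => ?_, fun A hA hJ => ?_⟩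
  · obtain ⟨D, hD⟩ := exists_adaptedData_generalLinear hJ hpos
    obtain ⟨h1, h2, r, h3, -, h4⟩ := D.distinctConormals_properties (mem_spaceI n)
      (𝔨 := lieI n) fun A _ B _ => conjTranspose_commutator_mem_lieI n A B
    exact ⟨h1, h2, r, h3, h4 hD⟩
  · obtain ⟨D⟩ := exists_adaptedData_orthogonal hJ hpos ((mem_spaceII n A).1 hA).1
    obtain ⟨h1, h2, r, h3, h4, -⟩ := D.distinctConormals_properties (mem_spaceII n)
      (𝔨 := lieII n) fun A hA B hB => conjTranspose_commutator_mem_lieII n hA hB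
    exact ⟨h1, h2, r, h3, h4⟩
  · obtain ⟨D, hD⟩ := exists_adaptedData_symplectic hJ hpos ((mem_spaceIII n A).1 hA).1
    obtain ⟨h1, h2, r, h3, -, h4⟩ := D.distinctConormals_properties (mem_spaceIII n)
      (𝔨 := lieIII n) fun A hA B hB => conjTranspose_commutator_mem_lieIII n hA hB
    exact ⟨h1, h2, r, h3, h4 hD⟩
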